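/- Let $E\subset\mathbb R^d$ be open, or closed with $dx(\partial E)=0$. Let $\varphi\in L^1_{loc}(E,dx)$ with $\varphi>0$ $dx$-a.e. on $E$, and $d\mu:=\varphi\,dx$ on $E$. Let $C_0^\infty(E)$ be the smooth functions with compact support in $E$ if $E$ is open, and the restrictions to $E$ of functions in $C_0^\infty(\mathbb R^d)$ if $E$ is closed. Let $A=(a_{ij})=(a_{ji})$ with $a_{ij}\in L^1_{loc}(E,\mu)$ be such that for every relatively compact open $V\subset E$ there is $\nu_V>0$ with $\nu_V^{-1}|\xi|^2\le\langle A(x)\xi,\xi\rangle\le\nu_V|\xi|^2$ for all $\xi\in\mathbb R^d$ and $\mu$-a.e. $x\in V$. Assume that $$\mathcal E^0(f,g)=\int_E\langle A\nabla f,\nabla g\rangle\,d\mu,\qquad f,g\in C_0^\infty(E),$$ is closable on $L^2(E,\mu)$, with closure $(\mathcal E^0,D(\mathcal E^0))$ and associated operator $(L^0,D(L^0))$. The gradient $\nabla u$ of $u\in D(\mathcal E^0)$ is the limit of the gradients of an approximating sequence in $C_0^\infty(E)$, and $\nabla u$ for $u\in D(\mathcal E^0)_{loc}$ (i.e. $u$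 agrees $\mu$-a.e. on each relatively compact open set with an element of $D(\mathcal E^0)$) is defined locally. Let $B\in L^2_{loc}(E,\mathbb R^d,\mu)$ satisfy $\int_E\langle B,\nabla f\rangle\,d\mu=0$ for all $f\in C_0^\infty(E)$. Assume: (B) $\rho\in D(\mathcal E^0)_{loc}$ is a non-negative continuous function on $E$ such that every $E_n:=\{x\in E:\rho(x)<n\}$ is relatively compact and open in $E$, and $K_0\subset E$ is a compact set with $\langle B,\nabla\rho\rangle\in L^\infty_{loc}(E\setminus K_0,\mu)$. (C) The set $D(L^0)_{0,b}$ of all $\mu$-essentially bounded functions in $D(L^0)$ with compact support in $E$ is dense in $L^1(E,\mu)$. Put $V_n:=E_{4n}$. Let $L^{0,n}$ be the operator on $L^2(V_n,\mu)$ associated with the closure of $\int_{V_n}\langle A\nabla f,\nabla g\rangle d\mu$, $f,g\in C_0^\infty(V_n):=\{u\in C_0^\infty(E):\operatorname{supp}u\subset V_n\}$; let $\overline L^n$ be the closure on $L^1(V_n,\mu)$ of $u\mapsto L^{0,n}u+\langle B,\nabla u\rangle$, defined for the bounded $u\in D(L^{0,n})$; let $L^n$ be the part of $\overline L^n$ on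 $L^2(V_n,\mu)$ and $G^n_\alpha f:=(\alpha-L^n)^{-1}(f1_{V_n})$, extended by $0$ outside $V_n$. Then there is exactly one sub-Markovian $C_0$-semigroup of contractions $(T_t)_{t\ge0}$ on $L^2(E,\mu)$ with the following property: for each $\alpha>0$ there is a bounded operator $G_\alpha$ on $L^2(E,\mu)$ with $G_\alpha f=\lim_n G^n_\alpha f$ $\mu$-a.e. for all bounded $0\le f\in L^2(E,\mu)$, and $G_\alpha f\in D(L)$, $(\alpha-L)G_\alpha f=f$ for all $f\in L^2(E,\mu)$, where $(L,D(L))$ is the generator of $(T_t)$. (It is the semigroup of the generalized Dirichlet form given by $\mathcal E(u,v)=(-Lu,v)$ for $u\in D(L)$, $v\in L^2(E,\mu)$.) Call $(T_t)$ conservative if $T_t1=1$ $\mu$-a.e. for all $t>0$, where $T_t1:=\lim_nT_tf_n$ for $0\le f_n\nearrow1$ $\mu$-a.e., $f_n\in L^2(E,\mu)$. For a function $\phi$ put $$\widehat A_n(\phi)=\Big(\sqrt{\operatorname*{ess\,sup}_{E_{4n}\setminus E_{2n}}\langle A\nabla\rho,\nabla\rho\rangle}+\operatorname*{ess\,sup}_{E_{4n}\setminus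 E_{2n}}\phi'(\rho)\langle A\nabla\rho,\nabla\rho\rangle\Big)\mu(E_{4n}\setminus E_{2n})^{1/2}+\|\langle B,\nabla\rho\rangle\|_{L^2(E_{4n}\setminus E_{2n},\mu)}.$$ Then $(T_t)$ is conservative if one of the following holds. (i) There are constants $M,C>0$, $0<\alpha<1$, $0\le\beta<2$ such that $$\Big|\langle A\nabla\rho,\nabla\rho\rangle+\frac{(\rho+1)\langle B,\nabla\rho\rangle}{C(2-\beta)(\log(\rho+1))^{1-\beta}}\Big|\le M(\rho+1)^2(\log(\rho+1))^\beta$$ $\mu$-a.e. outside some compact $K$ with $K_0\subset K\subset E$, and $\widehat A_n(\phi)\le n\exp(\alpha C(\log(n+1))^{2-\beta})$ for all large $n$, where $\phi(r)=C(\log(r+1))^{2-\beta}$. (ii) There are constants $M,C>0$, $0<\alpha<1$ such that $$\Big|\langle A\nabla\rho,\nabla\rho\rangle+\tfrac1C(\rho+1)\log(\rho+1)\langle B,\nabla\rho\rangle\Big|\le M(\rho+1)^2(\log(\rho+1))^2$$ $\mu$-a.e. outside some compact $K$ with $K_0\subset K\subset E$, and $\widehat A_n(\phi)\le n(\log(n+1))^{C\alpha}$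 for all large $n$, where $\phi(r)=C\log(\log(r+1)+1)$. (iii) There are constants $M,C>0$, $0<\alpha<2$ such that $$\Big|\langle A\nabla\rho,\nabla\rho\rangle+\frac{\langle B,\nabla\rho\rangle}{C\rho}\Big|\le M$$ $\mu$-a.e. outside some compact $K$ with $K_0\subset K\subset E$, and $\widehat A_n(\phi)\le n\exp(\alpha Cn^2)$ for all large $n$, where $\phi(r)=Cr^2/2$. -/

import Mathlib

open MeasureTheory Filter Topology
open scoped ENNReal NNReal ContDiff

namespace NonSectorial

noncomputable section

/-- Euclidean space `ℝ^d`. -/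
abbrev Eucl (d : ℕ) := EuclideanSpace ℝ (Fin d)

/-- The measure `dμ = φ dx` on `E`, viewed as a measure on `ℝ^d` which does not charge the
complement of `E`. -/
def wMeasure {d : ℕ} (E : Set (Eucl d)) (φ : Eucl d → ℝ) : Measure (Eucl d) :=
  (volume.restrict E).withDensity (fun x => ENNReal.ofReal (φ x))

/-- The bilinear expression `⟨A(x) ξ, η⟩`. -/
def aForm {d : ℕ} (A : Eucl d → Matrix (Fin d) (Fin d) ℝ) (x ξ η : Eucl d) : ℝ :=
  ∑ i, ∑ j, A x i j * ξ j * η i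

/-- `V` is a relatively compact open subset of the space `E` (with the subspace topology). -/
def IsRelCompactOpen {d : ℕ} (E V : Set (Eucl d)) : Prop :=
  (∃ U : Set (Eucl d), IsOpen U ∧ V = E ∩ U) ∧ ∃ K : Set (Eucl d), IsCompact K ∧ V ⊆ K ∧ K ⊆ E

/-- `C_0^∞(V)` for `V` relatively open in `E`: functions whose restriction to `E` has compact
support contained in `V`, and which are restrictions to `E` of functions in `C_0^∞(ℝ^d)`.
For `V = E` open, the restrictions to `E` are exactly the elements of the usual `C_0^∞(E)`
(extended by zero); for `V = E` closed, the last clause is automatic, and one gets the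
restrictions to `E` of all functions in `C_0^∞(ℝ^d)`. Only the values on `E` matter below. -/
def IsTest {d : ℕ} (E V : Set (Eucl d)) (f : Eucl d → ℝ) : Prop :=
  ContDiff ℝ ∞ f ∧ HasCompactSupport f ∧
    ∃ K : Set (Eucl d), IsCompact K ∧ K ⊆ V ∧ ∀ x ∈ E \ K, f x = 0

/-- The energy `∫_V ⟨A G, G⟩ dμ ∈ [0,∞]` of a vector field `G`. -/
def energy {d : ℕ} (A : Eucl d → Matrix (Fin d) (Fin d) ℝ) (μ : Measure (Eucl d))
    (V : Set (Eucl d)) (G : Eucl d → Eucl d) : ℝ≥0∞ :=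
  ∫⁻ x in V, ENNReal.ofReal (aForm A x (G x) (G x)) ∂μ

/-- Closability on `L²(E,μ)` of `ℰ⁰(f,g) = ∫_E ⟨A∇f,∇g⟩ dμ`, `f,g ∈ C_0^∞(E)`: every
`ℰ⁰`-Cauchy sequence which tends to `0` in `L²(E,μ)` satisfies `ℰ⁰(f_n,f_n) → 0`. -/
def IsClosableEnergy {d : ℕ} (E : Set (Eucl d)) (A : Eucl d → Matrix (Fin d) (Fin d) ℝ)
    (μ : Measure (Eucl d)) : Prop :=
  ∀ f : ℕ → Eucl d → ℝ, (∀ n, IsTest E E (f n)) →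
    Tendsto (fun n => eLpNorm (f n) 2 (μ.restrict E)) atTop (𝓝 0) →
    Tendsto (fun p : ℕ × ℕ => energy A μ E (fun x => gradient (f p.1) x - gradient (f p.2) x))
      atTop (𝓝 0) →
    Tendsto (fun n => energy A μ E (gradient (f n))) atTop (𝓝 0)

/-- `u` belongs to the domain of the closure on `L²(V,μ)` of the form `∫_V ⟨A∇f,∇g⟩ dμ`,
`f,g ∈ C_0^∞(V)`, and `∇u = G`: there are `f_n ∈ C_0^∞(V)` with `f_n → u` in `L²(V,μ)` and
`∫_V ⟨A(∇f_n - G),∇f_n - G⟩ dμ → 0`. For `V = E` this is `u ∈ D(ℰ⁰)`, and for `V = V_n` it is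
`u ∈ D(ℰ^{0,n})`. -/
def HasFormGradient {d : ℕ} (E : Set (Eucl d)) (A : Eucl d → Matrix (Fin d) (Fin d) ℝ)
    (μ : Measure (Eucl d)) (V : Set (Eucl d)) (u : Eucl d → ℝ) (G : Eucl d → Eucl d) : Prop :=
  MemLp u 2 (μ.restrict V) ∧ AEStronglyMeasurable G (μ.restrict V) ∧
    ∃ f : ℕ → Eucl d → ℝ, (∀ n, IsTest E V (f n)) ∧
      Tendsto (fun n => eLpNorm (fun x => f n x - u x) 2 (μ.restrict V)) atTop (𝓝 0) ∧
      Tendsto (fun n => energy A μ V (fun x => gradient (f n) x - G x)) atTop (𝓝 0)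

/-- `u ∈ D(ℰ⁰)_loc` and `∇u = G`: on every relatively compact open `V ⊆ E`, `u` and `G` agree
`μ`-a.e. with some element of `D(ℰ⁰)` and its gradient. -/
def HasLocFormGradient {d : ℕ} (E : Set (Eucl d)) (A : Eucl d → Matrix (Fin d) (Fin d) ℝ)
    (μ : Measure (Eucl d)) (u : Eucl d → ℝ) (G : Eucl d → Eucl d) : Prop :=
  ∀ V : Set (Eucl d), IsRelCompactOpen E V →
    ∃ (v : Eucl d → ℝ) (H : Eucl d → Eucl d), HasFormGradient E A μ E v H ∧
      u =ᵐ[μ.restrict V] v ∧ G =ᵐ[μ.restrict V] H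

/-- The operator of the closed form on `L²(V,μ)`: `u ∈ D(L^{0,V})` with `∇u = G` and
`L^{0,V} u = w ∈ L²(V,μ)`, i.e. `∫_V ⟨A∇u,∇v⟩ dμ = -∫_V w v dμ` for all `v` in the domain of
the form. -/
def IsFormOperator {d : ℕ} (E : Set (Eucl d)) (A : Eucl d → Matrix (Fin d) (Fin d) ℝ)
    (μ : Measure (Eucl d)) (V : Set (Eucl d)) (u : Eucl d → ℝ) (G : Eucl d → Eucl d)
    (w : Eucl d → ℝ) : Prop :=
  HasFormGradient E A μ V u G ∧ MemLp w 2 (μ.restrict V) ∧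
    ∀ (v : Eucl d → ℝ) (H : Eucl d → Eucl d), HasFormGradient E A μ V v H →
      ∫ x in V, aForm A x (G x) (H x) ∂μ = -∫ x in V, w x * v x ∂μ

/-- `f` is `μ`-essentially bounded on `V`. -/
def EssBddOn {d : ℕ} (μ : Measure (Eucl d)) (V : Set (Eucl d)) (f : Eucl d → ℝ) : Prop :=
  ∃ M : ℝ, ∀ᵐ x ∂(μ.restrict V), |f x| ≤ M

/-- `u ∈ D(L⁰)_{0,b}`: `u ∈ D(L⁰)` is `μ`-essentially bounded with compact support in `E`. -/
def IsCompactBddDomain {d : ℕ} (E : Set (Eucl d)) (A : Eucl d → Matrix (Fin d) (Fin d) ℝ)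
    (μ : Measure (Eucl d)) (u : Eucl d → ℝ) : Prop :=
  (∃ G w, IsFormOperator E A μ E u G w) ∧ EssBddOn μ E u ∧
    ∃ K : Set (Eucl d), IsCompact K ∧ K ⊆ E ∧ ∀ᵐ x ∂(μ.restrict (E \ K)), u x = 0

/-- `D(L⁰)_{0,b}` is dense in `L¹(E,μ)`. -/
def DenseCompactBddDomain {d : ℕ} (E : Set (Eucl d)) (A : Eucl d → Matrix (Fin d) (Fin d) ℝ)
    (μ : Measure (Eucl d)) : Prop :=
  ∀ f : Eucl d → ℝ, MemLp f 1 (μ.restrict E) → ∀ ε : ℝ≥0∞, 0 < ε →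
    ∃ u : Eucl d → ℝ, IsCompactBddDomain E A μ u ∧
      eLpNorm (fun x => f x - u x) 1 (μ.restrict E) < ε

/-- The graph of `u ↦ L^{0,V} u + ⟨B,∇u⟩`, `u ∈ D(L^{0,V})_b`. -/
def PreGenerator {d : ℕ} (E : Set (Eucl d)) (A : Eucl d → Matrix (Fin d) (Fin d) ℝ)
    (B : Eucl d → Eucl d) (μ : Measure (Eucl d)) (V : Set (Eucl d))
    (u w : Eucl d → ℝ) : Prop :=
  EssBddOn μ V u ∧ ∃ (G : Eucl d → Eucl d) (w₀ : Eucl d → ℝ), IsFormOperator E A μ V u G w₀ ∧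
    w =ᵐ[μ.restrict V] fun x => w₀ x + inner ℝ (B x) (G x)

/-- The graph of the closure of `PreGenerator` on `L¹(V,μ)`. -/
def L1Generator {d : ℕ} (E : Set (Eucl d)) (A : Eucl d → Matrix (Fin d) (Fin d) ℝ)
    (B : Eucl d → Eucl d) (μ : Measure (Eucl d)) (V : Set (Eucl d))
    (u w : Eucl d → ℝ) : Prop :=
  MemLp u 1 (μ.restrict V) ∧ MemLp w 1 (μ.restrict V) ∧
    ∃ U W : ℕ → Eucl d → ℝ, (∀ k, PreGenerator E A B μ V (U k) (W k)) ∧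
      Tendsto (fun k => eLpNorm (fun x => U k x - u x) 1 (μ.restrict V)) atTop (𝓝 0) ∧
      Tendsto (fun k => eLpNorm (fun x => W k x - w x) 1 (μ.restrict V)) atTop (𝓝 0)

/-- The graph of the part on `L²(V,μ)` of `L1Generator`. -/
def L2Generator {d : ℕ} (E : Set (Eucl d)) (A : Eucl d → Matrix (Fin d) (Fin d) ℝ)
    (B : Eucl d → Eucl d) (μ : Measure (Eucl d)) (V : Set (Eucl d))
    (u w : Eucl d → ℝ) : Prop :=
  MemLp u 2 (μ.restrict V) ∧ MemLp w 2 (μ.restrict V) ∧ L1Generator E A B μ V u w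

/-- `u = (α - L^V)⁻¹ (f 1_V)`, where `L^V` is the operator `L2Generator` on `L²(V,μ)`. -/
def IsLocalResolvent {d : ℕ} (E : Set (Eucl d)) (A : Eucl d → Matrix (Fin d) (Fin d) ℝ)
    (B : Eucl d → Eucl d) (μ : Measure (Eucl d)) (V : Set (Eucl d)) (α : ℝ)
    (f u : Eucl d → ℝ) : Prop :=
  L2Generator E A B μ V u (fun x => α * u x - f x)

/-- The sets `E_r = {x ∈ E : ρ(x) < r}`. -/
def sublevel {d : ℕ} (E : Set (Eucl d)) (ρ : Eucl d → ℝ) (r : ℝ) : Set (Eucl d) :=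
  {x | x ∈ E ∧ ρ x < r}

/-- The bounded operator `G` on `L²(E,μ)` is the limiting resolvent `G_α`:
for bounded `0 ≤ f ∈ L²(E,μ)`, `G f = lim_n G_α^n (f 1_{V_n})` `μ`-a.e., where
`V_n = E_{4n}` and `G_α^n g` is extended by zero outside `V_n`. (Such `f` span a dense
subspace, so this determines `G`.) -/
def IsLimitResolvent {d : ℕ} (E : Set (Eucl d)) (A : Eucl d → Matrix (Fin d) (Fin d) ℝ)
    (B : Eucl d → Eucl d) (μ : Measure (Eucl d)) (ρ : Eucl d → ℝ) (α : ℝ)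
    (G : Lp ℝ 2 μ →L[ℝ] Lp ℝ 2 μ) : Prop :=
  ∀ f : Lp ℝ 2 μ, 0 ≤ f → (∃ M : ℝ, ∀ᵐ x ∂μ, f x ≤ M) →
    ∃ u : ℕ → Eucl d → ℝ,
      (∀ n : ℕ, IsLocalResolvent E A B μ (sublevel E ρ (4 * n)) α f (u n)) ∧
      ∀ᵐ x ∂μ, Tendsto (fun n : ℕ => (sublevel E ρ (4 * n)).indicator (u n) x) atTop (𝓝 (G f x))

/-- `(T_t)_{t ≥ 0}` is a sub-Markovian `C_0`-semigroup of contractions on `L²(μ)`. -/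
structure IsSubMarkovSemigroup {d : ℕ} (μ : Measure (Eucl d))
    (T : ℝ≥0 → (Lp ℝ 2 μ →L[ℝ] Lp ℝ 2 μ)) : Prop where
  zero : T 0 = ContinuousLinearMap.id ℝ (Lp ℝ 2 μ)
  add : ∀ s t, T (s + t) = (T s).comp (T t)
  contraction : ∀ t, ‖T t‖ ≤ 1
  strongly_continuous : ∀ f : Lp ℝ 2 μ, Tendsto (fun t => T t f) (𝓝[>] 0) (𝓝 f)
  sub_markov : ∀ t, ∀ f : Lp ℝ 2 μ, (∀ᵐ x ∂μ, 0 ≤ f x ∧ f x ≤ 1) →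
    ∀ᵐ x ∂μ, 0 ≤ T t f x ∧ T t f x ≤ 1

/-- `u` is in the domain of the generator `L` of `(T_t)`, and `L u = w`. -/
def IsGenerator {d : ℕ} {μ : Measure (Eucl d)} (T : ℝ≥0 → (Lp ℝ 2 μ →L[ℝ] Lp ℝ 2 μ))
    (u w : Lp ℝ 2 μ) : Prop :=
  Tendsto (fun t : ℝ≥0 => (t : ℝ)⁻¹ • (T t u - u)) (𝓝[>] 0) (𝓝 w)

/-- `(T_t)` is the sub-Markovian `C_0`-semigroup of contractions on `L²(E,μ)` whose generator
`(L,D(L))` is the generator of the limiting resolvent `(G_α)_{α>0}`, i.e. `G_α f ∈ D(L)` and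
`(α - L) G_α f = f` for all `α > 0`, `f ∈ L²(E,μ)`. It is the semigroup of the generalized
Dirichlet form `ℰ(u,v) = (-Lu,v)`. -/
def IsAssociatedSemigroup {d : ℕ} (E : Set (Eucl d)) (A : Eucl d → Matrix (Fin d) (Fin d) ℝ)
    (B : Eucl d → Eucl d) (μ : Measure (Eucl d)) (ρ : Eucl d → ℝ)
    (T : ℝ≥0 → (Lp ℝ 2 μ →L[ℝ] Lp ℝ 2 μ)) : Prop :=
  IsSubMarkovSemigroup μ T ∧
    ∀ α : ℝ, 0 < α → ∃ G : Lp ℝ 2 μ →L[ℝ] Lp ℝ 2 μ, IsLimitResolvent E A B μ ρ α G ∧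
      ∀ f : Lp ℝ 2 μ, IsGenerator T (G f) (α • G f - f)

/-- Conservativeness, `T_t 1 = 1` `μ`-a.e. for all `t > 0`, where `T_t 1` is the `μ`-a.e. limit of
`T_t f_n` for sequences `0 ≤ f_n ↗ 1` in `L²(μ)`. -/
def IsConservative {d : ℕ} {μ : Measure (Eucl d)}
    (T : ℝ≥0 → (Lp ℝ 2 μ →L[ℝ] Lp ℝ 2 μ)) : Prop :=
  ∀ t : ℝ≥0, 0 < t → ∀ f : ℕ → Lp ℝ 2 μ, (∀ n, 0 ≤ f n) → Monotone f →
    (∀ᵐ x ∂μ, Tendsto (fun n => f n x) atTop (𝓝 1)) →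
    ∀ᵐ x ∂μ, Tendsto (fun n => T t (f n) x) atTop (𝓝 1)

/-- The quantity `Â_n(ϕ) ∈ [0,∞]`; here `R = E_{4n} \ E_{2n}` and `Dρ` is `∇ρ`. -/
def Ahat {d : ℕ} (E : Set (Eucl d)) (A : Eucl d → Matrix (Fin d) (Fin d) ℝ)
    (B : Eucl d → Eucl d) (μ : Measure (Eucl d)) (ρ : Eucl d → ℝ) (Dρ : Eucl d → Eucl d)
    (ϕ : ℝ → ℝ) (n : ℕ) : ℝ≥0∞ :=
  let R : Set (Eucl d) := sublevel E ρ (4 * n) \ sublevel E ρ (2 * n)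
  (essSup (fun x => ENNReal.ofReal (aForm A x (Dρ x) (Dρ x))) (μ.restrict R) ^ (1 / 2 : ℝ) +
      essSup (fun x => ENNReal.ofReal (deriv ϕ (ρ x) * aForm A x (Dρ x) (Dρ x))) (μ.restrict R)) *
    μ R ^ (1 / 2 : ℝ) +
  eLpNorm (fun x => inner ℝ (B x) (Dρ x)) 2 (μ.restrict R)

/-- The hypothesis of criterion (i). -/
def CriterionI {d : ℕ} (E : Set (Eucl d)) (A : Eucl d → Matrix (Fin d) (Fin d) ℝ)
    (B : Eucl d → Eucl d) (μ : Measure (Eucl d)) (ρ : Eucl d → ℝ) (Dρ : Eucl d → Eucl d)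
    (K₀ : Set (Eucl d)) : Prop :=
  ∃ M C α β : ℝ, 0 < M ∧ 0 < C ∧ 0 < α ∧ α < 1 ∧ 0 ≤ β ∧ β < 2 ∧
    (∃ K : Set (Eucl d), IsCompact K ∧ K ⊆ E ∧ K₀ ⊆ K ∧ ∀ᵐ x ∂(μ.restrict (E \ K)),
      |aForm A x (Dρ x) (Dρ x) + (ρ x + 1) * inner ℝ (B x) (Dρ x) /
          (C * (2 - β) * Real.log (ρ x + 1) ^ (1 - β))|
        ≤ M * (ρ x + 1) ^ 2 * Real.log (ρ x + 1) ^ β) ∧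
    ∀ᶠ n : ℕ in atTop,
      Ahat E A B μ ρ Dρ (fun r => C * Real.log (r + 1) ^ (2 - β)) n
        ≤ ENNReal.ofReal (n * Real.exp (α * C * Real.log (n + 1) ^ (2 - β)))

/-- The hypothesis of criterion (ii). -/
def CriterionII {d : ℕ} (E : Set (Eucl d)) (A : Eucl d → Matrix (Fin d) (Fin d) ℝ)
    (B : Eucl d → Eucl d) (μ : Measure (Eucl d)) (ρ : Eucl d → ℝ) (Dρ : Eucl d → Eucl d)
    (K₀ : Set (Eucl d)) : Prop :=
  ∃ M C α : ℝ, 0 < M ∧ 0 < C ∧ 0 < α ∧ α < 1 ∧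
    (∃ K : Set (Eucl d), IsCompact K ∧ K ⊆ E ∧ K₀ ⊆ K ∧ ∀ᵐ x ∂(μ.restrict (E \ K)),
      |aForm A x (Dρ x) (Dρ x) +
          1 / C * ((ρ x + 1) * Real.log (ρ x + 1) * inner ℝ (B x) (Dρ x))|
        ≤ M * (ρ x + 1) ^ 2 * Real.log (ρ x + 1) ^ 2) ∧
    ∀ᶠ n : ℕ in atTop,
      Ahat E A B μ ρ Dρ (fun r => C * Real.log (Real.log (r + 1) + 1)) n
        ≤ ENNReal.ofReal (n * Real.log (n + 1) ^ (C * α))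

/-- The hypothesis of criterion (iii). -/
def CriterionIII {d : ℕ} (E : Set (Eucl d)) (A : Eucl d → Matrix (Fin d) (Fin d) ℝ)
    (B : Eucl d → Eucl d) (μ : Measure (Eucl d)) (ρ : Eucl d → ℝ) (Dρ : Eucl d → Eucl d)
    (K₀ : Set (Eucl d)) : Prop :=
  ∃ M C α : ℝ, 0 < M ∧ 0 < C ∧ 0 < α ∧ α < 2 ∧
    (∃ K : Set (Eucl d), IsCompact K ∧ K ⊆ E ∧ K₀ ⊆ K ∧ ∀ᵐ x ∂(μ.restrict (E \ K)),
      |aForm A x (Dρ x) (Dρ x) + inner ℝ (B x) (Dρ x) / (C * ρ x)| ≤ M) ∧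
    ∀ᶠ n : ℕ in atTop,
      Ahat E A B μ ρ Dρ (fun r => C * r ^ 2 / 2) n
        ≤ ENNReal.ofReal (n * Real.exp (α * C * (n : ℝ) ^ 2))

end

end NonSectorial

namespace NonSectorial

noncomputable section

/-! ### Convergence in L² of sequences, products and inner products -/

section

section Convergence

variable {X F : Type*} [MeasurableSpace X] {ν : Measure X} [NormedAddCommGroup F]

/-! Construction of the semigroup. On a relatively compact open `V` the equation `(α - L⁰ - ⟨B,∇·⟩)
u = f` is solved weakly in the form domain (`LocalSetup.exists_weak_test`). The drift is only square
integrable, but, being divergence free, it is invisible to test functions of the form `ψ(u)`: with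
`Ψ' = ψ`, the product `⟨B,∇u⟩ ψ(u)` equals `⟨B,∇Ψ(u)⟩` and integrates to zero (`WeakSol.test_comp`).
So weak solutions are unique, depend positively on `f`, and satisfy the L¹, L² and L∞ contraction
bounds of a resolvent. Bounded weak solutions lie in the graph of the L¹-closure used in the
statement (`WeakSol.exists_graph_approx`), and that closure has at most one resolvent
(`GlobalSetup.isLocalResolvent_ae_eq`). The local resolvents increase with the domain
(`GlobalSetup.weakSol_mono`); their limit is a sub-Markovian contraction resolvent, strongly
continuous because of the density assumption (C) (`GlobalResolvent.strongResolvent`). Hille–Yosida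
then gives the semigroup, and the resolvent at `α = 1` already determines it.

Reduction of conservativeness. Let `R_α` be the limiting resolvent and `U_α = α R_α 1`, defined as a
monotone limit. Since `T_s 1` decreases in `s`, the formula `1 - U_α = α ∫ e^{-αs} (1 - T_s 1) ds`
gives `1 - U_α ≥ e^{-αt} (1 - T_t 1)`. If `U_α ≥ 1 - e^{-cα}` for all `α > 0` with one `c > 0`, then
`1 - T_t 1 ≤ e^{-(c-t)α}`, which tends to `0` as `α → ∞` for `t < c`; the semigroup property covers
all other times (`IsSubMarkovSemigroup.isConservative`).

The bound on the resolvent. Let `u` solve `(α - L) u = 1` on `V_n` and put `w = 1 - α u`, so that `0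
≤ w ≤ 1` and `L w = α w`. Take the weight `P(w,ρ) = p(w)² exp(-2Φ(ρ)(a - κ log w))`, where `p` is
convex and vanishes exactly on `w ≤ γ`, and test the equation with `∂_w P · χ(ρ)²`, where `χ` is a
cut-off. Adding `∫ ⟨B,∇(P χ²)⟩ dμ = 0` cancels all terms with `⟨B,∇w⟩`; of the drift only `⟨B,∇ρ⟩`
remains. The criteria give `Φ'² ⟨A∇ρ,∇ρ⟩ + Φ' ⟨B,∇ρ⟩ ≤ M Φ`. A weight `e^{-2aΦ}` alone would leave
the unbounded error `M Φ`. Making the exponent depend on `w`, that is, inserting the factor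
`w^{2κΦ}`, makes `α w ∂_w P` contain `2ακΦ P`, which absorbs this error when `κα = 4M`. The price is
that `a - κ log w` must stay below some `a₂ < 1` on `w > γ`; this holds for `γ = e^{-cα}` with `c =
(a₂ - a)/(4M)`, a constant which does not depend on `α`. The algebra is in `barrier_inequality`, the
integrated form in `GlobalSetup.barrier_estimate`.

What remains is supported in the annulus `E_{4n} \ E_{2n}`, where `χ` varies: it is of order `(b_n /
n)² e^{-2aΦ(2n)}` if `Ahat ≤ b_n`. The growth conditions send it to zero, so `P(1 - U_α, ρ) = 0`
almost everywhere, i.e. `1 - U_α ≤ γ` (`ExhaustionFunction.one_sub_le`). The three criteria are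
three choices of a growth function for `Φ`, cut off near the compact set where nothing is assumed
(`exists_cutoff_primitive`). -/

theorem tendsto_eLpNorm_two_of_dominated {f : ℕ → X → F} {g : X → F} {b : X → ℝ}
    (hf : ∀ n, AEStronglyMeasurable (fun x => f n x - g x) ν) (hb : MemLp b 2 ν)
    (hle : ∀ n, ∀ᵐ x ∂ν, ‖f n x - g x‖ ≤ b x)
    (hlim : ∀ᵐ x ∂ν, Tendsto (fun n => f n x) atTop (𝓝 (g x))) :
    Tendsto (fun n => eLpNorm (fun x => f n x - g x) 2 ν) atTop (𝓝 0) := by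
  have key : Tendsto (fun n => ∫⁻ x, ‖f n x - g x‖ₑ ^ (2 : ℝ) ∂ν) atTop (𝓝 0) := by
    have h0 : (0 : ℝ≥0∞) = ∫⁻ _, 0 ∂ν := by simp
    rw [h0]
    refine tendsto_lintegral_of_dominated_convergence' (fun x => ‖b x‖ₑ ^ (2 : ℝ)) ?_ ?_ ?_ ?_
    · exact fun n => ((hf n).enorm.pow_const _)
    · intro n
      filter_upwards [hle n] with x hx
      gcongr
      exact enorm_le_iff_norm_le.2 (hx.trans (le_abs_self _))
    · have := (eLpNorm_lt_top_iff_lintegral_rpow_enorm_lt_top (p := 2) (by simp) (by simp)).1 hb.2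
      simpa using this.ne
    · filter_upwards [hlim] with x hx
      have h1 : Tendsto (fun n => ‖f n x - g x‖ₑ) atTop (𝓝 0) := by
        have := (hx.sub_const (g x)).enorm
        simpa using this
      have h2 := ((ENNReal.continuous_rpow_const (y := (2 : ℝ))).tendsto 0).comp h1
      simpa [Function.comp_def] using h2
  have h3 := ((ENNReal.continuous_rpow_const (y := (1 / 2 : ℝ))).tendsto 0).comp key
  refine (h3.congr fun n => ?_).trans (by simp)
  rw [eLpNorm_eq_lintegral_rpow_enorm_toReal (by simp) (by simp)]
  simp [Function.comp_def]

theorem tendsto_eLpNorm_two_add {f f' : ℕ → X → F} {g g' : X → F}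
    (hf : ∀ n, AEStronglyMeasurable (fun x => f n x - g x) ν)
    (hf' : ∀ n, AEStronglyMeasurable (fun x => f' n x - g' x) ν)
    (h : Tendsto (fun n => eLpNorm (fun x => f n x - g x) 2 ν) atTop (𝓝 0))
    (h' : Tendsto (fun n => eLpNorm (fun x => f' n x - g' x) 2 ν) atTop (𝓝 0)) :
    Tendsto (fun n => eLpNorm (fun x => (f n x + f' n x) - (g x + g' x)) 2 ν) atTop (𝓝 0) := by
  have h2 := h.add h'
  rw [add_zero] at h2
  refine tendsto_of_tendsto_of_tendsto_of_le_of_le tendsto_const_nhds h2 (fun n => zero_le)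
    (fun n => ?_)
  have : (fun x => (f n x + f' n x) - (g x + g' x)) =
      (fun x => f n x - g x) + fun x => f' n x - g' x := by
    ext x; simp only [Pi.add_apply]; abel
  rw [this]
  exact eLpNorm_add_le (hf n) (hf' n) (by norm_num)

/-- Split the difference as `a_n (f_n - g) + (a_n - a') g`: the uniform bound handles the first
part, dominated convergence with majorant `2C‖g‖` the second. In the chain rule the factors `a_n`
are derivatives of a nonlinearity, for which only almost everywhere convergence is known. -/
theorem tendsto_eLpNorm_two_smul [NormedSpace ℝ F] {a : ℕ → X → ℝ} {a' : X → ℝ} {f : ℕ → X → F} {g : X → F} {C : ℝ}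
    (ha : ∀ n, AEStronglyMeasurable (a n) ν) (hg : MemLp g 2 ν)
    (hf : ∀ n, AEStronglyMeasurable (f n) ν)
    (haC : ∀ n, ∀ᵐ x ∂ν, |a n x| ≤ C)
    (hlim : ∀ᵐ x ∂ν, Tendsto (fun n => a n x) atTop (𝓝 (a' x)))
    (h : Tendsto (fun n => eLpNorm (fun x => f n x - g x) 2 ν) atTop (𝓝 0)) :
    Tendsto (fun n => eLpNorm (fun x => a n x • f n x - a' x • g x) 2 ν) atTop (𝓝 0) := by
  have ha' : AEStronglyMeasurable a' ν := aestronglyMeasurable_of_tendsto_ae atTop ha hlim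
  have ha'C : ∀ᵐ x ∂ν, |a' x| ≤ C := by
    filter_upwards [ae_all_iff.2 haC, hlim] with x hx hl
    exact le_of_tendsto hl.abs (Eventually.of_forall hx)
  have h1 : Tendsto (fun n => eLpNorm (fun x => a n x • (f n x - g x) - 0) 2 ν) atTop (𝓝 0) := by
    have h2 : Tendsto (fun n => ENNReal.ofReal C * eLpNorm (fun x => f n x - g x) 2 ν) atTop
        (𝓝 0) := by
      simpa using ENNReal.Tendsto.const_mul h (Or.inr ENNReal.ofReal_ne_top)
    refine tendsto_of_tendsto_of_tendsto_of_le_of_le tendsto_const_nhds h2 (fun n => zero_le)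
      (fun n => ?_)
    refine eLpNorm_le_mul_eLpNorm_of_ae_le_mul ?_ 2
    filter_upwards [haC n] with x hx
    rw [sub_zero, norm_smul]
    exact mul_le_mul_of_nonneg_right hx (norm_nonneg _)
  have h2 : Tendsto (fun n => eLpNorm (fun x => a n x • g x - a' x • g x) 2 ν) atTop (𝓝 0) := by
    refine tendsto_eLpNorm_two_of_dominated (b := fun x => 2 * C * ‖g x‖)
      (fun n => ((ha n).smul hg.1).sub (ha'.smul hg.1)) (hg.norm.const_mul _) (fun n => ?_) ?_
    · filter_upwards [haC n, ha'C] with x hx hx'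
      rw [← sub_smul, norm_smul]
      refine mul_le_mul_of_nonneg_right ?_ (norm_nonneg _)
      rw [Real.norm_eq_abs]
      exact (abs_sub _ _).trans (by linarith)
    · filter_upwards [hlim] with x hx using hx.smul_const _
  have := tendsto_eLpNorm_two_add (fun n => (((ha n).smul ((hf n).sub hg.1)).sub
    aestronglyMeasurable_const)) (fun n => ((ha n).smul hg.1).sub (ha'.smul hg.1)) h1 h2
  refine this.congr fun n => ?_
  congr 1
  ext x
  simp [smul_sub]

theorem eLpNorm_two_subseq_ae {f : ℕ → X → F} {g : X → F}
    (hf : ∀ n, AEStronglyMeasurable (f n) ν) (hg : AEStronglyMeasurable g ν)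
    (h : Tendsto (fun n => eLpNorm (fun x => f n x - g x) 2 ν) atTop (𝓝 0)) :
    ∃ ns : ℕ → ℕ, StrictMono ns ∧
      ∀ᵐ x ∂ν, Tendsto (fun n => f (ns n) x) atTop (𝓝 (g x)) :=
  (tendstoInMeasure_of_tendsto_eLpNorm (p := 2) (by simp) hf hg h).exists_seq_tendsto_ae

end Convergence

theorem tendsto_integral_inner {X F : Type*} [MeasurableSpace X] {ν : Measure X}
    [NormedAddCommGroup F] [InnerProductSpace ℝ F] {f f' : ℕ → X → F} {g g' : X → F}
    (hf : ∀ n, MemLp (f n) 2 ν) (hf' : ∀ n, MemLp (f' n) 2 ν) (hg : MemLp g 2 ν)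
    (hg' : MemLp g' 2 ν)
    (h : Tendsto (fun n => eLpNorm (fun x => f n x - g x) 2 ν) atTop (𝓝 0))
    (h' : Tendsto (fun n => eLpNorm (fun x => f' n x - g' x) 2 ν) atTop (𝓝 0)) :
    Tendsto (fun n => ∫ x, inner ℝ (f n x) (f' n x) ∂ν) atTop (𝓝 (∫ x, inner ℝ (g x) (g' x) ∂ν)) := by
  have e : ∀ {a b : X → F} (ha : MemLp a 2 ν) (hb : MemLp b 2 ν),
      ∫ x, inner ℝ (a x) (b x) ∂ν = inner ℝ (ha.toLp a) (hb.toLp b) := by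
    intro a b ha hb
    rw [L2.inner_def]
    refine integral_congr_ae ?_
    filter_upwards [ha.coeFn_toLp, hb.coeFn_toLp] with x h1 h2
    rw [h1, h2]
  rw [e hg hg']
  simp_rw [fun n => e (hf n) (hf' n)]
  refine Tendsto.inner ?_ ?_
  · exact (Lp.tendsto_Lp_iff_tendsto_eLpNorm'' f hf g hg).2 h
  · exact (Lp.tendsto_Lp_iff_tendsto_eLpNorm'' f' hf' g' hg').2 h'

theorem integrable_inner {X F : Type*} [MeasurableSpace X] {ν : Measure X}
    [NormedAddCommGroup F] [InnerProductSpace ℝ F] {f g : X → F}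
    (hf : MemLp f 2 ν) (hg : MemLp g 2 ν) : Integrable (fun x => inner ℝ (f x) (g x)) ν := by
  have := L2.integrable_inner (𝕜 := ℝ) (hf.toLp f) (hg.toLp g)
  refine this.congr ?_
  filter_upwards [hf.coeFn_toLp, hg.coeFn_toLp] with x h1 h2
  rw [h1, h2]

/-! ### Bounded modifications of smooth functions -/

section SmoothCutoff

/-- Multiplication by a bump function that equals `1` on a slightly larger ball. Bounded functions
do not notice the change, so chain rules proved for bounded derivatives apply to arbitrary smooth
nonlinearities; zeros are preserved so that the modified function still maps test functions to test
functions. -/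
theorem exists_bounded_modification {V : Type*} [NormedAddCommGroup V] [NormedSpace ℝ V]
    [FiniteDimensional ℝ V] {F : V → ℝ} (hF : ContDiff ℝ ∞ F) (M : ℝ) :
    ∃ F' : V → ℝ, ContDiff ℝ ∞ F' ∧ (∃ C, ∀ p, |F' p| ≤ C) ∧ (∃ C, ∀ p, ‖fderiv ℝ F' p‖ ≤ C) ∧
      (∀ p, ‖p‖ ≤ M → F' p = F p ∧ fderiv ℝ F' p = fderiv ℝ F p) ∧ ∀ p, F p = 0 → F' p = 0 := by
  have hr : (0 : ℝ) < |M| + 1 := by positivity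
  let b : ContDiffBump (0 : V) := ⟨|M| + 1, |M| + 2, hr, by linarith⟩
  have hcs : HasCompactSupport (fun p => b p * F p) := b.hasCompactSupport.mul_right
  have hcd : ContDiff ℝ ∞ (fun p => b p * F p) := b.contDiff.mul hF
  refine ⟨fun p => b p * F p, hcd, ?_, ?_, ?_, ?_⟩
  · obtain ⟨C, hC⟩ := hcd.continuous.bounded_above_of_compact_support hcs
    exact ⟨C, fun p => hC p⟩
  · obtain ⟨C, hC⟩ := (hcd.continuous_fderiv (by simp)).bounded_above_of_compact_support
      (hcs.fderiv (𝕜 := ℝ))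
    exact ⟨C, hC⟩
  · intro p hp
    have hev : (fun p => b p * F p) =ᶠ[𝓝 p] F := by
      have : p ∈ Metric.ball (0 : V) (|M| + 1) := by
        rw [mem_ball_zero_iff]; linarith [le_abs_self M]
      filter_upwards [Metric.isOpen_ball.mem_nhds this] with q hq
      rw [b.one_of_mem_closedBall (Metric.ball_subset_closedBall hq), one_mul]
    exact ⟨hev.eq_of_nhds, hev.fderiv_eq⟩
  · intro p hp
    simp [hp]

end SmoothCutoff

/-! ### Gradients of compositions and L² approximation of pairs (function, gradient) -/

section Gradient

variable {d : ℕ}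

theorem hasGradientAt_comp_pair {F : ℝ × ℝ → ℝ} {f h : Eucl d → ℝ} {x : Eucl d}
    (hF : DifferentiableAt ℝ F (f x, h x)) (hf : DifferentiableAt ℝ f x)
    (hh : DifferentiableAt ℝ h x) :
    gradient (fun y => F (f y, h y)) x =
      fderiv ℝ F (f x, h x) (1, 0) • gradient f x + fderiv ℝ F (f x, h x) (0, 1) • gradient h x := by
  have h1 : HasFDerivAt (fun y => F (f y, h y))
      ((fderiv ℝ F (f x, h x)).comp ((fderiv ℝ f x).prod (fderiv ℝ h x))) x :=
    HasFDerivAt.comp (g := F) x hF.hasFDerivAt (hf.hasFDerivAt.prodMk hh.hasFDerivAt)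
  apply (InnerProductSpace.toDual ℝ (Eucl d)).injective
  rw [toDual_gradient, h1.fderiv]
  ext v
  have : ((fderiv ℝ f x) v, (fderiv ℝ h x) v) =
      (fderiv ℝ f x) v • ((1, 0) : ℝ × ℝ) + (fderiv ℝ h x) v • ((0, 1) : ℝ × ℝ) := by simp
  simp only [ContinuousLinearMap.comp_apply, ContinuousLinearMap.prod_apply]
  rw [this, map_add, map_smul, map_smul]
  simp [toDual_gradient, mul_comm]

theorem gradient_mul {f h : Eucl d → ℝ} {x : Eucl d} (hf : DifferentiableAt ℝ f x)
    (hh : DifferentiableAt ℝ h x) :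
    gradient (fun y => f y * h y) x = f x • gradient h x + h x • gradient f x := by
  apply (InnerProductSpace.toDual ℝ (Eucl d)).injective
  rw [toDual_gradient, fderiv_fun_mul hf hh]
  simp [toDual_gradient]

theorem gradient_comp {ψ : ℝ → ℝ} {f : Eucl d → ℝ} {x : Eucl d} (hψ : DifferentiableAt ℝ ψ (f x))
    (hf : DifferentiableAt ℝ f x) :
    gradient (fun y => ψ (f y)) x = deriv ψ (f x) • gradient f x := by
  apply (InnerProductSpace.toDual ℝ (Eucl d)).injective
  have := (hψ.hasDerivAt.comp_hasFDerivAt x hf.hasFDerivAt).fderiv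
  rw [toDual_gradient]
  simp only [Function.comp_def] at this
  rw [this]
  simp [toDual_gradient]

theorem gradient_add {f h : Eucl d → ℝ} {x : Eucl d} (hf : DifferentiableAt ℝ f x)
    (hh : DifferentiableAt ℝ h x) :
    gradient (fun y => f y + h y) x = gradient f x + gradient h x := by
  apply (InnerProductSpace.toDual ℝ (Eucl d)).injective
  rw [toDual_gradient, fderiv_fun_add hf hh]
  simp [toDual_gradient]

theorem gradient_const_mul {f : Eucl d → ℝ} {x : Eucl d} (c : ℝ) (hf : DifferentiableAt ℝ f x) :
    gradient (fun y => c * f y) x = c • gradient f x := by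
  apply (InnerProductSpace.toDual ℝ (Eucl d)).injective
  rw [toDual_gradient, fderiv_const_mul hf]
  simp [toDual_gradient]

theorem continuous_gradient {f : Eucl d → ℝ} (hf : ContDiff ℝ ∞ f) : Continuous (gradient f) :=
  (InnerProductSpace.toDual ℝ (Eucl d)).symm.continuous.comp (hf.continuous_fderiv (by simp))

theorem exists_gradient_bound {f : Eucl d → ℝ} (hf : ContDiff ℝ ∞ f) (hc : HasCompactSupport f) :
    ∃ C, ∀ x, ‖gradient f x‖ ≤ C := by
  obtain ⟨C, hC⟩ := (hf.continuous_fderiv (by simp)).bounded_above_of_compact_support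
    (hc.fderiv (𝕜 := ℝ))
  exact ⟨C, fun x => by rw [gradient, LinearIsometryEquiv.norm_map]; exact hC x⟩

/-- Smooth functions `f n` which approximate the pair `(u, G)` of a function and its gradient in
`L²(ν)`, the functions also almost everywhere. -/
structure GradApprox (ν : Measure (Eucl d)) (f : ℕ → Eucl d → ℝ) (u : Eucl d → ℝ)
    (G : Eucl d → Eucl d) : Prop where
  smooth : ∀ n, ContDiff ℝ ∞ (f n)
  memLp : MemLp u 2 ν
  memLp_grad : MemLp G 2 ν
  lim : Tendsto (fun n => eLpNorm (fun x => f n x - u x) 2 ν) atTop (𝓝 0)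
  lim_grad : Tendsto (fun n => eLpNorm (fun x => gradient (f n) x - G x) 2 ν) atTop (𝓝 0)
  ae : ∀ᵐ x ∂ν, Tendsto (fun n => f n x) atTop (𝓝 (u x))

namespace GradApprox

variable {ν : Measure (Eucl d)} {f h : ℕ → Eucl d → ℝ} {u v : Eucl d → ℝ}
  {G H : Eucl d → Eucl d}

theorem meas (hu : GradApprox ν f u G) (n : ℕ) : AEStronglyMeasurable (f n) ν :=
  (hu.smooth n).continuous.aestronglyMeasurable

theorem meas_grad (hu : GradApprox ν f u G) (n : ℕ) : AEStronglyMeasurable (gradient (f n)) ν :=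
  (continuous_gradient (hu.smooth n)).aestronglyMeasurable

theorem congr (hu : GradApprox ν f u G) (h1 : u =ᵐ[ν] v) (h2 : G =ᵐ[ν] H) :
    GradApprox ν f v H where
  smooth := hu.smooth
  memLp := hu.memLp.ae_eq h1
  memLp_grad := hu.memLp_grad.ae_eq h2
  lim := hu.lim.congr fun n => eLpNorm_congr_ae (by filter_upwards [h1] with x hx; rw [hx])
  lim_grad := hu.lim_grad.congr fun n =>
    eLpNorm_congr_ae (by filter_upwards [h2] with x hx; rw [hx])
  ae := by filter_upwards [hu.ae, h1] with x hx h1; rwa [← h1]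

theorem mono (hu : GradApprox ν f u G) {ν' : Measure (Eucl d)} (hν : ν' ≤ ν) :
    GradApprox ν' f u G where
  smooth := hu.smooth
  memLp := hu.memLp.mono_measure hν
  memLp_grad := hu.memLp_grad.mono_measure hν
  lim := tendsto_of_tendsto_of_tendsto_of_le_of_le tendsto_const_nhds hu.lim (fun n => zero_le)
    (fun n => eLpNorm_mono_measure _ hν)
  lim_grad := tendsto_of_tendsto_of_tendsto_of_le_of_le tendsto_const_nhds hu.lim_grad
    (fun n => zero_le) (fun n => eLpNorm_mono_measure _ hν)
  ae := (Measure.absolutelyContinuous_of_le hν).ae_le hu.ae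

theorem add (hu : GradApprox ν f u G) (hv : GradApprox ν h v H) :
    GradApprox ν (fun n x => f n x + h n x) (fun x => u x + v x) (fun x => G x + H x) where
  smooth n := (hu.smooth n).add (hv.smooth n)
  memLp := hu.memLp.add hv.memLp
  memLp_grad := hu.memLp_grad.add hv.memLp_grad
  lim := tendsto_eLpNorm_two_add (fun n => (hu.meas n).sub hu.memLp.1)
    (fun n => (hv.meas n).sub hv.memLp.1) hu.lim hv.lim
  lim_grad := by
    have := tendsto_eLpNorm_two_add (fun n => (hu.meas_grad n).sub hu.memLp_grad.1)
      (fun n => (hv.meas_grad n).sub hv.memLp_grad.1) hu.lim_grad hv.lim_grad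
    refine this.congr fun n => ?_
    congr 1
    ext1 x
    rw [gradient_add ((hu.smooth n).differentiable (by simp) x)
      ((hv.smooth n).differentiable (by simp) x)]
  ae := by filter_upwards [hu.ae, hv.ae] with x h1 h2 using h1.add h2

/-- Multiplication with a bounded smooth function with bounded gradient. -/
theorem smooth_mul (hu : GradApprox ν f u G) {χ : Eucl d → ℝ} (hχ : ContDiff ℝ ∞ χ) {C : ℝ}
    (hχC : ∀ x, |χ x| ≤ C) (hχC' : ∀ x, ‖gradient χ x‖ ≤ C) :
    GradApprox ν (fun n x => χ x * f n x) (fun x => χ x * u x)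
      (fun x => χ x • G x + u x • gradient χ x) where
  smooth n := hχ.mul (hu.smooth n)
  memLp := hu.memLp.of_le_mul (hχ.continuous.aestronglyMeasurable.mul hu.memLp.1) (c := C)
    (Eventually.of_forall fun x => by
      rw [norm_mul]; exact mul_le_mul_of_nonneg_right (hχC x) (norm_nonneg _))
  memLp_grad := by
    refine MemLp.add ?_ ?_
    · exact hu.memLp_grad.of_le_mul (hχ.continuous.aestronglyMeasurable.smul hu.memLp_grad.1)
        (c := C) (Eventually.of_forall fun x => by
          rw [norm_smul]; exact mul_le_mul_of_nonneg_right (hχC x) (norm_nonneg _))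
    · exact hu.memLp.of_le_mul
        (hu.memLp.1.smul (continuous_gradient hχ).aestronglyMeasurable)
        (c := C) (Eventually.of_forall fun x => by
          rw [norm_smul, mul_comm]; exact mul_le_mul_of_nonneg_right (hχC' x) (norm_nonneg _))
  lim := tendsto_eLpNorm_two_smul (a := fun _ => χ) (a' := χ) (C := C)
    (fun n => hχ.continuous.aestronglyMeasurable) hu.memLp hu.meas
    (fun n => Eventually.of_forall hχC) (Eventually.of_forall fun x => tendsto_const_nhds) hu.lim
  lim_grad := by
    have h1 := tendsto_eLpNorm_two_smul (a := fun _ => χ) (a' := χ) (C := C)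
      (fun n => hχ.continuous.aestronglyMeasurable) hu.memLp_grad hu.meas_grad
      (fun n => Eventually.of_forall hχC) (Eventually.of_forall fun x => tendsto_const_nhds)
      hu.lim_grad
    have h2 : Tendsto (fun n => eLpNorm (fun x => f n x • gradient χ x - u x • gradient χ x) 2 ν)
        atTop (𝓝 0) := by
      have h2 : Tendsto (fun n => ENNReal.ofReal C * eLpNorm (fun x => f n x - u x) 2 ν) atTop
          (𝓝 0) := by
        simpa using ENNReal.Tendsto.const_mul hu.lim (Or.inr ENNReal.ofReal_ne_top)
      refine tendsto_of_tendsto_of_tendsto_of_le_of_le tendsto_const_nhds h2 (fun n => zero_le)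
        (fun n => ?_)
      refine eLpNorm_le_mul_eLpNorm_of_ae_le_mul (Eventually.of_forall fun x => ?_) 2
      rw [← sub_smul, norm_smul, mul_comm]
      exact mul_le_mul_of_nonneg_right (hχC' x) (norm_nonneg _)
    have cg := continuous_gradient hχ
    have := tendsto_eLpNorm_two_add
      (fun n => (hχ.continuous.aestronglyMeasurable.smul (hu.meas_grad n)).sub
        (hχ.continuous.aestronglyMeasurable.smul hu.memLp_grad.1))
      (fun n => ((hu.meas n).smul cg.aestronglyMeasurable).sub
        (hu.memLp.1.smul cg.aestronglyMeasurable)) h1 h2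
    refine this.congr fun n => ?_
    congr 1
    ext1 x
    rw [gradient_mul (hχ.differentiable (by simp) x) ((hu.smooth n).differentiable (by simp) x)]
    rfl
  ae := by filter_upwards [hu.ae] with x hx using hx.const_mul _

/-- Composition with a smooth function of two variables with bounded derivative. -/
theorem comp_pair [IsFiniteMeasure ν] (hu : GradApprox ν f u G) (hv : GradApprox ν h v H)
    {F : ℝ × ℝ → ℝ} (hF : ContDiff ℝ ∞ F) {C : ℝ} (hC : ∀ p, ‖fderiv ℝ F p‖ ≤ C) :
    GradApprox ν (fun n x => F (f n x, h n x)) (fun x => F (u x, v x))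
      (fun x => fderiv ℝ F (u x, v x) (1, 0) • G x + fderiv ℝ F (u x, v x) (0, 1) • H x) := by
  have hd : ∀ p, DifferentiableAt ℝ F p := fun p => hF.differentiable (by simp) p
  have hC0 : 0 ≤ C := (norm_nonneg _).trans (hC 0)
  -- The Lipschitz bound serves twice: for the integrability of `F(u,v)`, where the constant
  -- `F(0,0)` needs a finite measure, and for the L² convergence of the functions themselves.
  have hlip : ∀ p q, |F p - F q| ≤ C * (|p.1 - q.1| + |p.2 - q.2|) := by
    intro p q
    have := Convex.norm_image_sub_le_of_norm_fderiv_le (𝕜 := ℝ) (fun x _ => hd x)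
      (fun x _ => hC x) convex_univ (Set.mem_univ q) (Set.mem_univ p)
    refine this.trans (mul_le_mul_of_nonneg_left ?_ hC0)
    rw [Prod.norm_def]
    simp only [Prod.fst_sub, Prod.snd_sub, Real.norm_eq_abs]
    exact max_le (by linarith [abs_nonneg (p.2 - q.2)]) (by linarith [abs_nonneg (p.1 - q.1)])
  have hcont : ∀ e : ℝ × ℝ, Continuous fun p => fderiv ℝ F p e := fun e =>
    (hF.continuous_fderiv (by simp)).clm_apply continuous_const
  have hb : ∀ (e : ℝ × ℝ), ‖e‖ ≤ 1 → ∀ p, |fderiv ℝ F p e| ≤ C := fun e he p =>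
    ((fderiv ℝ F p).le_opNorm e).trans
      ((mul_le_mul (hC p) he (norm_nonneg _) hC0).trans (by simp))
  have e1 : ‖((1 : ℝ), (0 : ℝ))‖ ≤ 1 := by simp [Prod.norm_def]
  have e2 : ‖((0 : ℝ), (1 : ℝ))‖ ≤ 1 := by simp [Prod.norm_def]
  have mp : ∀ n, AEStronglyMeasurable (fun x => (f n x, h n x)) ν := fun n =>
    (hu.meas n).prodMk (hv.meas n)
  have mp' : AEStronglyMeasurable (fun x => (u x, v x)) ν := hu.memLp.1.prodMk hv.memLp.1
  have mF : AEStronglyMeasurable (fun x => F (u x, v x)) ν :=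
    hF.continuous.comp_aestronglyMeasurable mp'
  have md : ∀ e, AEStronglyMeasurable (fun x => fderiv ℝ F (u x, v x) e) ν := fun e =>
    (hcont e).comp_aestronglyMeasurable mp'
  have mdn : ∀ e n, AEStronglyMeasurable (fun x => fderiv ℝ F (f n x, h n x) e) ν := fun e n =>
    (hcont e).comp_aestronglyMeasurable (mp n)
  have lp : ∀ e, Continuous (fun p => fderiv ℝ F p e) →
    ∀ᵐ x ∂ν, Tendsto (fun n => fderiv ℝ F (f n x, h n x) e) atTop
      (𝓝 (fderiv ℝ F (u x, v x) e)) := by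
    intro e he
    filter_upwards [hu.ae, hv.ae] with x h1 h2
    exact (he.tendsto _).comp (h1.prodMk_nhds h2)
  refine ⟨fun n => hF.comp ((hu.smooth n).prodMk (hv.smooth n)), ?_, ?_, ?_, ?_, ?_⟩
  · have hbd : MemLp (fun x => |F (0, 0)| + C * (|u x| + |v x|)) 2 ν :=
      MemLp.add (f := fun _ => |F (0, 0)|) (g := fun x => C * (|u x| + |v x|)) (memLp_const _)
        (MemLp.const_mul (f := fun x => |u x| + |v x|) (hu.memLp.abs.add hv.memLp.abs) C)
    refine hbd.mono mF (Eventually.of_forall fun x => ?_)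
    have h0 := hlip (u x, v x) (0, 0)
    simp only [sub_zero] at h0
    rw [Real.norm_eq_abs, Real.norm_eq_abs]
    refine le_trans ?_ (le_abs_self _)
    have := abs_sub_abs_le_abs_sub (F (u x, v x)) (F (0, 0))
    linarith
  · refine MemLp.add ?_ ?_
    · exact hu.memLp_grad.of_le_mul ((md _).smul hu.memLp_grad.1) (c := C)
        (Eventually.of_forall fun x => by
          rw [norm_smul]; exact mul_le_mul_of_nonneg_right (hb _ e1 _) (norm_nonneg _))
    · exact hv.memLp_grad.of_le_mul ((md _).smul hv.memLp_grad.1) (c := C)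
        (Eventually.of_forall fun x => by
          rw [norm_smul]; exact mul_le_mul_of_nonneg_right (hb _ e2 _) (norm_nonneg _))
  · have h2 : Tendsto (fun n => ENNReal.ofReal C * (eLpNorm (fun x => f n x - u x) 2 ν +
        eLpNorm (fun x => h n x - v x) 2 ν)) atTop (𝓝 0) := by
      simpa using ENNReal.Tendsto.const_mul (hu.lim.add hv.lim) (Or.inr ENNReal.ofReal_ne_top)
    refine tendsto_of_tendsto_of_tendsto_of_le_of_le tendsto_const_nhds h2 (fun n => zero_le)
      (fun n => ?_)
    have m1 := (hu.meas n).sub hu.memLp.1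
    have m2 := (hv.meas n).sub hv.memLp.1
    have h3 : eLpNorm (fun x => F (f n x, h n x) - F (u x, v x)) 2 ν ≤ ENNReal.ofReal C *
        eLpNorm (fun x => |f n x - u x| + |h n x - v x|) 2 ν := by
      refine eLpNorm_le_mul_eLpNorm_of_ae_le_mul (Eventually.of_forall fun x => ?_) 2
      rw [Real.norm_eq_abs, Real.norm_of_nonneg (by positivity)]
      exact hlip _ _
    refine h3.trans (mul_le_mul_right ?_ _)
    have h4 := eLpNorm_add_le (p := 2) m1.norm m2.norm (by norm_num)
    refine h4.trans (le_of_eq ?_)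
    congr 1
    · exact eLpNorm_norm _
    · exact eLpNorm_norm _
  · have h1 := tendsto_eLpNorm_two_smul (C := C) (mdn (1, 0)) hu.memLp_grad hu.meas_grad
      (fun n => Eventually.of_forall fun x => hb _ e1 _) (lp _ (hcont _)) hu.lim_grad
    have h2 := tendsto_eLpNorm_two_smul (C := C) (mdn (0, 1)) hv.memLp_grad hv.meas_grad
      (fun n => Eventually.of_forall fun x => hb _ e2 _) (lp _ (hcont _)) hv.lim_grad
    have := tendsto_eLpNorm_two_add
      (fun n => ((mdn (1, 0) n).smul (hu.meas_grad n)).sub ((md _).smul hu.memLp_grad.1))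
      (fun n => ((mdn (0, 1) n).smul (hv.meas_grad n)).sub ((md _).smul hv.memLp_grad.1)) h1 h2
    refine this.congr fun n => ?_
    congr 1
    ext1 x
    rw [hasGradientAt_comp_pair (hd _) ((hu.smooth n).differentiable (by simp) x)
      ((hv.smooth n).differentiable (by simp) x)]
    rfl
  · filter_upwards [hu.ae, hv.ae] with x h1 h2
    exact (hF.continuous.tendsto _).comp (h1.prodMk_nhds h2)

theorem fderiv_comp_fst {ψ : ℝ → ℝ} (hψ : ContDiff ℝ ∞ ψ) (p : ℝ × ℝ) :
    fderiv ℝ (fun q : ℝ × ℝ => ψ q.1) p = deriv ψ p.1 • ContinuousLinearMap.fst ℝ ℝ ℝ := by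
  have h1 : HasDerivAt ψ (deriv ψ p.1) p.1 :=
    (hψ.differentiable (by simp) p.1).hasDerivAt
  exact (h1.comp_hasFDerivAt (f := Prod.fst) p hasFDerivAt_fst).fderiv

/-- Composition with a smooth function with bounded derivative. -/
theorem comp [IsFiniteMeasure ν] (hu : GradApprox ν f u G)
    {ψ : ℝ → ℝ} (hψ : ContDiff ℝ ∞ ψ) {C : ℝ} (hC : ∀ s, |deriv ψ s| ≤ C) :
    GradApprox ν (fun n x => ψ (f n x)) (fun x => ψ (u x)) (fun x => deriv ψ (u x) • G x) := by
  have h1 := hu.comp_pair hu (F := fun q => ψ q.1) (hψ.comp contDiff_fst) (C := C) (fun p => by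
    rw [fderiv_comp_fst hψ, norm_smul]
    have := hC p.1
    have h0 := ContinuousLinearMap.norm_fst_le ℝ ℝ ℝ
    rw [Real.norm_eq_abs]
    nlinarith [abs_nonneg (deriv ψ p.1)])
  refine h1.congr EventuallyEq.rfl (Eventually.of_forall fun x => ?_)
  simp [fderiv_comp_fst hψ]

end GradApprox

theorem exists_gradApprox_subseq {ν : Measure (Eucl d)} {f : ℕ → Eucl d → ℝ} {u : Eucl d → ℝ}
    {G : Eucl d → Eucl d} (hf : ∀ n, ContDiff ℝ ∞ (f n)) (hu : MemLp u 2 ν) (hG : MemLp G 2 ν)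
    (h1 : Tendsto (fun n => eLpNorm (fun x => f n x - u x) 2 ν) atTop (𝓝 0))
    (h2 : Tendsto (fun n => eLpNorm (fun x => gradient (f n) x - G x) 2 ν) atTop (𝓝 0)) :
    ∃ ns : ℕ → ℕ, StrictMono ns ∧ GradApprox ν (fun n => f (ns n)) u G := by
  obtain ⟨ns, hns, hae⟩ := eLpNorm_two_subseq_ae
    (fun n => (hf n).continuous.aestronglyMeasurable) hu.1 h1
  exact ⟨ns, hns, fun n => hf _, hu, hG, h1.comp hns.tendsto_atTop, h2.comp hns.tendsto_atTop, hae⟩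

end Gradient

end

/-! ### The quadratic form of the coefficients, and solvability of the local equation -/

section

section AForm

variable {d : ℕ} (A : Eucl d → Matrix (Fin d) (Fin d) ℝ)

/-- The vector `A(x) ξ`. -/
def aVec (x : Eucl d) : Eucl d →ₗ[ℝ] Eucl d := Matrix.toEuclideanLin (A x)

theorem aVec_apply (x ξ : Eucl d) (i : Fin d) : aVec A x ξ i = ∑ j, A x i j * ξ j := by
  simp [aVec, Matrix.toLpLin_apply, Matrix.mulVec, dotProduct]

theorem aForm_eq_inner (x ξ η : Eucl d) : aForm A x ξ η = inner ℝ (aVec A x ξ) η := by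
  simp [aForm, PiLp.inner_apply, aVec_apply, Finset.mul_sum, mul_comm]

variable {A}

theorem aForm_comm {x : Eucl d} (h : (A x).IsSymm) (ξ η : Eucl d) :
    aForm A x ξ η = aForm A x η ξ := by
  unfold aForm
  rw [Finset.sum_comm]
  refine Finset.sum_congr rfl fun i _ => Finset.sum_congr rfl fun j _ => ?_
  rw [h.apply]; ring

theorem aForm_add_left (x ξ ξ' η : Eucl d) :
    aForm A x (ξ + ξ') η = aForm A x ξ η + aForm A x ξ' η := by
  simp [aForm_eq_inner, inner_add_left]

theorem aForm_smul_left (x : Eucl d) (c : ℝ) (ξ η : Eucl d) :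
    aForm A x (c • ξ) η = c * aForm A x ξ η := by
  simp [aForm_eq_inner, inner_smul_left]

theorem aForm_add_right (x ξ η η' : Eucl d) :
    aForm A x ξ (η + η') = aForm A x ξ η + aForm A x ξ η' := by
  simp [aForm_eq_inner, inner_add_right]

theorem aForm_smul_right (x : Eucl d) (c : ℝ) (ξ η : Eucl d) :
    aForm A x ξ (c • η) = c * aForm A x ξ η := by
  simp [aForm_eq_inner, inner_smul_right]

theorem aForm_sub_left (x ξ ξ' η : Eucl d) :
    aForm A x (ξ - ξ') η = aForm A x ξ η - aForm A x ξ' η := by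
  simp [aForm_eq_inner, inner_sub_left]

theorem aForm_sub_right (x ξ η η' : Eucl d) :
    aForm A x ξ (η - η') = aForm A x ξ η - aForm A x ξ η' := by
  simp [aForm_eq_inner, inner_sub_right]

/-- Nonnegativity of the form at `ξ ± tη` with `t = s/(2ε)`, multiplied by `ε`. -/
theorem aForm_young {x : Eucl d} (h : (A x).IsSymm) (hpos : ∀ ξ, 0 ≤ aForm A x ξ ξ)
    (ξ η : Eucl d) {ε : ℝ} (hε : 0 < ε) (s : ℝ) :
    |s * aForm A x ξ η| ≤ ε * aForm A x ξ ξ + s ^ 2 / (4 * ε) * aForm A x η η := by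
  have e : ∀ t : ℝ, 0 ≤ aForm A x ξ ξ + 2 * t * aForm A x ξ η + t ^ 2 * aForm A x η η := by
    intro t
    have := hpos (ξ + t • η)
    rw [aForm_add_left, aForm_add_right, aForm_add_right, aForm_smul_left, aForm_smul_right,
      aForm_smul_left, aForm_smul_right, aForm_comm h η ξ] at this
    nlinarith
  have h1 := mul_nonneg hε.le (e (s / (2 * ε)))
  have h2 := mul_nonneg hε.le (e (-(s / (2 * ε))))
  rw [abs_le]
  have e1 : ε * (aForm A x ξ ξ + 2 * (s / (2 * ε)) * aForm A x ξ η
      + (s / (2 * ε)) ^ 2 * aForm A x η η) =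
      ε * aForm A x ξ ξ + s * aForm A x ξ η + s ^ 2 / (4 * ε) * aForm A x η η := by
    field_simp; ring
  have e2 : ε * (aForm A x ξ ξ + 2 * (-(s / (2 * ε))) * aForm A x ξ η
      + (-(s / (2 * ε))) ^ 2 * aForm A x η η) =
      ε * aForm A x ξ ξ - s * aForm A x ξ η + s ^ 2 / (4 * ε) * aForm A x η η := by
    field_simp; ring
  constructor <;> linarith

/-- Young's inequality with `η = Aξ` and `ε = Λ/2` bounds `‖Aξ‖² = ⟨Aξ,η⟩` by `Λ²‖ξ‖²/2 + ‖η‖²/2`,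
and the last term is half of the left side. This gives the operator norm bound from the quadratic
form alone. -/
theorem norm_aVec_le {x : Eucl d} (h : (A x).IsSymm) (hpos : ∀ ξ, 0 ≤ aForm A x ξ ξ) {Λ : ℝ}
    (hΛ : 0 < Λ) (hle : ∀ ξ, aForm A x ξ ξ ≤ Λ * ‖ξ‖ ^ 2) (ξ : Eucl d) :
    ‖aVec A x ξ‖ ≤ Λ * ‖ξ‖ := by
  set η := aVec A x ξ with hη
  have h1 := aForm_young h hpos ξ η (ε := Λ / 2) (by positivity) 1
  have h2 : aForm A x ξ η = ‖η‖ ^ 2 := by rw [aForm_eq_inner, ← hη, real_inner_self_eq_norm_sq]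
  rw [h2, one_mul, abs_of_nonneg (by positivity)] at h1
  have h3 := hle ξ
  have h4 := hle η
  have h5 : (1 : ℝ) ^ 2 / (4 * (Λ / 2)) * aForm A x η η ≤ 1 / 2 * ‖η‖ ^ 2 := by
    calc _ ≤ (1 : ℝ) ^ 2 / (4 * (Λ / 2)) * (Λ * ‖η‖ ^ 2) := by gcongr
      _ = 1 / 2 * ‖η‖ ^ 2 := by field_simp; ring
  have h6 : Λ / 2 * aForm A x ξ ξ ≤ Λ / 2 * (Λ * ‖ξ‖ ^ 2) := by gcongr
  have h7 : ‖η‖ ^ 2 ≤ (Λ * ‖ξ‖) ^ 2 := by nlinarith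
  exact le_of_sq_le_sq h7 (by positivity)
where
  le_of_sq_le_sq {a b : ℝ} (h : a ^ 2 ≤ b ^ 2) (hb : 0 ≤ b) : a ≤ b := abs_le_of_sq_le_sq' h hb |>.2

end AForm

/-- The Lions form of Lax–Milgram: coercivity on a space of test vectors yields existence, although
`K` need not be continuous for the norm of `ι`. Coercivity bounds `‖ι v‖` by the norm of the
projection of `K v` to the closed range of `ι`, so `K v ↦ ⟨F, ι v⟩` is a bounded functional on the
range of the projected `K`; Hahn–Banach and Riesz represent it. Uniqueness is not claimed and has to
come from elsewhere. -/
theorem lions_lemma {T X : Type*} [AddCommGroup T] [Module ℝ T] [NormedAddCommGroup X]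
    [InnerProductSpace ℝ X] [CompleteSpace X] (ι K : T →ₗ[ℝ] X) {c : ℝ} (hc : 0 < c)
    (h : ∀ v, c * ‖ι v‖ ^ 2 ≤ inner ℝ (ι v) (K v)) (F : X) :
    ∃ u ∈ closure (Set.range ι), ∀ v, inner ℝ u (K v) = inner ℝ F (ι v) := by
  set S : Submodule ℝ X := (LinearMap.range ι).topologicalClosure with hS
  have hScl : IsClosed (S : Set X) := Submodule.isClosed_topologicalClosure _
  have : CompleteSpace S := hScl.completeSpace_coe
  have hι : ∀ v, ι v ∈ S := fun v => Submodule.le_topologicalClosure _ ⟨v, rfl⟩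
  let K' : T →ₗ[ℝ] S := S.orthogonalProjectionOnto.toLinearMap ∘ₗ K
  have hK' : ∀ (s : S) v, inner ℝ s (K' v) = inner ℝ (s : X) (K v) := fun s v => by
    have := S.inner_orthogonalProjectionOnto_eq_of_mem_left s (K v)
    simpa [K'] using this
  have hbd : ∀ v, c * ‖ι v‖ ≤ ‖K' v‖ := by
    intro v
    have h1 := h v
    rw [← hK' ⟨ι v, hι v⟩ v] at h1
    have h2 := real_inner_le_norm (⟨ι v, hι v⟩ : S) (K' v)
    have h3 : ‖(⟨ι v, hι v⟩ : S)‖ = ‖ι v‖ := rfl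
    rw [h3] at h2
    rcases (norm_nonneg (ι v)).eq_or_lt with h0 | h0
    · rw [← h0]; simp
    · nlinarith
  -- A linear section makes the functional definable on the range; its independence of the section
  -- is recovered at the end from the coercivity bound `hbd`.
  obtain ⟨s, hs⟩ := K'.rangeRestrict.exists_rightInverse_of_surjective K'.range_rangeRestrict
  have hs' : ∀ m : LinearMap.range K', K' (s m) = m := fun m => by
    have := congrArg Subtype.val (LinearMap.congr_fun hs m)
    simpa using this
  let g0 : LinearMap.range K' →ₗ[ℝ] ℝ := (innerSL ℝ F).toLinearMap ∘ₗ ι ∘ₗ s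
  let g : LinearMap.range K' →L[ℝ] ℝ := g0.mkContinuous (‖F‖ / c) (fun m => by
    have h1 := norm_inner_le_norm (𝕜 := ℝ) F (ι (s m))
    have h2 := hbd (s m)
    rw [hs' m] at h2
    have h3 : ‖ι (s m)‖ ≤ ‖m‖ / c := by
      rw [le_div_iff₀ hc]; rw [mul_comm]; exact h2
    calc ‖g0 m‖ ≤ ‖F‖ * ‖ι (s m)‖ := h1
      _ ≤ ‖F‖ * (‖m‖ / c) := by gcongr
      _ = ‖F‖ / c * ‖m‖ := by ring)
  obtain ⟨G, hG, -⟩ := exists_extension_norm_eq (LinearMap.range K') g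
  refine ⟨((InnerProductSpace.toDual ℝ S).symm G : S), ?_, fun v => ?_⟩
  · exact ((InnerProductSpace.toDual ℝ S).symm G : S).2
  · rw [← hK', InnerProductSpace.toDual_symm_apply]
    have h1 := hG ⟨K' v, v, rfl⟩
    simp only at h1
    rw [h1]
    change inner ℝ F (ι (s ⟨K' v, v, rfl⟩)) = _
    have h2 : ι (s ⟨K' v, v, rfl⟩ - v) = 0 := by
      have := hbd (s ⟨K' v, v, rfl⟩ - v)
      rw [map_sub K', hs', sub_self, norm_zero] at this
      exact norm_le_zero_iff.1 (by nlinarith)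
    rw [map_sub, sub_eq_zero] at h2
    rw [h2]

/-! ### Weak solutions on a set of finite measure -/

section Local

variable {d : ℕ} {A : Eucl d → Matrix (Fin d) (Fin d) ℝ} {B : Eucl d → Eucl d}
  {ν : Measure (Eucl d)} {𝒯 : Set (Eucl d → ℝ)}

/-- The pair `(u, G)` of a function and its gradient is an `L²(ν)`-limit of functions in `𝒯` and
their gradients. -/
def HGrad (ν : Measure (Eucl d)) (𝒯 : Set (Eucl d → ℝ)) (u : Eucl d → ℝ) (G : Eucl d → Eucl d) :
    Prop :=
  ∃ f : ℕ → Eucl d → ℝ, (∀ n, f n ∈ 𝒯) ∧ GradApprox ν f u G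

/-- A finite measure `ν`, uniformly elliptic coefficients, a class of test functions `𝒯`, and a
square integrable vector field `B` which is divergence free with respect to `𝒯`. -/
structure LocalSetup (A : Eucl d → Matrix (Fin d) (Fin d) ℝ) (B : Eucl d → Eucl d)
    (ν : Measure (Eucl d)) (𝒯 : Set (Eucl d → ℝ)) : Prop where
  finite : IsFiniteMeasure ν
  symm : ∀ᵐ x ∂ν, (A x).IsSymm
  meas : ∀ i j, AEStronglyMeasurable (fun x => A x i j) ν
  ell : ∃ Λ : ℝ, 0 < Λ ∧ ∀ᵐ x ∂ν, ∀ ξ : Eucl d,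
    Λ⁻¹ * ‖ξ‖ ^ 2 ≤ aForm A x ξ ξ ∧ aForm A x ξ ξ ≤ Λ * ‖ξ‖ ^ 2
  memB : MemLp B 2 ν
  smooth : ∀ f ∈ 𝒯, ContDiff ℝ ∞ f
  compact : ∀ f ∈ 𝒯, HasCompactSupport f
  zero : (fun _ => 0) ∈ 𝒯
  add : ∀ f ∈ 𝒯, ∀ g ∈ 𝒯, (fun x => f x + g x) ∈ 𝒯
  comp : ∀ f ∈ 𝒯, ∀ ψ : ℝ → ℝ, ContDiff ℝ ∞ ψ → ψ 0 = 0 → (fun x => ψ (f x)) ∈ 𝒯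
  div : ∀ f ∈ 𝒯, ∫ x, inner ℝ (B x) (gradient f x) ∂ν = 0

theorem aestronglyMeasurable_aVec (hm : ∀ i j, AEStronglyMeasurable (fun x => A x i j) ν)
    {G : Eucl d → Eucl d} (hG : AEStronglyMeasurable G ν) :
    AEStronglyMeasurable (fun x => aVec A x (G x)) ν := by
  have h1 : ∀ i, AEMeasurable (fun x => ∑ j, A x i j * G x j) ν := fun i =>
    (Finset.univ.aemeasurable_fun_sum fun j _ => (hm i j).aemeasurable.mul
      ((EuclideanSpace.proj (𝕜 := ℝ) j).continuous.comp_aestronglyMeasurable hG).aemeasurable)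
  have h2 : AEMeasurable (fun x => fun i => ∑ j, A x i j * G x j) ν := aemeasurable_pi_iff.2 h1
  have h3 := (PiLp.continuous_toLp 2 (fun _ : Fin d => ℝ)).comp_aestronglyMeasurable
    h2.aestronglyMeasurable
  refine h3.congr (Eventually.of_forall fun x => ?_)
  ext i
  simp [aVec_apply]

theorem aestronglyMeasurable_aForm (hm : ∀ i j, AEStronglyMeasurable (fun x => A x i j) ν)
    {G H : Eucl d → Eucl d} (hG : AEStronglyMeasurable G ν) (hH : AEStronglyMeasurable H ν) :
    AEStronglyMeasurable (fun x => aForm A x (G x) (H x)) ν := by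
  simp_rw [aForm_eq_inner]
  exact (aestronglyMeasurable_aVec hm hG).inner hH

namespace LocalSetup

theorem memLp_aVec (S : LocalSetup A B ν 𝒯) {G : Eucl d → Eucl d} (hG : MemLp G 2 ν) :
    MemLp (fun x => aVec A x (G x)) 2 ν := by
  obtain ⟨Λ, hΛ, hell⟩ := S.ell
  refine hG.of_le_mul (aestronglyMeasurable_aVec S.meas hG.1) (c := Λ) ?_
  filter_upwards [hell, S.symm] with x hx hs
  exact norm_aVec_le hs (fun ξ => le_trans (by positivity) (hx ξ).1) hΛ (fun ξ => (hx ξ).2) _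

theorem integrable_aForm (S : LocalSetup A B ν 𝒯) {G H : Eucl d → Eucl d} (hG : MemLp G 2 ν)
    (hH : MemLp H 2 ν) : Integrable (fun x => aForm A x (G x) (H x)) ν := by
  simp_rw [aForm_eq_inner]
  exact integrable_inner (S.memLp_aVec hG) hH

theorem aForm_nonneg (S : LocalSetup A B ν 𝒯) : ∀ᵐ x ∂ν, ∀ ξ, 0 ≤ aForm A x ξ ξ := by
  obtain ⟨Λ, hΛ, hell⟩ := S.ell
  filter_upwards [hell] with x hx ξ using le_trans (by positivity) (hx ξ).1

theorem memLp_test (S : LocalSetup A B ν 𝒯) {f : Eucl d → ℝ} (hf : f ∈ 𝒯) : MemLp f 2 ν := by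
  have := S.finite
  obtain ⟨C, hC⟩ := (S.smooth f hf).continuous.bounded_above_of_compact_support (S.compact f hf)
  exact MemLp.of_bound (S.smooth f hf).continuous.aestronglyMeasurable C (Eventually.of_forall hC)

theorem memLp_gradient_test (S : LocalSetup A B ν 𝒯) {f : Eucl d → ℝ} (hf : f ∈ 𝒯) :
    MemLp (gradient f) 2 ν := by
  have := S.finite
  obtain ⟨C, hC⟩ := exists_gradient_bound (S.smooth f hf) (S.compact f hf)
  exact MemLp.of_bound (continuous_gradient (S.smooth f hf)).aestronglyMeasurable C
    (Eventually.of_forall hC)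

theorem hGrad_test (S : LocalSetup A B ν 𝒯) {f : Eucl d → ℝ} (hf : f ∈ 𝒯) :
    HGrad ν 𝒯 f (gradient f) :=
  ⟨fun _ => f, fun _ => hf, fun _ => S.smooth f hf, S.memLp_test hf, S.memLp_gradient_test hf,
    by simp, by simp, Eventually.of_forall fun x => tendsto_const_nhds⟩

theorem zero_drift (S : LocalSetup A B ν 𝒯) : LocalSetup A 0 ν 𝒯 :=
  { S with memB := MemLp.zero, div := fun f _ => by simp }

theorem smul_mem (S : LocalSetup A B ν 𝒯) {f : Eucl d → ℝ} (hf : f ∈ 𝒯) (c : ℝ) :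
    (fun x => c * f x) ∈ 𝒯 :=
  S.comp f hf (fun s => c * s) (contDiff_const.mul contDiff_id) (by simp)

theorem integrable_inner_B (S : LocalSetup A B ν 𝒯) {G : Eucl d → Eucl d} (hG : MemLp G 2 ν) :
    Integrable (fun x => inner ℝ (B x) (G x)) ν := integrable_inner S.memB hG

theorem integral_inner_B (S : LocalSetup A B ν 𝒯) {u : Eucl d → ℝ} {G : Eucl d → Eucl d}
    (h : HGrad ν 𝒯 u G) : ∫ x, inner ℝ (B x) (G x) ∂ν = 0 := by
  obtain ⟨f, hf, hfa⟩ := h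
  have := tendsto_integral_inner (f := fun _ => B) (g := B) (fun _ => S.memB)
    (fun n => S.memLp_gradient_test (hf n)) S.memB hfa.memLp_grad (by simp) hfa.lim_grad
  simp_rw [fun n => S.div _ (hf n)] at this
  exact tendsto_nhds_unique this tendsto_const_nhds

theorem hGrad_comp (S : LocalSetup A B ν 𝒯) {u : Eucl d → ℝ} {G : Eucl d → Eucl d}
    (h : HGrad ν 𝒯 u G) {ψ : ℝ → ℝ} (hψ : ContDiff ℝ ∞ ψ) (h0 : ψ 0 = 0) {C : ℝ}
    (hC : ∀ s, |deriv ψ s| ≤ C) :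
    HGrad ν 𝒯 (fun x => ψ (u x)) (fun x => deriv ψ (u x) • G x) := by
  have := S.finite
  obtain ⟨f, hf, hfa⟩ := h
  exact ⟨_, fun n => S.comp _ (hf n) ψ hψ h0, hfa.comp hψ hC⟩

theorem hGrad_add (S : LocalSetup A B ν 𝒯) {u v : Eucl d → ℝ} {G H : Eucl d → Eucl d}
    (h : HGrad ν 𝒯 u G) (h' : HGrad ν 𝒯 v H) :
    HGrad ν 𝒯 (fun x => u x + v x) (fun x => G x + H x) := by
  obtain ⟨f, hf, hfa⟩ := h
  obtain ⟨g, hg, hga⟩ := h'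
  exact ⟨_, fun n => S.add _ (hf n) _ (hg n), hfa.add hga⟩

theorem hGrad_const_mul (S : LocalSetup A B ν 𝒯) {u : Eucl d → ℝ} {G : Eucl d → Eucl d}
    (h : HGrad ν 𝒯 u G) (c : ℝ) : HGrad ν 𝒯 (fun x => c * u x) (fun x => c • G x) := by
  have h1 : ∀ s : ℝ, deriv (fun s => c * s) s = c := fun s => by
    simpa using deriv_const_mul (x := s) c differentiableAt_id
  have := S.hGrad_comp h (ψ := fun s => c * s) (contDiff_const.mul contDiff_id) (by simp)
    (C := |c|) (fun s => by rw [h1])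
  simpa [h1] using this

theorem hGrad_sub (S : LocalSetup A B ν 𝒯) {u v : Eucl d → ℝ} {G H : Eucl d → Eucl d}
    (h : HGrad ν 𝒯 u G) (h' : HGrad ν 𝒯 v H) :
    HGrad ν 𝒯 (fun x => u x - v x) (fun x => G x - H x) := by
  have := S.hGrad_add h (S.hGrad_const_mul h' (-1))
  simpa [sub_eq_add_neg] using this

/-- Bounded functions have uniformly bounded approximations. -/
theorem exists_bounded_approx (S : LocalSetup A B ν 𝒯) {u : Eucl d → ℝ} {G : Eucl d → Eucl d}
    (h : HGrad ν 𝒯 u G) {M : ℝ} (hM : ∀ᵐ x ∂ν, |u x| ≤ M) :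
    ∃ (f : ℕ → Eucl d → ℝ) (C : ℝ), (∀ n, f n ∈ 𝒯) ∧ GradApprox ν f u G ∧ ∀ n x, |f n x| ≤ C := by
  have := S.finite
  obtain ⟨f, hf, hfa⟩ := h
  obtain ⟨ψ, hψ, ⟨C, hC⟩, ⟨C', hC'⟩, heq, h0⟩ :=
    exists_bounded_modification (F := fun s : ℝ => s) contDiff_id M
  have hd : ∀ s, |deriv ψ s| ≤ C' := fun s => by
    rw [← Real.norm_eq_abs, norm_deriv_eq_norm_fderiv]; exact hC' s
  refine ⟨fun n x => ψ (f n x), C, fun n => S.comp _ (hf n) ψ hψ (h0 0 rfl), ?_, fun n x => hC _⟩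
  refine (hfa.comp hψ hd).congr ?_ ?_
  · filter_upwards [hM] with x hx using (heq _ hx).1
  · filter_upwards [hM] with x hx
    have : deriv ψ (u x) = 1 := by
      rw [← fderiv_apply_one_eq_deriv, (heq _ hx).2, fderiv_apply_one_eq_deriv]
      exact deriv_id _
    rw [this, one_smul]

end LocalSetup

/-- `u` with gradient `G` is the weak solution of `(α - L) u = f`, where `L = L⁰ + ⟨B, ∇ ·⟩`. -/
def WeakSol (A : Eucl d → Matrix (Fin d) (Fin d) ℝ) (B : Eucl d → Eucl d) (ν : Measure (Eucl d))
    (𝒯 : Set (Eucl d → ℝ)) (α : ℝ) (f u : Eucl d → ℝ) (G : Eucl d → Eucl d) : Prop :=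
  HGrad ν 𝒯 u G ∧ Integrable f ν ∧ ∀ v H, HGrad ν 𝒯 v H → (∃ M : ℝ, ∀ᵐ x ∂ν, |v x| ≤ M) →
    α * ∫ x, u x * v x ∂ν + ∫ x, aForm A x (G x) (H x) ∂ν - ∫ x, inner ℝ (B x) (G x) * v x ∂ν =
      ∫ x, f x * v x ∂ν

theorem integrable_mul_of_bdd {X : Type*} [MeasurableSpace X] {ν : Measure X} {f v : X → ℝ}
    (hf : Integrable f ν) (hv : AEStronglyMeasurable v ν) {M : ℝ} (hM : ∀ᵐ x ∂ν, |v x| ≤ M) :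
    Integrable (fun x => f x * v x) ν := hf.mul_bdd hv hM

theorem integrable_mul_of_memLp {X : Type*} [MeasurableSpace X] {ν : Measure X} {f v : X → ℝ}
    (hf : MemLp f 2 ν) (hv : MemLp v 2 ν) :
    Integrable (fun x => f x * v x) ν := hf.integrable_mul hv

theorem tendsto_integral_mul {X : Type*} [MeasurableSpace X] {ν : Measure X}
    {f f' : ℕ → X → ℝ} {g g' : X → ℝ}
    (hf : ∀ n, MemLp (f n) 2 ν) (hf' : ∀ n, MemLp (f' n) 2 ν) (hg : MemLp g 2 ν)
    (hg' : MemLp g' 2 ν)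
    (h : Tendsto (fun n => eLpNorm (fun x => f n x - g x) 2 ν) atTop (𝓝 0))
    (h' : Tendsto (fun n => eLpNorm (fun x => f' n x - g' x) 2 ν) atTop (𝓝 0)) :
    Tendsto (fun n => ∫ x, f n x * f' n x ∂ν) atTop (𝓝 (∫ x, g x * g' x ∂ν)) := by
  have := tendsto_integral_inner hf' hf hg' hg h' h
  simpa using this

namespace LocalSetup

/-- `lions_lemma` in `L² × L²` with `ι v = (v, ∇v)`, `K v = (αv, A∇v - vB)` and `F = (f, 0)`. As `B`
is merely square integrable, the form is not continuous for the energy norm, but `vB` is in `L²` for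
a bounded test function `v`. -/
theorem exists_weak_test (S : LocalSetup A B ν 𝒯) {α : ℝ} (hα : 0 < α) {f : Eucl d → ℝ}
    (hf : MemLp f 2 ν) :
    ∃ u G, HGrad ν 𝒯 u G ∧ ∀ v ∈ 𝒯,
      α * ∫ x, u x * v x ∂ν + ∫ x, aForm A x (G x) (gradient v x) ∂ν
        - ∫ x, inner ℝ (B x) (G x) * v x ∂ν = ∫ x, f x * v x ∂ν := by
  have := S.finite
  let T : Submodule ℝ (Eucl d → ℝ) :=
    { carrier := 𝒯
      add_mem' := fun {a b} ha hb => S.add a ha b hb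
      zero_mem' := S.zero
      smul_mem' := fun c a ha => S.smul_mem ha c }
  have hT : ∀ v : T, (v : Eucl d → ℝ) ∈ 𝒯 := fun v => v.2
  have hdiff : ∀ (v : T) x, DifferentiableAt ℝ (v : Eucl d → ℝ) x := fun v x =>
    (S.smooth _ (hT v)).differentiable (by simp) x
  have gadd : ∀ v w : T, gradient ((v + w : T) : Eucl d → ℝ) =
      gradient (v : Eucl d → ℝ) + gradient (w : Eucl d → ℝ) := fun v w => by
    ext1 x; exact gradient_add (hdiff v x) (hdiff w x)
  have gsmul : ∀ (c : ℝ) (v : T), gradient ((c • v : T) : Eucl d → ℝ) =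
      c • gradient (v : Eucl d → ℝ) := fun c v => by
    ext1 x; exact gradient_const_mul c (hdiff v x)
  have m1 : ∀ v : T, MemLp (v : Eucl d → ℝ) 2 ν := fun v => S.memLp_test (hT v)
  have m2 : ∀ v : T, MemLp (gradient (v : Eucl d → ℝ)) 2 ν := fun v => S.memLp_gradient_test (hT v)
  have m3 : ∀ v : T, MemLp (fun x => (v : Eucl d → ℝ) x • B x) 2 ν := fun v => by
    obtain ⟨C, hC⟩ := (S.smooth _ (hT v)).continuous.bounded_above_of_compact_support
      (S.compact _ (hT v))
    refine S.memB.of_le_mul ((m1 v).1.smul S.memB.1) (c := C) (Eventually.of_forall fun x => ?_)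
    rw [norm_smul]; exact mul_le_mul_of_nonneg_right (hC x) (norm_nonneg _)
  have m4 : ∀ v : T, MemLp (fun x => aVec A x (gradient (v : Eucl d → ℝ) x) -
      (v : Eucl d → ℝ) x • B x) 2 ν := fun v => (S.memLp_aVec (m2 v)).sub (m3 v)
  let ι : T →ₗ[ℝ] WithLp 2 (Lp ℝ 2 ν × Lp (Eucl d) 2 ν) :=
    { toFun := fun v => WithLp.toLp 2 ((m1 v).toLp _, (m2 v).toLp _)
      map_add' := fun v w => congrArg (WithLp.toLp 2) (Prod.ext
        (MemLp.toLp_add (m1 v) (m1 w))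
        ((MemLp.toLp_congr (m2 (v + w)) ((m2 v).add (m2 w)) (by rw [gadd])).trans
          (MemLp.toLp_add (m2 v) (m2 w))))
      map_smul' := fun c v => congrArg (WithLp.toLp 2) (Prod.ext
        (MemLp.toLp_const_smul c (m1 v))
        ((MemLp.toLp_congr (m2 (c • v)) ((m2 v).const_smul c) (by rw [gsmul])).trans
          (MemLp.toLp_const_smul c (m2 v)))) }
  let K : T →ₗ[ℝ] WithLp 2 (Lp ℝ 2 ν × Lp (Eucl d) 2 ν) :=
    { toFun := fun v => WithLp.toLp 2 (α • (m1 v).toLp _, (m4 v).toLp _)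
      map_add' := fun v w => congrArg (WithLp.toLp 2) (Prod.ext
        ((congrArg (α • ·) (MemLp.toLp_add (m1 v) (m1 w))).trans (smul_add _ _ _))
        ((MemLp.toLp_congr (m4 (v + w)) ((m4 v).add (m4 w)) (Eventually.of_forall fun x => by
          rw [gadd]
          simp only [Pi.add_apply, map_add, Submodule.coe_add, add_smul]
          abel)).trans (MemLp.toLp_add (m4 v) (m4 w))))
      map_smul' := fun c v => congrArg (WithLp.toLp 2) (Prod.ext
        ((congrArg (α • ·) (MemLp.toLp_const_smul c (m1 v))).trans (smul_comm _ _ _))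
        ((MemLp.toLp_congr (m4 (c • v)) ((m4 v).const_smul c) (Eventually.of_forall fun x => by
          rw [gsmul]
          simp only [Pi.smul_apply, map_smul, Submodule.coe_smul, smul_sub, smul_assoc])).trans
          (MemLp.toLp_const_smul c (m4 v)))) }
  have inn : ∀ {F : Type} [NormedAddCommGroup F] [InnerProductSpace ℝ F] {a : Lp F 2 ν}
      {b : Eucl d → F} (hb : MemLp b 2 ν),
      inner ℝ a (hb.toLp b) = ∫ x, inner ℝ (a x) (b x) ∂ν := by
    intro F _ _ a b hb
    rw [L2.inner_def]
    refine integral_congr_ae ?_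
    filter_upwards [hb.coeFn_toLp] with x h2
    rw [h2]
  have innK : ∀ (p : WithLp 2 (Lp ℝ 2 ν × Lp (Eucl d) 2 ν)) (v : T), inner ℝ p (K v) =
      α * ∫ x, p.fst x * (v : Eucl d → ℝ) x ∂ν
        + ∫ x, aForm A x (p.snd x) (gradient (v : Eucl d → ℝ) x) ∂ν
        - ∫ x, inner ℝ (B x) (p.snd x) * (v : Eucl d → ℝ) x ∂ν := by
    intro p v
    have hp := Lp.memLp p.snd
    rw [WithLp.prod_inner_apply]
    change inner ℝ p.fst (α • (m1 v).toLp _) + inner ℝ p.snd ((m4 v).toLp _) = _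
    rw [inner_smul_right, inn, inn, add_sub_assoc]
    congr 1
    · simp [mul_comm]
    · rw [← integral_sub (S.integrable_aForm hp (m2 v))]
      · refine integral_congr_ae ?_
        filter_upwards [S.symm] with x hs
        rw [inner_sub_right, aForm_comm hs, aForm_eq_inner, real_inner_comm, inner_smul_right,
          real_inner_comm (B x), mul_comm]
      · have := integrable_inner (m3 v) hp
        refine this.congr (Eventually.of_forall fun x => ?_)
        simp only [inner_smul_left]
        simp [mul_comm]
  obtain ⟨Λ, hΛ, hell⟩ := S.ell
  have hcoer : ∀ v, min α Λ⁻¹ * ‖ι v‖ ^ 2 ≤ inner ℝ (ι v) (K v) := by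
    intro v
    rw [innK, WithLp.prod_norm_sq_eq_of_L2]
    change _ * (‖(m1 v).toLp _‖ ^ 2 + ‖(m2 v).toLp _‖ ^ 2) ≤ α * ∫ x, (m1 v).toLp _ x * _ ∂ν
      + ∫ x, aForm A x ((m2 v).toLp _ x) _ ∂ν - ∫ x, inner ℝ (B x) ((m2 v).toLp _ x) * _ ∂ν
    have e1 : ∫ x, (m1 v).toLp _ x * (v : Eucl d → ℝ) x ∂ν = ‖(m1 v).toLp _‖ ^ 2 := by
      rw [← real_inner_self_eq_norm_sq, inn]
      refine integral_congr_ae (Eventually.of_forall fun x => ?_)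
      simp [mul_comm]
    have e2 : ∫ x, aForm A x ((m2 v).toLp _ x) (gradient (v : Eucl d → ℝ) x) ∂ν ≥
        Λ⁻¹ * ‖(m2 v).toLp _‖ ^ 2 := by
      rw [← real_inner_self_eq_norm_sq, inn, ge_iff_le, ← integral_const_mul]
      have hm := Lp.memLp ((m2 v).toLp _)
      refine integral_mono_ae ((integrable_inner hm (m2 v)).const_mul _)
        (S.integrable_aForm hm (m2 v)) ?_
      filter_upwards [hell, (m2 v).coeFn_toLp] with x hx h1
      rw [h1, real_inner_self_eq_norm_sq]
      exact (hx _).1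
    -- `2v∇v` is the gradient of the test function `v²`, so the drift does not affect coercivity.
    have e3 : ∫ x, inner ℝ (B x) ((m2 v).toLp _ x) * (v : Eucl d → ℝ) x ∂ν = 0 := by
      have h1 := S.div _ (S.comp _ (hT v) (fun s => s ^ 2) (contDiff_id.pow 2) (by simp))
      have h2 : ∀ x, gradient (fun x => (v : Eucl d → ℝ) x ^ 2) x =
          (2 * (v : Eucl d → ℝ) x) • gradient (v : Eucl d → ℝ) x := fun x => by
        rw [gradient_comp (ψ := fun s => s ^ 2) (by fun_prop) (hdiff v x)]
        simp
      simp_rw [h2, inner_smul_right] at h1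
      have h3 : ∫ x, inner ℝ (B x) ((m2 v).toLp _ x) * (v : Eucl d → ℝ) x ∂ν =
          ∫ x, (1 / 2 : ℝ) * (2 * (v : Eucl d → ℝ) x *
            inner ℝ (B x) (gradient (v : Eucl d → ℝ) x)) ∂ν := by
        refine integral_congr_ae ?_
        filter_upwards [(m2 v).coeFn_toLp] with x h4
        rw [h4]; ring
      rw [h3, integral_const_mul, h1, mul_zero]
    rw [e1, e3]
    have a1 := min_le_left α Λ⁻¹
    have a2 := min_le_right α Λ⁻¹
    have a3 := mul_le_mul_of_nonneg_right a1 (sq_nonneg ‖(m1 v).toLp _‖)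
    have a4 := mul_le_mul_of_nonneg_right a2 (sq_nonneg ‖(m2 v).toLp _‖)
    linarith
  obtain ⟨p, hp, hpv⟩ := lions_lemma ι K (lt_min hα (inv_pos.2 hΛ)) hcoer
    (WithLp.toLp 2 (hf.toLp f, 0))
  rw [mem_closure_iff_seq_limit] at hp
  obtain ⟨q, hq, hqp⟩ := hp
  choose w hw using hq
  have hqp' : Tendsto (fun n => (q n).ofLp) atTop (𝓝 p.ofLp) :=
    ((WithLp.prod_continuous_ofLp 2 _ _).tendsto p).comp hqp
  have l1 : Tendsto (fun n => (m1 (w n)).toLp _) atTop (𝓝 p.fst) := by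
    refine (hqp'.fst_nhds).congr fun n => ?_
    rw [← hw n]; rfl
  have l2 : Tendsto (fun n => (m2 (w n)).toLp _) atTop (𝓝 p.snd) := by
    refine (hqp'.snd_nhds).congr fun n => ?_
    rw [← hw n]; rfl
  have l1' : Tendsto (fun n => eLpNorm (fun x => (w n : Eucl d → ℝ) x - p.fst x) 2 ν) atTop
      (𝓝 0) := by
    refine ((Lp.tendsto_Lp_iff_tendsto_eLpNorm' _ _).1 l1).congr fun n => eLpNorm_congr_ae ?_
    filter_upwards [(m1 (w n)).coeFn_toLp] with x hx
    simp [hx]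
  have l2' : Tendsto (fun n => eLpNorm (fun x => gradient (w n : Eucl d → ℝ) x - p.snd x) 2 ν)
      atTop (𝓝 0) := by
    refine ((Lp.tendsto_Lp_iff_tendsto_eLpNorm' _ _).1 l2).congr fun n => eLpNorm_congr_ae ?_
    filter_upwards [(m2 (w n)).coeFn_toLp] with x hx
    simp [hx]
  obtain ⟨ns, -, hga⟩ := exists_gradApprox_subseq (fun n => S.smooth _ (hT (w n)))
    (Lp.memLp p.fst) (Lp.memLp p.snd) l1' l2'
  refine ⟨p.fst, p.snd, ⟨_, fun n => hT (w (ns n)), hga⟩, fun v hv => ?_⟩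
  have := hpv ⟨v, hv⟩
  rw [innK] at this
  rw [this, WithLp.prod_inner_apply]
  change inner ℝ (hf.toLp f) ((m1 _).toLp _) + inner ℝ 0 _ = _
  rw [inner_zero_left, add_zero, inn]
  refine integral_congr_ae ?_
  filter_upwards [hf.coeFn_toLp] with x hx
  rw [hx]; simp [mul_comm]

theorem tendsto_integral_mul_bdd {X : Type*} [MeasurableSpace X] {ν : Measure X} {f : X → ℝ}
    {v : ℕ → X → ℝ} {w : X → ℝ} {C : ℝ} (hf : Integrable f ν)
    (hv : ∀ n, AEStronglyMeasurable (v n) ν) (hC : ∀ n, ∀ᵐ x ∂ν, |v n x| ≤ C)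
    (hlim : ∀ᵐ x ∂ν, Tendsto (fun n => v n x) atTop (𝓝 (w x))) :
    Tendsto (fun n => ∫ x, f x * v n x ∂ν) atTop (𝓝 (∫ x, f x * w x ∂ν)) := by
  refine tendsto_integral_of_dominated_convergence (fun x => |f x| * C)
    (fun n => hf.1.mul (hv n)) (hf.abs.mul_const C) (fun n => ?_) ?_
  · filter_upwards [hC n] with x hx
    rw [norm_mul]; exact mul_le_mul_of_nonneg_left hx (abs_nonneg _)
  · filter_upwards [hlim] with x hx using hx.const_mul _

/-- The weak equation extends from test functions to bounded functions. -/
theorem weakSol_of_test (S : LocalSetup A B ν 𝒯) {α : ℝ} {f u : Eucl d → ℝ} {G : Eucl d → Eucl d}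
    (hu : HGrad ν 𝒯 u G) (hf : Integrable f ν)
    (h : ∀ v ∈ 𝒯, α * ∫ x, u x * v x ∂ν + ∫ x, aForm A x (G x) (gradient v x) ∂ν
        - ∫ x, inner ℝ (B x) (G x) * v x ∂ν = ∫ x, f x * v x ∂ν) :
    WeakSol A B ν 𝒯 α f u G := by
  refine ⟨hu, hf, fun v H hv ⟨M, hM⟩ => ?_⟩
  obtain ⟨w, C, hw, hwa, hwC⟩ := S.exists_bounded_approx hv hM
  obtain ⟨_, _, hua⟩ := hu
  have t1 := tendsto_integral_mul (f := fun _ => u) (g := u) (fun _ => hua.memLp)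
    (fun n => S.memLp_test (hw n)) hua.memLp hwa.memLp (by simp) hwa.lim
  have t2 := tendsto_integral_inner (f := fun _ x => aVec A x (G x)) (g := fun x => aVec A x (G x))
    (fun _ => S.memLp_aVec hua.memLp_grad) (fun n => S.memLp_gradient_test (hw n))
    (S.memLp_aVec hua.memLp_grad) hwa.memLp_grad (by simp) hwa.lim_grad
  simp_rw [← aForm_eq_inner] at t2
  have t3 := tendsto_integral_mul_bdd (S.integrable_inner_B hua.memLp_grad) hwa.meas
    (fun n => Eventually.of_forall (hwC n)) hwa.ae
  have t4 := tendsto_integral_mul_bdd hf hwa.meas (fun n => Eventually.of_forall (hwC n)) hwa.ae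
  exact tendsto_nhds_unique (((t1.const_mul α).add t2).sub t3)
    (t4.congr fun n => (h _ (hw n)).symm)

theorem exists_weakSol (S : LocalSetup A B ν 𝒯) {α : ℝ} (hα : 0 < α) {f : Eucl d → ℝ}
    (hf : MemLp f 2 ν) : ∃ u G, WeakSol A B ν 𝒯 α f u G := by
  have := S.finite
  obtain ⟨u, G, hu, h⟩ := S.exists_weak_test hα hf
  exact ⟨u, G, S.weakSol_of_test hu (hf.integrable (by norm_num)) h⟩

end LocalSetup

end Local

end

/-! ### Contraction and positivity estimates for weak solutions -/

section

/-- Supplies `Ψ` with `∇Ψ(u) = ψ(u)∇u`, the device that turns drift terms into integrals of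
`⟨B,∇Ψ(u)⟩`. -/
theorem exists_smooth_antideriv {ψ : ℝ → ℝ} (hψ : ContDiff ℝ ∞ ψ) :
    ∃ Ψ : ℝ → ℝ, ContDiff ℝ ∞ Ψ ∧ Ψ 0 = 0 ∧ ∀ s, HasDerivAt Ψ (ψ s) s := by
  have h : ∀ s, HasDerivAt (fun s => ∫ t in (0 : ℝ)..s, ψ t) (ψ s) s := fun s =>
    intervalIntegral.integral_hasDerivAt_right (hψ.continuous.intervalIntegrable _ _)
      hψ.continuous.aestronglyMeasurable.stronglyMeasurableAtFilter hψ.continuous.continuousAt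
  refine ⟨_, ?_, by simp, h⟩
  rw [contDiff_infty_iff_deriv]
  refine ⟨fun s => (h s).differentiableAt, ?_⟩
  have : deriv (fun s => ∫ t in (0 : ℝ)..s, ψ t) = ψ := funext fun s => (h s).deriv
  rwa [this]

theorem exists_deriv_smoothTransition_bound : ∃ C, ∀ s, |deriv Real.smoothTransition s| ≤ C := by
  have hc : Continuous (deriv Real.smoothTransition) :=
    (Real.smoothTransition.contDiff (n := 1)).continuous_deriv (by simp)
  obtain ⟨C, hC⟩ := (isCompact_Icc (a := (0 : ℝ)) (b := 1)).exists_bound_of_continuousOn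
    hc.continuousOn
  have hC0 : 0 ≤ C := (norm_nonneg _).trans (hC 0 (by simp))
  refine ⟨C, fun s => ?_⟩
  by_cases h0 : s < 0
  · have : Real.smoothTransition =ᶠ[𝓝 s] fun _ => 0 := by
      filter_upwards [gt_mem_nhds h0] with t ht using Real.smoothTransition.zero_of_nonpos ht.le
    rw [this.deriv_eq]; simpa
  by_cases h1 : 1 < s
  · have : Real.smoothTransition =ᶠ[𝓝 s] fun _ => 1 := by
      filter_upwards [lt_mem_nhds h1] with t ht using Real.smoothTransition.one_of_one_le ht.le
    rw [this.deriv_eq]; simpa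
  exact hC s ⟨not_lt.1 h0, not_lt.1 h1⟩

theorem deriv_arctan_mul (c s : ℝ) :
    HasDerivAt (fun s => Real.arctan (c * s)) (1 / (1 + (c * s) ^ 2) * c) s := by
  have := ((hasDerivAt_id s).const_mul c).arctan
  simpa using this

theorem abs_arctan_le_pi_div_two (s : ℝ) : |Real.arctan s| ≤ Real.pi / 2 :=
  abs_le.2 ⟨(Real.neg_pi_div_two_lt_arctan s).le, (Real.arctan_lt_pi_div_two s).le⟩

theorem abs_arctan_le (s : ℝ) : |Real.arctan s| ≤ |s| := by
  have := Convex.norm_image_sub_le_of_norm_deriv_le (𝕜 := ℝ) (f := Real.arctan) (C := 1)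
    (fun x _ => Real.differentiableAt_arctan x) (fun x _ => by
      rw [Real.deriv_arctan, Real.norm_of_nonneg (by positivity)]
      rw [div_le_one (by positivity)]
      nlinarith [sq_nonneg x]) convex_univ (Set.mem_univ 0) (Set.mem_univ s)
  simpa using this

/-- The functions `n arctan(s/n)` are bounded smooth increasing approximations of the identity,
dominated by `|s|`; they make it possible to test with the possibly unbounded solution itself. -/
theorem tendsto_nat_mul_arctan_div (s : ℝ) :
    Tendsto (fun n : ℕ => ((n : ℝ) + 1) * Real.arctan (((n : ℝ) + 1)⁻¹ * s)) atTop (𝓝 s) := by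
  have h1 : HasDerivAt (fun t : ℝ => Real.arctan (s * t)) s 0 := by
    simpa using deriv_arctan_mul s 0
  have h2 := h1.tendsto_slope_zero_right
  have h3 : Tendsto (fun n : ℕ => ((n : ℝ) + 1)⁻¹) atTop (𝓝[>] 0) := by
    refine tendsto_nhdsWithin_iff.2 ⟨by simpa using tendsto_one_div_add_atTop_nhds_zero_nat (𝕜 := ℝ),
      Eventually.of_forall fun n => ?_⟩
    simp only [Set.mem_Ioi]; positivity
  refine (h2.comp h3).congr fun n => ?_
  simp [mul_comm]

section Estimates

variable {d : ℕ} {A : Eucl d → Matrix (Fin d) (Fin d) ℝ} {B : Eucl d → Eucl d}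
  {ν : Measure (Eucl d)} {𝒯 : Set (Eucl d → ℝ)} {α : ℝ} {f f' u u' : Eucl d → ℝ}
  {G G' : Eucl d → Eucl d}

theorem HGrad.memLp (h : HGrad ν 𝒯 u G) : MemLp u 2 ν := h.choose_spec.2.memLp

theorem HGrad.memLp_grad (h : HGrad ν 𝒯 u G) : MemLp G 2 ν := h.choose_spec.2.memLp_grad

theorem HGrad.congr (h : HGrad ν 𝒯 u G) (hu : u =ᵐ[ν] u') (hG : G =ᵐ[ν] G') :
    HGrad ν 𝒯 u' G' := by
  obtain ⟨f, hf, hfa⟩ := h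
  exact ⟨f, hf, hfa.congr hu hG⟩

namespace WeakSol

theorem memLp (h : WeakSol A B ν 𝒯 α f u G) : MemLp u 2 ν := h.1.memLp

theorem memLp_grad (h : WeakSol A B ν 𝒯 α f u G) : MemLp G 2 ν := h.1.memLp_grad

theorem congr (h : WeakSol A B ν 𝒯 α f u G) (hf : f =ᵐ[ν] f') (hu : u =ᵐ[ν] u') :
    WeakSol A B ν 𝒯 α f' u' G := by
  refine ⟨h.1.congr hu EventuallyEq.rfl, h.2.1.congr hf, fun v H hv hM => ?_⟩
  have e1 : ∫ x, u' x * v x ∂ν = ∫ x, u x * v x ∂ν := integral_congr_ae (by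
    filter_upwards [hu] with x hx; rw [hx])
  have e2 : ∫ x, f' x * v x ∂ν = ∫ x, f x * v x ∂ν := integral_congr_ae (by
    filter_upwards [hf] with x hx; rw [hx])
  rw [e1, e2]
  exact h.2.2 v H hv hM

theorem add (S : LocalSetup A B ν 𝒯) (h : WeakSol A B ν 𝒯 α f u G)
    (h' : WeakSol A B ν 𝒯 α f' u' G') :
    WeakSol A B ν 𝒯 α (fun x => f x + f' x) (fun x => u x + u' x) (fun x => G x + G' x) := by
  refine ⟨S.hGrad_add h.1 h'.1, h.2.1.add h'.2.1, fun v H hv ⟨M, hM⟩ => ?_⟩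
  have e := h.2.2 v H hv ⟨M, hM⟩
  have e' := h'.2.2 v H hv ⟨M, hM⟩
  have m := hv.memLp
  simp_rw [aForm_add_left, inner_add_right, add_mul]
  rw [integral_add (integrable_mul_of_memLp h.memLp m) (integrable_mul_of_memLp h'.memLp m),
    integral_add (S.integrable_aForm h.memLp_grad hv.memLp_grad)
      (S.integrable_aForm h'.memLp_grad hv.memLp_grad),
    integral_add (integrable_mul_of_bdd (S.integrable_inner_B h.memLp_grad) m.1 hM)
      (integrable_mul_of_bdd (S.integrable_inner_B h'.memLp_grad) m.1 hM),
    integral_add (integrable_mul_of_bdd h.2.1 m.1 hM) (integrable_mul_of_bdd h'.2.1 m.1 hM),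
    ← e, ← e']
  ring

theorem const_mul (S : LocalSetup A B ν 𝒯) (h : WeakSol A B ν 𝒯 α f u G) (c : ℝ) :
    WeakSol A B ν 𝒯 α (fun x => c * f x) (fun x => c * u x) (fun x => c • G x) := by
  refine ⟨S.hGrad_const_mul h.1 c, h.2.1.const_mul c, fun v H hv hM => ?_⟩
  have e := h.2.2 v H hv hM
  simp_rw [aForm_smul_left, inner_smul_right, mul_assoc]
  rw [integral_const_mul, integral_const_mul, integral_const_mul, integral_const_mul, ← e]
  ring

theorem sub (S : LocalSetup A B ν 𝒯) (h : WeakSol A B ν 𝒯 α f u G)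
    (h' : WeakSol A B ν 𝒯 α f' u' G') :
    WeakSol A B ν 𝒯 α (fun x => f x - f' x) (fun x => u x - u' x) (fun x => G x - G' x) := by
  have := add S h (const_mul S h' (-1))
  simpa [sub_eq_add_neg] using this

theorem change_param (S : LocalSetup A B ν 𝒯) (h : WeakSol A B ν 𝒯 α f u G) (β : ℝ) :
    WeakSol A B ν 𝒯 β (fun x => f x + (β - α) * u x) u G := by
  have := S.finite
  have hui : Integrable u ν := h.memLp.integrable (by norm_num)
  refine ⟨h.1, h.2.1.add (hui.const_mul _), fun v H hv ⟨M, hM⟩ => ?_⟩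
  have e := h.2.2 v H hv ⟨M, hM⟩
  have m := hv.memLp
  simp_rw [add_mul, mul_assoc]
  rw [integral_add (integrable_mul_of_bdd h.2.1 m.1 hM)
    ((integrable_mul_of_bdd hui m.1 hM).const_mul _), integral_const_mul, ← e]
  ring

/-- Testing the weak equation with a function of the solution: the drift does not contribute. -/
theorem test_comp (S : LocalSetup A B ν 𝒯) (h : WeakSol A B ν 𝒯 α f u G) {ψ : ℝ → ℝ}
    (hψ : ContDiff ℝ ∞ ψ) (h0 : ψ 0 = 0) {C C' : ℝ} (hC : ∀ s, |ψ s| ≤ C)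
    (hC' : ∀ s, |deriv ψ s| ≤ C') :
    α * ∫ x, u x * ψ (u x) ∂ν + ∫ x, deriv ψ (u x) * aForm A x (G x) (G x) ∂ν =
      ∫ x, f x * ψ (u x) ∂ν := by
  have e := h.2.2 _ _ (S.hGrad_comp h.1 hψ h0 hC') ⟨C, Eventually.of_forall fun x => hC _⟩
  obtain ⟨Ψ, hΨ, hΨ0, hd⟩ := exists_smooth_antideriv hψ
  have e2 := S.integral_inner_B (S.hGrad_comp h.1 hΨ hΨ0 (C := C)
    (fun s => by rw [(hd s).deriv]; exact hC s))
  simp_rw [inner_smul_right, (hd _).deriv] at e2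
  simp_rw [aForm_smul_right] at e
  rw [← e]
  have : ∫ x, inner ℝ (B x) (G x) * ψ (u x) ∂ν = 0 := by
    rw [← e2]; exact integral_congr_ae (Eventually.of_forall fun x => mul_comm _ _)
  rw [this, sub_zero]

theorem test_comp_le (S : LocalSetup A B ν 𝒯) (h : WeakSol A B ν 𝒯 α f u G) {ψ : ℝ → ℝ}
    (hψ : ContDiff ℝ ∞ ψ) (h0 : ψ 0 = 0) {C C' : ℝ} (hC : ∀ s, |ψ s| ≤ C)
    (hC' : ∀ s, |deriv ψ s| ≤ C') (hmono : ∀ s, 0 ≤ deriv ψ s) :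
    α * ∫ x, u x * ψ (u x) ∂ν ≤ ∫ x, f x * ψ (u x) ∂ν := by
  rw [← test_comp S h hψ h0 hC hC', le_add_iff_nonneg_right]
  refine integral_nonneg_of_ae ?_
  filter_upwards [S.aForm_nonneg] with x hx using mul_nonneg (hmono _) (hx _)

/-- One family of bounded increasing test functions serves for two limits: `c → ∞` gives the sign
function and hence the L¹ bound, while `c → 0` after division by `c` gives the identity and hence
the L² bound. -/
theorem test_arctan_le (S : LocalSetup A B ν 𝒯) (h : WeakSol A B ν 𝒯 α f u G) {c : ℝ}
    (hc : 0 < c) :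
    α * ∫ x, u x * Real.arctan (c * u x) ∂ν ≤ ∫ x, f x * Real.arctan (c * u x) ∂ν := by
  refine test_comp_le S h (ψ := fun s => Real.arctan (c * s)) (C := Real.pi / 2) (C' := c)
    (Real.contDiff_arctan.comp (contDiff_const.mul contDiff_id)) (by simp)
    (fun s => abs_arctan_le_pi_div_two _) (fun s => ?_) (fun s => ?_)
  · rw [(deriv_arctan_mul c s).deriv, abs_of_nonneg (by positivity)]
    have : 1 / (1 + (c * s) ^ 2) ≤ 1 := by
      rw [div_le_one (by positivity)]; nlinarith [sq_nonneg (c * s)]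
    nlinarith
  · rw [(deriv_arctan_mul c s).deriv]; positivity

theorem integral_abs_le (S : LocalSetup A B ν 𝒯) (h : WeakSol A B ν 𝒯 α f u G) :
    α * ∫ x, |u x| ∂ν ≤ ∫ x, |f x| ∂ν := by
  have := S.finite
  have hui : Integrable u ν := h.memLp.integrable (by norm_num)
  have key : ∀ n : ℕ, α * ∫ x, u x * Real.arctan (((n : ℝ) + 1) * u x) ∂ν ≤
      Real.pi / 2 * ∫ x, |f x| ∂ν := by
    intro n
    refine (test_arctan_le S h (by positivity)).trans ?_
    rw [← integral_const_mul]
    refine integral_mono_ae (integrable_mul_of_bdd h.2.1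
      (Real.continuous_arctan.comp_aestronglyMeasurable (h.memLp.1.const_mul _))
      (Eventually.of_forall fun x => abs_arctan_le_pi_div_two _)) (h.2.1.abs.const_mul _)
      (Eventually.of_forall fun x => ?_)
    refine (le_abs_self _).trans ?_
    rw [abs_mul, mul_comm]
    exact mul_le_mul_of_nonneg_right (abs_arctan_le_pi_div_two _) (abs_nonneg _)
  have lim : Tendsto (fun n : ℕ => α * ∫ x, u x * Real.arctan (((n : ℝ) + 1) * u x) ∂ν) atTop
      (𝓝 (α * ∫ x, Real.pi / 2 * |u x| ∂ν)) := by
    refine Tendsto.const_mul _ ?_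
    refine tendsto_integral_of_dominated_convergence (fun x => |u x| * (Real.pi / 2))
      (fun n => h.memLp.1.mul (Real.continuous_arctan.comp_aestronglyMeasurable
        (h.memLp.1.const_mul _))) (hui.abs.mul_const _) (fun n => Eventually.of_forall fun x => ?_)
      (Eventually.of_forall fun x => ?_)
    · rw [norm_mul]
      exact mul_le_mul_of_nonneg_left (abs_arctan_le_pi_div_two _) (norm_nonneg _)
    · have ht : Tendsto (fun n : ℕ => ((n : ℝ) + 1)) atTop atTop :=
        tendsto_atTop_add_const_right _ _ tendsto_natCast_atTop_atTop
      rcases lt_trichotomy (u x) 0 with hx | hx | hx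
      · have h1 : Tendsto (fun n : ℕ => Real.arctan (((n : ℝ) + 1) * u x)) atTop
          (𝓝 (-(Real.pi / 2))) := (Real.tendsto_arctan_atBot.mono_right nhdsWithin_le_nhds).comp
            (ht.atTop_mul_const_of_neg hx)
        have := h1.const_mul (u x)
        rw [abs_of_neg hx]
        convert this using 2; ring
      · simp [hx]
      · have h1 : Tendsto (fun n : ℕ => Real.arctan (((n : ℝ) + 1) * u x)) atTop
          (𝓝 (Real.pi / 2)) := (Real.tendsto_arctan_atTop.mono_right nhdsWithin_le_nhds).comp
            (ht.atTop_mul_const hx)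
        have := h1.const_mul (u x)
        rw [abs_of_pos hx]
        convert this using 2; ring
  have := le_of_tendsto lim (Eventually.of_forall key)
  rw [integral_const_mul] at this
  have hpi := Real.pi_pos
  nlinarith

theorem integral_sq_le (S : LocalSetup A B ν 𝒯) (h : WeakSol A B ν 𝒯 α f u G)
    (hf : MemLp f 2 ν) : α * ∫ x, u x ^ 2 ∂ν ≤ ∫ x, |f x| * |u x| ∂ν := by
  have hfu : Integrable (fun x => |f x| * |u x|) ν := integrable_mul_of_memLp hf.abs h.memLp.abs
  have bd : ∀ (n : ℕ) (s : ℝ), |((n : ℝ) + 1) * Real.arctan (((n : ℝ) + 1)⁻¹ * s)| ≤ |s| := by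
    intro n s
    have hn : (0 : ℝ) < (n : ℝ) + 1 := by positivity
    rw [abs_mul, abs_of_pos hn]
    have := mul_le_mul_of_nonneg_left (abs_arctan_le (((n : ℝ) + 1)⁻¹ * s)) hn.le
    rwa [abs_mul, abs_of_pos (inv_pos.2 hn), mul_inv_cancel_left₀ hn.ne'] at this
  have mm : ∀ n : ℕ, AEStronglyMeasurable
      (fun x => ((n : ℝ) + 1) * Real.arctan (((n : ℝ) + 1)⁻¹ * u x)) ν := fun n =>
    (Real.continuous_arctan.comp_aestronglyMeasurable (h.memLp.1.const_mul _)).const_mul _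
  have key : ∀ n : ℕ, α * ∫ x, u x * (((n : ℝ) + 1) * Real.arctan (((n : ℝ) + 1)⁻¹ * u x)) ∂ν ≤
      ∫ x, |f x| * |u x| ∂ν := by
    intro n
    have h1 := test_arctan_le S h (c := ((n : ℝ) + 1)⁻¹) (by positivity)
    have h2 : ∫ x, u x * (((n : ℝ) + 1) * Real.arctan (((n : ℝ) + 1)⁻¹ * u x)) ∂ν =
        ((n : ℝ) + 1) * ∫ x, u x * Real.arctan (((n : ℝ) + 1)⁻¹ * u x) ∂ν := by
      rw [← integral_const_mul]
      exact integral_congr_ae (Eventually.of_forall fun x => by ring)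
    have h3 : ∫ x, f x * (((n : ℝ) + 1) * Real.arctan (((n : ℝ) + 1)⁻¹ * u x)) ∂ν =
        ((n : ℝ) + 1) * ∫ x, f x * Real.arctan (((n : ℝ) + 1)⁻¹ * u x) ∂ν := by
      rw [← integral_const_mul]
      exact integral_congr_ae (Eventually.of_forall fun x => by ring)
    have h4 : ∫ x, f x * (((n : ℝ) + 1) * Real.arctan (((n : ℝ) + 1)⁻¹ * u x)) ∂ν ≤
        ∫ x, |f x| * |u x| ∂ν := by
      refine integral_mono_of_nonneg_or hfu (hf.1.mul (mm n)) fun x => ?_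
      rw [abs_mul]
      exact mul_le_mul_of_nonneg_left (bd n _) (abs_nonneg _)
    rw [h2]
    rw [h3] at h4
    have hn : (0 : ℝ) < (n : ℝ) + 1 := by positivity
    calc _ = ((n : ℝ) + 1) * (α * ∫ x, u x * Real.arctan (((n : ℝ) + 1)⁻¹ * u x) ∂ν) := by ring
      _ ≤ _ := (mul_le_mul_of_nonneg_left h1 hn.le).trans h4
  have lim : Tendsto (fun n : ℕ => α * ∫ x, u x * (((n : ℝ) + 1) *
      Real.arctan (((n : ℝ) + 1)⁻¹ * u x)) ∂ν) atTop (𝓝 (α * ∫ x, u x ^ 2 ∂ν)) := by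
    refine Tendsto.const_mul _ ?_
    refine tendsto_integral_of_dominated_convergence (fun x => |u x| * |u x|)
      (fun n => h.memLp.1.mul (mm n)) (integrable_mul_of_memLp h.memLp.abs h.memLp.abs)
      (fun n => Eventually.of_forall fun x => ?_) (Eventually.of_forall fun x => ?_)
    · rw [norm_mul]; exact mul_le_mul_of_nonneg_left (bd n _) (abs_nonneg _)
    · rw [sq]; exact (tendsto_nat_mul_arctan_div _).const_mul _
  exact le_of_tendsto lim (Eventually.of_forall key)
where
  integral_mono_of_nonneg_or {f g : Eucl d → ℝ} (hg : Integrable g ν)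
      (hf : AEStronglyMeasurable f ν) (hfg : ∀ x, |f x| ≤ g x) : ∫ x, f x ∂ν ≤ ∫ x, g x ∂ν :=
    integral_mono (hg.mono' hf (Eventually.of_forall hfg)) hg fun x => (le_abs_self _).trans (hfg x)

/-- Test with a smooth nondecreasing `ψ` which is positive exactly above `M/α`. Then `∫ (αu - f)
ψ(u) ≤ 0` while the integrand is nonnegative, hence zero; where `αu > M` both factors would be
positive. -/
theorem le_of_le (S : LocalSetup A B ν 𝒯) (hα : 0 < α) (h : WeakSol A B ν 𝒯 α f u G) {M : ℝ}
    (hM : 0 ≤ M) (hf : ∀ᵐ x ∂ν, f x ≤ M) : ∀ᵐ x ∂ν, α * u x ≤ M := by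
  have := S.finite
  have hui : Integrable u ν := h.memLp.integrable (by norm_num)
  obtain ⟨C, hC⟩ := exists_deriv_smoothTransition_bound
  set ψ : ℝ → ℝ := fun s => Real.smoothTransition (s - M / α) with hψ
  have hcd : ContDiff ℝ ∞ ψ := Real.smoothTransition.contDiff.comp (contDiff_id.sub contDiff_const)
  have hder : ∀ s, deriv ψ s = deriv Real.smoothTransition (s - M / α) := fun s =>
    deriv_comp_sub_const _ _ _
  have hb : ∀ s, |ψ s| ≤ 1 := fun s => by
    rw [abs_of_nonneg (Real.smoothTransition.nonneg _)]; exact Real.smoothTransition.le_one _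
  have h1 := test_comp_le S h hcd (Real.smoothTransition.zero_of_nonpos (by
    simp only [zero_sub, Left.neg_nonpos_iff]; positivity)) hb
    (fun s => by rw [hder]; exact hC _)
    (fun s => by rw [hder]; exact Real.smoothTransition.monotone.deriv_nonneg)
  have mψ : AEStronglyMeasurable (fun x => ψ (u x)) ν :=
    hcd.continuous.comp_aestronglyMeasurable h.memLp.1
  have i1 := integrable_mul_of_bdd hui mψ (Eventually.of_forall fun x => hb _)
  have i2 := integrable_mul_of_bdd h.2.1 mψ (Eventually.of_forall fun x => hb _)
  have h2 : ∫ x, (α * (u x * ψ (u x)) - f x * ψ (u x)) ∂ν ≤ 0 := by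
    rw [integral_sub (i1.const_mul _) i2, integral_const_mul]; linarith
  have h3 : 0 ≤ᵐ[ν] fun x => α * (u x * ψ (u x)) - f x * ψ (u x) := by
    filter_upwards [hf] with x hx
    have e : α * (u x * ψ (u x)) - f x * ψ (u x) = (α * u x - f x) * ψ (u x) := by ring
    simp only [Pi.zero_apply]
    rw [e]
    by_cases hux : u x ≤ M / α
    · rw [hψ]; simp only
      rw [Real.smoothTransition.zero_of_nonpos (by linarith), mul_zero]
    · refine mul_nonneg ?_ (Real.smoothTransition.nonneg _)
      rw [not_le, div_lt_iff₀ hα] at hux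
      linarith
  have h4 := (integral_eq_zero_iff_of_nonneg_ae h3 ((i1.const_mul _).sub i2)).1
    (le_antisymm h2 (integral_nonneg_of_ae h3))
  filter_upwards [hf, h4] with x hx h4
  by_contra hcon
  rw [not_le] at hcon
  have h5 : 0 < ψ (u x) := Real.smoothTransition.pos_of_pos (by
    rw [sub_pos, div_lt_iff₀ hα]; linarith)
  have e : (α * u x - f x) * ψ (u x) = 0 := by
    simp only [Pi.zero_apply] at h4
    linarith
  have : 0 < (α * u x - f x) * ψ (u x) := mul_pos (by linarith) h5
  linarith

theorem nonneg_of_nonneg (S : LocalSetup A B ν 𝒯) (hα : 0 < α) (h : WeakSol A B ν 𝒯 α f u G)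
    (hf : ∀ᵐ x ∂ν, 0 ≤ f x) : ∀ᵐ x ∂ν, 0 ≤ u x := by
  have := le_of_le S hα (const_mul S h (-1)) le_rfl (by filter_upwards [hf] with x hx; linarith)
  filter_upwards [this] with x hx
  by_contra hcon
  nlinarith

theorem abs_le_of_abs_le (S : LocalSetup A B ν 𝒯) (hα : 0 < α) (h : WeakSol A B ν 𝒯 α f u G)
    {M : ℝ} (hM : 0 ≤ M) (hf : ∀ᵐ x ∂ν, |f x| ≤ M) : ∀ᵐ x ∂ν, α * |u x| ≤ M := by
  have h1 := le_of_le S hα h hM (by filter_upwards [hf] with x hx using (abs_le.1 hx).2)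
  have h2 := le_of_le S hα (const_mul S h (-1)) hM (by
    filter_upwards [hf] with x hx; linarith [(abs_le.1 hx).1])
  filter_upwards [h1, h2] with x h1 h2
  rcases abs_cases (u x) with h | h <;> rw [h.1] <;> linarith

theorem ae_eq (S : LocalSetup A B ν 𝒯) (hα : 0 < α) (h : WeakSol A B ν 𝒯 α f u G)
    (h' : WeakSol A B ν 𝒯 α f u' G') : u =ᵐ[ν] u' := by
  have := abs_le_of_abs_le S hα (sub S h h') le_rfl (Eventually.of_forall fun x => by simp)
  filter_upwards [this] with x hx
  have : |u x - u' x| ≤ 0 := by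
    by_contra hcon
    nlinarith
  exact sub_eq_zero.1 (abs_nonpos_iff.1 this)

theorem eLpNorm_le (S : LocalSetup A B ν 𝒯) (h : WeakSol A B ν 𝒯 α f u G)
    (hf : MemLp f 2 ν) : α * (eLpNorm u 2 ν).toReal ≤ (eLpNorm f 2 ν).toReal := by
  have h1 := integral_sq_le S h hf
  have e1 : ∫ x, u x ^ 2 ∂ν = ‖h.memLp.toLp u‖ ^ 2 := by
    rw [← real_inner_self_eq_norm_sq, L2.inner_def]
    refine integral_congr_ae ?_
    filter_upwards [h.memLp.coeFn_toLp] with x hx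
    rw [hx]; simp [sq]
  have e2 : ∫ x, |f x| * |u x| ∂ν ≤ ‖hf.toLp f‖ * ‖h.memLp.toLp u‖ := by
    have ha : MemLp (fun x => |f x|) 2 ν := hf.abs
    have hb : MemLp (fun x => |u x|) 2 ν := h.memLp.abs
    have this := real_inner_le_norm (ha.toLp (fun x => |f x|)) (hb.toLp (fun x => |u x|))
    have n1 : ‖ha.toLp (fun x => |f x|)‖ = ‖hf.toLp f‖ := by
      rw [Lp.norm_toLp, Lp.norm_toLp]
      exact congrArg _ (eLpNorm_congr_norm_ae (Eventually.of_forall fun x => by simp))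
    have n2 : ‖hb.toLp (fun x => |u x|)‖ = ‖h.memLp.toLp u‖ := by
      rw [Lp.norm_toLp, Lp.norm_toLp]
      exact congrArg _ (eLpNorm_congr_norm_ae (Eventually.of_forall fun x => by simp))
    rw [n1, n2] at this
    refine le_trans (le_of_eq ?_) this
    rw [L2.inner_def]
    refine integral_congr_ae ?_
    filter_upwards [hb.coeFn_toLp, ha.coeFn_toLp] with x hx hx'
    rw [hx, hx']; simp [mul_comm]
  rw [e1] at h1
  have h2 := h1.trans e2
  rw [← Lp.norm_toLp u h.memLp, ← Lp.norm_toLp f hf]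
  rcases (norm_nonneg (h.memLp.toLp u)).eq_or_lt with h0 | h0
  · rw [← h0, mul_zero]; exact norm_nonneg _
  · nlinarith

end WeakSol

end Estimates

end

/-! ### Bounded weak solutions belong to the closure of L⁰ + ⟨B,∇·⟩ in L¹ -/

section

section Graph

variable {d : ℕ} {A : Eucl d → Matrix (Fin d) (Fin d) ℝ} {B : Eucl d → Eucl d}
  {ν : Measure (Eucl d)} {𝒯 : Set (Eucl d → ℝ)} {α : ℝ} {f f' u u' : Eucl d → ℝ}
  {G G' : Eucl d → Eucl d}

/-- `u` is in the domain of the operator of the closed form, with `∇u = G` and image `w`. -/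
def FormOp (A : Eucl d → Matrix (Fin d) (Fin d) ℝ) (ν : Measure (Eucl d))
    (𝒯 : Set (Eucl d → ℝ)) (u : Eucl d → ℝ) (G : Eucl d → Eucl d) (w : Eucl d → ℝ) : Prop :=
  HGrad ν 𝒯 u G ∧ MemLp w 2 ν ∧ ∀ v H, HGrad ν 𝒯 v H →
    ∫ x, aForm A x (G x) (H x) ∂ν = -∫ x, w x * v x ∂ν

theorem FormOp.weakSol (S : LocalSetup A B ν 𝒯) {w : Eucl d → ℝ} (h : FormOp A ν 𝒯 u G w)
    {W : Eucl d → ℝ} (hW : W =ᵐ[ν] fun x => w x + inner ℝ (B x) (G x)) (α : ℝ) :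
    WeakSol A B ν 𝒯 α (fun x => α * u x - W x) u G := by
  have := S.finite
  have hB := S.integrable_inner_B h.1.memLp_grad
  have hui : Integrable u ν := h.1.memLp.integrable (by norm_num)
  have hwi : Integrable w ν := h.2.1.integrable (by norm_num)
  have hWi : Integrable W ν := (hwi.add hB).congr hW.symm
  refine ⟨h.1, (hui.const_mul _).sub hWi, fun v H hv ⟨M, hM⟩ => ?_⟩
  have m := hv.memLp.1
  rw [h.2.2 v H hv]
  have e : ∫ x, (α * u x - W x) * v x ∂ν =
      ∫ x, (α * (u x * v x) - (w x * v x + inner ℝ (B x) (G x) * v x)) ∂ν := by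
    refine integral_congr_ae ?_
    filter_upwards [hW] with x hx
    rw [hx]; ring
  have i1 := integrable_mul_of_bdd hui m hM
  have i2 := integrable_mul_of_bdd hwi m hM
  have i3 := integrable_mul_of_bdd hB m hM
  have i4 : Integrable (fun x => w x * v x + inner ℝ (B x) (G x) * v x) ν := i2.add i3
  rw [e, integral_sub (i1.const_mul _) i4, integral_add i2 i3, integral_const_mul]
  ring

/-- Without drift and with square integrable data every term is continuous in the energy norm, so
the equation extends from test functions to the whole form domain, unbounded functions included. -/
theorem WeakSol.formOp (S : LocalSetup A B ν 𝒯) {β : ℝ} (h : WeakSol A 0 ν 𝒯 β f u G)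
    (hf : MemLp f 2 ν) : FormOp A ν 𝒯 u G (fun x => β * u x - f x) := by
  have hw : MemLp (fun x => β * u x - f x) 2 ν := (h.memLp.const_mul β).sub hf
  refine ⟨h.1, hw, fun v H hv => ?_⟩
  obtain ⟨g, hg, hga⟩ := hv
  have t1 := tendsto_integral_mul (f := fun _ x => β * u x - f x) (g := fun x => β * u x - f x)
    (fun _ => hw) (fun n => S.memLp_test (hg n)) hw hga.memLp (by simp) hga.lim
  have t2 := tendsto_integral_inner (f := fun _ x => aVec A x (G x)) (g := fun x => aVec A x (G x))
    (fun _ => S.memLp_aVec h.memLp_grad) (fun n => S.memLp_gradient_test (hg n))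
    (S.memLp_aVec h.memLp_grad) hga.memLp_grad (by simp) hga.lim_grad
  simp_rw [← aForm_eq_inner] at t2
  refine tendsto_nhds_unique t2 (t1.neg.congr fun n => ?_)
  obtain ⟨C, hC⟩ := (S.smooth _ (hg n)).continuous.bounded_above_of_compact_support
    (S.compact _ (hg n))
  have e := h.2.2 _ _ (S.hGrad_test (hg n)) ⟨C, Eventually.of_forall hC⟩
  have m := S.memLp_test (hg n)
  simp only [Pi.zero_apply, inner_zero_left, zero_mul, integral_zero, sub_zero] at e
  simp_rw [sub_mul, mul_assoc]
  rw [integral_sub ((integrable_mul_of_memLp h.memLp m).const_mul _)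
    (integrable_mul_of_memLp hf m), integral_const_mul, ← e]
  ring

/-- The symmetric resolvent `β G_β u` of a bounded function whose form pairing is given by an
integrable function. -/
theorem exists_resolvent_approx (S : LocalSetup A B ν 𝒯) {M : ℝ} (hu : HGrad ν 𝒯 u G)
    (hM0 : 0 ≤ M) (hM : ∀ᵐ x ∂ν, |u x| ≤ M) {β : ℝ} (hβ : 0 < β) :
    ∃ U G', FormOp A ν 𝒯 U G' (fun x => β * (U x - u x)) ∧ (∀ᵐ x ∂ν, |U x| ≤ M) := by
  have S0 := S.zero_drift
  obtain ⟨U, G', hU⟩ := S0.exists_weakSol hβ (hu.memLp.const_mul β)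
  have h1 := hU.formOp S (hu.memLp.const_mul β)
  refine ⟨U, G', ?_, ?_⟩
  · have e : (fun x => β * (U x - u x)) = fun x => β * U x - β * u x := by ext x; ring
    rw [e]; exact h1
  · have := hU.abs_le_of_abs_le S0 hβ (M := β * M) (by positivity) (by
      filter_upwards [hM] with x hx
      rw [abs_mul, abs_of_pos hβ]; gcongr)
    filter_upwards [this] with x hx
    exact le_of_mul_le_mul_left hx hβ

theorem integral_mul_sq_le {X : Type*} [MeasurableSpace X] {ν : Measure X} {f g : X → ℝ}
    (hf : MemLp f 2 ν) (hg : MemLp g 2 ν) :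
    (∫ x, f x * g x ∂ν) ^ 2 ≤ (∫ x, f x ^ 2 ∂ν) * ∫ x, g x ^ 2 ∂ν := by
  have e : ∀ {a b : X → ℝ} (ha : MemLp a 2 ν) (hb : MemLp b 2 ν),
      ∫ x, a x * b x ∂ν = inner ℝ (ha.toLp a) (hb.toLp b) := by
    intro a b ha hb
    rw [L2.inner_def]
    refine integral_congr_ae ?_
    filter_upwards [ha.coeFn_toLp, hb.coeFn_toLp] with x h1 h2
    rw [h1, h2]; simp [mul_comm]
  simp_rw [sq, e hf hg, e hf hf, e hg hg]
  exact real_inner_mul_inner_self_le _ _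

theorem tendsto_integral_abs_of_sq {X : Type*} [MeasurableSpace X] {ν : Measure X}
    [IsFiniteMeasure ν] {f : ℕ → X → ℝ} (hf : ∀ n, MemLp (f n) 2 ν)
    (h : Tendsto (fun n => ∫ x, f n x ^ 2 ∂ν) atTop (𝓝 0)) :
    Tendsto (fun n => ∫ x, |f n x| ∂ν) atTop (𝓝 0) := by
  have h1 : ∀ n, (∫ x, |f n x| ∂ν) ^ 2 ≤ (∫ x, f n x ^ 2 ∂ν) * ∫ _, (1 : ℝ) ^ 2 ∂ν := by
    intro n
    have h0 : MemLp (fun x => |f n x|) 2 ν := (hf n).abs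
    have := integral_mul_sq_le h0 (memLp_const (1 : ℝ))
    simpa using this
  have h2 : Tendsto (fun n => (∫ x, |f n x| ∂ν) ^ 2) atTop (𝓝 0) := by
    refine squeeze_zero (fun n => sq_nonneg _) h1 ?_
    have h4 := h.mul_const (∫ _, (1 : ℝ) ^ 2 ∂ν)
    rwa [zero_mul] at h4
  have h3 := h2.sqrt
  simp only [Real.sqrt_zero] at h3
  exact h3.congr fun n => Real.sqrt_sq (integral_nonneg fun x => abs_nonneg _)

/-- Insert `U - u` into both equations and subtract. The function `g` is only integrable, and the
common bound on `u` and `U` makes the right side meaningful. The identity controls both the energy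
and `β‖U - u‖²`. -/
theorem energy_identity (S : LocalSetup A B ν 𝒯) {g U : Eucl d → ℝ} {β M : ℝ}
    (hu : HGrad ν 𝒯 u G)
    (hug : ∀ v H, HGrad ν 𝒯 v H → (∃ M : ℝ, ∀ᵐ x ∂ν, |v x| ≤ M) →
      ∫ x, aForm A x (G x) (H x) ∂ν = -∫ x, g x * v x ∂ν)
    (hM : ∀ᵐ x ∂ν, |u x| ≤ M) (hMU : ∀ᵐ x ∂ν, |U x| ≤ M)
    (hU : FormOp A ν 𝒯 U G' (fun x => β * (U x - u x))) :
    ∫ x, aForm A x (G' x - G x) (G' x - G x) ∂ν + β * ∫ x, (U x - u x) ^ 2 ∂ν =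
      ∫ x, g x * (U x - u x) ∂ν := by
  have hD := S.hGrad_sub hU.1 hu
  have hb : ∀ᵐ x ∂ν, |U x - u x| ≤ M + M := by
    filter_upwards [hM, hMU] with x h1 h2 using (abs_sub _ _).trans (by linarith)
  have e1 := hug _ _ hD ⟨_, hb⟩
  have e2 := hU.2.2 _ _ hD
  have e3 : ∫ x, aForm A x (G' x - G x) (G' x - G x) ∂ν =
      ∫ x, aForm A x (G' x) (G' x - G x) ∂ν - ∫ x, aForm A x (G x) (G' x - G x) ∂ν := by
    simp_rw [aForm_sub_left]
    exact integral_sub (S.integrable_aForm hU.1.memLp_grad hD.memLp_grad)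
      (S.integrable_aForm hu.memLp_grad hD.memLp_grad)
  have e4 : ∫ x, β * (U x - u x) * (U x - u x) ∂ν = β * ∫ x, (U x - u x) ^ 2 ∂ν := by
    rw [← integral_const_mul]
    exact integral_congr_ae (Eventually.of_forall fun x => by ring)
  rw [e3, e1, e2, e4]; ring

/-- A rate `1/β` for the L² convergence of the symmetric resolvent `β G_β h` to `h` on the form
domain. It rests on `ℰ(U, U - h) + ℰ(h, h) ≥ 0`, an instance of Young's inequality with `ε = 1/4`.
-/
theorem resolvent_test_estimate (S : LocalSetup A B ν 𝒯) {h U : Eucl d → ℝ} {β : ℝ}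
    (hh : HGrad ν 𝒯 h G) (hU : FormOp A ν 𝒯 U G' (fun x => β * (U x - h x))) :
    β * ∫ x, (U x - h x) ^ 2 ∂ν ≤ ∫ x, aForm A x (G x) (G x) ∂ν := by
  have hD := S.hGrad_sub hU.1 hh
  have e2 := hU.2.2 _ _ hD
  have e4 : ∫ x, β * (U x - h x) * (U x - h x) ∂ν = β * ∫ x, (U x - h x) ^ 2 ∂ν := by
    rw [← integral_const_mul]
    exact integral_congr_ae (Eventually.of_forall fun x => by ring)
  rw [e4] at e2
  have i1 := S.integrable_aForm hU.1.memLp_grad hD.memLp_grad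
  have i2 := S.integrable_aForm hh.memLp_grad hh.memLp_grad
  have : 0 ≤ ∫ x, (aForm A x (G' x) (G' x - G x) + aForm A x (G x) (G x)) ∂ν := by
    refine integral_nonneg_of_ae ?_
    filter_upwards [S.aForm_nonneg, S.symm] with x hp hs
    have y := aForm_young hs hp (G x) (G' x - G x) (ε := 1 / 4) (by norm_num) 1
    have e : aForm A x (G' x) (G' x - G x) =
        aForm A x (G' x - G x) (G' x - G x) + aForm A x (G x) (G' x - G x) := by
      rw [← aForm_add_left]; simp
    rw [abs_le] at y
    have := hp (G x)
    simp only [Pi.zero_apply]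
    rw [e]
    linarith [y.1]
  rw [integral_add i1 i2] at this
  linarith

/-- A bounded weak solution is in the domain of the closure of the operator `L⁰ + ⟨B, ∇ ·⟩`, defined
on the bounded functions in the domain of `L⁰`. -/
theorem WeakSol.exists_graph_approx (S : LocalSetup A B ν 𝒯)
    (hdense : ∀ g, Integrable g ν → ∀ ε > 0, ∃ h ∈ 𝒯, ∫ x, |g x - h x| ∂ν ≤ ε)
    (hu : WeakSol A B ν 𝒯 α f u G) {M : ℝ} (hM0 : 0 ≤ M) (hM : ∀ᵐ x ∂ν, |u x| ≤ M) :
    ∃ (U : ℕ → Eucl d → ℝ) (G' : ℕ → Eucl d → Eucl d) (w : ℕ → Eucl d → ℝ),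
      (∀ k, FormOp A ν 𝒯 (U k) (G' k) (w k) ∧ ∀ᵐ x ∂ν, |U k x| ≤ M) ∧
      Tendsto (fun k => ∫ x, |U k x - u x| ∂ν) atTop (𝓝 0) ∧
      Tendsto (fun k => ∫ x, |w k x + inner ℝ (B x) (G' k x) - (α * u x - f x)| ∂ν) atTop
        (𝓝 0) := by
  have := S.finite
  have S0 := S.zero_drift
  have hui : Integrable u ν := hu.memLp.integrable (by norm_num)
  have hBG := S.integrable_inner_B hu.memLp_grad
  -- Formally `g = L⁰u`. It is integrable but in general not square integrable, so `u` need not be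
  -- in the domain of `L⁰`; this is why an approximation is needed.
  set g : Eucl d → ℝ := fun x => α * u x - f x - inner ℝ (B x) (G x) with hgdef
  have hg : Integrable g ν := ((hui.const_mul _).sub hu.2.1).sub hBG
  have hug : ∀ v H, HGrad ν 𝒯 v H → (∃ M : ℝ, ∀ᵐ x ∂ν, |v x| ≤ M) →
      ∫ x, aForm A x (G x) (H x) ∂ν = -∫ x, g x * v x ∂ν := by
    intro v H hv ⟨M, hM⟩
    have e := hu.2.2 v H hv ⟨M, hM⟩
    have m := hv.memLp.1
    have i1 := (integrable_mul_of_bdd hui m hM).const_mul α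
    have i2 := integrable_mul_of_bdd hu.2.1 m hM
    have i3 := integrable_mul_of_bdd hBG m hM
    simp_rw [hgdef, sub_mul, mul_assoc]
    have i4 : Integrable (fun x => α * (u x * v x) - f x * v x) ν := i1.sub i2
    rw [integral_sub i4 i3, integral_sub i1 i2, integral_const_mul, ← e]
    ring
  have hβ : ∀ k : ℕ, (0 : ℝ) < (k : ℝ) + 1 := fun k => by positivity
  choose U G' hU hUM using fun k : ℕ => exists_resolvent_approx S hu.1 hM0 hM (hβ k)
  have hD : ∀ k, HGrad ν 𝒯 (fun x => U k x - u x) (fun x => G' k x - G x) := fun k =>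
    S.hGrad_sub (hU k).1 hu.1
  have hDb : ∀ k, ∀ᵐ x ∂ν, |U k x - u x| ≤ M + M := fun k => by
    filter_upwards [hM, hUM k] with x h1 h2 using (abs_sub _ _).trans (by linarith)
  have en := fun k => energy_identity S hu.1 hug hM (hUM k) (hU k)
  have enn : ∀ k, 0 ≤ ∫ x, aForm A x (G' k x - G x) (G' k x - G x) ∂ν := fun k =>
    integral_nonneg_of_ae (by filter_upwards [S.aForm_nonneg] with x hx using hx _)
  have hinv : Tendsto (fun k : ℕ => 1 / ((k : ℝ) + 1)) atTop (𝓝 0) :=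
    tendsto_one_div_add_atTop_nhds_zero_nat
  have hsq : Tendsto (fun k => ∫ x, (U k x - u x) ^ 2 ∂ν) atTop (𝓝 0) := by
    refine squeeze_zero (fun k => integral_nonneg fun x => sq_nonneg _)
      (g := fun k : ℕ => (∫ x, |g x| * (M + M) ∂ν) * (1 / ((k : ℝ) + 1))) (fun k => ?_) ?_
    · rw [mul_one_div, le_div_iff₀ (hβ k)]
      have h1 : ∫ x, g x * (U k x - u x) ∂ν ≤ ∫ x, |g x| * (M + M) ∂ν := by
        refine integral_mono_ae (integrable_mul_of_bdd hg (hD k).memLp.1 (hDb k))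
          (hg.abs.mul_const _) ?_
        filter_upwards [hDb k] with x hx
        refine (le_abs_self _).trans ?_
        rw [abs_mul]; gcongr
      linarith [en k, enn k]
    · simpa using hinv.const_mul (∫ x, |g x| * (M + M) ∂ν)
  have hl1 := tendsto_integral_abs_of_sq (fun k => (hD k).memLp) hsq
  have hsq2 : Tendsto (fun k => eLpNorm (fun x => U k x - u x) 1 ν) atTop (𝓝 0) := by
    have h2 : ∀ k, eLpNorm (fun x => U k x - u x) 1 ν = ENNReal.ofReal (∫ x, |U k x - u x| ∂ν) := by
      intro k
      rw [eLpNorm_one_eq_lintegral_enorm]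
      exact (ofReal_integral_norm_eq_lintegral_enorm
        ((hD k).memLp.integrable (by norm_num))).symm
    simp_rw [h2]
    simpa using ENNReal.tendsto_ofReal hl1
  -- Almost everywhere convergence along a subsequence is required, because `∫ g (U - u)` with `g`
  -- in `L¹` is only accessible to dominated convergence.
  obtain ⟨ns, hns, hae⟩ := (tendstoInMeasure_of_tendsto_eLpNorm one_ne_zero
    (fun k => (hU k).1.memLp.1) hu.memLp.1 hsq2).exists_seq_tendsto_ae
  -- By the energy identity this forces the energy of `U - u`, hence `∇U - ∇u` in L² and `⟨B, ∇U -
  -- ∇u⟩` in L¹, to tend to zero.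
  have hgD : Tendsto (fun k => ∫ x, g x * (U (ns k) x - u x) ∂ν) atTop (𝓝 0) := by
    have := LocalSetup.tendsto_integral_mul_bdd hg (v := fun k x => U (ns k) x - u x)
      (w := fun _ => 0) (fun k => (hD (ns k)).memLp.1) (fun k => hDb (ns k)) (by
        filter_upwards [hae] with x hx
        simpa using hx.sub_const (u x))
    simpa using this
  have hE : Tendsto (fun k => ∫ x, aForm A x (G' (ns k) x - G x) (G' (ns k) x - G x) ∂ν) atTop
      (𝓝 0) := squeeze_zero (fun k => enn _) (fun k => by
        have : 0 ≤ ((ns k : ℝ) + 1) * ∫ x, (U (ns k) x - u x) ^ 2 ∂ν :=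
          mul_nonneg (hβ _).le (integral_nonneg fun x => sq_nonneg _)
        linarith [en (ns k)]) hgD
  obtain ⟨Λ, hΛ, hell⟩ := S.ell
  have hGG : Tendsto (fun k => ∫ x, ‖G' (ns k) x - G x‖ ^ 2 ∂ν) atTop (𝓝 0) := by
    refine squeeze_zero (fun k => integral_nonneg fun x => sq_nonneg _)
      (g := fun k => Λ * ∫ x, aForm A x (G' (ns k) x - G x) (G' (ns k) x - G x) ∂ν) (fun k => ?_)
      (by simpa using hE.const_mul Λ)
    have m := (hD (ns k)).memLp_grad
    rw [← integral_const_mul]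
    refine integral_mono_ae m.norm.integrable_sq ((S.integrable_aForm m m).const_mul _) ?_
    filter_upwards [hell] with x hx
    have := mul_le_mul_of_nonneg_left (hx (G' (ns k) x - G x)).1 hΛ.le
    rwa [mul_inv_cancel_left₀ hΛ.ne'] at this
  have hBD : Tendsto (fun k => ∫ x, |inner ℝ (B x) (G' (ns k) x - G x)| ∂ν) atTop (𝓝 0) := by
    have h1 : ∀ k, (∫ x, |inner ℝ (B x) (G' (ns k) x - G x)| ∂ν) ≤
        ∫ x, ‖B x‖ * ‖G' (ns k) x - G x‖ ∂ν := fun k =>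
      integral_mono (S.integrable_inner_B (hD (ns k)).memLp_grad).abs
        (integrable_mul_of_memLp S.memB.norm (hD (ns k)).memLp_grad.norm)
        fun x => abs_real_inner_le_norm _ _
    have h2 : Tendsto (fun k => Real.sqrt ((∫ x, ‖B x‖ ^ 2 ∂ν) *
        ∫ x, ‖G' (ns k) x - G x‖ ^ 2 ∂ν)) atTop (𝓝 0) := by
      simpa using (hGG.const_mul (∫ x, ‖B x‖ ^ 2 ∂ν)).sqrt
    refine squeeze_zero (fun k => integral_nonneg fun x => abs_nonneg _)
      (fun k => (h1 k).trans (Real.le_sqrt_of_sq_le ?_)) h2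
    exact integral_mul_sq_le S.memB.norm (hD (ns k)).memLp_grad.norm
  have hy : Tendsto (fun k => ∫ x, |((ns k : ℝ) + 1) * (U (ns k) x - u x) - g x| ∂ν) atTop
      (𝓝 0) := by
    suffices h : Tendsto (fun k : ℕ => ∫ x, |((k : ℝ) + 1) * (U k x - u x) - g x| ∂ν) atTop (𝓝 0)
      from h.comp hns.tendsto_atTop
    -- The function `(k+1)(U_k - u)` is `(k+1) G_{k+1} g` for the symmetric resolvent. The claim
    -- thus is L¹ strong continuity at `g`: replace `g` by a test function `h`, using the L¹
    -- contraction for the difference and `resolvent_test_estimate` for `h`.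
    have hweak : ∀ k : ℕ, WeakSol A 0 ν 𝒯 ((k : ℝ) + 1) (fun x => ((k : ℝ) + 1) * g x)
        (fun x => ((k : ℝ) + 1) * (U k x - u x)) (fun x => ((k : ℝ) + 1) • (G' k x - G x)) := by
      intro k
      refine ⟨S.hGrad_const_mul (hD k) _, hg.const_mul _, fun v H hv hvM => ?_⟩
      have e1 := hug v H hv hvM
      have e2 := (hU k).2.2 v H hv
      simp_rw [aForm_smul_left, aForm_sub_left, mul_assoc] at e2 ⊢
      simp only [Pi.zero_apply, inner_zero_left, zero_mul, integral_zero, sub_zero]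
      rw [integral_const_mul] at e2
      rw [integral_const_mul, integral_const_mul, integral_const_mul,
        integral_sub (S.integrable_aForm (hU k).1.memLp_grad hv.memLp_grad)
          (S.integrable_aForm hu.memLp_grad hv.memLp_grad), e1, e2]
      ring
    rw [Metric.tendsto_atTop]
    intro ε hε
    obtain ⟨h, hh, hgh⟩ := hdense g hg (ε / 4) (by positivity)
    obtain ⟨C, hC⟩ := (S.smooth _ hh).continuous.bounded_above_of_compact_support (S.compact _ hh)
    have hhG := S.hGrad_test hh
    have hhi : Integrable h ν := hhG.memLp.integrable (by norm_num)
    choose Z Z' hZ hZM using fun k : ℕ => exists_resolvent_approx S hhG (abs_nonneg C)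
      (Eventually.of_forall fun x => (hC x).trans (le_abs_self C)) (hβ k)
    have hZi : ∀ k, Integrable (Z k) ν := fun k => (hZ k).1.memLp.integrable (by norm_num)
    have hZsq : Tendsto (fun k => ∫ x, (Z k x - h x) ^ 2 ∂ν) atTop (𝓝 0) := by
      refine squeeze_zero (fun k => integral_nonneg fun x => sq_nonneg _)
        (g := fun k : ℕ => (∫ x, aForm A x (gradient h x) (gradient h x) ∂ν) * (1 / ((k : ℝ) + 1)))
        (fun k => ?_) ?_
      · rw [mul_one_div, le_div_iff₀ (hβ k), mul_comm]
        exact resolvent_test_estimate S hhG (hZ k)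
      · simpa using hinv.const_mul (∫ x, aForm A x (gradient h x) (gradient h x) ∂ν)
    have hZl := tendsto_integral_abs_of_sq (f := fun k x => Z k x - h x)
      (fun k => (hZ k).1.memLp.sub hhG.memLp) hZsq
    obtain ⟨N, hN⟩ := Metric.tendsto_atTop.1 hZl (ε / 4) (by positivity)
    refine ⟨N, fun k hk => ?_⟩
    have hN' := hN k hk
    rw [Real.dist_eq, sub_zero, abs_of_nonneg (integral_nonneg fun x => abs_nonneg _)] at hN' ⊢
    have hZw := (hZ k).weakSol S0 (W := fun x => ((k : ℝ) + 1) * (Z k x - h x)) (by simp)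
      ((k : ℝ) + 1)
    have hl := ((hweak k).sub S0 hZw).integral_abs_le S0
    have e1 : ∫ x, |((k : ℝ) + 1) * g x - (((k : ℝ) + 1) * Z k x - ((k : ℝ) + 1) * (Z k x - h x))|
        ∂ν = ((k : ℝ) + 1) * ∫ x, |g x - h x| ∂ν := by
      rw [← integral_const_mul]
      refine integral_congr_ae (Eventually.of_forall fun x => ?_)
      have : ((k : ℝ) + 1) * g x - (((k : ℝ) + 1) * Z k x - ((k : ℝ) + 1) * (Z k x - h x)) =
        ((k : ℝ) + 1) * (g x - h x) := by ring
      simp only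
      rw [this, abs_mul, abs_of_pos (hβ k)]
    rw [e1] at hl
    have hl' := le_of_mul_le_mul_left hl (hβ k)
    have iy : Integrable (fun x => ((k : ℝ) + 1) * (U k x - u x)) ν :=
      ((hD k).memLp.integrable (by norm_num)).const_mul _
    have j1 : Integrable (fun x => |((k : ℝ) + 1) * (U k x - u x) - Z k x|) ν :=
      (iy.sub (hZi k)).abs
    have j2 : Integrable (fun x => |Z k x - h x|) ν := ((hZi k).sub hhi).abs
    have j3 : Integrable (fun x => |g x - h x|) ν := (hg.sub hhi).abs
    have j4 : Integrable (fun x => |((k : ℝ) + 1) * (U k x - u x) - Z k x| + |Z k x - h x|) ν :=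
      j1.add j2
    calc ∫ x, |((k : ℝ) + 1) * (U k x - u x) - g x| ∂ν
        ≤ ∫ x, (|((k : ℝ) + 1) * (U k x - u x) - Z k x| + |Z k x - h x| + |g x - h x|) ∂ν := by
          refine integral_mono (iy.sub hg).abs (j4.add j3) fun x => ?_
          have h1 := abs_sub_le (((k : ℝ) + 1) * (U k x - u x)) (Z k x) (g x)
          have h2 := abs_sub_le (Z k x) (h x) (g x)
          rw [abs_sub_comm (h x)] at h2
          simp only
          linarith
      _ = ∫ x, |((k : ℝ) + 1) * (U k x - u x) - Z k x| ∂ν + ∫ x, |Z k x - h x| ∂ν +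
          ∫ x, |g x - h x| ∂ν := by rw [integral_add j4 j3, integral_add j1 j2]
      _ < ε := by linarith
  refine ⟨fun k => U (ns k), fun k => G' (ns k),
    fun k x => ((ns k : ℝ) + 1) * (U (ns k) x - u x), fun k => ⟨hU _, hUM _⟩,
    hl1.comp hns.tendsto_atTop, ?_⟩
  refine squeeze_zero (fun k => integral_nonneg fun x => abs_nonneg _) (fun k => ?_)
    (by simpa using hy.add hBD)
  have iy : Integrable (fun x => ((ns k : ℝ) + 1) * (U (ns k) x - u x)) ν :=
    ((hD (ns k)).memLp.integrable (by norm_num)).const_mul _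
  have j1 : Integrable (fun x => |((ns k : ℝ) + 1) * (U (ns k) x - u x) - g x|) ν :=
    (iy.sub hg).abs
  have j2 : Integrable (fun x => |inner ℝ (B x) (G' (ns k) x - G x)|) ν :=
    (S.integrable_inner_B (hD (ns k)).memLp_grad).abs
  rw [← integral_add j1 j2]
  refine integral_mono_of_nonneg (Eventually.of_forall fun x => abs_nonneg _) (j1.add j2)
    (Eventually.of_forall fun x => ?_)
  refine le_trans (le_of_eq ?_) (abs_add_le _ _)
  simp only [hgdef, inner_sub_right]
  ring_nf

end Graph

end

/-! ### Test functions, standing assumptions, and passage between E and relatively compact sets -/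

section

section TestFunctions

variable {d : ℕ} {E V V' : Set (Eucl d)} {f g : Eucl d → ℝ}

theorem IsTest.mono (h : IsTest E V f) (hV : V ⊆ V') : IsTest E V' f := by
  obtain ⟨h1, h2, K, hK, hKV, h3⟩ := h
  exact ⟨h1, h2, K, hK, hKV.trans hV, h3⟩

theorem isTest_zero : IsTest E V (fun _ => 0) :=
  ⟨contDiff_const, HasCompactSupport.zero, ∅, isCompact_empty, Set.empty_subset _, by simp⟩

theorem IsTest.add (hf : IsTest E V f) (hg : IsTest E V g) : IsTest E V (fun x => f x + g x) := by
  obtain ⟨h1, h2, K, hK, hKV, h3⟩ := hf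
  obtain ⟨h1', h2', K', hK', hKV', h3'⟩ := hg
  refine ⟨h1.add h1', h2.add h2', K ∪ K', hK.union hK', Set.union_subset hKV hKV', ?_⟩
  rintro x ⟨hx, hxK⟩
  rw [Set.mem_union, not_or] at hxK
  simp only [h3 x ⟨hx, hxK.1⟩, h3' x ⟨hx, hxK.2⟩, add_zero]

theorem IsTest.comp (hf : IsTest E V f) {ψ : ℝ → ℝ} (hψ : ContDiff ℝ ∞ ψ) (h0 : ψ 0 = 0) :
    IsTest E V (fun x => ψ (f x)) := by
  obtain ⟨h1, h2, K, hK, hKV, h3⟩ := hf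
  exact ⟨hψ.comp h1, h2.comp_left h0, K, hK, hKV, fun x hx => by simp only [h3 x hx, h0]⟩

/-- A smooth function of two functions, which vanishes where the first one vanishes, is a test
function if the first function is one. -/
theorem IsTest.comp_pair (hf : IsTest E V f) (hg : ContDiff ℝ ∞ g) {F : ℝ × ℝ → ℝ}
    (hF : ContDiff ℝ ∞ F) (h0 : ∀ t, F (0, t) = 0) : IsTest E V (fun x => F (f x, g x)) := by
  obtain ⟨h1, h2, K, hK, hKV, h3⟩ := hf
  refine ⟨hF.comp (h1.prodMk hg), ?_, K, hK, hKV, fun x hx => by simp only [h3 x hx, h0]⟩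
  refine h2.mono' fun x hx => subset_tsupport _ ?_
  simp only [Function.mem_support] at hx ⊢
  intro h
  exact hx (by rw [h, h0])

/-- Cut-off functions for compact subsets of relatively compact open sets. -/
theorem IsRelCompactOpen.exists_cutoff (hV : IsRelCompactOpen E V) {K : Set (Eucl d)}
    (hK : IsCompact K) (hKV : K ⊆ V) :
    ∃ χ : Eucl d → ℝ, ContDiff ℝ ∞ χ ∧ HasCompactSupport χ ∧ (∀ x, 0 ≤ χ x ∧ χ x ≤ 1) ∧
      (∀ x ∈ K, χ x = 1 ∧ gradient χ x = 0) ∧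
      ∀ f : Eucl d → ℝ, ContDiff ℝ ∞ f → IsTest E V (fun x => χ x * f x) := by
  obtain ⟨⟨U, hU, rfl⟩, K', hK', hVK', hK'E⟩ := hV
  obtain ⟨L, hL, hKL, hLU⟩ := exists_compact_between hK hU (hKV.trans Set.inter_subset_right)
  obtain ⟨χ, h1, h0, hχ⟩ := exists_contMDiffMap_one_nhds_of_subset_interior
    (modelWithCornersSelf ℝ (Eucl d)) (n := (⊤ : ℕ∞)) hK.isClosed hKL
  have hcd : ContDiff ℝ ∞ χ := χ.contMDiff.contDiff
  have hcs : HasCompactSupport χ := HasCompactSupport.intro hL h0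
  refine ⟨χ, hcd, hcs, hχ, fun x hx => ?_, fun f hf => ⟨hcd.mul hf, hcs.mul_right, ?_⟩⟩
  · have h2 : ∀ᶠ y in 𝓝 x, χ y = 1 := h1.filter_mono (nhds_le_nhdsSet hx)
    refine ⟨h2.self_of_nhds, ?_⟩
    have h3 : (χ : Eucl d → ℝ) =ᶠ[𝓝 x] fun _ => 1 := h2
    rw [h3.gradient_eq, gradient_fun_const]
  · refine ⟨L ∩ K', hL.inter hK', fun x hx => ⟨hK'E hx.2, hLU hx.1⟩, fun x hx => ?_⟩
    by_cases hxL : x ∈ L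
    · exact absurd ⟨hxL, hVK' ⟨hx.1, hLU hxL⟩⟩ hx.2
    · simp only [h0 x hxL, zero_mul]

end TestFunctions

/-- The standing assumptions on the measure and the coefficients. -/
structure GlobalSetup {d : ℕ} (E : Set (Eucl d)) (A : Eucl d → Matrix (Fin d) (Fin d) ℝ)
    (B : Eucl d → Eucl d) (μ : Measure (Eucl d)) : Prop where
  measE : MeasurableSet E
  interior : ∀ᵐ x ∂μ, x ∈ interior E
  finite : ∀ K, IsCompact K → K ⊆ E → μ K < ⊤
  symm : ∀ᵐ x ∂μ, (A x).IsSymm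
  meas : ∀ i j, AEStronglyMeasurable (fun x => A x i j) μ
  ell : ∀ V, IsRelCompactOpen E V → ∃ ν : ℝ, 0 < ν ∧ ∀ᵐ x ∂(μ.restrict V), ∀ ξ : Eucl d,
    ν⁻¹ * ‖ξ‖ ^ 2 ≤ aForm A x ξ ξ ∧ aForm A x ξ ξ ≤ ν * ‖ξ‖ ^ 2
  nonneg : ∀ᵐ x ∂μ, ∀ ξ, 0 ≤ aForm A x ξ ξ
  clos : IsClosableEnergy E A μ
  memB : ∀ K, IsCompact K → K ⊆ E → MemLp B 2 (μ.restrict K)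
  div : ∀ f, IsTest E E f → ∫ x in E, inner ℝ (B x) (gradient f x) ∂μ = 0

theorem eLpNorm_one_eq_ofReal {X : Type*} [MeasurableSpace X] {ν : Measure X} {g : X → ℝ}
    (hg : Integrable g ν) : eLpNorm g 1 ν = ENNReal.ofReal (∫ x, |g x| ∂ν) := by
  rw [eLpNorm_one_eq_lintegral_enorm]
  exact (ofReal_integral_norm_eq_lintegral_enorm hg).symm

namespace GlobalSetup

variable {d : ℕ} {E V V' : Set (Eucl d)} {A : Eucl d → Matrix (Fin d) (Fin d) ℝ}
  {B : Eucl d → Eucl d} {μ : Measure (Eucl d)} {f u v w : Eucl d → ℝ} {G H : Eucl d → Eucl d}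

theorem measurableSet (S : GlobalSetup E A B μ) (hV : IsRelCompactOpen E V) : MeasurableSet V := by
  obtain ⟨⟨U, hU, rfl⟩, -⟩ := hV
  exact S.measE.inter hU.measurableSet

theorem subset (hV : IsRelCompactOpen E V) : V ⊆ E := by
  obtain ⟨⟨U, hU, rfl⟩, -⟩ := hV
  exact Set.inter_subset_left

theorem ae_mem (S : GlobalSetup E A B μ) : ∀ᵐ x ∂μ, x ∈ E := by
  filter_upwards [S.interior] with x hx using interior_subset hx

theorem restrict_eq (S : GlobalSetup E A B μ) : μ.restrict E = μ :=
  Measure.restrict_eq_self_of_ae_mem S.ae_mem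

/-- A test function is prescribed only on `E`, so its gradient off the compact set is known to
vanish only at interior points of `E`; these carry all the mass of `μ`. -/
theorem test_zero_off (S : GlobalSetup E A B μ) (hf : IsTest E V f) :
    ∀ᵐ x ∂μ, x ∉ V → f x = 0 ∧ gradient f x = 0 := by
  obtain ⟨h1, h2, K, hK, hKV, h3⟩ := hf
  filter_upwards [S.interior] with x hx hxV
  have hxK : x ∉ K := fun h => hxV (hKV h)
  have hev : f =ᶠ[𝓝 x] fun _ => 0 := by
    filter_upwards [isOpen_interior.mem_nhds hx, hK.isClosed.isOpen_compl.mem_nhds hxK] with y h4 h5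
    exact h3 y ⟨interior_subset h4, h5⟩
  exact ⟨hev.eq_of_nhds, by rw [hev.gradient_eq, gradient_fun_const]⟩

theorem finite_restrict (S : GlobalSetup E A B μ) (hV : IsRelCompactOpen E V) :
    IsFiniteMeasure (μ.restrict V) := by
  obtain ⟨-, K, hK, hVK, hKE⟩ := hV
  exact ⟨by rw [Measure.restrict_apply_univ]; exact (measure_mono hVK).trans_lt (S.finite K hK hKE)⟩

theorem localSetup (S : GlobalSetup E A B μ) (hV : IsRelCompactOpen E V) :
    LocalSetup A B (μ.restrict V) {f | IsTest E V f} where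
  finite := S.finite_restrict hV
  symm := ae_restrict_of_ae S.symm
  meas i j := (S.meas i j).restrict
  ell := S.ell V hV
  memB := by
    obtain ⟨-, K, hK, hVK, hKE⟩ := hV
    exact (S.memB K hK hKE).mono_measure (Measure.restrict_mono hVK le_rfl)
  smooth f hf := hf.1
  compact f hf := hf.2.1
  zero := isTest_zero
  add f hf g hg := IsTest.add hf hg
  comp f hf ψ hψ h0 := IsTest.comp hf hψ h0
  div f hf := by
    rw [← S.div f (IsTest.mono hf (subset hV)), S.restrict_eq]
    refine setIntegral_eq_integral_of_ae_compl_eq_zero ?_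
    filter_upwards [S.test_zero_off hf] with x hx hxV
    rw [(hx hxV).2, inner_zero_right]

theorem energy_le (hΛ : 0 < Λ) (hell : ∀ᵐ x ∂(μ.restrict V), ∀ ξ : Eucl d,
      Λ⁻¹ * ‖ξ‖ ^ 2 ≤ aForm A x ξ ξ ∧ aForm A x ξ ξ ≤ Λ * ‖ξ‖ ^ 2) (X : Eucl d → Eucl d) :
    energy A μ V X ≤ ENNReal.ofReal Λ * eLpNorm X 2 (μ.restrict V) ^ 2 ∧
      eLpNorm X 2 (μ.restrict V) ^ 2 ≤ ENNReal.ofReal Λ * energy A μ V X := by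
  have e : eLpNorm X 2 (μ.restrict V) ^ 2 = ∫⁻ x in V, ‖X x‖ₑ ^ 2 ∂μ := by
    rw [eLpNorm_eq_lintegral_rpow_enorm_toReal (by simp) (by simp), ← ENNReal.rpow_natCast,
      ← ENNReal.rpow_mul]
    simp
  have e2 : ∀ x, ‖X x‖ₑ ^ 2 = ENNReal.ofReal (‖X x‖ ^ 2) := fun x => by
    rw [ENNReal.ofReal_pow (norm_nonneg _), ofReal_norm]
  rw [e]
  unfold energy
  constructor
  · rw [← lintegral_const_mul' _ _ ENNReal.ofReal_ne_top]
    refine lintegral_mono_ae ?_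
    filter_upwards [hell] with x hx
    rw [e2, ← ENNReal.ofReal_mul hΛ.le]
    exact ENNReal.ofReal_le_ofReal (hx _).2
  · rw [← lintegral_const_mul' _ _ ENNReal.ofReal_ne_top]
    refine lintegral_mono_ae ?_
    filter_upwards [hell] with x hx
    rw [e2, ← ENNReal.ofReal_mul hΛ.le]
    refine ENNReal.ofReal_le_ofReal ?_
    have := mul_le_mul_of_nonneg_left (hx (X x)).1 hΛ.le
    rwa [mul_inv_cancel_left₀ hΛ.ne'] at this

theorem tendsto_energy_iff (S : GlobalSetup E A B μ) (hV : IsRelCompactOpen E V)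
    {X : ℕ → Eucl d → Eucl d} :
    Tendsto (fun n => energy A μ V (X n)) atTop (𝓝 0) ↔
      Tendsto (fun n => eLpNorm (X n) 2 (μ.restrict V)) atTop (𝓝 0) := by
  obtain ⟨Λ, hΛ, hell⟩ := S.ell V hV
  constructor
  · intro h
    have h1 : Tendsto (fun n => eLpNorm (X n) 2 (μ.restrict V) ^ 2) atTop (𝓝 0) := by
      refine tendsto_of_tendsto_of_tendsto_of_le_of_le tendsto_const_nhds ?_ (fun n => zero_le)
        (fun n => (energy_le hΛ hell (X n)).2)
      simpa using ENNReal.Tendsto.const_mul h (Or.inr ENNReal.ofReal_ne_top)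
    have h2 := ((ENNReal.continuous_rpow_const (y := (1 / 2 : ℝ))).tendsto 0).comp h1
    refine (h2.congr fun n => ?_).trans (by simp)
    rw [Function.comp_apply, ← ENNReal.rpow_natCast, ← ENNReal.rpow_mul]
    simp
  · intro h
    refine tendsto_of_tendsto_of_tendsto_of_le_of_le tendsto_const_nhds ?_ (fun n => zero_le)
      (fun n => (energy_le hΛ hell (X n)).1)
    simpa using ENNReal.Tendsto.const_mul (ENNReal.Tendsto.pow (n := 2) h) (Or.inr ENNReal.ofReal_ne_top)

/-- Approximating sequences in the sense of the energy yield `L²`-approximations of the gradient on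
relatively compact open sets. -/
theorem exists_gradApprox (S : GlobalSetup E A B μ) (hV : IsRelCompactOpen E V)
    {W : Set (Eucl d)} (hVW : V ⊆ W) (hu : HasFormGradient E A μ W u G) :
    ∃ f : ℕ → Eucl d → ℝ, (∀ n, IsTest E W (f n)) ∧ GradApprox (μ.restrict V) f u G := by
  obtain ⟨hu2, hG, f, hf, h1, h2⟩ := hu
  have := S.finite_restrict hV
  have hle : μ.restrict V ≤ μ.restrict W := Measure.restrict_mono hVW le_rfl
  have h1' : Tendsto (fun n => eLpNorm (fun x => f n x - u x) 2 (μ.restrict V)) atTop (𝓝 0) :=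
    tendsto_of_tendsto_of_tendsto_of_le_of_le tendsto_const_nhds h1 (fun n => zero_le)
      (fun n => eLpNorm_mono_measure _ hle)
  have h2' : Tendsto (fun n => eLpNorm (fun x => gradient (f n) x - G x) 2 (μ.restrict V)) atTop
      (𝓝 0) := (S.tendsto_energy_iff hV).1
    (tendsto_of_tendsto_of_tendsto_of_le_of_le tendsto_const_nhds h2 (fun n => zero_le)
      (fun n => lintegral_mono' hle le_rfl))
  have hG' : AEStronglyMeasurable G (μ.restrict V) := hG.mono_measure hle
  have hG2 : MemLp G 2 (μ.restrict V) := by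
    obtain ⟨n, hn⟩ := ((tendsto_order.1 h2').2 1 one_pos).exists
    have m1 : MemLp (gradient (f n)) 2 (μ.restrict V) := by
      obtain ⟨C, hC⟩ := exists_gradient_bound (hf n).1 (hf n).2.1
      exact MemLp.of_bound (continuous_gradient (hf n).1).aestronglyMeasurable C
        (Eventually.of_forall hC)
    have m2 : MemLp (fun x => gradient (f n) x - G x) 2 (μ.restrict V) :=
      ⟨m1.1.sub hG', hn.trans ENNReal.one_lt_top⟩
    have := m1.sub m2
    refine this.ae_eq (Eventually.of_forall fun x => ?_)
    simp
  obtain ⟨ns, -, hga⟩ := exists_gradApprox_subseq (fun n => (hf n).1)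
    (hu2.mono_measure hle) hG2 h1' h2'
  exact ⟨_, fun n => hf (ns n), hga⟩

theorem hasFormGradient_iff (S : GlobalSetup E A B μ) (hV : IsRelCompactOpen E V) :
    HasFormGradient E A μ V u G ↔ HGrad (μ.restrict V) {f | IsTest E V f} u G := by
  constructor
  · intro h
    exact S.exists_gradApprox hV subset_rfl h
  · rintro ⟨f, hf, hfa⟩
    exact ⟨hfa.memLp, hfa.memLp_grad.1, f, hf, hfa.lim, (S.tendsto_energy_iff hV).2 hfa.lim_grad⟩

theorem isFormOperator_iff (S : GlobalSetup E A B μ) (hV : IsRelCompactOpen E V) :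
    IsFormOperator E A μ V u G w ↔ FormOp A (μ.restrict V) {f | IsTest E V f} u G w := by
  unfold IsFormOperator FormOp
  simp_rw [S.hasFormGradient_iff hV]

/-- Test functions are dense in `L¹`. -/
theorem dense_test (S : GlobalSetup E A B μ) (hV : IsRelCompactOpen E V) (g : Eucl d → ℝ)
    (hg : Integrable g (μ.restrict V)) {ε : ℝ} (hε : 0 < ε) :
    ∃ h ∈ {f | IsTest E V f}, ∫ x in V, |g x - h x| ∂μ ≤ ε := by
  have := S.finite_restrict hV
  have hVm := S.measurableSet hV
  obtain ⟨δ, hδ, hδg⟩ := (memLp_one_iff_integrable.2 hg).eLpNorm_indicator_le le_rfl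
    ENNReal.one_ne_top (ε := ε / 3) (by positivity)
  obtain ⟨K, hKV, hK, hKδ⟩ := hVm.exists_isCompact_sdiff_lt (μ := μ.restrict V)
    (measure_ne_top _ _) (ε := ENNReal.ofReal δ) (by simpa using hδ)
  set g1 : Eucl d → ℝ := K.indicator g with hg1
  have hKm := hK.measurableSet
  have hg1i : Integrable g1 (μ.restrict V) := hg.indicator hKm
  have e1 : ∫ x in V, |g x - g1 x| ∂μ ≤ ε / 3 := by
    have h1 := hδg (V \ K) (hVm.diff hKm) hKδ.le
    have h2 : eLpNorm (fun x => g x - g1 x) 1 (μ.restrict V) =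
        eLpNorm ((V \ K).indicator g) 1 (μ.restrict V) := by
      refine eLpNorm_congr_ae ?_
      filter_upwards [ae_restrict_mem hVm] with x hx
      by_cases hxK : x ∈ K <;> simp [hg1, hxK, hx]
    rw [← h2, eLpNorm_one_eq_ofReal (g := fun x => g x - g1 x) (hg.sub hg1i)] at h1
    exact (ENNReal.ofReal_le_ofReal_iff (by positivity)).1 h1
  obtain ⟨h0, h0c, h0g, h0cont, h0L⟩ :=
    (memLp_one_iff_integrable.2 hg1i).exists_hasCompactSupport_eLpNorm_sub_le
    ENNReal.one_ne_top (ε := ENNReal.ofReal (ε / 3)) (by simpa using hε)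
  have h0i : Integrable h0 (μ.restrict V) := memLp_one_iff_integrable.1 h0L
  have e2 : ∫ x in V, |g1 x - h0 x| ∂μ ≤ ε / 3 := by
    have h2 : eLpNorm (g1 - h0) 1 (μ.restrict V) =
      ENNReal.ofReal (∫ x in V, |g1 x - h0 x| ∂μ) := eLpNorm_one_eq_ofReal (hg1i.sub h0i)
    rw [h2] at h0g
    exact (ENNReal.ofReal_le_ofReal_iff (by positivity)).1 h0g
  set m := (μ.restrict V).real Set.univ with hm
  obtain ⟨h1, h1s, h1d⟩ := (h0c.uniformContinuous_of_continuous h0cont).exists_contDiff_dist_le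
    (ε := ε / 3 / (m + 1)) (by positivity)
  have hb : ∀ x, |h0 x - h1 x| ≤ ε / 3 / (m + 1) := fun x => by
    have := h1d x
    rw [dist_comm, Real.dist_eq] at this
    exact this.le
  have ib : Integrable (fun x => |h0 x - h1 x|) (μ.restrict V) :=
    Integrable.of_bound (h0cont.sub h1s.continuous).abs.aestronglyMeasurable (ε / 3 / (m + 1))
      (Eventually.of_forall fun x => by simpa using hb x)
  have e3 : ∫ x in V, |h0 x - h1 x| ∂μ ≤ ε / 3 := by
    calc _ ≤ ∫ x in V, ε / 3 / (m + 1) ∂μ := integral_mono ib (integrable_const _) hb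
      _ = m * (ε / 3 / (m + 1)) := by rw [integral_const, smul_eq_mul]
      _ ≤ ε / 3 := by
        rw [mul_div_assoc', div_le_iff₀ (by positivity)]
        nlinarith [show 0 ≤ m from measureReal_nonneg]
  -- The cut-off is `1` on `K`, where nothing changes, and off `K`, where the target `g1` vanishes,
  -- it can only decrease `|h1|`. The smoothing therefore need not respect the boundary of `V`.
  obtain ⟨χ, hχ, -, hχ01, hχK, hχt⟩ := hV.exists_cutoff hK hKV
  refine ⟨fun x => χ x * h1 x, hχt h1 h1s, ?_⟩
  have j1 : Integrable (fun x => |g x - g1 x|) (μ.restrict V) := (hg.sub hg1i).abs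
  have j2 : Integrable (fun x => |g1 x - h0 x|) (μ.restrict V) := (hg1i.sub h0i).abs
  have j12 : Integrable (fun x => |g x - g1 x| + |g1 x - h0 x|) (μ.restrict V) := j1.add j2
  calc ∫ x in V, |g x - χ x * h1 x| ∂μ
      ≤ ∫ x in V, (|g x - g1 x| + |g1 x - h0 x| + |h0 x - h1 x|) ∂μ := by
        refine integral_mono_of_nonneg (Eventually.of_forall fun x => abs_nonneg _) (j12.add ib)
          (Eventually.of_forall fun x => ?_)
        simp only
        by_cases hx : x ∈ K
        · have : g1 x = g x := by simp [hg1, hx]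
          rw [(hχK x hx).1, one_mul, this, sub_self, abs_zero, zero_add]
          exact abs_sub_le _ _ _
        · have h2 : g1 x = 0 := by simp [hg1, hx]
          rw [h2, sub_zero, zero_sub, abs_neg]
          have h3 : |χ x * h1 x| ≤ |h1 x| := by
            rw [abs_mul, abs_of_nonneg (hχ01 x).1]
            exact mul_le_of_le_one_left (abs_nonneg _) (hχ01 x).2
          have h4 : |h1 x| ≤ |h0 x| + |h0 x - h1 x| := by
            have := abs_sub_abs_le_abs_sub (h1 x) (h0 x)
            rw [abs_sub_comm] at this
            linarith
          have h5 := abs_sub (g x) (χ x * h1 x)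
          linarith
    _ = ∫ x in V, |g x - g1 x| ∂μ + ∫ x in V, |g1 x - h0 x| ∂μ + ∫ x in V, |h0 x - h1 x| ∂μ := by
        rw [integral_add j12 ib, integral_add j1 j2]
    _ ≤ ε := by linarith

end GlobalSetup

end

/-! ### Identification of local resolvents, extension by zero, uniqueness of gradients -/

section

namespace GlobalSetup

variable {d : ℕ} {E V V' : Set (Eucl d)} {A : Eucl d → Matrix (Fin d) (Fin d) ℝ}
  {B : Eucl d → Eucl d} {μ : Measure (Eucl d)} {f u u' v w : Eucl d → ℝ} {G G' H : Eucl d → Eucl d}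
  {α : ℝ}

theorem isLocalResolvent_of_weakSol (S : GlobalSetup E A B μ) (hV : IsRelCompactOpen E V)
    (hf : MemLp f 2 (μ.restrict V)) (h : WeakSol A B (μ.restrict V) {f | IsTest E V f} α f u G)
    (hM : ∃ M : ℝ, ∀ᵐ x ∂(μ.restrict V), |u x| ≤ M) : IsLocalResolvent E A B μ V α f u := by
  have S' := S.localSetup hV
  have := S.finite_restrict hV
  obtain ⟨M, hM⟩ := hM
  have hw : MemLp (fun x => α * u x - f x) 2 (μ.restrict V) := (h.memLp.const_mul α).sub hf
  obtain ⟨U, G', w, hU, h1, h2⟩ := h.exists_graph_approx S'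
    (fun g hg ε hε => S.dense_test hV g hg hε) (abs_nonneg M)
    (by filter_upwards [hM] with x hx using hx.trans (le_abs_self M))
  refine ⟨h.memLp, hw, h.memLp.mono_exponent (by norm_num), hw.mono_exponent (by norm_num), U,
    fun k x => w k x + inner ℝ (B x) (G' k x), fun k => ⟨⟨_, (hU k).2⟩, G' k, w k,
      (S.isFormOperator_iff hV).2 (hU k).1, EventuallyEq.rfl⟩, ?_, ?_⟩
  · have e : ∀ k, eLpNorm (fun x => U k x - u x) 1 (μ.restrict V) =
        ENNReal.ofReal (∫ x in V, |U k x - u x| ∂μ) := fun k => eLpNorm_one_eq_ofReal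
      (((hU k).1.1.memLp.sub h.memLp).integrable (by norm_num))
    simp_rw [e]
    simpa using ENNReal.tendsto_ofReal h1
  · have e : ∀ k, eLpNorm (fun x => w k x + inner ℝ (B x) (G' k x) - (α * u x - f x)) 1
        (μ.restrict V) = ENNReal.ofReal (∫ x in V, |w k x + inner ℝ (B x) (G' k x) -
          (α * u x - f x)| ∂μ) := fun k => by
      have i1 : Integrable (w k) (μ.restrict V) := (hU k).1.2.1.integrable (by norm_num)
      have i2 := S'.integrable_inner_B (hU k).1.1.memLp_grad
      have i3 : Integrable (fun x => α * u x - f x) (μ.restrict V) := hw.integrable (by norm_num)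
      exact eLpNorm_one_eq_ofReal ((i1.add i2).sub i3)
    simp_rw [e]
    simpa using ENNReal.tendsto_ofReal h2

/-- The L¹ dissipativity `α‖u‖₁ ≤ ‖(α - L)u‖₁` holds for the operator before closure, because its
elements are weak solutions, and it passes to L¹ limits. So `α` minus the closure is injective. -/
theorem isLocalResolvent_ae_eq (S : GlobalSetup E A B μ) (hV : IsRelCompactOpen E V) (hα : 0 < α)
    (h : IsLocalResolvent E A B μ V α f u) (h' : IsLocalResolvent E A B μ V α f u') :
    u =ᵐ[μ.restrict V] u' := by
  have S' := S.localSetup hV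
  have := S.finite_restrict hV
  obtain ⟨-, -, hu, hw, U, W, hUW, hU, hW⟩ := h
  obtain ⟨-, -, hu', hw', U', W', hUW', hU', hW'⟩ := h'
  have key : ∀ k, ENNReal.ofReal α * eLpNorm (fun x => U k x - U' k x) 1 (μ.restrict V) ≤
      eLpNorm (fun x => (α * U k x - W k x) - (α * U' k x - W' k x)) 1 (μ.restrict V) := by
    intro k
    obtain ⟨-, G, w, hF, hWe⟩ := hUW k
    obtain ⟨-, G', w', hF', hWe'⟩ := hUW' k
    have e1 := ((S.isFormOperator_iff hV).1 hF).weakSol S' hWe α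
    have e2 := ((S.isFormOperator_iff hV).1 hF').weakSol S' hWe' α
    have e3 := (e1.sub S' e2).integral_abs_le S'
    rw [eLpNorm_one_eq_ofReal ((e1.sub S' e2).memLp.integrable (by norm_num)),
      eLpNorm_one_eq_ofReal (e1.sub S' e2).2.1, ← ENNReal.ofReal_mul hα.le]
    exact ENNReal.ofReal_le_ofReal e3
  have mU : ∀ k, AEStronglyMeasurable (U k) (μ.restrict V) := fun k => by
    obtain ⟨-, G, w, hF, hWe⟩ := hUW k; exact hF.1.1.1
  have mU' : ∀ k, AEStronglyMeasurable (U' k) (μ.restrict V) := fun k => by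
    obtain ⟨-, G, w, hF, hWe⟩ := hUW' k; exact hF.1.1.1
  have mW : ∀ k, AEStronglyMeasurable (W k) (μ.restrict V) := fun k => by
    obtain ⟨-, G, w, hF, hWe⟩ := hUW k
    exact (hF.2.1.1.add (S'.memB.1.inner hF.1.2.1)).congr hWe.symm
  have mW' : ∀ k, AEStronglyMeasurable (W' k) (μ.restrict V) := fun k => by
    obtain ⟨-, G, w, hF, hWe⟩ := hUW' k
    exact (hF.2.1.1.add (S'.memB.1.inner hF.1.2.1)).congr hWe.symm
  set a := fun k => eLpNorm (fun x => U k x - u x) 1 (μ.restrict V)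
  set a' := fun k => eLpNorm (fun x => U' k x - u' x) 1 (μ.restrict V)
  set b := fun k => eLpNorm (fun x => W k x - (α * u x - f x)) 1 (μ.restrict V)
  set b' := fun k => eLpNorm (fun x => W' k x - (α * u' x - f x)) 1 (μ.restrict V)
  set c := ENNReal.ofReal α with hc
  have hcα : ‖α‖ₑ = c := by rw [Real.enorm_eq_ofReal hα.le]
  have n1 : ∀ k, eLpNorm (fun x => (α * U k x - W k x) - (α * U' k x - W' k x)) 1 (μ.restrict V) ≤
      (c * a k + b k) + (c * a' k + b' k) := by
    intro k
    have e : (fun x => (α * U k x - W k x) - (α * U' k x - W' k x)) =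
        ((fun x => α • (U k x - u x)) - fun x => W k x - (α * u x - f x)) -
        ((fun x => α • (U' k x - u' x)) - fun x => W' k x - (α * u' x - f x)) := by
      ext x; simp only [Pi.sub_apply, smul_eq_mul]; ring
    have p1 : AEStronglyMeasurable (fun x => α • (U k x - u x)) (μ.restrict V) :=
      ((mU k).sub hu.1).const_smul α
    have p2 : AEStronglyMeasurable (fun x => W k x - (α * u x - f x)) (μ.restrict V) :=
      (mW k).sub hw.1
    have p3 : AEStronglyMeasurable (fun x => α • (U' k x - u' x)) (μ.restrict V) :=
      ((mU' k).sub hu'.1).const_smul α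
    have p4 : AEStronglyMeasurable (fun x => W' k x - (α * u' x - f x)) (μ.restrict V) :=
      (mW' k).sub hw'.1
    rw [e]
    refine (eLpNorm_sub_le (p1.sub p2) (p3.sub p4) le_rfl).trans (add_le_add ?_ ?_)
    · refine (eLpNorm_sub_le p1 p2 le_rfl).trans (le_of_eq ?_)
      congr 1
      rw [← hcα]; exact eLpNorm_const_smul α _ _ _
    · refine (eLpNorm_sub_le p3 p4 le_rfl).trans (le_of_eq ?_)
      congr 1
      rw [← hcα]; exact eLpNorm_const_smul α _ _ _
  have n2 : ∀ k, c * eLpNorm (fun x => u x - u' x) 1 (μ.restrict V) ≤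
      c * a k + ((c * a k + b k) + (c * a' k + b' k)) + c * a' k := by
    intro k
    have e : (fun x => u x - u' x) = ((fun x => U k x - U' k x) - fun x => U k x - u x) +
        fun x => U' k x - u' x := by
      ext x; simp only [Pi.sub_apply, Pi.add_apply]; ring
    have p0 : AEStronglyMeasurable (fun x => U k x - U' k x) (μ.restrict V) := (mU k).sub (mU' k)
    have p1 : AEStronglyMeasurable (fun x => U k x - u x) (μ.restrict V) := (mU k).sub hu.1
    have p3 : AEStronglyMeasurable (fun x => U' k x - u' x) (μ.restrict V) := (mU' k).sub hu'.1
    have e2 : eLpNorm (fun x => u x - u' x) 1 (μ.restrict V) ≤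
        (eLpNorm (fun x => U k x - U' k x) 1 (μ.restrict V) + a k) + a' k := by
      rw [e]
      exact (eLpNorm_add_le (p0.sub p1) p3 le_rfl).trans
        (add_le_add (eLpNorm_sub_le p0 p1 le_rfl) le_rfl)
    calc c * eLpNorm (fun x => u x - u' x) 1 (μ.restrict V)
        ≤ c * ((eLpNorm (fun x => U k x - U' k x) 1 (μ.restrict V) + a k) + a' k) := by gcongr
      _ = c * eLpNorm (fun x => U k x - U' k x) 1 (μ.restrict V) + c * a k + c * a' k := by ring
      _ ≤ ((c * a k + b k) + (c * a' k + b' k)) + c * a k + c * a' k := by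
        gcongr; exact (key k).trans (n1 k)
      _ = _ := by ring
  have lim : Tendsto (fun k => c * a k + ((c * a k + b k) + (c * a' k + b' k)) + c * a' k) atTop
      (𝓝 0) := by
    have t1 := ENNReal.Tendsto.const_mul (a := c) hU (Or.inr ENNReal.ofReal_ne_top)
    have t2 := ENNReal.Tendsto.const_mul (a := c) hU' (Or.inr ENNReal.ofReal_ne_top)
    simpa using (t1.add ((t1.add hW).add (t2.add hW'))).add t2
  have h0 : c * eLpNorm (fun x => u x - u' x) 1 (μ.restrict V) = 0 :=
    le_antisymm (ge_of_tendsto lim (Eventually.of_forall n2)) zero_le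
  have hc0 : c ≠ 0 := by simpa [hc] using hα
  have h1 : eLpNorm (fun x => u x - u' x) 1 (μ.restrict V) = 0 := by simpa [hc0] using h0
  rw [eLpNorm_eq_zero_iff (f := fun x => u x - u' x) (hu.1.sub hu'.1) one_ne_zero] at h1
  filter_upwards [h1] with x hx using sub_eq_zero.1 hx

/-- Extension by zero of functions in the domain of the form on `V`. -/
theorem hGrad_extend (S : GlobalSetup E A B μ) (hV : MeasurableSet V) (hVV' : V ⊆ V')
    (h : HGrad (μ.restrict V) {f | IsTest E V f} v H) :
    HGrad (μ.restrict V') {f | IsTest E V' f} (V.indicator v) (V.indicator H) := by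
  obtain ⟨f, hf, hfa⟩ := h
  have hr : (μ.restrict V').restrict V = μ.restrict V := Measure.restrict_restrict_of_subset hVV'
  have z : ∀ n, ∀ᵐ x ∂(μ.restrict V'), x ∉ V → f n x = 0 ∧ gradient (f n) x = 0 := fun n =>
    ae_restrict_of_ae (S.test_zero_off (hf n))
  refine ⟨f, fun n => IsTest.mono (hf n) hVV', hfa.smooth, ?_, ?_, ?_, ?_, ?_⟩
  · rw [memLp_indicator_iff_restrict hV, hr]; exact hfa.memLp
  · rw [memLp_indicator_iff_restrict hV, hr]; exact hfa.memLp_grad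
  · refine hfa.lim.congr fun n => ?_
    rw [← hr, ← eLpNorm_indicator_eq_eLpNorm_restrict hV]
    refine eLpNorm_congr_ae ?_
    filter_upwards [z n] with x hx
    by_cases hxV : x ∈ V
    · simp [hxV]
    · simp [hxV, (hx hxV).1]
  · refine hfa.lim_grad.congr fun n => ?_
    rw [← hr, ← eLpNorm_indicator_eq_eLpNorm_restrict hV]
    refine eLpNorm_congr_ae ?_
    filter_upwards [z n] with x hx
    by_cases hxV : x ∈ V
    · simp [hxV]
    · simp [hxV, (hx hxV).2]
  · have h1 := hfa.ae
    rw [← hr, ae_restrict_iff' hV] at h1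
    filter_upwards [h1, ae_all_iff.2 z] with x h1 h2
    by_cases hxV : x ∈ V
    · simpa [hxV] using h1 hxV
    · simp [hxV, fun n => (h2 n hxV).1]

theorem energy_add_le (S : GlobalSetup E A B μ) {X Y : Eucl d → Eucl d}
    (hX : AEStronglyMeasurable X (μ.restrict V)) :
    energy A μ V (fun x => X x + Y x) ≤ 2 * energy A μ V X + 2 * energy A μ V Y := by
  unfold energy
  rw [← lintegral_const_mul' _ _ ENNReal.ofNat_ne_top, ← lintegral_const_mul' _ _ ENNReal.ofNat_ne_top,
    ← lintegral_add_left']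
  · refine lintegral_mono_ae ?_
    filter_upwards [ae_restrict_of_ae S.nonneg] with x hx
    have h1 := hx (X x - Y x)
    have e2 : ∀ a : ℝ, (2 : ℝ≥0∞) * ENNReal.ofReal a = ENNReal.ofReal (2 * a) := fun a => by
      rw [ENNReal.ofReal_mul (by norm_num)]; simp
    rw [e2, e2, ← ENNReal.ofReal_add (by linarith [hx (X x)]) (by linarith [hx (Y x)])]
    refine ENNReal.ofReal_le_ofReal ?_
    simp only [aForm_add_left, aForm_add_right, aForm_sub_left, aForm_sub_right] at h1 ⊢
    linarith
  · exact ((aestronglyMeasurable_aForm (fun i j => (S.meas i j).restrict) hX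
      hX).aemeasurable.ennreal_ofReal).const_mul _

theorem energy_neg (X : Eucl d → Eucl d) : energy A μ V (fun x => -X x) = energy A μ V X := by
  unfold energy
  congr 1
  ext x
  have : -X x = (-1 : ℝ) • X x := by simp
  simp only
  rw [this, aForm_smul_left, aForm_smul_right]
  ring_nf

theorem hasFormGradient_extend (S : GlobalSetup E A B μ) (hV : IsRelCompactOpen E V)
    (h : HasFormGradient E A μ V v H) :
    HasFormGradient E A μ E (V.indicator v) (V.indicator H) := by
  have hVE := subset hV
  have hVm := S.measurableSet hV
  have hr : (μ.restrict E).restrict V = μ.restrict V := Measure.restrict_restrict_of_subset hVE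
  obtain ⟨h1, h2, f, hf, h3, h4⟩ := h
  have z : ∀ n, ∀ᵐ x ∂(μ.restrict E), x ∉ V → f n x = 0 ∧ gradient (f n) x = 0 := fun n =>
    ae_restrict_of_ae (S.test_zero_off (hf n))
  refine ⟨?_, ?_, f, fun n => IsTest.mono (hf n) hVE, ?_, ?_⟩
  · rw [memLp_indicator_iff_restrict hVm, hr]; exact h1
  · rw [aestronglyMeasurable_indicator_iff hVm, hr]; exact h2
  · refine h3.congr fun n => ?_
    rw [← hr, ← eLpNorm_indicator_eq_eLpNorm_restrict hVm]
    refine eLpNorm_congr_ae ?_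
    filter_upwards [z n] with x hx
    by_cases hxV : x ∈ V
    · simp [hxV]
    · simp [hxV, (hx hxV).1]
  · refine h4.congr fun n => ?_
    unfold energy
    rw [← hr, ← lintegral_indicator hVm]
    refine lintegral_congr_ae ?_
    filter_upwards [z n] with x hx
    by_cases hxV : x ∈ V
    · simp [hxV]
    · simp [hxV, (hx hxV).2, aForm]

/-- The gradient of a function in the domain of the closed form is unique. -/
theorem gradient_unique (S : GlobalSetup E A B μ) (h : HasFormGradient E A μ E u G)
    (h' : HasFormGradient E A μ E u' G') (huu' : u =ᵐ[μ.restrict E] u')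
    (hV : IsRelCompactOpen E V) : G =ᵐ[μ.restrict V] G' := by
  obtain ⟨h1, h2, f, hf, h3, h4⟩ := h
  obtain ⟨h1', h2', f', hf', h3', h4'⟩ := h'
  have mg : ∀ n, AEStronglyMeasurable (fun x => gradient (f n) x - G x) (μ.restrict E) := fun n =>
    (continuous_gradient (hf n).1).aestronglyMeasurable.sub h2
  have mg' : ∀ n, AEStronglyMeasurable (fun x => gradient (f' n) x - G' x) (μ.restrict E) :=
    fun n => (continuous_gradient (hf' n).1).aestronglyMeasurable.sub h2'
  set a := fun n => energy A μ E (fun x => gradient (f n) x - G x)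
  set a' := fun n => energy A μ E (fun x => gradient (f' n) x - G' x)
  -- The difference of two approximating sequences tends to zero in L² and is Cauchy for the energy;
  -- closability makes its energy vanish in the limit, and so the energy of `G - G'` is zero.
  set g : ℕ → Eucl d → ℝ := fun n x => f n x + (-1) * f' n x with hg
  have hgt : ∀ n, IsTest E E (g n) := fun n => (hf n).add
    ((hf' n).comp (ψ := fun s => (-1) * s) (contDiff_const.mul contDiff_id) (by simp))
  have hgrad : ∀ n x, gradient (g n) x = gradient (f n) x - gradient (f' n) x := fun n x => by
    have d1 : DifferentiableAt ℝ (f n) x := (hf n).1.differentiable (by simp) x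
    have d2 : DifferentiableAt ℝ (f' n) x := (hf' n).1.differentiable (by simp) x
    rw [hg]
    simp only
    rw [gradient_add d1 (d2.const_mul _), gradient_const_mul _ d2]
    simp [sub_eq_add_neg]
  have b1 : ∀ n, energy A μ E (fun x => (gradient (f n) x - G x) + -(gradient (f' n) x - G' x)) ≤
      2 * a n + 2 * a' n := fun n => by
    refine (S.energy_add_le (mg n)).trans ?_
    rw [energy_neg]
  have mgg : ∀ n, AEStronglyMeasurable (fun x => (gradient (f n) x - G x) +
      -(gradient (f' n) x - G' x)) (μ.restrict E) := fun n => (mg n).add (mg' n).neg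
  have hb : Tendsto (fun n => 2 * a n + 2 * a' n) atTop (𝓝 0) := by
    have t1 := ENNReal.Tendsto.const_mul (a := 2) h4 (Or.inr ENNReal.ofNat_ne_top)
    have t2 := ENNReal.Tendsto.const_mul (a := 2) h4' (Or.inr ENNReal.ofNat_ne_top)
    simpa using t1.add t2
  have c1 := S.clos g hgt (by
    have t := tendsto_eLpNorm_two_add (f' := fun n x => (-1 : ℝ) * f' n x)
      (g' := fun x => (-1 : ℝ) * u' x) (fun n => ((hf n).1.continuous.aestronglyMeasurable).sub h1.1)
      (fun n => (((hf' n).1.continuous.aestronglyMeasurable).const_mul _).sub (h1'.1.const_mul _))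
      h3 (h3'.congr fun n => by
        rw [← eLpNorm_neg]
        congr 1
        ext x; simp only [Pi.neg_apply]; ring)
    refine t.congr fun n => eLpNorm_congr_ae ?_
    filter_upwards [huu'] with x hx
    rw [hx]; simp [hg]) (by
    have t : Tendsto (fun p : ℕ × ℕ => 2 * (2 * a p.1 + 2 * a' p.1) + 2 * (2 * a p.2 + 2 * a' p.2))
        atTop (𝓝 0) := by
      rw [← prod_atTop_atTop_eq]
      have t1 := ENNReal.Tendsto.const_mul (a := 2) (hb.comp tendsto_fst)
        (Or.inr ENNReal.ofNat_ne_top) (f := atTop ×ˢ (atTop : Filter ℕ))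
      have t2 := ENNReal.Tendsto.const_mul (a := 2) (hb.comp tendsto_snd)
        (Or.inr ENNReal.ofNat_ne_top) (f := (atTop : Filter ℕ) ×ˢ atTop)
      simpa [Function.comp_def] using t1.add t2
    refine tendsto_of_tendsto_of_tendsto_of_le_of_le tendsto_const_nhds t (fun n => zero_le)
      (fun p => ?_)
    have e : (fun x => gradient (g p.1) x - gradient (g p.2) x) = fun x =>
        ((gradient (f p.1) x - G x) + -(gradient (f' p.1) x - G' x)) +
        -((gradient (f p.2) x - G x) + -(gradient (f' p.2) x - G' x)) := by
      ext1 x; rw [hgrad, hgrad]; abel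
    simp only
    rw [e]
    refine (S.energy_add_le (mgg p.1)).trans ?_
    rw [energy_neg]
    gcongr <;> exact b1 _)
  have c2 : energy A μ E (fun x => G x - G' x) = 0 := by
    refine le_antisymm (ge_of_tendsto (x := atTop)
      (f := fun n => 2 * energy A μ E (gradient (g n)) + 2 * (2 * a n + 2 * a' n)) ?_
      (Eventually.of_forall fun n => ?_)) zero_le
    · have t1 := ENNReal.Tendsto.const_mul (a := 2) c1 (Or.inr ENNReal.ofNat_ne_top)
      have t2 := ENNReal.Tendsto.const_mul (a := 2) hb (Or.inr ENNReal.ofNat_ne_top)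
      simpa using t1.add t2
    · have e : (fun x => G x - G' x) = fun x => gradient (g n) x +
          -((gradient (f n) x - G x) + -(gradient (f' n) x - G' x)) := by
        ext1 x; rw [hgrad]; abel
      rw [e]
      refine (S.energy_add_le (continuous_gradient (hgt n).1).aestronglyMeasurable).trans ?_
      rw [energy_neg]
      gcongr
      exact b1 n
  have hVE := subset hV
  have c3 : energy A μ V (fun x => G x - G' x) = 0 := le_antisymm
    ((lintegral_mono' (Measure.restrict_mono hVE le_rfl) le_rfl).trans c2.le) zero_le
  obtain ⟨Λ, hΛ, hell⟩ := S.ell V hV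
  have c4 := (energy_le hΛ hell (fun x => G x - G' x)).2
  rw [c3, mul_zero] at c4
  have c5 : eLpNorm (fun x => G x - G' x) 2 (μ.restrict V) = 0 := by simpa using c4
  have hle : μ.restrict V ≤ μ.restrict E := Measure.restrict_mono hVE le_rfl
  rw [eLpNorm_eq_zero_iff (f := fun x => G x - G' x) ((h2.mono_measure hle).sub (h2'.mono_measure hle)) two_ne_zero] at c5
  filter_upwards [c5] with x hx using sub_eq_zero.1 hx

end GlobalSetup

end

/-! ### Smooth truncation, domain monotonicity, locality of L⁰ -/

section

theorem deriv_smoothTransition_of_neg {y : ℝ} (hy : y < 0) : deriv Real.smoothTransition y = 0 := by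
  have h : Real.smoothTransition =ᶠ[𝓝 y] fun _ => 0 := by
    filter_upwards [Iio_mem_nhds hy] with z hz using Real.smoothTransition.zero_of_nonpos (le_of_lt hz)
  rw [h.deriv_eq, deriv_const]

theorem deriv_smoothTransition_of_one_lt {y : ℝ} (hy : 1 < y) :
    deriv Real.smoothTransition y = 0 := by
  have h : Real.smoothTransition =ᶠ[𝓝 y] fun _ => 1 := by
    filter_upwards [Ioi_mem_nhds hy] with z hz using Real.smoothTransition.one_of_one_le (le_of_lt hz)
  rw [h.deriv_eq, deriv_const]

theorem deriv_smoothTransition_nonneg (y : ℝ) : 0 ≤ deriv Real.smoothTransition y :=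
  Real.smoothTransition.monotone.deriv_nonneg

/-- A smooth function which is the identity on `[0,∞)` and bounded below by `-δ`. -/
theorem exists_smooth_truncation {δ : ℝ} (hδ : 0 < δ) :
    ∃ θ : ℝ → ℝ, ContDiff ℝ ∞ θ ∧ (∀ s, -δ ≤ θ s) ∧ (∀ s, 0 ≤ s → θ s = s ∧ deriv θ s = 1) ∧
      ∃ C, ∀ s, |deriv θ s| ≤ C := by
  obtain ⟨C, hC⟩ := exists_deriv_smoothTransition_bound
  have hC0 : 0 ≤ C := (abs_nonneg _).trans (hC 0)
  set y : ℝ → ℝ := fun s => s / δ + 1 with hy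
  have hder : ∀ s, HasDerivAt (fun s => s * Real.smoothTransition (y s))
      (Real.smoothTransition (y s) + (s / δ) * deriv Real.smoothTransition (y s)) s := fun s => by
    have h1 : HasDerivAt y (1 / δ) s := ((hasDerivAt_id s).div_const δ).add_const 1
    have h2 : HasDerivAt Real.smoothTransition (deriv Real.smoothTransition (y s)) (y s) :=
      ((Real.smoothTransition.contDiff (n := 1)).differentiable (by simp) _).hasDerivAt
    refine ((hasDerivAt_id s).mul (h2.comp s h1)).congr_deriv ?_
    simp only [id_eq, Function.comp_apply]
    ring
  refine ⟨fun s => s * Real.smoothTransition (y s), ?_, fun s => ?_, fun s hs => ⟨?_, ?_⟩, 1 + C,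
    fun s => ?_⟩
  · exact contDiff_id.mul (Real.smoothTransition.contDiff.comp
      ((contDiff_id.div_const δ).add contDiff_const))
  · rcases le_total s (-δ) with h | h
    · have : y s ≤ 0 := by
        have : s / δ ≤ -1 := by rw [div_le_iff₀ hδ]; linarith
        simp only [hy]; linarith
      simp only [Real.smoothTransition.zero_of_nonpos this, mul_zero]; linarith
    · have h0 := Real.smoothTransition.nonneg (y s)
      have h1 := Real.smoothTransition.le_one (y s)
      nlinarith
  · have : 1 ≤ y s := by have := div_nonneg hs hδ.le; simp only [hy]; linarith
    simp only [Real.smoothTransition.one_of_one_le this, mul_one]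
  · rw [(hder s).deriv]
    rcases hs.eq_or_lt with rfl | hs
    · simp [hy]
    · have : 1 < y s := by have := div_pos hs hδ; simp only [hy]; linarith
      rw [Real.smoothTransition.one_of_one_le this.le, deriv_smoothTransition_of_one_lt this]; simp
  · rw [(hder s).deriv]
    have h0 := Real.smoothTransition.nonneg (y s)
    have h1 := Real.smoothTransition.le_one (y s)
    refine (abs_add_le _ _).trans (add_le_add (by rwa [abs_of_nonneg h0]) ?_)
    rw [abs_mul]
    rcases le_or_gt |s / δ| 1 with h | h
    · exact (mul_le_mul h (hC _) (abs_nonneg _) zero_le_one).trans (by rw [one_mul])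
    · have : deriv Real.smoothTransition (y s) = 0 := by
        rcases lt_abs.1 h with h | h
        · exact deriv_smoothTransition_of_one_lt (by simp only [hy]; linarith)
        · exact deriv_smoothTransition_of_neg (by simp only [hy]; linarith)
      rw [this]; simpa using hC0

namespace GlobalSetup

variable {d : ℕ} {E V V' : Set (Eucl d)} {A : Eucl d → Matrix (Fin d) (Fin d) ℝ}
  {B : Eucl d → Eucl d} {μ : Measure (Eucl d)} {f u u' v w : Eucl d → ℝ} {G G' H : Eucl d → Eucl d}
  {α : ℝ}

/-- Functions of `u - u'` for `u` in the domain of the form on `V` and `u' ≥ 0` in the domain of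
the form on a larger set. -/
theorem hGrad_sub_larger (S : GlobalSetup E A B μ) (hV : IsRelCompactOpen E V) (hVV' : V ⊆ V')
    (h : HGrad (μ.restrict V) {f | IsTest E V f} u G)
    (h' : HGrad (μ.restrict V') {f | IsTest E V' f} u' G')
    (hu' : ∀ᵐ x ∂(μ.restrict V), 0 ≤ u' x) {δ : ℝ} (hδ : 0 < δ) {ψ : ℝ → ℝ}
    (hψ : ContDiff ℝ ∞ ψ) (h0 : ∀ s ≤ 0, ψ s = 0) {C : ℝ} (hC : ∀ s, |deriv ψ s| ≤ C) :
    HGrad (μ.restrict V) {f | IsTest E V f} (fun x => ψ (u x - u' x - δ))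
      (fun x => deriv ψ (u x - u' x - δ) • (G x - G' x)) := by
  obtain ⟨θ, hθ, hθδ, hθ1, C', hC'⟩ := exists_smooth_truncation hδ
  obtain ⟨f, hf, hfa⟩ := h
  obtain ⟨g, hg, hga⟩ := h'
  have := S.finite_restrict hV
  have hga := hga.mono (Measure.restrict_mono hVV' le_rfl : μ.restrict V ≤ μ.restrict V')
  set F : ℝ × ℝ → ℝ := fun p => ψ (p.1 - θ p.2 - δ) with hF
  have hFs : ContDiff ℝ ∞ F :=
    hψ.comp ((contDiff_fst.sub (hθ.comp contDiff_snd)).sub contDiff_const)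
  have hC0 : 0 ≤ C := (abs_nonneg _).trans (hC 0)
  have hC0' : 0 ≤ C' := (abs_nonneg _).trans (hC' 0)
  have hder : ∀ p, HasFDerivAt F (deriv ψ (p.1 - θ p.2 - δ) •
      (ContinuousLinearMap.fst ℝ ℝ ℝ - deriv θ p.2 • ContinuousLinearMap.snd ℝ ℝ ℝ)) p := fun p => by
    have d1 : HasDerivAt ψ (deriv ψ (p.1 - θ p.2 - δ)) (p.1 - θ p.2 - δ) :=
      (hψ.differentiable (by simp) _).hasDerivAt
    have d2 : HasDerivAt θ (deriv θ p.2) p.2 := (hθ.differentiable (by simp) _).hasDerivAt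
    have d3 : HasFDerivAt (fun q : ℝ × ℝ => θ q.2) (deriv θ p.2 • ContinuousLinearMap.snd ℝ ℝ ℝ) p :=
      d2.comp_hasFDerivAt p hasFDerivAt_snd
    exact d1.comp_hasFDerivAt p ((hasFDerivAt_fst.sub d3).sub_const δ)
  have hbd : ∀ p, ‖fderiv ℝ F p‖ ≤ C * (1 + C') := fun p => by
    rw [(hder p).fderiv, norm_smul]
    refine mul_le_mul (hC _) ?_ (norm_nonneg _) hC0
    refine (norm_sub_le _ _).trans (add_le_add (ContinuousLinearMap.norm_fst_le ..) ?_)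
    rw [norm_smul]
    calc _ ≤ C' * 1 := mul_le_mul (hC' _) (ContinuousLinearMap.norm_snd_le ..) (norm_nonneg _) hC0'
      _ = C' := mul_one _
  refine HGrad.congr ⟨_, fun n => ?_, hfa.comp_pair hga hFs hbd⟩ ?_ ?_
  -- Where `f n` vanishes the argument of `ψ` is `-θ(g n) - δ ≤ 0`, because `θ ≥ -δ`. The composite
  -- is thus a test function on `V` although `g n` only is one on the larger set; since `u' ≥ 0`,
  -- the truncation `θ` disappears in the limit.
  · exact (hf n).comp_pair (hg n).1 hFs fun t => h0 _ (by linarith [hθδ t])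
  · filter_upwards [hu'] with x hx
    simp only [hF, (hθ1 _ hx).1]
  · filter_upwards [hu'] with x hx
    rw [(hder _).fderiv]
    simp [(hθ1 _ hx).1, (hθ1 _ hx).2, sub_eq_add_neg]

/-- Domain monotonicity of weak solutions. -/
theorem weakSol_mono (S : GlobalSetup E A B μ) (hV : IsRelCompactOpen E V)
    (hV' : IsRelCompactOpen E V') (hVV' : V ⊆ V') (hα : 0 < α)
    (h : WeakSol A B (μ.restrict V) {f | IsTest E V f} α f u G)
    (h' : WeakSol A B (μ.restrict V') {f | IsTest E V' f} α f u' G')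
    (hf : ∀ᵐ x ∂(μ.restrict V'), 0 ≤ f x) : ∀ᵐ x ∂(μ.restrict V), u x ≤ u' x := by
  have SV := S.localSetup hV
  have SV' := S.localSetup hV'
  have hVm := S.measurableSet hV
  have hr : (μ.restrict V').restrict V = μ.restrict V := Measure.restrict_restrict_of_subset hVV'
  have hle : μ.restrict V ≤ μ.restrict V' := Measure.restrict_mono hVV' le_rfl
  have hu' : ∀ᵐ x ∂(μ.restrict V), 0 ≤ u' x :=
    (Measure.absolutelyContinuous_of_le hle).ae_le (h'.nonneg_of_nonneg SV' hα hf)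
  have key : ∀ δ : ℝ, 0 < δ → ∀ᵐ x ∂(μ.restrict V), u x - u' x ≤ δ := by
    intro δ hδ
    obtain ⟨C, hC⟩ := exists_deriv_smoothTransition_bound
    obtain ⟨Ψ, hΨ, hΨ0, hΨd⟩ := exists_smooth_antideriv Real.smoothTransition.contDiff
    have hΨz : ∀ s ≤ 0, Ψ s = 0 := by
      intro s hs
      have : ∀ x ∈ Set.Icc s 0, Ψ x = Ψ s := by
        refine constant_of_has_deriv_right_zero (hΨ.continuous.continuousOn) fun x hx => ?_
        have := (hΨd x).hasDerivWithinAt (s := Set.Ici x)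
        rwa [Real.smoothTransition.zero_of_nonpos hx.2.le] at this
      rw [← this 0 ⟨hs, le_rfl⟩, hΨ0]
    -- A smooth substitute for the indicator of `u > u' + δ`. It vanishes for `u ≤ δ`, which keeps
    -- it in the form domain of the smaller set, and after extension by zero it tests the equation
    -- on the larger one as well.
    set v : Eucl d → ℝ := fun x => Real.smoothTransition (u x - u' x - δ) with hv
    set H : Eucl d → Eucl d := fun x => deriv Real.smoothTransition (u x - u' x - δ) • (G x - G' x)
      with hH
    have hvH : HGrad (μ.restrict V) {f | IsTest E V f} v H :=
      S.hGrad_sub_larger hV hVV' h.1 h'.1 hu' hδ Real.smoothTransition.contDiff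
        (fun s hs => Real.smoothTransition.zero_of_nonpos hs) hC
    have hΨH := S.hGrad_sub_larger hV hVV' h.1 h'.1 hu' hδ hΨ hΨz (C := 1) (fun s => by
      rw [(hΨd s).deriv, abs_of_nonneg (Real.smoothTransition.nonneg s)]
      exact Real.smoothTransition.le_one s)
    have hB := SV.integral_inner_B hΨH
    have hv1 : ∀ x, |v x| ≤ 1 := fun x => by
      rw [abs_of_nonneg (Real.smoothTransition.nonneg _)]; exact Real.smoothTransition.le_one _
    have e1 := h.2.2 v H hvH ⟨1, Eventually.of_forall hv1⟩
    have e2 := h'.2.2 _ _ (S.hGrad_extend hVm hVV' hvH) ⟨1, Eventually.of_forall fun x => by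
      by_cases hx : x ∈ V
      · simpa [hx] using hv1 x
      · simp [hx]⟩
    have ind : ∀ a b : Eucl d → ℝ, (∀ x, b x = V.indicator a x) →
        ∫ x in V', b x ∂μ = ∫ x in V, a x ∂μ := fun a b hab => by
      rw [show b = V.indicator a from funext hab, integral_indicator hVm, hr]
    rw [ind (fun x => u' x * v x) _ (fun x => by by_cases hx : x ∈ V <;> simp [hx]),
      ind (fun x => aForm A x (G' x) (H x)) _
        (fun x => by by_cases hx : x ∈ V <;> simp [hx, aForm]),
      ind (fun x => inner ℝ (B x) (G' x) * v x) _ (fun x => by by_cases hx : x ∈ V <;> simp [hx]),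
      ind (fun x => f x * v x) _ (fun x => by by_cases hx : x ∈ V <;> simp [hx])] at e2
    have mG := h.memLp_grad
    have mG' := h'.memLp_grad.mono_measure hle
    have mu' := h'.memLp.mono_measure hle
    have mv := hvH.memLp
    have iu : Integrable (fun x => u x * v x) (μ.restrict V) := integrable_mul_of_memLp h.memLp mv
    have iu' : Integrable (fun x => u' x * v x) (μ.restrict V) := integrable_mul_of_memLp mu' mv
    have ia := SV.integrable_aForm mG hvH.memLp_grad
    have ia' := SV.integrable_aForm mG' hvH.memLp_grad
    have ib := integrable_mul_of_bdd (SV.integrable_inner_B mG) mv.1 (Eventually.of_forall hv1)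
    have ib' := integrable_mul_of_bdd (SV.integrable_inner_B mG') mv.1 (Eventually.of_forall hv1)
    have e3 : ∫ x in V, aForm A x (G x) (H x) ∂μ - ∫ x in V, aForm A x (G' x) (H x) ∂μ =
        ∫ x in V, aForm A x (G x - G' x) (H x) ∂μ := by
      rw [← integral_sub ia ia']; simp_rw [aForm_sub_left]
    have e4 : ∫ x in V, inner ℝ (B x) (G x) * v x ∂μ - ∫ x in V, inner ℝ (B x) (G' x) * v x ∂μ = 0 := by
      rw [← integral_sub ib ib', ← hB]
      refine integral_congr_ae (Eventually.of_forall fun x => ?_)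
      simp only [(hΨd _).deriv, inner_smul_right, inner_sub_right, hv]
      ring
    have e5 : 0 ≤ ∫ x in V, aForm A x (G x - G' x) (H x) ∂μ := by
      refine integral_nonneg_of_ae ?_
      filter_upwards [SV.aForm_nonneg] with x hx
      simp only [hH, aForm_smul_right, Pi.zero_apply]
      exact mul_nonneg (deriv_smoothTransition_nonneg _) (hx _)
    have e6 : α * ∫ x in V, (u x - u' x) * v x ∂μ ≤ 0 := by
      have : ∫ x in V, (u x - u' x) * v x ∂μ =
          ∫ x in V, u x * v x ∂μ - ∫ x in V, u' x * v x ∂μ := by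
        rw [← integral_sub iu iu']; simp_rw [sub_mul]
      rw [this]; linarith
    have nn : ∀ x, 0 ≤ (u x - u' x) * v x := fun x => by
      rcases le_total (u x - u' x - δ) 0 with hx | hx
      · simp [hv, Real.smoothTransition.zero_of_nonpos hx]
      · exact mul_nonneg (by linarith) (Real.smoothTransition.nonneg _)
    have e7 : ∫ x in V, (u x - u' x) * v x ∂μ = 0 :=
      le_antisymm (by nlinarith) (integral_nonneg nn)
    have iuu : Integrable (fun x => (u x - u' x) * v x) (μ.restrict V) :=
      (iu.sub iu').congr (Eventually.of_forall fun x => by simp [sub_mul])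
    rw [integral_eq_zero_iff_of_nonneg nn iuu] at e7
    filter_upwards [e7] with x hx
    by_contra! hlt
    have h1 : 0 < v x := Real.smoothTransition.pos_of_pos (by linarith)
    have h2 : 0 < (u x - u' x) * v x := mul_pos (by linarith) h1
    exact h2.ne' hx
  have h1 : ∀ᵐ x ∂(μ.restrict V), ∀ n : ℕ, u x - u' x ≤ 1 / ((n : ℝ) + 1) :=
    ae_all_iff.2 fun n => key _ (by positivity)
  filter_upwards [h1] with x hx
  have := ge_of_tendsto' tendsto_one_div_add_atTop_nhds_zero_nat hx
  linarith

/-- A compactly supported function in the domain of `L⁰` belongs to the domain of the local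
operators. -/
theorem exists_formOp (S : GlobalSetup E A B μ) {V₀ V₁ K K₁ : Set (Eucl d)}
    (hV₀ : IsRelCompactOpen E V₀) (hK : IsCompact K) (hKV₀ : K ⊆ V₀) (hK₁ : IsCompact K₁)
    (hV₀K₁ : V₀ ⊆ K₁) (hK₁V₁ : K₁ ⊆ V₁) (hF : IsFormOperator E A μ E u G w)
    (hu : ∀ᵐ x ∂(μ.restrict (E \ K)), u x = 0) :
    ∃ G' : Eucl d → Eucl d, (∀ x, x ∉ V₀ → G' x = 0) ∧ ∀ V, IsRelCompactOpen E V → V₁ ⊆ V →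
      FormOp A (μ.restrict V) {f | IsTest E V f} u G' (K₁.indicator w) := by
  have hV₀E := subset hV₀
  have hV₀m := S.measurableSet hV₀
  obtain ⟨f, hf, hfa⟩ := S.exists_gradApprox hV₀ hV₀E hF.1
  obtain ⟨χ, hχ, hχc, hχ1, hχK, hχt⟩ := hV₀.exists_cutoff hK hKV₀
  obtain ⟨C, hC⟩ := exists_gradient_bound hχ hχc
  have hfχ := hfa.smooth_mul hχ (C := max 1 C)
    (fun x => by rw [abs_of_nonneg (hχ1 x).1]; exact (hχ1 x).2.trans (le_max_left _ _))
    (fun x => (hC x).trans (le_max_right _ _))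
  have hu0 : ∀ᵐ x ∂μ, x ∉ K → u x = 0 := by
    rw [ae_restrict_iff' (S.measE.diff hK.measurableSet)] at hu
    filter_upwards [hu, S.ae_mem] with x h1 h2 h3 using h1 ⟨h2, h3⟩
  -- The gradient of `χu`, a function equal to `u`. Its extension by zero is a version of `∇u`
  -- supported in `V₀`, by uniqueness of the gradient.
  set G₁ : Eucl d → Eucl d := fun x => χ x • G x + u x • gradient χ x
  have h₀ : HGrad (μ.restrict V₀) {f | IsTest E V₀ f} u G₁ := by
    refine HGrad.congr ⟨_, fun n => hχt _ (hf n).1, hfχ⟩ ?_ EventuallyEq.rfl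
    filter_upwards [ae_restrict_of_ae hu0] with x hx
    by_cases hxK : x ∈ K
    · simp [(hχK x hxK).1]
    · simp [hx hxK]
  have hue : V₀.indicator u =ᵐ[μ] u := by
    filter_upwards [hu0] with x hx
    by_cases hx0 : x ∈ V₀
    · simp [hx0]
    · simp [hx0, hx fun h => hx0 (hKV₀ h)]
  have hE := S.hasFormGradient_extend hV₀ ((S.hasFormGradient_iff hV₀).2 h₀)
  refine ⟨V₀.indicator G₁, fun x hx => by simp [hx], fun V hV hV₁V => ?_⟩
  have hVm := S.measurableSet hV
  have hVE := subset hV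
  have hV₀V : V₀ ⊆ V := hV₀K₁.trans (hK₁V₁.trans hV₁V)
  have hr : (μ.restrict E).restrict V = μ.restrict V := Measure.restrict_restrict_of_subset hVE
  have SV := S.localSetup hV
  have := S.finite_restrict hV
  have hGG : G =ᵐ[μ.restrict V] V₀.indicator G₁ :=
    S.gradient_unique hF.1 hE (ae_restrict_of_ae hue.symm) hV
  have hg : HGrad (μ.restrict V) {f | IsTest E V f} u (V₀.indicator G₁) :=
    (S.hGrad_extend hV₀m hV₀V h₀).congr (ae_restrict_of_ae hue) EventuallyEq.rfl
  have hw : MemLp w 2 (μ.restrict V) :=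
    hF.2.1.mono_measure (Measure.restrict_mono hVE le_rfl)
  have heq : ∀ v H, HGrad (μ.restrict V) {f | IsTest E V f} v H →
      ∫ x in V, aForm A x (V₀.indicator G₁ x) (H x) ∂μ = -∫ x in V, w x * v x ∂μ := by
    intro v H hv
    have h1 := hF.2.2 _ _ (S.hasFormGradient_extend hV ((S.hasFormGradient_iff hV).2 hv))
    have ind : ∀ a b : Eucl d → ℝ, (∀ x, b x = V.indicator a x) →
        ∫ x in E, b x ∂μ = ∫ x in V, a x ∂μ := fun a b hab => by
      rw [show b = V.indicator a from funext hab, integral_indicator hVm, hr]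
    rw [ind (fun x => aForm A x (G x) (H x)) _
        (fun x => by by_cases hx : x ∈ V <;> simp [hx, aForm]),
      ind (fun x => w x * v x) _ (fun x => by by_cases hx : x ∈ V <;> simp [hx])] at h1
    rw [← h1]
    refine integral_congr_ae ?_
    filter_upwards [hGG] with x hx
    rw [hx]
  -- Locality of the form: test functions supported off `K₁` see no gradient, so `w` vanishes there.
  -- One and the same pair then represents `∇u` and `L⁰u` on every larger `V`.
  have hw0 : ∀ᵐ x ∂(μ.restrict V), w x = K₁.indicator w x := by
    obtain ⟨⟨U, hU, hVU⟩, Kc, hKc, hVKc, hKcE⟩ := hV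
    have h1 : ∀ᵐ x ∂(μ.restrict V), x ∈ U \ K₁ → w x = 0 := by
      refine (hU.sdiff hK₁.isClosed).ae_eq_zero_of_integral_contDiff_smul_eq_zero
        ((hw.integrable (by norm_num)).locallyIntegrable.locallyIntegrableOn _) ?_
      intro g hgs hgc hgU
      have hgt : IsTest E V g := by
        refine ⟨hgs, hgc, tsupport g ∩ Kc, hgc.isCompact.inter hKc, ?_, ?_⟩
        · rintro x ⟨hx1, hx2⟩
          rw [hVU]; exact ⟨hKcE hx2, (hgU hx1).1⟩
        · rintro x ⟨hx1, hx2⟩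
          by_contra hne
          have hx3 : x ∈ tsupport g := subset_tsupport _ hne
          exact hx2 ⟨hx3, hVKc (by rw [hVU]; exact ⟨hx1, (hgU hx3).1⟩)⟩
      have h2 := heq g (gradient g) (SV.hGrad_test hgt)
      have h3 : ∫ x in V, aForm A x (V₀.indicator G₁ x) (gradient g x) ∂μ = 0 := by
        refine integral_eq_zero_of_ae (Eventually.of_forall fun x => ?_)
        by_cases hx : x ∈ V₀
        · have h4 : g =ᶠ[𝓝 x] fun _ => 0 := notMem_tsupport_iff_eventuallyEq.1
            fun h => (hgU h).2 (hV₀K₁ hx)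
          simp [h4.gradient_eq, gradient_fun_const, aForm]
        · simp [hx, aForm]
      rw [h3] at h2
      simp_rw [smul_eq_mul]
      simp_rw [mul_comm (g _)]
      linarith
    filter_upwards [h1, ae_restrict_mem hVm] with x hx hxV
    by_cases hxK : x ∈ K₁
    · simp [hxK]
    · simp [hxK, hx ⟨(hVU ▸ hxV : x ∈ E ∩ U).2, hxK⟩]
  refine ⟨hg, hw.ae_eq hw0, fun v H hv => ?_⟩
  rw [heq v H hv]
  congr 1
  refine integral_congr_ae ?_
  filter_upwards [hw0] with x hx
  rw [← hx]

end GlobalSetup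

end

/-! ### Exponentials of bounded operators -/

section

section Exponential

variable {X : Type*} [NormedAddCommGroup X] [NormedSpace ℝ X] [CompleteSpace X]

theorem exp_add_of_commute_clm {Y Z : X →L[ℝ] X} (h : Commute Y Z) :
    NormedSpace.exp (Y + Z) = NormedSpace.exp Y * NormedSpace.exp Z := by
  let _ := NormedAlgebra.restrictScalars ℚ ℝ (X →L[ℝ] X)
  exact NormedSpace.exp_add_of_commute h

/-- Closed convex sets which are invariant under `P` are invariant under `exp (s (P - 1))`. -/
theorem exp_smul_sub_one_mem {K : Set X} (hK : IsClosed K) (hKc : Convex ℝ K) {P : X →L[ℝ] X}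
    (hP : ∀ f ∈ K, P f ∈ K) {s : ℝ} (hs : 0 ≤ s) {f : X} (hf : f ∈ K) :
    NormedSpace.exp (s • (P - 1)) f ∈ K := by
  have hPk : ∀ k : ℕ, (P ^ k) f ∈ K := fun k => by
    induction k with
    | zero => simpa
    | succ k ih => rw [pow_succ']; exact hP _ ih
  have e1 : NormedSpace.exp (s • (P - 1)) = Real.exp (-s) • NormedSpace.exp (s • P) := by
    have : s • (P - 1) = algebraMap ℝ (X →L[ℝ] X) (-s) + s • P := by
      rw [Algebra.algebraMap_eq_smul_one, smul_sub, neg_smul]; abel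
    rw [this, exp_add_of_commute_clm (Algebra.commute_algebraMap_left _ _),
      ← NormedSpace.algebraMap_exp_comm, ← Real.exp_eq_exp_ℝ, Algebra.algebraMap_eq_smul_one,
      smul_mul_assoc, one_mul]
  have h1 : HasSum (fun k : ℕ => ((k.factorial : ℝ)⁻¹ * s ^ k) • (P ^ k) f)
      (NormedSpace.exp (s • P) f) := by
    have := (NormedSpace.exp_series_hasSum_exp' (𝕂 := ℝ) (s • P)).mapL
      (ContinuousLinearMap.apply ℝ X f)
    simpa [smul_pow, smul_smul] using this
  have h2 : HasSum (fun k : ℕ => (k.factorial : ℝ)⁻¹ * s ^ k) (Real.exp s) := by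
    have := NormedSpace.exp_series_hasSum_exp' (𝕂 := ℝ) s
    rw [← Real.exp_eq_exp_ℝ] at this
    simpa using this
  have t1 := h1.tendsto_sum_nat
  have t2 := h2.tendsto_sum_nat
  -- The operator is `e^{-s} ∑ s^k/k! P^k`, a Poisson average of powers of `P`. Partial sums
  -- normalised by the partial sums of `e^s` are genuine convex combinations, hence stay in `K`.
  have t3 := ((t2.inv₀ (Real.exp_pos s).ne').smul t1)
  rw [e1, Real.exp_neg]
  refine hK.mem_of_tendsto t3 ?_
  filter_upwards [eventually_gt_atTop 0] with n hn
  have hpos : 0 < ∑ k ∈ Finset.range n, (k.factorial : ℝ)⁻¹ * s ^ k := by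
    refine lt_of_lt_of_le (by simp : (0 : ℝ) < ((0 : ℕ).factorial : ℝ)⁻¹ * s ^ 0)
      (Finset.single_le_sum (f := fun k : ℕ => (k.factorial : ℝ)⁻¹ * s ^ k)
        (fun k _ => by positivity) (Finset.mem_range.2 hn))
  rw [Finset.smul_sum]
  simp_rw [smul_smul]
  refine hKc.sum_mem (fun k _ => by positivity) ?_ (fun k _ => hPk k)
  rw [← Finset.mul_sum]
  exact inv_mul_cancel₀ hpos.ne'

/-- Duhamel's argument: the path `s ↦ e^{sY} e^{(t-s)Z} f` joins the two vectors, and its derivative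
is a product of two contractions applied to `(Y - Z) f`. Because `Y` and `Z` commute, the path can
be written with the single exponential of `s(Y - Z)`. -/
theorem norm_exp_smul_sub_le {Y Z : X →L[ℝ] X} (hYZ : Commute Y Z)
    (hY : ∀ t : ℝ, 0 ≤ t → ∀ f, ‖NormedSpace.exp (t • Y) f‖ ≤ ‖f‖)
    (hZ : ∀ t : ℝ, 0 ≤ t → ∀ f, ‖NormedSpace.exp (t • Z) f‖ ≤ ‖f‖) {t : ℝ} (ht : 0 ≤ t) (f : X) :
    ‖NormedSpace.exp (t • Y) f - NormedSpace.exp (t • Z) f‖ ≤ ‖Y f - Z f‖ * t := by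
  have hD : Commute Z (Y - Z) := hYZ.symm.sub_right (Commute.refl Z)
  set φ : ℝ → X := fun s => NormedSpace.exp (t • Z) (NormedSpace.exp (s • (Y - Z)) f) with hφ
  have hder : ∀ s, HasDerivAt φ
      (NormedSpace.exp (t • Z) (NormedSpace.exp (s • (Y - Z)) ((Y - Z) f))) s := fun s => by
    have h1 := hasDerivAt_exp_smul_const (𝕂 := ℝ) (Y - Z) s
    have h2 := h1.clm_apply (hasDerivAt_const s f)
    have h3 := (NormedSpace.exp (t • Z)).hasFDerivAt.comp_hasDerivAt s h2
    simpa [hφ, Function.comp_def] using h3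
  have hbd : ∀ s ∈ Set.Ico 0 t, ‖NormedSpace.exp (t • Z) (NormedSpace.exp (s • (Y - Z))
      ((Y - Z) f))‖ ≤ ‖Y f - Z f‖ := fun s hs => by
    have e : NormedSpace.exp (t • Z) * NormedSpace.exp (s • (Y - Z)) =
        NormedSpace.exp (s • Y) * NormedSpace.exp ((t - s) • Z) := by
      rw [← exp_add_of_commute_clm ((hD.smul_left _).smul_right _),
        ← exp_add_of_commute_clm ((hYZ.smul_left _).smul_right _)]
      congr 1
      rw [smul_sub, sub_smul]; abel
    rw [← mul_apply_eq_comp, e, mul_apply_eq_comp]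
    exact (hY s hs.1 _).trans (hZ _ (by linarith [hs.2]) _)
  have h := norm_image_sub_le_of_norm_deriv_le_segment' (fun s _ => (hder s).hasDerivWithinAt) hbd
    t ⟨ht, le_rfl⟩
  have e1 : φ t = NormedSpace.exp (t • Y) f := by
    rw [hφ]
    simp only
    rw [← mul_apply_eq_comp,
      ← exp_add_of_commute_clm ((hD.smul_left _).smul_right _)]
    congr 2
    rw [smul_sub]; abel
  have e0 : φ 0 = NormedSpace.exp (t • Z) f := by simp [hφ]
  rwa [e1, e0, sub_zero] at h

/-- The vector `h` is a substitute for `Yf` on which `Y` stays bounded along the Yosida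
approximations. The bound survives the limit and gives differentiability at `0` without second
powers of the generator acting on `f`. -/
theorem norm_exp_smul_taylor_le {Y : X →L[ℝ] X}
    (hY : ∀ t : ℝ, 0 ≤ t → ∀ f, ‖NormedSpace.exp (t • Y) f‖ ≤ ‖f‖) {t : ℝ} (ht : 0 ≤ t)
    (f h : X) :
    ‖NormedSpace.exp (t • Y) f - f - t • Y f‖ ≤ (2 * ‖Y f - h‖ + t * ‖Y h‖) * t := by
  have h0 : ∀ s : ℝ, 0 ≤ s → ∀ g, ‖NormedSpace.exp (s • Y) g - g‖ ≤ ‖Y g‖ * s := fun s hs g => by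
    have := norm_exp_smul_sub_le (Commute.zero_right Y) hY (fun t _ f => by simp) hs g
    simpa using this
  have hder : ∀ s, HasDerivAt (fun s : ℝ => NormedSpace.exp (s • Y) f - s • Y f)
      (NormedSpace.exp (s • Y) (Y f) - Y f) s := fun s => by
    have h1 := hasDerivAt_exp_smul_const (𝕂 := ℝ) Y s
    have h2 := h1.clm_apply (hasDerivAt_const s f)
    have h3 := h2.fun_sub ((hasDerivAt_id s).smul_const (Y f))
    simpa using h3
  have hbd : ∀ s ∈ Set.Ico 0 t, ‖NormedSpace.exp (s • Y) (Y f) - Y f‖ ≤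
      2 * ‖Y f - h‖ + t * ‖Y h‖ := fun s hs => by
    have e : NormedSpace.exp (s • Y) (Y f) - Y f =
        NormedSpace.exp (s • Y) (Y f - h) + (NormedSpace.exp (s • Y) h - h) - (Y f - h) := by
      rw [map_sub]; abel
    rw [e]
    refine (norm_sub_le _ _).trans ?_
    have := norm_add_le (NormedSpace.exp (s • Y) (Y f - h)) (NormedSpace.exp (s • Y) h - h)
    have h1 := hY s hs.1 (Y f - h)
    have h2 := h0 s hs.1 h
    have h3 : ‖Y h‖ * s ≤ t * ‖Y h‖ := by
      rw [mul_comm]; exact mul_le_mul_of_nonneg_right hs.2.le (norm_nonneg _)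
    linarith
  have h := norm_image_sub_le_of_norm_deriv_le_segment' (fun s _ => (hder s).hasDerivWithinAt) hbd
    t ⟨ht, le_rfl⟩
  simp only [zero_smul, NormedSpace.exp_zero, sub_zero, one_apply_eq_self] at h
  convert h using 2
  abel

end Exponential

/-! ### The Hille–Yosida theorem -/

section HilleYosida

variable {X : Type*} [NormedAddCommGroup X] [NormedSpace ℝ X]

/-- Strongly continuous contraction resolvents. -/
structure StrongResolvent (R : ℝ → X →L[ℝ] X) : Prop where
  contraction : ∀ α, 0 < α → ∀ f, ‖α • R α f‖ ≤ ‖f‖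
  resolvent : ∀ α β, 0 < α → 0 < β → ∀ f, R α f - R β f = (β - α) • R α (R β f)
  strong : ∀ f, Tendsto (fun n : ℕ => ((n : ℝ) + 1) • R ((n : ℝ) + 1) f) atTop (𝓝 f)

namespace StrongResolvent

variable {R : ℝ → X →L[ℝ] X}

theorem commute (h : StrongResolvent R) {α β : ℝ} (hα : 0 < α) (hβ : 0 < β) :
    Commute (R α) (R β) := by
  rcases eq_or_ne α β with rfl | hne
  · exact Commute.refl _
  · ext f
    have h1 := h.resolvent α β hα hβ f
    have h2 := h.resolvent β α hβ hα f
    have h3 : (β - α) • (R α (R β f) - R β (R α f)) = 0 := by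
      rw [smul_sub, ← h1, ← neg_sub α β, neg_smul, ← h2]; abel
    rw [smul_eq_zero] at h3
    rcases h3 with h3 | h3
    · exact absurd (sub_eq_zero.1 h3).symm hne
    · exact sub_eq_zero.1 h3

variable (R) in
/-- The Yosida approximations of the generator. -/
def yosida (n : ℕ) : X →L[ℝ] X := ((n : ℝ) + 1) • (((n : ℝ) + 1) • R ((n : ℝ) + 1) - 1)

theorem exists_range_close (h : StrongResolvent R) (f : X) {ε : ℝ} (hε : 0 < ε) :
    ∃ α, 0 < α ∧ ∃ g, ‖f - R α g‖ < ε := by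
  have := (h.strong f).eventually (Metric.ball_mem_nhds f hε)
  obtain ⟨n, hn⟩ := this.exists
  refine ⟨(n : ℝ) + 1, by positivity, ((n : ℝ) + 1) • f, ?_⟩
  rw [map_smul, ← dist_eq_norm, dist_comm]
  exact hn

theorem commute_yosida (h : StrongResolvent R) (n m : ℕ) : Commute (yosida R n) (yosida R m) := by
  have hn : (0 : ℝ) < (n : ℝ) + 1 := by positivity
  have hm : (0 : ℝ) < (m : ℝ) + 1 := by positivity
  have h1 := (((h.commute hn hm).smul_left ((n : ℝ) + 1)).smul_right ((m : ℝ) + 1))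
  exact (((h1.sub_left (Commute.one_left _)).sub_right (Commute.one_right _)).smul_left _).smul_right _

/-- By the resolvent identity a Yosida approximation at `R_β f` is `a R_a` applied to the fixed
vector `βR_β f - f`, so strong continuity of the resolvent applies. -/
theorem tendsto_yosida (h : StrongResolvent R) {β : ℝ} (hβ : 0 < β) (f : X) :
    Tendsto (fun n => yosida R n (R β f)) atTop (𝓝 (β • R β f - f)) := by
  refine (h.strong (β • R β f - f)).congr fun n => ?_
  set a : ℝ := (n : ℝ) + 1 with ha
  have hapos : 0 < a := by positivity
  have h1 := h.resolvent a β hapos hβ f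
  have h2 : a • R a (R β f) - R β f = R a (β • R β f - f) := by
    rw [map_sub, map_smul]
    have h3 : R a f = R β f + (β - a) • R a (R β f) := by rw [← h1]; abel
    rw [h3, sub_smul]; abel
  simp only [yosida, smul_apply, sub_apply,
    one_apply_eq_self]
  rw [← ha, h2]

variable [CompleteSpace X]

theorem exp_yosida_mem (n : ℕ) {K : Set X} (hK : IsClosed K) (hKc : Convex ℝ K)
    (hR : ∀ α, 0 < α → ∀ f ∈ K, α • R α f ∈ K) {t : ℝ} (ht : 0 ≤ t) {f : X} (hf : f ∈ K) :
    NormedSpace.exp (t • yosida R n) f ∈ K := by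
  rw [yosida, smul_smul]
  exact exp_smul_sub_one_mem hK hKc (fun g hg => hR _ (by positivity) g hg) (by positivity) hf

theorem norm_exp_yosida_le (h : StrongResolvent R) (n : ℕ) (t : ℝ) (ht : 0 ≤ t) (f : X) :
    ‖NormedSpace.exp (t • yosida R n) f‖ ≤ ‖f‖ := by
  have := exp_yosida_mem n (Metric.isClosed_closedBall (x := (0 : X)) (ε := ‖f‖))
    (convex_closedBall _ _) (R := R) (fun α hα g hg => by
      rw [mem_closedBall_zero_iff] at hg ⊢
      exact (h.contraction α hα g).trans hg) ht (f := f) (by simp)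
  simpa using this

/-- The Hille–Yosida theorem. -/
theorem exists_semigroup (h : StrongResolvent R) :
    ∃ T : ℝ≥0 → X →L[ℝ] X, T 0 = ContinuousLinearMap.id ℝ X ∧
      (∀ s t, T (s + t) = (T s).comp (T t)) ∧ (∀ t, ‖T t‖ ≤ 1) ∧
      (∀ f, Tendsto (fun t => T t f) (𝓝[>] 0) (𝓝 f)) ∧
      (∀ K : Set X, IsClosed K → Convex ℝ K → (∀ α, 0 < α → ∀ f ∈ K, α • R α f ∈ K) →
        ∀ t, ∀ f ∈ K, T t f ∈ K) ∧
      ∀ α, 0 < α → ∀ f, Tendsto (fun t : ℝ≥0 => (t : ℝ)⁻¹ • (T t (R α f) - R α f)) (𝓝[>] 0)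
        (𝓝 (α • R α f - f)) := by
  set S : ℝ≥0 → ℕ → X →L[ℝ] X := fun t n => NormedSpace.exp ((t : ℝ) • yosida R n) with hS
  have hS1 : ∀ t n f, ‖S t n f‖ ≤ ‖f‖ := fun t n f => h.norm_exp_yosida_le n t t.2 f
  have hcauchy : ∀ t f, CauchySeq fun n => S t n f := by
    intro t f
    rw [Metric.cauchySeq_iff']
    intro ε hε
    -- On the range of the resolvent the Yosida approximations converge, so there the exponentials
    -- are Cauchy; the contraction property extends this to all `f`.
    obtain ⟨α, hα, g, hg⟩ := h.exists_range_close f (ε := ε / 4) (by positivity)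
    have hc := (h.tendsto_yosida hα g).cauchySeq
    rw [Metric.cauchySeq_iff'] at hc
    obtain ⟨N, hN⟩ := hc (ε / 4 / ((t : ℝ) + 1)) (by positivity)
    refine ⟨N, fun n hn => ?_⟩
    have h1 := norm_exp_smul_sub_le (h.commute_yosida n N) (h.norm_exp_yosida_le n)
      (h.norm_exp_yosida_le N) t.2 (R α g)
    have h2 := (hN n hn).le
    rw [dist_eq_norm] at h2 ⊢
    have h3 : ‖yosida R n (R α g) - yosida R N (R α g)‖ * t ≤ ε / 4 := by
      calc _ ≤ ε / 4 / ((t : ℝ) + 1) * t := mul_le_mul_of_nonneg_right h2 t.2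
        _ = ε / 4 * (t / ((t : ℝ) + 1)) := by ring
        _ ≤ ε / 4 * 1 := by
          gcongr
          rw [div_le_one (by positivity)]; linarith
        _ = ε / 4 := mul_one _
    have e : S t n f - S t N f = S t n (f - R α g) + (S t n (R α g) - S t N (R α g)) -
        S t N (f - R α g) := by rw [map_sub, map_sub]; abel
    have h4 := hS1 t n (f - R α g)
    have h5 := hS1 t N (f - R α g)
    have h6 : ‖S t n (R α g) - S t N (R α g)‖ ≤ ε / 4 := h1.trans h3
    rw [e]
    have h7 := norm_sub_le (S t n (f - R α g) + (S t n (R α g) - S t N (R α g))) (S t N (f - R α g))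
    have h8 := norm_add_le (S t n (f - R α g)) (S t n (R α g) - S t N (R α g))
    linarith
  choose L hL using fun t f => cauchySeq_tendsto_of_complete (hcauchy t f)
  set T : ℝ≥0 → X →L[ℝ] X := fun t =>
    continuousLinearMapOfTendsto (S t) (tendsto_pi_nhds.2 (hL t)) with hT
  have hTL : ∀ t f, Tendsto (fun n => S t n f) atTop (𝓝 (T t f)) := fun t f => hL t f
  have hT1 : ∀ t f, ‖T t f‖ ≤ ‖f‖ := fun t f =>
    le_of_tendsto (hTL t f).norm (Eventually.of_forall fun n => hS1 t n f)
  have hlip : ∀ t α, 0 < α → ∀ g, ‖T t (R α g) - R α g‖ ≤ ‖α • R α g - g‖ * t := by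
    intro t α hα g
    refine le_of_tendsto_of_tendsto ((hTL t (R α g)).sub_const _).norm
      ((h.tendsto_yosida hα g).norm.mul_const _) (Eventually.of_forall fun n => ?_)
    have := norm_exp_smul_sub_le (Commute.zero_right (yosida R n)) (h.norm_exp_yosida_le n)
      (fun t _ f => by simp) t.2 (R α g)
    simpa using this
  -- An estimate uniform in the Yosida index. The vector `R_β g'` is chosen afterwards so close to
  -- `αR_α g - g` that the first error is small, and then `t` is taken small for the second.
  have htay : ∀ (t : ℝ≥0) α, 0 < α → ∀ g β, 0 < β → ∀ g',
      ‖T t (R α g) - R α g - (t : ℝ) • (α • R α g - g)‖ ≤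
      (2 * ‖(α • R α g - g) - R β g'‖ + t * ‖β • R β g' - g'‖) * t := by
    intro t α hα g β hβ g'
    have t1 := h.tendsto_yosida hα g
    have t2 := h.tendsto_yosida hβ g'
    refine le_of_tendsto_of_tendsto (((hTL t (R α g)).sub_const _).sub (t1.const_smul _)).norm
      ((((t1.sub_const _).norm.const_mul 2).add (t2.norm.const_mul _)).mul_const _)
      (Eventually.of_forall fun n => ?_)
    exact norm_exp_smul_taylor_le (h.norm_exp_yosida_le n) t.2 (R α g) (R β g')
  have ht0 : Tendsto (fun t : ℝ≥0 => (t : ℝ)) (𝓝[>] 0) (𝓝 0) :=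
    (NNReal.continuous_coe.tendsto' 0 0 (by simp)).mono_left nhdsWithin_le_nhds
  refine ⟨T, ?_, ?_, ?_, ?_, ?_, ?_⟩
  · ext f
    refine tendsto_nhds_unique (hTL 0 f) ?_
    simp [hS]
  · intro s t
    ext f
    have h1 : Tendsto (fun n => S s n (S t n f) - S s n (T t f)) atTop (𝓝 0) := by
      have h2 : Tendsto (fun n => ‖S t n f - T t f‖) atTop (𝓝 0) := by
        simpa using ((hTL t f).sub_const (T t f)).norm
      refine squeeze_zero_norm (fun n => ?_) h2
      rw [← map_sub]
      exact hS1 _ _ _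
    have h3 := h1.add (hTL s (T t f))
    refine tendsto_nhds_unique (hTL (s + t) f) ?_
    rw [zero_add] at h3
    refine h3.congr fun n => ?_
    rw [sub_add_cancel, ← mul_apply_eq_comp]
    simp only [hS]
    rw [← exp_add_of_commute_clm (((Commute.refl _).smul_left _).smul_right _), ← add_smul]
    simp
  · intro t
    exact ContinuousLinearMap.opNorm_le_bound _ zero_le_one (by simpa using hT1 t)
  · intro f
    rw [Metric.tendsto_nhds]
    intro ε hε
    obtain ⟨α, hα, g, hg⟩ := h.exists_range_close f (ε := ε / 4) (by positivity)
    have h1 : ∀ᶠ t : ℝ≥0 in 𝓝[>] 0, ‖α • R α g - g‖ * t < ε / 4 := by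
      have := ht0.const_mul ‖α • R α g - g‖
      rw [mul_zero] at this
      exact this.eventually (gt_mem_nhds (by positivity))
    filter_upwards [h1] with t ht
    have e : T t f - f = T t (f - R α g) + (T t (R α g) - R α g) - (f - R α g) := by
      rw [map_sub]; abel
    rw [dist_eq_norm, e]
    have h4 := hT1 t (f - R α g)
    have h6 := hlip t α hα g
    have h7 := norm_sub_le (T t (f - R α g) + (T t (R α g) - R α g)) (f - R α g)
    have h8 := norm_add_le (T t (f - R α g)) (T t (R α g) - R α g)
    linarith
  · intro K hK hKc hR t f hf
    exact hK.mem_of_tendsto (hTL t f)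
      (Eventually.of_forall fun n => exp_yosida_mem n hK hKc hR t.2 hf)
  · intro α hα f
    rw [Metric.tendsto_nhds]
    intro ε hε
    obtain ⟨β, hβ, g, hg⟩ := h.exists_range_close (α • R α f - f) (ε := ε / 4) (by positivity)
    have h1 : ∀ᶠ t : ℝ≥0 in 𝓝[>] 0, (t : ℝ) * ‖β • R β g - g‖ < ε / 4 := by
      have := ht0.mul_const ‖β • R β g - g‖
      rw [zero_mul] at this
      exact this.eventually (gt_mem_nhds (by positivity))
    filter_upwards [h1, self_mem_nhdsWithin] with t ht htpos
    have htpos' : (0 : ℝ) < t := htpos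
    have h2 := htay t α hα f β hβ g
    have e : (t : ℝ)⁻¹ • (T t (R α f) - R α f) - (α • R α f - f) =
        (t : ℝ)⁻¹ • (T t (R α f) - R α f - (t : ℝ) • (α • R α f - f)) := by
      rw [smul_sub _ _ ((t : ℝ) • _), smul_smul, inv_mul_cancel₀ htpos'.ne', one_smul]
    rw [dist_eq_norm, e, norm_smul, norm_inv, Real.norm_of_nonneg htpos'.le, inv_mul_lt_iff₀ htpos']
    refine h2.trans_lt ?_
    rw [mul_comm]
    refine mul_lt_mul_of_pos_left ?_ htpos'
    linarith

end StrongResolvent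

end HilleYosida

end

/-! ### Contraction semigroups on a Hilbert space, and sub-Markovian semigroups -/

section

section Semigroups

variable {X : Type*} [NormedAddCommGroup X] [InnerProductSpace ℝ X]

/-- Strongly continuous contraction semigroups. -/
structure ContractionSemigroup (T : ℝ≥0 → X →L[ℝ] X) : Prop where
  zero : T 0 = ContinuousLinearMap.id ℝ X
  add : ∀ s t, T (s + t) = (T s).comp (T t)
  contraction : ∀ t, ‖T t‖ ≤ 1
  strongly_continuous : ∀ f, Tendsto (fun t => T t f) (𝓝[>] 0) (𝓝 f)

namespace ContractionSemigroup

variable {T T' : ℝ≥0 → X →L[ℝ] X} {u w f g : X} {G : X →L[ℝ] X}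

theorem norm_apply_le (h : ContractionSemigroup T) (t : ℝ≥0) (f : X) : ‖T t f‖ ≤ ‖f‖ := by
  simpa using (T t).le_of_opNorm_le (h.contraction t) f

theorem apply_add (h : ContractionSemigroup T) (s t : ℝ≥0) (f : X) :
    T (s + t) f = T s (T t f) := by rw [h.add]; rfl

theorem apply_comm (h : ContractionSemigroup T) (s t : ℝ≥0) (f : X) :
    T s (T t f) = T t (T s f) := by rw [← h.apply_add, add_comm, h.apply_add]

theorem continuous_apply (h : ContractionSemigroup T) (f : X) : Continuous fun t => T t f := by
  have key : ∀ s t : ℝ≥0, s ≤ t → dist (T s f) (T t f) ≤ ‖T (t - s) f - f‖ := fun s t hst => by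
    have e : T t f = T s (T (t - s) f) := by rw [← h.apply_add, add_tsub_cancel_of_le hst]
    rw [dist_comm, dist_eq_norm, e, ← map_sub]
    exact h.norm_apply_le _ _
  rw [Metric.continuous_iff]
  intro s ε hε
  have h1 := h.strongly_continuous f
  rw [Metric.tendsto_nhdsWithin_nhds] at h1
  obtain ⟨δ, hδ, h1⟩ := h1 ε hε
  have h2 : ∀ r : ℝ≥0, (r : ℝ) < δ → ‖T r f - f‖ < ε := fun r hr => by
    rcases eq_or_ne r 0 with rfl | hr0
    · simpa [h.zero] using hε
    · rw [← dist_eq_norm]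
      exact h1 (pos_iff_ne_zero.2 hr0) (by simpa [NNReal.dist_eq] using hr)
  refine ⟨δ, hδ, fun t ht => ?_⟩
  rw [NNReal.dist_eq, abs_lt] at ht
  rcases le_total s t with hst | hst
  · rw [dist_comm]
    exact (key s t hst).trans_lt (h2 _ (by rw [NNReal.coe_sub hst]; linarith))
  · exact (key t s hst).trans_lt (h2 _ (by rw [NNReal.coe_sub hst]; linarith))

theorem hasDerivWithinAt (h : ContractionSemigroup T)
    (hu : Tendsto (fun t : ℝ≥0 => (t : ℝ)⁻¹ • (T t u - u)) (𝓝[>] 0) (𝓝 w)) {s : ℝ} (hs : 0 ≤ s) :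
    HasDerivWithinAt (fun s : ℝ => T s.toNNReal u) (T s.toNNReal w) (Set.Ici s) s := by
  rw [hasDerivWithinAt_iff_tendsto_slope, Set.Ici_sdiff_left]
  have h1 : Tendsto (fun r : ℝ => (r - s).toNNReal) (𝓝[>] s) (𝓝[>] 0) := by
    refine tendsto_nhdsWithin_iff.2 ⟨?_, ?_⟩
    · refine ((continuous_real_toNNReal.comp (continuous_id.sub continuous_const)).tendsto'
        s 0 (by simp)).mono_left nhdsWithin_le_nhds
    · filter_upwards [self_mem_nhdsWithin] with r hr
      exact Real.toNNReal_pos.2 (sub_pos.2 hr)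
  have h2 := ((T s.toNNReal).continuous.tendsto w).comp (hu.comp h1)
  refine h2.congr' ?_
  filter_upwards [self_mem_nhdsWithin] with r hr
  have hr' : 0 ≤ r - s := sub_nonneg.2 (le_of_lt hr)
  have e : r.toNNReal = s.toNNReal + (r - s).toNNReal := by
    rw [← Real.toNNReal_add hs hr']; congr 1; ring
  simp only [Function.comp_apply, slope_def_module]
  rw [e, h.apply_add, map_smul, map_sub, Real.coe_toNNReal _ hr']

theorem inner_generator_nonpos (h : ContractionSemigroup T)
    (hu : Tendsto (fun t : ℝ≥0 => (t : ℝ)⁻¹ • (T t u - u)) (𝓝[>] 0) (𝓝 w)) :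
    inner ℝ w u ≤ 0 := by
  refine le_of_tendsto (hu.inner tendsto_const_nhds) (Eventually.of_forall fun t => ?_)
  rw [real_inner_smul_left, inner_sub_left, real_inner_self_eq_norm_sq]
  refine mul_nonpos_of_nonneg_of_nonpos (by positivity) ?_
  have h1 := real_inner_le_norm (T t u) u
  have h2 := mul_le_mul_of_nonneg_right (h.norm_apply_le t u) (norm_nonneg u)
  nlinarith

/-- The difference `z = T_s G f - G T_s f` satisfies `Lz = z`, which dissipativity excludes unless
`z = 0`. -/
theorem apply_resolvent (h : ContractionSemigroup T)
    (hG : ∀ f, Tendsto (fun t : ℝ≥0 => (t : ℝ)⁻¹ • (T t (G f) - G f)) (𝓝[>] 0) (𝓝 (G f - f)))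
    (s : ℝ≥0) (f : X) : T s (G f) = G (T s f) := by
  have h1 : Tendsto (fun t : ℝ≥0 => (t : ℝ)⁻¹ • (T t (T s (G f)) - T s (G f))) (𝓝[>] 0)
      (𝓝 (T s (G f - f))) := by
    refine (((T s).continuous.tendsto _).comp (hG f)).congr fun t => ?_
    simp only [Function.comp_apply, map_smul, map_sub]
    rw [h.apply_comm]
  have h2 := h1.sub (hG (T s f))
  have h3 : Tendsto (fun t : ℝ≥0 => (t : ℝ)⁻¹ • (T t (T s (G f) - G (T s f)) -
      (T s (G f) - G (T s f)))) (𝓝[>] 0) (𝓝 (T s (G f) - G (T s f))) := by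
    have e : T s (G f - f) - (G (T s f) - T s f) = T s (G f) - G (T s f) := by
      rw [map_sub]; abel
    rw [e] at h2
    refine h2.congr fun t => ?_
    rw [← smul_sub, map_sub]
    congr 1; abel
  have h4 := h.inner_generator_nonpos h3
  rw [real_inner_self_eq_norm_sq] at h4
  have h5 : ‖T s (G f) - G (T s f)‖ = 0 := by
    have := norm_nonneg (T s (G f) - G (T s f)); nlinarith
  exact sub_eq_zero.1 (norm_eq_zero.1 h5)

/-- On the range of the common resolvent, `y(s) = T_s G f - T'_s G f` equals `G k(s)` with `k = T f
- T' f`. Hence the right derivative of `‖y‖²` is `2⟨y, Gk - k⟩`, which is nonpositive by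
dissipativity, and `y(0) = 0`. No representation of the resolvent as a Laplace transform is needed.
-/
theorem eq_of_resolvent (h : ContractionSemigroup T) (h' : ContractionSemigroup T')
    (hG : ∀ f, Tendsto (fun t : ℝ≥0 => (t : ℝ)⁻¹ • (T t (G f) - G f)) (𝓝[>] 0) (𝓝 (G f - f)))
    (hG' : ∀ f, Tendsto (fun t : ℝ≥0 => (t : ℝ)⁻¹ • (T' t (G f) - G f)) (𝓝[>] 0) (𝓝 (G f - f)))
    (hd : DenseRange G) : T = T' := by
  have key : ∀ f : X, ∀ t : ℝ≥0, T t (G f) = T' t (G f) := by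
    intro f t
    set y : ℝ → X := fun s => T s.toNNReal (G f) - T' s.toNNReal (G f) with hy
    set k : ℝ → X := fun s => T s.toNNReal f - T' s.toNNReal f with hk
    have yk : ∀ s, y s = G (k s) := fun s => by
      simp only [hy, hk]
      rw [h.apply_resolvent hG, h'.apply_resolvent hG', map_sub]
    have hyd : ∀ s ∈ Set.Ico (0 : ℝ) t, HasDerivWithinAt (fun s => ‖y s‖ ^ 2)
        (2 * inner ℝ (y s) (G (k s) - k s)) (Set.Ici s) s := fun s hs => by
      have h1 := (h.hasDerivWithinAt (hG f) hs.1).fun_sub (h'.hasDerivWithinAt (hG' f) hs.1)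
      have e : T s.toNNReal (G f - f) - T' s.toNNReal (G f - f) = G (k s) - k s := by
        rw [← yk]; simp only [hy, hk, map_sub]; abel
      rw [e] at h1
      exact h1.norm_sq
    have hyc : Continuous y := ((h.continuous_apply _).comp continuous_real_toNNReal).sub
      ((h'.continuous_apply _).comp continuous_real_toNNReal)
    have h2 := image_le_of_deriv_right_le_deriv_boundary (B := fun _ => 0) (B' := fun _ => 0)
      (hyc.norm.pow 2).continuousOn hyd (by simp [hy, h.zero, h'.zero])
      continuousOn_const (fun s _ => hasDerivWithinAt_const _ _ _) (fun s _ => by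
        have := h.inner_generator_nonpos (hG (k s))
        rw [← yk, real_inner_comm, yk] at this
        rw [yk]
        linarith) (x := (t : ℝ)) ⟨t.2, le_rfl⟩
    have h3 : ‖y t‖ = 0 := by
      have := norm_nonneg (y t)
      have h2 : ‖y t‖ ^ 2 ≤ 0 := h2
      nlinarith
    have h4 := norm_eq_zero.1 h3
    simp only [hy, Real.toNNReal_coe] at h4
    exact sub_eq_zero.1 h4
  funext t
  ext1 x
  exact congrFun (hd.equalizer (T t).continuous (T' t).continuous (funext fun f => key f t)) x

/-- The Laplace transform estimate `α∫ e^{-αs}⟨T_s f, g⟩ ds ≤ I(1 - e^{-αt}) + J e^{-αt}`, obtained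
without integrating vector-valued functions: `e^{-αs}⟨T_s u, g⟩` has right derivative `-e^{-αs}⟨T_s
f, g⟩`. -/
theorem inner_resolvent_le (h : ContractionSemigroup T) {α : ℝ} (hα : 0 < α)
    (hu : Tendsto (fun t : ℝ≥0 => (t : ℝ)⁻¹ • (T t u - u)) (𝓝[>] 0) (𝓝 (α • u - f)))
    {I J : ℝ} {t : ℝ≥0} (hI : ∀ s, inner ℝ (T s f) g ≤ I)
    (hJ : ∀ s, t ≤ s → inner ℝ (T s f) g ≤ J) :
    α * inner ℝ u g ≤ I - (I - J) * Real.exp (-(α * t)) := by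
  set F : ℝ → ℝ := fun s => Real.exp (-(α * s)) * inner ℝ (T s.toNNReal u) g with hF
  have hFc : Continuous F := (by fun_prop : Continuous fun s : ℝ => Real.exp (-(α * s))).mul
    (((h.continuous_apply u).comp continuous_real_toNNReal).inner continuous_const)
  have hexp : ∀ s, HasDerivAt (fun s : ℝ => Real.exp (-(α * s))) (-(α * Real.exp (-(α * s)))) s :=
    fun s => by
      refine (((hasDerivAt_id' s).const_mul α).fun_neg.exp).congr_deriv ?_
      ring
  have hFd : ∀ s : ℝ, 0 ≤ s → HasDerivWithinAt (fun s => -F s)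
      (Real.exp (-(α * s)) * inner ℝ (T s.toNNReal f) g) (Set.Ici s) s := fun s hs => by
    have h1 := (h.hasDerivWithinAt hu hs).inner (𝕜 := ℝ)
      (hasDerivWithinAt_const s (Set.Ici s) g)
    have h2 := ((hexp s).hasDerivWithinAt.mul h1).neg
    refine h2.congr_deriv ?_
    simp only [inner_zero_right, map_sub, map_smul, inner_sub_left, real_inner_smul_left]
    ring
  -- Comparison with the explicit solution for a constant bound `K`, used on `[0,t]` with `I` and on
  -- `[t,b]` with `J`, then `b → ∞`.
  have step : ∀ a b K : ℝ, 0 ≤ a → a ≤ b →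
      (∀ s ∈ Set.Ico a b, inner ℝ (T s.toNNReal f) g ≤ K) →
      α * F a ≤ α * F b + K * (Real.exp (-(α * a)) - Real.exp (-(α * b))) := by
    intro a b K ha hab hK
    have h2 := image_le_of_deriv_right_le_deriv_boundary
      (B := fun s => -F a + K / α * (Real.exp (-(α * a)) - Real.exp (-(α * s))))
      (B' := fun s => K / α * (0 - -(α * Real.exp (-(α * s)))))
      hFc.neg.continuousOn (fun s hs => hFd s (ha.trans hs.1)) (by simp) (by fun_prop)
      (fun s _ => ((((hasDerivAt_const s _).sub (hexp s)).const_mul _).const_add _).hasDerivWithinAt)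
      (fun s hs => by
        have e : K / α * (0 - -(α * Real.exp (-(α * s)))) = Real.exp (-(α * s)) * K := by
          field_simp; ring
        rw [e]
        exact mul_le_mul_of_nonneg_left (hK s hs) (Real.exp_pos _).le) (x := b) ⟨hab, le_rfl⟩
    have h3 := mul_le_mul_of_nonneg_left h2 hα.le
    have e : α * (-F a + K / α * (Real.exp (-(α * a)) - Real.exp (-(α * b)))) =
        -(α * F a) + K * (Real.exp (-(α * a)) - Real.exp (-(α * b))) := by
      field_simp
    rw [e, Pi.neg_apply] at h3
    linarith
  have h0 : F 0 = inner ℝ u g := by simp [hF, h.zero]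
  have s1 := step 0 t I le_rfl t.2 (fun s _ => hI _)
  have s2 : ∀ b : ℝ, (t : ℝ) ≤ b → α * F t ≤ α * F b +
      J * (Real.exp (-(α * t)) - Real.exp (-(α * b))) := fun b hb =>
    step t b J t.2 hb (fun s hs => hJ _ (NNReal.le_toNNReal_of_coe_le hs.1))
  have lexp : Tendsto (fun b : ℝ => Real.exp (-(α * b))) atTop (𝓝 0) :=
    Real.tendsto_exp_neg_atTop_nhds_zero.comp (tendsto_id.const_mul_atTop hα)
  have lF : Tendsto F atTop (𝓝 0) := by
    have h3 : Tendsto (fun b : ℝ => Real.exp (-(α * b)) * (‖u‖ * ‖g‖)) atTop (𝓝 0) := by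
      simpa using lexp.mul_const (‖u‖ * ‖g‖)
    refine squeeze_zero_norm (fun b => ?_) h3
    rw [hF]
    simp only [norm_mul, Real.norm_of_nonneg (Real.exp_pos _).le]
    refine mul_le_mul_of_nonneg_left ?_ (Real.exp_pos _).le
    exact (norm_inner_le_norm _ _).trans
      (mul_le_mul_of_nonneg_right (h.norm_apply_le _ _) (norm_nonneg _))
  have s3 : α * F t ≤ α * 0 + J * (Real.exp (-(α * t)) - 0) :=
    ge_of_tendsto ((lF.const_mul α).add ((tendsto_const_nhds.sub lexp).const_mul J))
      (by filter_upwards [eventually_ge_atTop (t : ℝ)] with b hb using s2 b hb)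
  rw [h0] at s1
  simp only [mul_zero, neg_zero, Real.exp_zero] at s1
  nlinarith

end ContractionSemigroup

end Semigroups

section SubMarkov

variable {d : ℕ} {μ : Measure (Eucl d)} {T : ℝ≥0 → (Lp ℝ 2 μ →L[ℝ] Lp ℝ 2 μ)}

theorem IsSubMarkovSemigroup.contractionSemigroup (h : IsSubMarkovSemigroup μ T) :
    ContractionSemigroup T := ⟨h.zero, h.add, h.contraction, h.strongly_continuous⟩

theorem IsSubMarkovSemigroup.mono (h : IsSubMarkovSemigroup μ T) (t : ℝ≥0) {f g : Lp ℝ 2 μ}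
    (hf : ∀ᵐ x ∂μ, 0 ≤ f x) (hfg : ∀ᵐ x ∂μ, f x ≤ g x) (hg : ∀ᵐ x ∂μ, g x ≤ 1) :
    ∀ᵐ x ∂μ, 0 ≤ T t f x ∧ T t f x ≤ T t g x ∧ T t g x ≤ 1 := by
  have h1 := h.sub_markov t f (by
    filter_upwards [hf, hfg, hg] with x h1 h2 h3 using ⟨h1, h2.trans h3⟩)
  have h2 := h.sub_markov t g (by
    filter_upwards [hf, hfg, hg] with x h1 h2 h3 using ⟨h1.trans h2, h3⟩)
  have h3 := h.sub_markov t (g - f) (by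
    filter_upwards [hf, hfg, hg, Lp.coeFn_sub g f] with x h1 h2 h3 h4
    rw [h4, Pi.sub_apply]
    exact ⟨by linarith, by linarith⟩)
  rw [map_sub] at h3
  filter_upwards [h1, h2, h3, Lp.coeFn_sub (T t g) (T t f)] with x a b c e
  rw [e, Pi.sub_apply] at c
  exact ⟨a.1, by linarith [c.1], b.2⟩

theorem tendsto_Lp_of_dominated {f : ℕ → Lp ℝ 2 μ} {g : Lp ℝ 2 μ}
    (hle : ∀ n, ∀ᵐ x ∂μ, |f n x| ≤ |g x|)
    (hlim : ∀ᵐ x ∂μ, Tendsto (fun n => f n x) atTop (𝓝 (g x))) : Tendsto f atTop (𝓝 g) := by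
  rw [Lp.tendsto_Lp_iff_tendsto_eLpNorm']
  have := tendsto_eLpNorm_two_of_dominated (f := fun n => f n) (g := g)
    (b := fun x => 2 * ‖g x‖)
    (fun n => (Lp.aestronglyMeasurable _).sub (Lp.aestronglyMeasurable _))
    ((Lp.memLp g).norm.const_mul 2) (fun n => by
      filter_upwards [hle n] with x hx
      have h1 := norm_sub_le (f n x) (g x)
      rw [Real.norm_eq_abs, Real.norm_eq_abs, Real.norm_eq_abs] at *
      linarith) hlim
  exact this

theorem exists_subseq_ae_of_tendsto {f : ℕ → Lp ℝ 2 μ} {g : Lp ℝ 2 μ}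
    (h : Tendsto f atTop (𝓝 g)) : ∃ ns : ℕ → ℕ, StrictMono ns ∧
      ∀ᵐ x ∂μ, Tendsto (fun n => f (ns n) x) atTop (𝓝 (g x)) := by
  rw [Lp.tendsto_Lp_iff_tendsto_eLpNorm'] at h
  exact eLpNorm_two_subseq_ae (f := fun n => (f n : Eucl d → ℝ)) (g := (g : Eucl d → ℝ))
    (fun n => Lp.aestronglyMeasurable (f n)) (Lp.aestronglyMeasurable g) h

end SubMarkov

end

/-! ### Conservativeness from a lower bound for the resolvent -/

section

section Conservative

variable {d : ℕ} {μ : Measure (Eucl d)} {T : ℝ≥0 → (Lp ℝ 2 μ →L[ℝ] Lp ℝ 2 μ)}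

theorem inner_indicatorConstLp_eq {s : Set (Eucl d)} (hs : MeasurableSet s) (hμs : μ s ≠ ⊤)
    (f : Lp ℝ 2 μ) : inner ℝ f (indicatorConstLp 2 hs hμs (1 : ℝ)) = ∫ x in s, f x ∂μ := by
  rw [real_inner_comm, L2.inner_indicatorConstLp_one]

theorem ae_indicatorConstLp_one {s : Set (Eucl d)} (hs : MeasurableSet s) (hμs : μ s ≠ ⊤) :
    ∀ᵐ x ∂μ, (indicatorConstLp 2 hs hμs (1 : ℝ) : Lp ℝ 2 μ) x = s.indicator (fun _ => 1) x :=
  indicatorConstLp_coeFn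

/-- Multiplication by the indicator function of a set. -/
def restrictLp {s : Set (Eucl d)} (hs : MeasurableSet s) (f : Lp ℝ 2 μ) : Lp ℝ 2 μ :=
  ((Lp.memLp f).indicator hs).toLp _

theorem restrictLp_coeFn {s : Set (Eucl d)} (hs : MeasurableSet s) (f : Lp ℝ 2 μ) :
    ∀ᵐ x ∂μ, restrictLp hs f x = s.indicator f x := MemLp.coeFn_toLp _

theorem setIntegral_mono_of_ae {s : Set (Eucl d)} (hμs : μ s ≠ ⊤)
    {f g : Lp ℝ 2 μ} (hfg : ∀ᵐ x ∂μ, f x ≤ g x) : ∫ x in s, f x ∂μ ≤ ∫ x in s, g x ∂μ := by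
  have : IsFiniteMeasure (μ.restrict s) := ⟨by simpa using hμs.lt_top⟩
  exact integral_mono_ae (((Lp.memLp f).restrict s).integrable (by norm_num))
    (((Lp.memLp g).restrict s).integrable (by norm_num)) (ae_restrict_of_ae hfg)

theorem setIntegral_le_measure {s : Set (Eucl d)} (hμs : μ s ≠ ⊤)
    {f : Lp ℝ 2 μ} (hf : ∀ᵐ x ∂μ, f x ≤ 1) : ∫ x in s, f x ∂μ ≤ μ.real s := by
  have : IsFiniteMeasure (μ.restrict s) := ⟨by simpa using hμs.lt_top⟩
  have := integral_mono_ae (((Lp.memLp f).restrict s).integrable (by norm_num))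
    (integrable_const (1 : ℝ)) (ae_restrict_of_ae hf)
  simpa using this

theorem ae_le_one_of_tendsto {f : ℕ → Lp ℝ 2 μ} (hmono : Monotone f)
    (hlim : ∀ᵐ x ∂μ, Tendsto (fun n => f n x) atTop (𝓝 1)) :
    ∀ᵐ x ∂μ, (∀ n, f n x ≤ 1) ∧ Monotone fun n => f n x := by
  have h1 : ∀ᵐ x ∂μ, ∀ n, f n x ≤ f (n + 1) x := ae_all_iff.2 fun n =>
    (Lp.coeFn_le _ _).2 (hmono n.le_succ)
  filter_upwards [h1, hlim] with x hx hl
  have hm := monotone_nat_of_le_succ hx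
  exact ⟨fun n => hm.ge_of_tendsto hl n, hm⟩

/-- It suffices to check conservativeness for one sequence increasing to `1`. -/
theorem IsSubMarkovSemigroup.tendsto_one_of_tendsto_one (h : IsSubMarkovSemigroup μ T) {t : ℝ≥0}
    {s : ℕ → Set (Eucl d)} (hs : ∀ n, MeasurableSet (s n)) (hμs : ∀ n, μ (s n) ≠ ⊤)
    (ht : ∀ᵐ x ∂μ, Tendsto (fun n => T t (indicatorConstLp 2 (hs n) (hμs n) (1 : ℝ)) x) atTop (𝓝 1))
    {f : ℕ → Lp ℝ 2 μ} (hf0 : ∀ n, 0 ≤ f n) (hmono : Monotone f)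
    (hlim : ∀ᵐ x ∂μ, Tendsto (fun n => f n x) atTop (𝓝 1)) :
    ∀ᵐ x ∂μ, Tendsto (fun n => T t (f n) x) atTop (𝓝 1) := by
  have hle := ae_le_one_of_tendsto hmono hlim
  have hf0' : ∀ᵐ x ∂μ, ∀ n, 0 ≤ f n x := ae_all_iff.2 fun n => (Lp.coeFn_nonneg _).2 (hf0 n)
  have hT : ∀ᵐ x ∂μ, ∀ n, 0 ≤ T t (f n) x ∧ T t (f n) x ≤ T t (f (n + 1)) x ∧
      T t (f (n + 1)) x ≤ 1 := ae_all_iff.2 fun n => h.mono t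
    (by filter_upwards [hf0'] with x hx using hx n)
    (by filter_upwards [hle] with x hx using hx.2 n.le_succ)
    (by filter_upwards [hle] with x hx using hx.1 _)
  have key : ∀ᵐ x ∂μ, ∀ m, ∀ l, Tendsto (fun n => T t (f n) x) atTop (𝓝 l) →
      T t (indicatorConstLp 2 (hs m) (hμs m) (1 : ℝ)) x ≤ l := by
    refine ae_all_iff.2 fun m => ?_
    set e : Lp ℝ 2 μ := indicatorConstLp 2 (hs m) (hμs m) (1 : ℝ)
    -- The limit `1` of `f n` need not lie in L², but `1_{s_m} f_n` converges in L² to the indicator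
    -- of `s_m`. Positivity gives `T_t(1_{s_m} f_n) ≤ T_t f_n`, hence every `T_t 1_{s_m}` is below
    -- the limit.
    set k : ℕ → Lp ℝ 2 μ := fun n => restrictLp (hs m) (f n) with hk
    have hk' : ∀ᵐ x ∂μ, ∀ n, k n x = (s m).indicator (f n) x :=
      ae_all_iff.2 fun n => restrictLp_coeFn (hs m) (f n)
    have hke : Tendsto k atTop (𝓝 e) := by
      refine tendsto_Lp_of_dominated (fun n => ?_) ?_
      · filter_upwards [hk', hle, hf0', ae_indicatorConstLp_one (hs m) (hμs m)] with x h1 h2 h3 h4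
        rw [h1, h4]
        by_cases hx : x ∈ s m
        · simpa [hx, abs_of_nonneg (h3 n)] using h2.1 n
        · simp [hx]
      · filter_upwards [hk', hlim, ae_indicatorConstLp_one (hs m) (hμs m)] with x h1 h2 h4
        rw [h4]
        simp_rw [h1]
        by_cases hx : x ∈ s m
        · simpa [hx] using h2
        · simp [hx]
    obtain ⟨ns, hns, hns'⟩ := exists_subseq_ae_of_tendsto (((T t).continuous.tendsto e).comp hke)
    have hkf : ∀ᵐ x ∂μ, ∀ n, T t (k n) x ≤ T t (f n) x := ae_all_iff.2 fun n => by
      filter_upwards [h.mono t (f := k n) (g := f n)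
        (by
          filter_upwards [hk', hf0'] with x h1 h2
          rw [h1]; exact Set.indicator_nonneg (fun _ _ => h2 n) _)
        (by
          filter_upwards [hk', hf0'] with x h1 h2
          rw [h1]; exact Set.indicator_le_self' (fun _ _ => h2 n) _)
        (by filter_upwards [hle] with x hx using hx.1 _)] with x hx using hx.2.1
    filter_upwards [hns', hkf] with x h1 h2 l hl
    exact le_of_tendsto_of_tendsto' h1 (hl.comp hns.tendsto_atTop) fun n => h2 _
  filter_upwards [hT, key, ht] with x h1 h2 h3
  have hm : Monotone fun n => T t (f n) x := monotone_nat_of_le_succ fun n => (h1 n).2.1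
  have hb : ∀ n, T t (f n) x ≤ 1 := fun n => (h1 n).2.1.trans (h1 n).2.2
  have hl := tendsto_atTop_ciSup hm ⟨1, by rintro _ ⟨n, rfl⟩; exact hb n⟩
  have h4 : (1 : ℝ) ≤ ⨆ n, T t (f n) x := le_of_tendsto' h3 fun m => h2 m _ hl
  have h5 : ⨆ n, T t (f n) x ≤ 1 := ciSup_le hb
  rwa [le_antisymm h5 h4] at hl

/-- Pair everything with the indicator of a set `s_j`. Before time `t` the pairing `⟨T_r 1,
1_{s_j}⟩` is at most the measure of `s_j`, afterwards at most its value at `t`. With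
`inner_resolvent_le` the lower bound for `α R_α 1` yields that the integral of `1 - T_t 1` over
`s_j` is at most a constant times `e^{-(c-t)α}`; then `α → ∞`. -/
theorem IsSubMarkovSemigroup.tendsto_one_of_resolvent (h : IsSubMarkovSemigroup μ T)
    {G : ℝ → Lp ℝ 2 μ →L[ℝ] Lp ℝ 2 μ}
    (hG : ∀ α, 0 < α → ∀ f, IsGenerator T (G α f) (α • G α f - f))
    {s : ℕ → Set (Eucl d)} (hs : ∀ n, MeasurableSet (s n)) (hμs : ∀ n, μ (s n) ≠ ⊤)
    (hsm : Monotone s) (hsu : ∀ᵐ x ∂μ, ∃ n, x ∈ s n) {c : ℝ} {u : ℝ → Eucl d → ℝ}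
    (hGle : ∀ α, 0 < α → ∀ᵐ x ∂μ, Tendsto (fun n => α * G α (indicatorConstLp 2 (hs n) (hμs n) 1) x)
      atTop (𝓝 (u α x)))
    (hGb : ∀ α, 0 < α → ∀ n, ∀ᵐ x ∂μ, 0 ≤ α * G α (indicatorConstLp 2 (hs n) (hμs n) 1) x ∧
      α * G α (indicatorConstLp 2 (hs n) (hμs n) 1) x ≤ 1)
    (hu : ∀ α, 0 < α → ∀ᵐ x ∂μ, 1 - Real.exp (-(c * α)) ≤ u α x) {t : ℝ≥0} (htc : t < c) :
    ∀ᵐ x ∂μ, Tendsto (fun n => T t (indicatorConstLp 2 (hs n) (hμs n) (1 : ℝ)) x) atTop (𝓝 1) := by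
  have hC := h.contractionSemigroup
  set e : ℕ → Lp ℝ 2 μ := fun n => indicatorConstLp 2 (hs n) (hμs n) (1 : ℝ) with he
  have he' : ∀ᵐ x ∂μ, ∀ n, e n x = (s n).indicator (fun _ => 1) x :=
    ae_all_iff.2 fun n => ae_indicatorConstLp_one (hs n) (hμs n)
  have he0 : ∀ n, ∀ᵐ x ∂μ, 0 ≤ e n x := fun n => by
    filter_upwards [he'] with x hx
    rw [hx]; exact Set.indicator_nonneg (fun _ _ => zero_le_one) _
  have he1 : ∀ n, ∀ᵐ x ∂μ, e n x ≤ 1 := fun n => by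
    filter_upwards [he'] with x hx
    rw [hx]; exact Set.indicator_le' (fun _ _ => le_rfl) (fun _ _ => zero_le_one) _
  have hem : ∀ n, ∀ᵐ x ∂μ, e n x ≤ e (n + 1) x := fun n => by
    filter_upwards [he'] with x hx
    rw [hx, hx]
    exact Set.indicator_le_indicator_of_subset (hsm n.le_succ) (fun _ => zero_le_one) _
  have hT : ∀ r : ℝ≥0, ∀ᵐ x ∂μ, ∀ n, 0 ≤ T r (e n) x ∧ T r (e n) x ≤ T r (e (n + 1)) x ∧
      T r (e (n + 1)) x ≤ 1 := fun r => ae_all_iff.2 fun n => h.mono r (he0 n) (hem n) (he1 _)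
  set hl : Eucl d → ℝ := fun x => ⨆ n, T t (e n) x with hhl
  have hlim : ∀ᵐ x ∂μ, Tendsto (fun n => T t (e n) x) atTop (𝓝 (hl x)) ∧ hl x ≤ 1 ∧
      ∀ n, T t (e n) x ≤ hl x := by
    filter_upwards [hT t] with x h1
    have hm : Monotone fun n => T t (e n) x := monotone_nat_of_le_succ fun n => (h1 n).2.1
    have hb : ∀ n, T t (e n) x ≤ 1 := fun n => (h1 n).2.1.trans (h1 n).2.2
    have hbd : BddAbove (Set.range fun n => T t (e n) x) := ⟨1, by rintro _ ⟨n, rfl⟩; exact hb n⟩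
    exact ⟨tendsto_atTop_ciSup hm hbd, ciSup_le hb, fun n => le_ciSup hbd n⟩
  have hone : ∀ j, ∀ᵐ x ∂(μ.restrict (s j)), hl x = 1 := by
    intro j
    have hfin : IsFiniteMeasure (μ.restrict (s j)) := ⟨by simpa using (hμs j).lt_top⟩
    have hTint : ∀ f : Lp ℝ 2 μ, Integrable f (μ.restrict (s j)) := fun f =>
      ((Lp.memLp f).restrict _).integrable (by norm_num)
    have hlm : AEStronglyMeasurable hl (μ.restrict (s j)) :=
      aestronglyMeasurable_of_tendsto_ae atTop
        (fun n => ((Lp.aestronglyMeasurable (T t (e n))).restrict))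
        (ae_restrict_of_ae (hlim.mono fun x hx => hx.1))
    have hl01 : ∀ᵐ x ∂(μ.restrict (s j)), ‖hl x‖ ≤ 1 := by
      filter_upwards [ae_restrict_of_ae hlim, ae_restrict_of_ae (hT t)] with x h1 h2
      rw [Real.norm_of_nonneg ((h2 0).1.trans (h1.2.2 0))]; exact h1.2.1
    have hlint : Integrable hl (μ.restrict (s j)) := Integrable.of_bound hlm 1 hl01
    set J := ∫ x in s j, hl x ∂μ with hJ
    have hJe : ∀ m, ∫ x in s j, T t (e m) x ∂μ ≤ J := fun m =>
      integral_mono_ae (hTint _) hlint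
        (ae_restrict_of_ae (by filter_upwards [hlim] with x hx using hx.2.2 m))
    set I := μ.real (s j) with hI
    have hinner : ∀ f : Lp ℝ 2 μ, inner ℝ f (e j) = ∫ x in s j, f x ∂μ := fun f =>
      inner_indicatorConstLp_eq (hs j) (hμs j) f
    -- The bound `T_t k ≤ T_t 1` for an arbitrary `0 ≤ k ≤ 1`, via the restrictions of `k` to the
    -- sets `s_m`. Applied to `k = T_{r-t} e_n` it is the monotonicity of `T_r 1` in time.
    have hkJ : ∀ k : Lp ℝ 2 μ, (∀ᵐ x ∂μ, 0 ≤ k x ∧ k x ≤ 1) → ∫ x in s j, T t k x ∂μ ≤ J := by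
      intro k hk
      set km : ℕ → Lp ℝ 2 μ := fun m => restrictLp (hs m) k
      have hkm : ∀ᵐ x ∂μ, ∀ m, km m x = (s m).indicator k x :=
        ae_all_iff.2 fun m => restrictLp_coeFn (hs m) k
      have hlimk : Tendsto km atTop (𝓝 k) := by
        refine tendsto_Lp_of_dominated (fun m => ?_) ?_
        · filter_upwards [hkm] with x hx
          rw [hx]
          by_cases hxs : x ∈ s m <;> simp [hxs]
        · filter_upwards [hkm, hsu] with x hx hxs
          obtain ⟨n, hn⟩ := hxs
          refine tendsto_const_nhds.congr' ?_
          filter_upwards [eventually_ge_atTop n] with m hm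
          rw [hx, Set.indicator_of_mem (hsm hm hn)]
      have h1 : Tendsto (fun m => inner ℝ (T t (km m)) (e j)) atTop (𝓝 (inner ℝ (T t k) (e j))) :=
        (((T t).continuous.tendsto k).comp hlimk).inner tendsto_const_nhds
      rw [← hinner]
      refine le_of_tendsto' h1 fun m => ?_
      rw [hinner]
      refine (setIntegral_mono_of_ae (hμs j) ?_).trans (hJe m)
      filter_upwards [h.mono t (f := km m) (g := e m)
        (by
          filter_upwards [hkm, hk] with x h1 h2
          rw [h1]; exact Set.indicator_nonneg (fun _ _ => h2.1) _)
        (by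
          filter_upwards [hkm, hk, he'] with x h1 h2 h3
          rw [h1, h3]
          by_cases hxs : x ∈ s m
          · simpa [hxs] using h2.2
          · simp [hxs])
        (he1 m)] with x hx using hx.2.1
    -- Here `I - J` is the mass defect on `s_j` at time `t`, the integral of `1 - hl`.
    have hα : ∀ α, 0 < α → (I - J) ≤ I * Real.exp (-((c - t) * α)) := by
      intro α hα
      have h1 : ∀ n, α * inner ℝ (G α (e n)) (e j) ≤ I - (I - J) * Real.exp (-(α * t)) := fun n => by
        refine hC.inner_resolvent_le hα (hG α hα (e n)) (fun r => ?_) (fun r hr => ?_)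
        · rw [hinner]
          refine setIntegral_le_measure (hμs j) ?_
          filter_upwards [hT r] with x hx using (hx n).2.1.trans (hx n).2.2
        · rw [hinner]
          have e1 : T r (e n) = T t (T (r - t) (e n)) := by
            rw [← hC.apply_add, add_tsub_cancel_of_le hr]
          rw [e1]
          refine hkJ _ ?_
          filter_upwards [hT (r - t)] with x hx using ⟨(hx n).1, (hx n).2.1.trans (hx n).2.2⟩
      have h2 : Tendsto (fun n => α * inner ℝ (G α (e n)) (e j)) atTop (𝓝 (∫ x in s j, u α x ∂μ)) := by
        simp_rw [hinner, ← integral_const_mul]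
        refine tendsto_integral_of_dominated_convergence (fun _ => 1)
          (fun n => ((hTint _).1.const_mul _)) (integrable_const _) (fun n => ?_)
          (ae_restrict_of_ae (hGle α hα))
        filter_upwards [ae_restrict_of_ae (hGb α hα n)] with x hx
        rw [Real.norm_of_nonneg hx.1]; exact hx.2
      have h3 : (1 - Real.exp (-(c * α))) * I ≤ ∫ x in s j, u α x ∂μ := by
        have i1 : Integrable (u α) (μ.restrict (s j)) := by
          refine Integrable.of_bound (C := 1) (aestronglyMeasurable_of_tendsto_ae atTop
            (fun n => ((hTint (G α (e n))).1.const_mul α)) (ae_restrict_of_ae (hGle α hα))) ?_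
          filter_upwards [ae_restrict_of_ae (hGle α hα),
            ae_restrict_of_ae (ae_all_iff.2 (hGb α hα))] with x h1 h2
          have h3 : 0 ≤ u α x := ge_of_tendsto' h1 fun n => (h2 n).1
          rw [Real.norm_of_nonneg h3]
          exact le_of_tendsto' h1 fun n => (h2 n).2
        have := integral_mono_ae (integrable_const (1 - Real.exp (-(c * α)))) i1
          (ae_restrict_of_ae (hu α hα))
        simpa [hI, mul_comm] using this
      have h4 := h3.trans (le_of_tendsto' h2 h1)
      have h5 : (I - J) * Real.exp (-(α * t)) ≤ I * Real.exp (-(c * α)) := by linarith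
      have h6 := mul_le_mul_of_nonneg_right h5 (Real.exp_pos (α * t)).le
      rw [mul_assoc, ← Real.exp_add, mul_assoc, ← Real.exp_add] at h6
      simp only [neg_add_cancel, Real.exp_zero, mul_one] at h6
      refine h6.trans (le_of_eq ?_)
      congr 2; ring
    have hIJ : I - J ≤ 0 := by
      have h1 : Tendsto (fun α : ℝ => I * Real.exp (-((c - t) * α))) atTop (𝓝 0) := by
        have := (Real.tendsto_exp_neg_atTop_nhds_zero.comp
          (tendsto_id.const_mul_atTop (sub_pos.2 htc))).const_mul I
        simpa using this
      exact ge_of_tendsto h1 (by filter_upwards [eventually_gt_atTop 0] with α hα' using hα α hα')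
    have nn : 0 ≤ᵐ[μ.restrict (s j)] fun x => 1 - hl x := by
      filter_upwards [ae_restrict_of_ae hlim] with x hx
      simpa using hx.2.1
    have h7 : ∫ x in s j, (1 - hl x) ∂μ = 0 := by
      refine le_antisymm ?_ (integral_nonneg_of_ae nn)
      rw [integral_sub (integrable_const _) hlint]
      simpa [hI] using hIJ
    rw [integral_eq_zero_iff_of_nonneg_ae nn ((integrable_const _).sub hlint)] at h7
    filter_upwards [h7] with x hx
    simp only [Pi.zero_apply] at hx
    linarith
  have hone' : ∀ᵐ x ∂μ, ∀ j, x ∈ s j → hl x = 1 :=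
    ae_all_iff.2 fun j => (ae_restrict_iff' (hs j)).1 (hone j)
  filter_upwards [hone', hsu, hlim] with x h1 h2 h3
  obtain ⟨n, hn⟩ := h2
  have h4 := h3.1
  rwa [h1 n hn] at h4

/-- A criterion for conservativeness in terms of the resolvent. -/
theorem IsSubMarkovSemigroup.isConservative (h : IsSubMarkovSemigroup μ T)
    {G : ℝ → Lp ℝ 2 μ →L[ℝ] Lp ℝ 2 μ}
    (hG : ∀ α, 0 < α → ∀ f, IsGenerator T (G α f) (α • G α f - f))
    {s : ℕ → Set (Eucl d)} (hs : ∀ n, MeasurableSet (s n)) (hμs : ∀ n, μ (s n) ≠ ⊤)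
    (hsm : Monotone s) (hsu : ∀ᵐ x ∂μ, ∃ n, x ∈ s n) {c : ℝ} (hc : 0 < c) {u : ℝ → Eucl d → ℝ}
    (hGle : ∀ α, 0 < α → ∀ᵐ x ∂μ, Tendsto (fun n => α * G α (indicatorConstLp 2 (hs n) (hμs n) 1) x)
      atTop (𝓝 (u α x)))
    (hGb : ∀ α, 0 < α → ∀ n, ∀ᵐ x ∂μ, 0 ≤ α * G α (indicatorConstLp 2 (hs n) (hμs n) 1) x ∧
      α * G α (indicatorConstLp 2 (hs n) (hμs n) 1) x ≤ 1)
    (hu : ∀ α, 0 < α → ∀ᵐ x ∂μ, 1 - Real.exp (-(c * α)) ≤ u α x) : IsConservative T := by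
  have small : ∀ t : ℝ≥0, (t : ℝ) < c → ∀ f : ℕ → Lp ℝ 2 μ, (∀ n, 0 ≤ f n) → Monotone f →
      (∀ᵐ x ∂μ, Tendsto (fun n => f n x) atTop (𝓝 1)) →
      ∀ᵐ x ∂μ, Tendsto (fun n => T t (f n) x) atTop (𝓝 1) := fun t ht f hf hm hl =>
    h.tendsto_one_of_tendsto_one hs hμs
      (h.tendsto_one_of_resolvent hG hs hμs hsm hsu hGle hGb hu ht) hf hm hl
  -- The functions `T_t f_n` again increase to `1` once `t < c`, so short time intervals can be
  -- concatenated. This is the reason for quantifying over all increasing sequences instead of a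
  -- fixed one.
  have iter : ∀ t : ℝ≥0, (t : ℝ) < c → ∀ N : ℕ, ∀ f : ℕ → Lp ℝ 2 μ, (∀ n, 0 ≤ f n) → Monotone f →
      (∀ᵐ x ∂μ, Tendsto (fun n => f n x) atTop (𝓝 1)) →
      ∀ᵐ x ∂μ, Tendsto (fun n => T (N * t) (f n) x) atTop (𝓝 1) := by
    intro t ht N
    induction N with
    | zero => intro f _ _ hl; simpa [h.zero] using hl
    | succ N ih =>
      intro f hf hm hl
      have e : ∀ n, T ((N + 1 : ℕ) * t) (f n) = T (N * t) (T t (f n)) := fun n => by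
        rw [← h.contractionSemigroup.apply_add]; congr 2; push_cast; ring
      simp_rw [e]
      have hle := ae_le_one_of_tendsto hm hl
      have hT : ∀ n m, n ≤ m → ∀ᵐ x ∂μ, 0 ≤ T t (f n) x ∧ T t (f n) x ≤ T t (f m) x ∧
          T t (f m) x ≤ 1 := fun n m hnm => h.mono t ((Lp.coeFn_nonneg _).2 (hf n))
        ((Lp.coeFn_le _ _).2 (hm hnm)) (by filter_upwards [hle] with x hx using hx.1 _)
      refine ih (fun n => T t (f n)) (fun n => ?_) (fun n m hnm => ?_) (small t ht f hf hm hl)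
      · exact (Lp.coeFn_nonneg _).1 (by filter_upwards [hT n n le_rfl] with x hx using hx.1)
      · exact (Lp.coeFn_le _ _).1 (by filter_upwards [hT n m hnm] with x hx using hx.2.1)
  intro t ht f hf hm hl
  obtain ⟨N, hN⟩ := exists_nat_gt ((t : ℝ) / c)
  have hN0 : (0 : ℝ) < N := lt_of_le_of_lt (by positivity) hN
  have hN0' : (N : ℝ≥0) ≠ 0 := by
    intro h0; rw [← NNReal.coe_natCast, h0] at hN0; simp at hN0
  have h1 := iter (t / N) (by
    rw [NNReal.coe_div, NNReal.coe_natCast, div_lt_iff₀ hN0]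
    rw [div_lt_iff₀ hc] at hN; linarith) N f hf hm hl
  rwa [mul_div_cancel₀ _ hN0'] at h1

end Conservative

end

/-! ### Local resolvents as operators on the whole L² space -/

section

namespace GlobalSetup

variable {d : ℕ} {E V V' : Set (Eucl d)} {A : Eucl d → Matrix (Fin d) (Fin d) ℝ}
  {B : Eucl d → Eucl d} {μ : Measure (Eucl d)} {α β : ℝ}

/-- `R` is the resolvent operator on `V`, extended by zero. -/
def IsZeroExtendedResolvent (E : Set (Eucl d)) (A : Eucl d → Matrix (Fin d) (Fin d) ℝ)
    (B : Eucl d → Eucl d) (μ : Measure (Eucl d)) (V : Set (Eucl d)) (α : ℝ)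
    (R : Lp ℝ 2 μ →L[ℝ] Lp ℝ 2 μ) : Prop :=
  ∀ f : Lp ℝ 2 μ, (∃ G, WeakSol A B (μ.restrict V) {f | IsTest E V f} α f (R f) G) ∧
    ∀ᵐ x ∂μ, x ∉ V → R f x = 0

theorem eLpNorm_restrict_of_zero_off (S : GlobalSetup E A B μ) (hV : IsRelCompactOpen E V)
    {f : Eucl d → ℝ} (hf : ∀ᵐ x ∂μ, x ∉ V → f x = 0) (p : ℝ≥0∞) :
    eLpNorm f p μ = eLpNorm f p (μ.restrict V) := by
  rw [← eLpNorm_indicator_eq_eLpNorm_restrict (S.measurableSet hV)]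
  refine eLpNorm_congr_ae ?_
  filter_upwards [hf] with x hx
  by_cases hxV : x ∈ V
  · simp [hxV]
  · simp [hxV, hx hxV]

theorem exists_isZeroExtendedResolvent (S : GlobalSetup E A B μ) (hV : IsRelCompactOpen E V)
    (hα : 0 < α) : ∃ R : Lp ℝ 2 μ →L[ℝ] Lp ℝ 2 μ, IsZeroExtendedResolvent E A B μ V α R := by
  have SV := S.localSetup hV
  have hVm := S.measurableSet hV
  choose u G hu using fun f : Lp ℝ 2 μ => SV.exists_weakSol hα ((Lp.memLp f).restrict V)
  have hm : ∀ f, MemLp (V.indicator (u f)) 2 μ := fun f => by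
    rw [memLp_indicator_iff_restrict hVm]; exact (hu f).memLp
  set r : Lp ℝ 2 μ → Lp ℝ 2 μ := fun f => (hm f).toLp _ with hr
  have hrc : ∀ f, r f =ᵐ[μ] V.indicator (u f) := fun f => (hm f).coeFn_toLp
  have hrV : ∀ f, u f =ᵐ[μ.restrict V] r f := fun f => by
    filter_upwards [ae_restrict_of_ae (hrc f), ae_restrict_mem hVm] with x hx hxV
    rw [hx, Set.indicator_of_mem hxV]
  have hr0 : ∀ f, ∀ᵐ x ∂μ, x ∉ V → r f x = 0 := fun f => by
    filter_upwards [hrc f] with x hx hxV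
    rw [hx, Set.indicator_of_notMem hxV]
  have hw : ∀ f : Lp ℝ 2 μ, WeakSol A B (μ.restrict V) {f | IsTest E V f} α f (r f) (G f) := fun f =>
    (hu f).congr EventuallyEq.rfl (hrV f)
  have huniq : ∀ (f g : Lp ℝ 2 μ) (H : Eucl d → Eucl d),
      WeakSol A B (μ.restrict V) {f | IsTest E V f} α f g H →
      (∀ᵐ x ∂μ, x ∉ V → g x = 0) → r f = g := fun f g H hg hg0 => by
    have h1 := (hw f).ae_eq SV hα hg
    refine Lp.ext ?_
    filter_upwards [(ae_restrict_iff' hVm).1 h1, hr0 f, hg0] with x h1 h2 h3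
    by_cases hx : x ∈ V
    · exact h1 hx
    · rw [h2 hx, h3 hx]
  set L : Lp ℝ 2 μ →ₗ[ℝ] Lp ℝ 2 μ :=
    { toFun := r
      map_add' := fun f g => by
        refine huniq _ _ (fun x => G f x + G g x) (((hw f).add SV (hw g)).congr ?_ ?_) ?_
        · exact ae_restrict_of_ae (Lp.coeFn_add f g).symm
        · exact ae_restrict_of_ae (Lp.coeFn_add (r f) (r g)).symm
        · filter_upwards [Lp.coeFn_add (r f) (r g), hr0 f, hr0 g] with x h1 h2 h3 hx
          rw [h1, Pi.add_apply, h2 hx, h3 hx, add_zero]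
      map_smul' := fun c f => by
        refine huniq _ _ (fun x => c • G f x) (((hw f).const_mul SV c).congr ?_ ?_) ?_
        · exact ae_restrict_of_ae (Lp.coeFn_smul c f).symm
        · exact ae_restrict_of_ae (Lp.coeFn_smul c (r f)).symm
        · filter_upwards [Lp.coeFn_smul c (r f), hr0 f] with x h1 h2 hx
          rw [RingHom.id_apply, h1, Pi.smul_apply, h2 hx, smul_zero] } with hL
  refine ⟨L.mkContinuous α⁻¹ fun f => ?_, fun f => ⟨⟨G f, hw f⟩, hr0 f⟩⟩
  have h1 := (hw f).eLpNorm_le SV ((Lp.memLp f).restrict V)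
  rw [← S.eLpNorm_restrict_of_zero_off hV (hr0 f)] at h1
  have h2 : (eLpNorm f 2 (μ.restrict V)).toReal ≤ ‖f‖ := by
    rw [Lp.norm_def]
    exact ENNReal.toReal_mono (Lp.eLpNorm_ne_top f) (eLpNorm_mono_measure _ Measure.restrict_le_self)
  have h3 : ‖L f‖ = (eLpNorm (r f) 2 μ).toReal := Lp.norm_def _
  rw [h3, inv_mul_eq_div, le_div_iff₀ hα, mul_comm]
  exact h1.trans h2

namespace IsZeroExtendedResolvent

variable {R R' : Lp ℝ 2 μ →L[ℝ] Lp ℝ 2 μ}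

theorem contraction (S : GlobalSetup E A B μ) (hV : IsRelCompactOpen E V)
    (h : IsZeroExtendedResolvent E A B μ V α R) (f : Lp ℝ 2 μ) : α * ‖R f‖ ≤ ‖f‖ := by
  obtain ⟨⟨G, hG⟩, h0⟩ := h f
  have h1 := hG.eLpNorm_le (S.localSetup hV) ((Lp.memLp f).restrict V)
  rw [← S.eLpNorm_restrict_of_zero_off hV h0] at h1
  rw [Lp.norm_def, Lp.norm_def]
  exact h1.trans (ENNReal.toReal_mono (Lp.eLpNorm_ne_top f)
    (eLpNorm_mono_measure _ Measure.restrict_le_self))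

theorem eLpNorm_one_le (S : GlobalSetup E A B μ) (hV : IsRelCompactOpen E V) (hα : 0 < α)
    (h : IsZeroExtendedResolvent E A B μ V α R) (f : Lp ℝ 2 μ) :
    ENNReal.ofReal α * eLpNorm (R f) 1 μ ≤ eLpNorm f 1 μ := by
  obtain ⟨⟨G, hG⟩, h0⟩ := h f
  have := S.finite_restrict hV
  have h1 := hG.integral_abs_le (S.localSetup hV)
  rw [S.eLpNorm_restrict_of_zero_off hV h0,
    eLpNorm_one_eq_ofReal (hG.memLp.integrable (by norm_num)), ← ENNReal.ofReal_mul hα.le]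
  refine (ENNReal.ofReal_le_ofReal h1).trans ?_
  rw [← eLpNorm_one_eq_ofReal hG.2.1]
  exact eLpNorm_mono_measure _ Measure.restrict_le_self

theorem nonneg (S : GlobalSetup E A B μ) (hV : IsRelCompactOpen E V) (hα : 0 < α)
    (h : IsZeroExtendedResolvent E A B μ V α R) {f : Lp ℝ 2 μ} (hf : ∀ᵐ x ∂μ, 0 ≤ f x) :
    ∀ᵐ x ∂μ, 0 ≤ R f x := by
  obtain ⟨⟨G, hG⟩, h0⟩ := h f
  have h1 := hG.nonneg_of_nonneg (S.localSetup hV) hα (ae_restrict_of_ae hf)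
  filter_upwards [(ae_restrict_iff' (S.measurableSet hV)).1 h1, h0] with x h1 h2
  by_cases hx : x ∈ V
  · exact h1 hx
  · rw [h2 hx]

theorem le_one (S : GlobalSetup E A B μ) (hV : IsRelCompactOpen E V) (hα : 0 < α)
    (h : IsZeroExtendedResolvent E A B μ V α R) {f : Lp ℝ 2 μ} (hf : ∀ᵐ x ∂μ, f x ≤ 1) :
    ∀ᵐ x ∂μ, α * R f x ≤ 1 := by
  obtain ⟨⟨G, hG⟩, h0⟩ := h f
  have h1 := hG.le_of_le (S.localSetup hV) hα zero_le_one (ae_restrict_of_ae hf)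
  filter_upwards [(ae_restrict_iff' (S.measurableSet hV)).1 h1, h0] with x h1 h2
  by_cases hx : x ∈ V
  · exact h1 hx
  · rw [h2 hx]; simp

theorem mono (S : GlobalSetup E A B μ) (hV : IsRelCompactOpen E V) (hV' : IsRelCompactOpen E V')
    (hVV' : V ⊆ V') (hα : 0 < α) (h : IsZeroExtendedResolvent E A B μ V α R)
    (h' : IsZeroExtendedResolvent E A B μ V' α R') {f : Lp ℝ 2 μ} (hf : ∀ᵐ x ∂μ, 0 ≤ f x) :
    ∀ᵐ x ∂μ, R f x ≤ R' f x := by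
  obtain ⟨⟨G, hG⟩, h0⟩ := h f
  obtain ⟨⟨G', hG'⟩, -⟩ := h' f
  have h1 := S.weakSol_mono hV hV' hVV' hα hG hG' (ae_restrict_of_ae hf)
  filter_upwards [(ae_restrict_iff' (S.measurableSet hV)).1 h1, h0, h'.nonneg S hV' hα hf]
    with x h1 h2 h3
  by_cases hx : x ∈ V
  · exact h1 hx
  · rw [h2 hx]; exact h3

theorem resolvent_identity (S : GlobalSetup E A B μ) (hV : IsRelCompactOpen E V)
    (hβ : 0 < β) (h : IsZeroExtendedResolvent E A B μ V α R)
    (h' : IsZeroExtendedResolvent E A B μ V β R') (f : Lp ℝ 2 μ) :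
    R f = R' (f + (β - α) • R f) := by
  have SV := S.localSetup hV
  obtain ⟨⟨G, hG⟩, h0⟩ := h f
  obtain ⟨⟨G', hG'⟩, h0'⟩ := h' (f + (β - α) • R f)
  have h1 := (hG.change_param SV β).congr (f' := (f + (β - α) • R f : Lp ℝ 2 μ)) (by
    filter_upwards [ae_restrict_of_ae (Lp.coeFn_add f ((β - α) • R f)),
      ae_restrict_of_ae (Lp.coeFn_smul (β - α) (R f))] with x e1 e2
    rw [e1, Pi.add_apply, e2, Pi.smul_apply, smul_eq_mul]) EventuallyEq.rfl
  have h2 := h1.ae_eq SV hβ hG'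
  refine Lp.ext ?_
  filter_upwards [(ae_restrict_iff' (S.measurableSet hV)).1 h2, h0, h0'] with x h1 h2 h3
  by_cases hx : x ∈ V
  · exact h1 hx
  · rw [h2 hx, h3 hx]

end IsZeroExtendedResolvent

end GlobalSetup

/-! ### Monotone convergence in L² -/

section MonotoneConvergence

variable {X : Type*} [MeasurableSpace X] {μ : Measure X}

/-- For `0 ≤ f ≤ g` the product `⟨f, g - f⟩` is nonnegative. Hence an increasing norm-bounded
sequence of nonnegative functions is Cauchy as soon as its norms converge. -/
theorem norm_sub_sq_le_of_le {f g : Lp ℝ 2 μ} (hf : ∀ᵐ x ∂μ, 0 ≤ f x)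
    (hfg : ∀ᵐ x ∂μ, f x ≤ g x) : ‖g - f‖ ^ 2 ≤ ‖g‖ ^ 2 - ‖f‖ ^ 2 := by
  have h1 : 0 ≤ inner ℝ f (g - f) := by
    rw [L2.inner_def]
    refine integral_nonneg_of_ae ?_
    filter_upwards [hf, hfg, Lp.coeFn_sub g f] with x h1 h2 h3
    rw [h3]
    simp only [Pi.zero_apply, Pi.sub_apply, RCLike.inner_apply, conj_trivial]
    exact mul_nonneg (sub_nonneg.2 h2) h1
  have h2 : ‖g‖ ^ 2 = ‖g - f‖ ^ 2 + 2 * inner ℝ f (g - f) + ‖f‖ ^ 2 := by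
    have : g = f + (g - f) := by abel
    conv_lhs => rw [this]
    rw [norm_add_sq_real]; ring
  linarith

theorem exists_tendsto_of_monotone {f : ℕ → Lp ℝ 2 μ} (hf : ∀ n, ∀ᵐ x ∂μ, 0 ≤ f n x)
    (hmono : ∀ n m, n ≤ m → ∀ᵐ x ∂μ, f n x ≤ f m x) {C : ℝ} (hC : ∀ n, ‖f n‖ ≤ C) :
    ∃ g, Tendsto f atTop (𝓝 g) := by
  have hn : Monotone fun n => ‖f n‖ ^ 2 := fun n m hnm => by
    have := norm_sub_sq_le_of_le (hf n) (hmono n m hnm)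
    have h2 := sq_nonneg ‖f m - f n‖
    simp only
    linarith
  have hb : BddAbove (Set.range fun n => ‖f n‖ ^ 2) := ⟨C ^ 2, by
    rintro _ ⟨n, rfl⟩
    exact pow_le_pow_left₀ (norm_nonneg _) (hC n) 2⟩
  have hc := (tendsto_atTop_ciSup hn hb).cauchySeq
  refine cauchySeq_tendsto_of_complete ?_
  rw [Metric.cauchySeq_iff'] at hc ⊢
  intro ε hε
  obtain ⟨N, hN⟩ := hc (ε ^ 2) (by positivity)
  refine ⟨N, fun n hn' => ?_⟩
  have h1 := hN n hn'
  rw [Real.dist_eq] at h1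
  have h2 := norm_sub_sq_le_of_le (hf N) (hmono N n hn')
  rw [dist_eq_norm]
  refine lt_of_pow_lt_pow_left₀ 2 hε.le ?_
  exact h2.trans_lt ((le_abs_self _).trans_lt h1)

end MonotoneConvergence

end

/-! ### The limiting resolvent and its strong continuity -/

section

/-- A relatively compact open exhaustion of `E`. -/
structure Exhaustion {d : ℕ} (E : Set (Eucl d)) (V : ℕ → Set (Eucl d)) : Prop where
  relCompact : ∀ n, IsRelCompactOpen E (V n)
  mono : Monotone V
  exists_subset : ∀ K, IsCompact K → K ⊆ E → ∃ n, K ⊆ V n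

/-- `R` is the limit of the resolvents on the sets of the exhaustion `V`. -/
structure GlobalResolvent {d : ℕ} (E : Set (Eucl d)) (A : Eucl d → Matrix (Fin d) (Fin d) ℝ)
    (B : Eucl d → Eucl d) (μ : Measure (Eucl d)) (V : ℕ → Set (Eucl d))
    (Rn : ℕ → ℝ → Lp ℝ 2 μ →L[ℝ] Lp ℝ 2 μ) (R : ℝ → Lp ℝ 2 μ →L[ℝ] Lp ℝ 2 μ) : Prop where
  isResolvent : ∀ n α, 0 < α → GlobalSetup.IsZeroExtendedResolvent E A B μ (V n) α (Rn n α)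
  lim : ∀ α, 0 < α → ∀ f, Tendsto (fun n => Rn n α f) atTop (𝓝 (R α f))

variable {d : ℕ} {E : Set (Eucl d)} {A : Eucl d → Matrix (Fin d) (Fin d) ℝ}
  {B : Eucl d → Eucl d} {μ : Measure (Eucl d)} {V : ℕ → Set (Eucl d)} {α : ℝ}

/-- For `f ≥ 0` domain monotonicity makes the local resolvents increase, and their norms are at most
`‖f‖/α`; general `f` is split into positive and negative parts. -/
theorem exists_globalResolvent (S : GlobalSetup E A B μ) (hV : Exhaustion E V) :
    ∃ Rn R, GlobalResolvent E A B μ V Rn R := by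
  have h0 : ∀ n α, ∃ R : Lp ℝ 2 μ →L[ℝ] Lp ℝ 2 μ, 0 < α →
      GlobalSetup.IsZeroExtendedResolvent E A B μ (V n) α R := fun n α => by
    by_cases hα : 0 < α
    · obtain ⟨R, hR⟩ := S.exists_isZeroExtendedResolvent (hV.relCompact n) hα
      exact ⟨R, fun _ => hR⟩
    · exact ⟨0, fun h => absurd h hα⟩
  choose Rn hRn using h0
  have h1 : ∀ α, 0 < α → ∀ f : Lp ℝ 2 μ, 0 ≤ f →
      ∃ g, Tendsto (fun n => Rn n α f) atTop (𝓝 g) := fun α hα f hf => by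
    have hf' := (Lp.coeFn_nonneg f).2 hf
    refine exists_tendsto_of_monotone (C := α⁻¹ * ‖f‖)
      (fun n => (hRn n α hα).nonneg S (hV.relCompact n) hα hf')
      (fun n m hnm => (hRn n α hα).mono S (hV.relCompact n) (hV.relCompact m) (hV.mono hnm) hα
        (hRn m α hα) hf') (fun n => ?_)
    have := (hRn n α hα).contraction S (hV.relCompact n) f
    rw [inv_mul_eq_div, le_div_iff₀ hα, mul_comm]
    exact this
  have h2 : ∀ α, 0 < α → ∀ f : Lp ℝ 2 μ, ∃ g, Tendsto (fun n => Rn n α f) atTop (𝓝 g) :=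
    fun α hα f => by
    obtain ⟨g, hg⟩ := h1 α hα _ (Lp.coeFn_nonneg (Lp.posPart f) |>.1 (by
      filter_upwards [Lp.coeFn_posPart f] with x hx
      rw [hx]; exact le_max_right _ _))
    obtain ⟨g', hg'⟩ := h1 α hα _ (Lp.coeFn_nonneg (Lp.negPart f) |>.1 (by
      filter_upwards [Lp.coeFn_negPart_eq_max f] with x hx
      rw [hx]; exact le_max_right _ _))
    refine ⟨g - g', (hg.sub hg').congr fun n => ?_⟩
    rw [← map_sub]
    congr 1
    refine Lp.ext ?_
    filter_upwards [Lp.coeFn_sub (Lp.posPart f) (Lp.negPart f), Lp.coeFn_posPart f,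
      Lp.coeFn_negPart_eq_max f] with x h1 h2 h3
    rw [h1, Pi.sub_apply, h2, h3]
    rcases le_total 0 (f x) with h | h
    · rw [max_eq_left h, max_eq_right (by linarith), sub_zero]
    · rw [max_eq_right h, max_eq_left (by linarith)]; simp
  choose! L hL using h2
  refine ⟨Rn, fun α => if hα : 0 < α then
    continuousLinearMapOfTendsto (fun n => Rn n α) (tendsto_pi_nhds.2 (hL α hα)) else 0,
    hRn, fun α hα f => ?_⟩
  rw [dif_pos hα]
  exact hL α hα f

namespace GlobalResolvent

variable {Rn : ℕ → ℝ → Lp ℝ 2 μ →L[ℝ] Lp ℝ 2 μ} {R : ℝ → Lp ℝ 2 μ →L[ℝ] Lp ℝ 2 μ}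

theorem ae_monotone (h : GlobalResolvent E A B μ V Rn R) (S : GlobalSetup E A B μ)
    (hV : Exhaustion E V) (hα : 0 < α) {f : Lp ℝ 2 μ} (hf : ∀ᵐ x ∂μ, 0 ≤ f x) :
    ∀ᵐ x ∂μ, Monotone fun n => Rn n α f x := by
  have : ∀ᵐ x ∂μ, ∀ n, Rn n α f x ≤ Rn (n + 1) α f x := ae_all_iff.2 fun n =>
    (h.isResolvent n α hα).mono S (hV.relCompact n) (hV.relCompact (n + 1)) (hV.mono n.le_succ) hα
      (h.isResolvent (n + 1) α hα) hf
  filter_upwards [this] with x hx using monotone_nat_of_le_succ hx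

/-- L² convergence provides a subsequence converging almost everywhere, and pointwise monotonicity
in `n` extends this to the full sequence. -/
theorem ae_tendsto (h : GlobalResolvent E A B μ V Rn R) (S : GlobalSetup E A B μ)
    (hV : Exhaustion E V) (hα : 0 < α) {f : Lp ℝ 2 μ} (hf : ∀ᵐ x ∂μ, 0 ≤ f x) :
    ∀ᵐ x ∂μ, Tendsto (fun n => Rn n α f x) atTop (𝓝 (R α f x)) := by
  obtain ⟨ns, hns, hlim⟩ := exists_subseq_ae_of_tendsto (h.lim α hα f)
  filter_upwards [h.ae_monotone S hV hα hf, hlim] with x hx hl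
  exact (tendsto_iff_tendsto_subseq_of_monotone hx hns.tendsto_atTop).2 hl

theorem contraction (h : GlobalResolvent E A B μ V Rn R) (S : GlobalSetup E A B μ)
    (hV : Exhaustion E V) (hα : 0 < α) (f : Lp ℝ 2 μ) : ‖α • R α f‖ ≤ ‖f‖ := by
  rw [norm_smul, Real.norm_of_nonneg hα.le]
  exact le_of_tendsto' ((h.lim α hα f).norm.const_mul α)
    fun n => (h.isResolvent n α hα).contraction S (hV.relCompact n) f

theorem resolvent_identity (h : GlobalResolvent E A B μ V Rn R) (S : GlobalSetup E A B μ)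
    (hV : Exhaustion E V) {β : ℝ} (hα : 0 < α) (hβ : 0 < β) (f : Lp ℝ 2 μ) :
    R α f - R β f = (β - α) • R α (R β f) := by
  have h1 : Tendsto (fun n => Rn n α (Rn n β f)) atTop (𝓝 (R α (R β f))) := by
    have h2 : Tendsto (fun n => Rn n α (Rn n β f) - Rn n α (R β f)) atTop (𝓝 0) := by
      have h3 : Tendsto (fun n => α⁻¹ * ‖Rn n β f - R β f‖) atTop (𝓝 0) := by
        simpa using ((h.lim β hβ f).sub_const (R β f)).norm.const_mul α⁻¹
      refine squeeze_zero_norm (fun n => ?_) h3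
      rw [← map_sub, inv_mul_eq_div, le_div_iff₀ hα, mul_comm]
      exact (h.isResolvent n α hα).contraction S (hV.relCompact n) _
    have := h2.add (h.lim α hα (R β f))
    simpa using this
  have h4 : Tendsto (fun n => Rn n β f) atTop (𝓝 (R α f + (α - β) • R α (R β f))) := by
    refine ((h.lim α hα f).add (h1.const_smul (α - β))).congr fun n => ?_
    have := (h.isResolvent n β hβ).resolvent_identity S (hV.relCompact n) hα
      (h.isResolvent n α hα) f
    conv_rhs => rw [this]
    rw [map_add, map_smul]
  have h5 := tendsto_nhds_unique (h.lim β hβ f) h4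
  have h6 : (β - α) • R α (R β f) = -((α - β) • R α (R β f)) := by rw [← neg_smul, neg_sub]
  rw [h6]
  conv_lhs => rw [h5]
  exact sub_add_cancel_left _ _

theorem smul_mem_Icc (h : GlobalResolvent E A B μ V Rn R) (S : GlobalSetup E A B μ)
    (hV : Exhaustion E V) (hα : 0 < α) {f : Lp ℝ 2 μ} (hf : ∀ᵐ x ∂μ, 0 ≤ f x ∧ f x ≤ 1) :
    ∀ᵐ x ∂μ, 0 ≤ α * R α f x ∧ α * R α f x ≤ 1 := by
  have hf0 : ∀ᵐ x ∂μ, 0 ≤ f x := hf.mono fun x hx => hx.1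
  have h1 := ae_all_iff.2 fun n => (h.isResolvent n α hα).nonneg S (hV.relCompact n) hα hf0
  have h2 := ae_all_iff.2 fun n => (h.isResolvent n α hα).le_one S (hV.relCompact n) hα
    (hf.mono fun x hx => hx.2)
  filter_upwards [h1, h2, h.ae_tendsto S hV hα hf0] with x h1 h2 h3
  exact ⟨mul_nonneg hα.le (ge_of_tendsto' h3 h1), le_of_tendsto' (h3.const_mul α) h2⟩

theorem eLpNorm_one_le (h : GlobalResolvent E A B μ V Rn R) (S : GlobalSetup E A B μ)
    (hV : Exhaustion E V) (hα : 0 < α) (f : Lp ℝ 2 μ) :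
    eLpNorm (R α f) 1 μ ≤ (ENNReal.ofReal α)⁻¹ * eLpNorm f 1 μ := by
  obtain ⟨ns, hns, hlim⟩ := exists_subseq_ae_of_tendsto (h.lim α hα f)
  refine Lp.eLpNorm_le_of_ae_tendsto (Eventually.of_forall fun n => ?_)
    (fun n => Lp.aestronglyMeasurable (Rn (ns n) α f)) hlim
  have := (h.isResolvent (ns n) α hα).eLpNorm_one_le S (hV.relCompact _) hα f
  rw [mul_comm, ← div_eq_mul_inv, ENNReal.le_div_iff_mul_le (by simp [hα]) (by simp), mul_comm]
  exact this

/-- `α R_α u - u = R_α L u` on functions in the domain of `L⁰` with compact support. -/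
theorem exists_eLpNorm_sub_le (h : GlobalResolvent E A B μ V Rn R) (S : GlobalSetup E A B μ)
    (hV : Exhaustion E V) {u : Lp ℝ 2 μ} (hu : IsCompactBddDomain E A μ u) :
    ∃ C : ℝ≥0∞, C ≠ ⊤ ∧ ∀ α, 0 < α →
      eLpNorm (fun x => α * R α u x - u x) 1 μ ≤ (ENNReal.ofReal α)⁻¹ * C := by
  obtain ⟨⟨G, w, hF⟩, -, K, hK, hKE, hu0⟩ := hu
  obtain ⟨n₀, hn₀⟩ := hV.exists_subset K hK hKE
  obtain ⟨-, K₁, hK₁, hVK₁, hK₁E⟩ := hV.relCompact n₀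
  obtain ⟨n₁, hn₁⟩ := hV.exists_subset K₁ hK₁ hK₁E
  obtain ⟨G', hG'0, hG'⟩ := S.exists_formOp (hV.relCompact n₀) hK hn₀ hK₁ hVK₁ hn₁ hF hu0
  -- The function `Lu`, the same for every `V_n` with `n ≥ n₁`. Both summands vanish off `V_{n₁}`,
  -- so its L¹ norm is a constant independent of `n`.
  set l : Eucl d → ℝ := fun x => K₁.indicator w x + inner ℝ (B x) (G' x) with hl
  have hle : ∀ n, n₁ ≤ n → eLpNorm l 1 (μ.restrict (V n)) ≤ eLpNorm l 1 (μ.restrict (V n₁)) := by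
    intro n hn
    have e : l = (V n₁).indicator l := by
      ext x
      by_cases hx : x ∈ V n₁
      · rw [Set.indicator_of_mem hx]
      · rw [Set.indicator_of_notMem hx, hl]
        have h1 : x ∉ K₁ := fun hx1 => hx (hn₁ hx1)
        simp [h1, hG'0 x fun hx1 => h1 (hVK₁ hx1)]
    conv_lhs => rw [e]
    rw [eLpNorm_indicator_eq_eLpNorm_restrict (S.measurableSet (hV.relCompact n₁))]
    exact eLpNorm_mono_measure _ (by
      rw [Measure.restrict_restrict_of_subset (hV.mono hn)])
  have hWn : ∀ n, n₁ ≤ n → ∀ α, WeakSol A B (μ.restrict (V n)) {f | IsTest E (V n) f} α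
      (fun x => α * u x - l x) u G' := fun n hn α =>
    (hG' (V n) (hV.relCompact n) (hV.mono hn)).weakSol (S.localSetup (hV.relCompact n))
      EventuallyEq.rfl α
  have := S.finite_restrict (hV.relCompact n₁)
  have S₁ := S.localSetup (hV.relCompact n₁)
  have hlint : Integrable l (μ.restrict (V n₁)) := by
    have h1 := hG' (V n₁) (hV.relCompact n₁) le_rfl
    exact (h1.2.1.integrable (by norm_num)).add (S₁.integrable_inner_B h1.1.memLp_grad)
  have hu0' : ∀ᵐ x ∂μ, x ∉ V n₁ → u x = 0 := by
    have hVK : V n₀ ⊆ V n₁ := hVK₁.trans hn₁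
    rw [ae_restrict_iff' (S.measE.diff hK.measurableSet)] at hu0
    filter_upwards [hu0, S.ae_mem] with x h1 h2 h3
    exact h1 ⟨h2, fun h4 => h3 (hVK (hn₀ h4))⟩
  refine ⟨eLpNorm l 1 (μ.restrict (V n₁)), (memLp_one_iff_integrable.2 hlint).eLpNorm_ne_top,
    fun α hα => ?_⟩
  obtain ⟨ns, hns, hlim⟩ := exists_subseq_ae_of_tendsto (h.lim α hα u)
  have hlim' : ∀ᵐ x ∂μ, Tendsto (fun n => α * Rn (ns n) α u x - u x) atTop
      (𝓝 (α * R α u x - u x)) := by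
    filter_upwards [hlim] with x hx using (hx.const_mul α).sub_const _
  refine Lp.eLpNorm_le_of_ae_tendsto ?_ (fun n => ((Lp.aestronglyMeasurable _).const_mul α).sub
    (Lp.aestronglyMeasurable _)) hlim'
  filter_upwards [eventually_ge_atTop n₁] with n hn
  have hn' : n₁ ≤ ns n := hn.trans hns.le_apply
  have Sn := S.localSetup (hV.relCompact (ns n))
  have := S.finite_restrict (hV.relCompact (ns n))
  obtain ⟨⟨H, hH⟩, hH0⟩ := h.isResolvent (ns n) α hα u
  -- The difference `αR_α^n u - u` solves the local resolvent equation with right side `l`; the L¹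
  -- contraction then gives the factor `1/α`.
  have h1 := ((hH.const_mul Sn α).sub Sn (hWn (ns n) hn' α)).congr (f' := l)
    (Eventually.of_forall fun x => by simp) EventuallyEq.rfl
  have h2 := h1.integral_abs_le Sn
  have h3 : ∀ᵐ x ∂μ, x ∉ V (ns n) → α * Rn (ns n) α u x - u x = 0 := by
    filter_upwards [hH0, hu0'] with x e1 e2 hx
    rw [e1 hx, e2 fun hx1 => hx (hV.mono hn' hx1)]; simp
  change eLpNorm (fun x => α * Rn (ns n) α u x - u x) 1 μ ≤ _
  rw [S.eLpNorm_restrict_of_zero_off (hV.relCompact _) h3,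
    eLpNorm_one_eq_ofReal (h1.memLp.integrable (by norm_num)), mul_comm, ← div_eq_mul_inv,
    ENNReal.le_div_iff_mul_le (by simp [hα]) (by simp), mul_comm, ← ENNReal.ofReal_mul hα.le]
  refine (ENNReal.ofReal_le_ofReal h2).trans ?_
  rw [← eLpNorm_one_eq_ofReal h1.2.1]
  exact hle _ hn'

/-- Convergence in L¹ comes from the rate on `D(L⁰)_{0,b}`, its L¹ density and the L¹ contraction.
Because `0 ≤ f ≤ 1` and the resolvent is sub-Markovian, `|αR_α f - f| ≤ 1`, so its square is below
its absolute value and L² convergence follows. -/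
theorem tendsto_smul_of_bdd (h : GlobalResolvent E A B μ V Rn R) (S : GlobalSetup E A B μ)
    (hV : Exhaustion E V) (hC : DenseCompactBddDomain E A μ) {f : Lp ℝ 2 μ} (hf : MemLp f 1 μ)
    (hf01 : ∀ᵐ x ∂μ, 0 ≤ f x ∧ f x ≤ 1) :
    Tendsto (fun n : ℕ => ((n : ℝ) + 1) • R ((n : ℝ) + 1) f) atTop (𝓝 f) := by
  set a : ℕ → ℝ := fun n => (n : ℝ) + 1 with ha
  have hapos : ∀ n, 0 < a n := fun n => by positivity
  have hainf : Tendsto (fun n => (ENNReal.ofReal (a n))⁻¹) atTop (𝓝 0) := by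
    rw [← ENNReal.inv_top]
    exact (ENNReal.tendsto_ofReal_atTop.comp
      (tendsto_natCast_atTop_atTop.atTop_add tendsto_const_nhds)).inv
  set y : ℕ → Eucl d → ℝ := fun n x => a n * R (a n) f x - f x with hy
  have hym : ∀ n, AEStronglyMeasurable (y n) μ := fun n =>
    ((Lp.aestronglyMeasurable _).const_mul _).sub (Lp.aestronglyMeasurable _)
  have h1 : Tendsto (fun n => eLpNorm (y n) 1 μ) atTop (𝓝 0) := by
    rw [ENNReal.tendsto_nhds_zero]
    intro ε hε
    have hε4 : 0 < ε / 4 := ENNReal.div_pos hε.ne' (by simp)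
    obtain ⟨u, hu, hfu⟩ := hC f (by rwa [S.restrict_eq]) (ε / 4) hε4
    rw [S.restrict_eq] at hfu
    have hu2 : MemLp u 2 μ := by
      obtain ⟨⟨G, w, hF⟩, -⟩ := hu
      have := hF.1.1
      rwa [S.restrict_eq] at this
    set U : Lp ℝ 2 μ := hu2.toLp u
    have hUu : U =ᵐ[μ] u := hu2.coeFn_toLp
    have hU : IsCompactBddDomain E A μ U := by
      obtain ⟨⟨G, w, hF⟩, ⟨M, hM⟩, K, hK, hKE, hu0⟩ := hu
      refine ⟨⟨G, w, ⟨?_, hF.1.2.1, ?_⟩, hF.2.1, hF.2.2⟩, ⟨M, ?_⟩, K, hK, hKE, ?_⟩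
      · rw [S.restrict_eq]; exact Lp.memLp U
      · obtain ⟨g, hg, h1, h2⟩ := hF.1.2.2
        refine ⟨g, hg, h1.congr fun n => eLpNorm_congr_ae ?_, h2⟩
        filter_upwards [ae_restrict_of_ae hUu] with x hx
        rw [hx]
      · filter_upwards [hM, ae_restrict_of_ae hUu] with x h1 h2
        rwa [h2]
      · filter_upwards [hu0, ae_restrict_of_ae hUu] with x h1 h2
        rwa [h2]
    obtain ⟨C, hC, hCle⟩ := h.exists_eLpNorm_sub_le S hV hU
    have hlim : Tendsto (fun n => (ENNReal.ofReal (a n))⁻¹ * C) atTop (𝓝 0) := by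
      have := ENNReal.Tendsto.mul_const (b := C) hainf (Or.inr hC)
      simpa using this
    have hfU : eLpNorm (f - U : Lp ℝ 2 μ) 1 μ ≤ ε / 4 := by
      refine le_trans (le_of_eq (eLpNorm_congr_ae ?_)) hfu.le
      filter_upwards [Lp.coeFn_sub f U, hUu] with x h1 h2
      rw [h1, Pi.sub_apply, h2]
    rw [ENNReal.tendsto_nhds_zero] at hlim
    filter_upwards [hlim (ε / 4) hε4] with n hn
    have e : y n =ᵐ[μ] ((fun x => a n • R (a n) (f - U) x) + fun x => a n * R (a n) U x - U x) -
        (f - U : Lp ℝ 2 μ) := by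
      filter_upwards [Lp.coeFn_sub f U, Lp.coeFn_sub (R (a n) f) (R (a n) U)] with x h1 h2
      simp only [hy, Pi.add_apply, Pi.sub_apply, h1, map_sub, smul_eq_mul]
      rw [h2, Pi.sub_apply]; ring
    have m1 : AEStronglyMeasurable (fun x => a n • R (a n) (f - U) x) μ :=
      (Lp.aestronglyMeasurable (R (a n) (f - U))).const_mul (a n)
    have m2 : AEStronglyMeasurable (fun x => a n * R (a n) U x - U x) μ :=
      ((Lp.aestronglyMeasurable _).const_mul _).sub (Lp.aestronglyMeasurable _)
    rw [eLpNorm_congr_ae e]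
    refine (eLpNorm_sub_le (m1.add m2) (Lp.aestronglyMeasurable _) le_rfl).trans ?_
    have b1 : eLpNorm (fun x => a n • R (a n) (f - U) x) 1 μ ≤ ε / 4 := by
      have : (fun x => a n • R (a n) (f - U) x) = a n • (R (a n) (f - U) : Eucl d → ℝ) := rfl
      rw [this, eLpNorm_const_smul, Real.enorm_eq_ofReal (hapos n).le]
      refine le_trans (mul_le_mul_right (h.eLpNorm_one_le S hV (hapos n) (f - U)) _) ?_
      rw [← mul_assoc, ENNReal.mul_inv_cancel (by simp [hapos n]) (by simp), one_mul]
      exact hfU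
    have b2 := (eLpNorm_add_le m1 m2 le_rfl).trans (add_le_add b1 ((hCle _ (hapos n)).trans hn))
    refine (add_le_add b2 hfU).trans ?_
    have e4 : ε / 4 + ε / 4 + ε / 4 + ε / 4 = ε := by
      have : ε / 4 = ε / 2 / 2 := by
        rw [ENNReal.div_eq_inv_mul, ENNReal.div_eq_inv_mul, ENNReal.div_eq_inv_mul, ← mul_assoc,
          ← ENNReal.mul_inv (by simp) (by simp)]
        norm_num
      rw [this, ENNReal.add_halves, add_assoc, ENNReal.add_halves, ENNReal.add_halves]
    calc _ ≤ ε / 4 + ε / 4 + ε / 4 + ε / 4 := le_self_add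
      _ = ε := e4
  have h2 : ∀ n, ∀ᵐ x ∂μ, |y n x| ≤ 1 := fun n => by
    filter_upwards [h.smul_mem_Icc S hV (hapos n) hf01, hf01] with x h1 h2
    simp only [hy]
    rw [abs_le]; constructor <;> linarith [h1.1, h1.2, h2.1, h2.2]
  rw [Lp.tendsto_Lp_iff_tendsto_eLpNorm']
  have h3 : ∀ n, eLpNorm (⇑(a n • R (a n) f) - ⇑f) 2 μ ^ (2 : ℝ) ≤ eLpNorm (y n) 1 μ := by
    intro n
    have e : (⇑(a n • R (a n) f) - ⇑f) =ᵐ[μ] y n := by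
      filter_upwards [Lp.coeFn_smul (a n) (R (a n) f)] with x hx
      rw [Pi.sub_apply, hx]; rfl
    rw [eLpNorm_congr_ae e, eLpNorm_eq_lintegral_rpow_enorm_toReal two_ne_zero ENNReal.ofNat_ne_top,
      eLpNorm_one_eq_lintegral_enorm, ← ENNReal.rpow_mul]
    norm_num
    refine lintegral_mono_ae ?_
    filter_upwards [h2 n] with x hx
    have : ‖y n x‖ₑ ≤ 1 := by
      rw [Real.enorm_eq_ofReal_abs]; simpa using hx
    calc ‖y n x‖ₑ ^ 2 = ‖y n x‖ₑ * ‖y n x‖ₑ := sq _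
      _ ≤ ‖y n x‖ₑ * 1 := by gcongr
      _ = _ := mul_one _
  have h4 := tendsto_of_tendsto_of_tendsto_of_le_of_le tendsto_const_nhds h1
    (fun n => zero_le) h3
  have h5 := h4.ennrpow_const (1 / 2 : ℝ)
  rw [ENNReal.zero_rpow_of_pos (by norm_num)] at h5
  refine h5.congr fun n => ?_
  simp only [← ENNReal.rpow_mul]
  norm_num
  rfl

/-- Indicators of sets of finite measure are bounded and integrable, so `tendsto_smul_of_bdd` covers
them; linearity and the contraction property reach all of L². -/
theorem strongResolvent (h : GlobalResolvent E A B μ V Rn R) (S : GlobalSetup E A B μ)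
    (hV : Exhaustion E V) (hC : DenseCompactBddDomain E A μ) : StrongResolvent R where
  contraction α hα f := h.contraction S hV hα f
  resolvent α β hα hβ f := h.resolvent_identity S hV hα hβ f
  strong := by
    refine Lp.induction (by simp) _ ?_ ?_ ?_
    · intro c s hs hμs
      have h1 : (Lp.simpleFunc.indicatorConst 2 hs hμs.ne c : Lp ℝ 2 μ) =
          c • indicatorConstLp 2 hs hμs.ne (1 : ℝ) := by
        rw [Lp.simpleFunc.coe_indicatorConst]
        refine Lp.ext ?_
        filter_upwards [Lp.coeFn_smul c (indicatorConstLp 2 hs hμs.ne (1 : ℝ) : Lp ℝ 2 μ),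
          ae_indicatorConstLp_one hs hμs.ne (μ := μ),
          (indicatorConstLp_coeFn : indicatorConstLp 2 hs hμs.ne c =ᵐ[μ] _)] with x e1 e2 e3
        rw [e1, Pi.smul_apply, e2, e3]
        by_cases hx : x ∈ s <;> simp [hx]
      rw [h1]
      have h2 := h.tendsto_smul_of_bdd S hV hC (f := indicatorConstLp 2 hs hμs.ne (1 : ℝ)) ?_ ?_
      · refine (h2.const_smul c).congr fun n => ?_
        rw [map_smul, smul_comm]
      · refine (memLp_congr_ae (ae_indicatorConstLp_one hs hμs.ne)).2 ?_
        exact memLp_indicator_const 1 hs 1 (Or.inr hμs.ne)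
      · filter_upwards [ae_indicatorConstLp_one hs hμs.ne (μ := μ)] with x hx
        rw [hx]
        by_cases hx : x ∈ s <;> simp [hx]
    · intro f g hf hg _ h1 h2
      refine (h1.add h2).congr fun n => ?_
      rw [map_add, smul_add]
    · rw [← isSeqClosed_iff_isClosed]
      intro fs f hfs hlim
      rw [Set.mem_ofPred_eq, Metric.tendsto_atTop]
      intro ε hε
      obtain ⟨k, hk⟩ := ((Metric.tendsto_nhds.1 hlim) (ε / 3) (by positivity)).exists
      obtain ⟨N, hN⟩ := (Metric.tendsto_atTop.1 (hfs k)) (ε / 3) (by positivity)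
      refine ⟨N, fun n hn => ?_⟩
      have h1 := hN n hn
      have h2 := h.contraction S hV (show (0 : ℝ) < (n : ℝ) + 1 by positivity) (f - fs k)
      rw [dist_eq_norm] at h1 hk ⊢
      have e : ((n : ℝ) + 1) • R ((n : ℝ) + 1) f - f = ((n : ℝ) + 1) • R ((n : ℝ) + 1) (f - fs k) +
          (((n : ℝ) + 1) • R ((n : ℝ) + 1) (fs k) - fs k) + (fs k - f) := by
        rw [map_sub, smul_sub]; abel
      rw [e]
      have h3 := norm_add₃_le (a := ((n : ℝ) + 1) • R ((n : ℝ) + 1) (f - fs k))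
        (b := ((n : ℝ) + 1) • R ((n : ℝ) + 1) (fs k) - fs k) (c := fs k - f)
      rw [norm_sub_rev f] at h2
      linarith

end GlobalResolvent

end

/-! ### Existence and uniqueness of the associated semigroup -/

section

variable {d : ℕ} {E : Set (Eucl d)} {A : Eucl d → Matrix (Fin d) (Fin d) ℝ}
  {B : Eucl d → Eucl d} {μ : Measure (Eucl d)} {ρ : Eucl d → ℝ} {α : ℝ}
  {Rn : ℕ → ℝ → Lp ℝ 2 μ →L[ℝ] Lp ℝ 2 μ} {R : ℝ → Lp ℝ 2 μ →L[ℝ] Lp ℝ 2 μ}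

theorem GlobalResolvent.isLimitResolvent
    (h : GlobalResolvent E A B μ (fun n : ℕ => sublevel E ρ (4 * n)) Rn R)
    (S : GlobalSetup E A B μ) (hV : Exhaustion E fun n : ℕ => sublevel E ρ (4 * n)) (hα : 0 < α) :
    IsLimitResolvent E A B μ ρ α (R α) := by
  rintro f hf ⟨M, hM⟩
  have hf0 := (Lp.coeFn_nonneg f).2 hf
  refine ⟨fun n => Rn n α f, fun n => ?_, ?_⟩
  · obtain ⟨⟨G, hG⟩, -⟩ := h.isResolvent n α hα f
    refine S.isLocalResolvent_of_weakSol (hV.relCompact n) ((Lp.memLp f).restrict _) hG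
      ⟨α⁻¹ * max M 0, ?_⟩
    have := hG.abs_le_of_abs_le (S.localSetup (hV.relCompact n)) hα (le_max_right M 0)
      (ae_restrict_of_ae (by
        filter_upwards [hf0, hM] with x h1 h2
        rw [abs_of_nonneg h1]; exact h2.trans (le_max_left _ _)))
    filter_upwards [this] with x hx
    rw [inv_mul_eq_div, le_div_iff₀ hα, mul_comm]
    exact hx
  · have h0 := ae_all_iff.2 fun n => (h.isResolvent n α hα f).2
    filter_upwards [h.ae_tendsto S hV hα hf0, h0] with x h1 h2
    refine h1.congr fun n => ?_
    by_cases hx : x ∈ sublevel E ρ (4 * n)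
    · rw [Set.indicator_of_mem hx]
    · rw [Set.indicator_of_notMem hx, h2 n hx]

theorem GlobalSetup.limitResolvent_unique (S : GlobalSetup E A B μ)
    (hV : Exhaustion E fun n : ℕ => sublevel E ρ (4 * n)) (hα : 0 < α)
    {G G' : Lp ℝ 2 μ →L[ℝ] Lp ℝ 2 μ} (hG : IsLimitResolvent E A B μ ρ α G)
    (hG' : IsLimitResolvent E A B μ ρ α G') : G = G' := by
  have key : ∀ f : Lp ℝ 2 μ, 0 ≤ f → (∃ M : ℝ, ∀ᵐ x ∂μ, f x ≤ M) → G f = G' f := by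
    intro f hf hM
    obtain ⟨u, hu, hlim⟩ := hG f hf hM
    obtain ⟨u', hu', hlim'⟩ := hG' f hf hM
    have huu : ∀ᵐ x ∂μ, ∀ n, x ∈ sublevel E ρ (4 * (n : ℕ)) → u n x = u' n x :=
      ae_all_iff.2 fun n => (ae_restrict_iff' (S.measurableSet (hV.relCompact n))).1
        (S.isLocalResolvent_ae_eq (hV.relCompact n) hα (hu n) (hu' n))
    refine Lp.ext ?_
    filter_upwards [hlim, hlim', huu] with x h1 h2 h3
    refine tendsto_nhds_unique h1 (h2.congr fun n => ?_)
    by_cases hx : x ∈ sublevel E ρ (4 * n)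
    · rw [Set.indicator_of_mem hx, Set.indicator_of_mem hx, h3 n hx]
    · rw [Set.indicator_of_notMem hx, Set.indicator_of_notMem hx]
  ext1 f
  refine Lp.induction (by simp) (motive := fun f => G f = G' f) ?_ ?_ ?_ f
  · intro c s hs hμs
    have h1 : (Lp.simpleFunc.indicatorConst 2 hs hμs.ne c : Lp ℝ 2 μ) =
        c • indicatorConstLp 2 hs hμs.ne (1 : ℝ) := by
      rw [Lp.simpleFunc.coe_indicatorConst]
      refine Lp.ext ?_
      filter_upwards [Lp.coeFn_smul c (indicatorConstLp 2 hs hμs.ne (1 : ℝ) : Lp ℝ 2 μ),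
        ae_indicatorConstLp_one hs hμs.ne (μ := μ),
        (indicatorConstLp_coeFn : indicatorConstLp 2 hs hμs.ne c =ᵐ[μ] _)] with x e1 e2 e3
      rw [e1, Pi.smul_apply, e2, e3]
      by_cases hx : x ∈ s <;> simp [hx]
    rw [h1, map_smul, map_smul, key]
    · refine (Lp.coeFn_nonneg _).1 ?_
      filter_upwards [ae_indicatorConstLp_one hs hμs.ne (μ := μ)] with x hx
      rw [hx]; exact Set.indicator_nonneg (fun _ _ => zero_le_one) _
    · refine ⟨1, ?_⟩
      filter_upwards [ae_indicatorConstLp_one hs hμs.ne (μ := μ)] with x hx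
      rw [hx]; exact Set.indicator_le' (fun _ _ => le_rfl) (fun _ _ => zero_le_one) _
  · intro f g hf hg _ h1 h2
    rw [map_add, map_add, h1, h2]
  · exact isClosed_eq G.continuous G'.continuous

theorem isClosed_unitInterval_Lp : IsClosed {f : Lp ℝ 2 μ | ∀ᵐ x ∂μ, 0 ≤ f x ∧ f x ≤ 1} := by
  rw [← isSeqClosed_iff_isClosed]
  intro fs f hfs hlim
  obtain ⟨ns, -, hns⟩ := exists_subseq_ae_of_tendsto hlim
  have h1 : ∀ᵐ x ∂μ, ∀ n, 0 ≤ fs n x ∧ fs n x ≤ 1 := ae_all_iff.2 hfs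
  rw [Set.mem_ofPred_eq]
  filter_upwards [hns, h1] with x h1 h2
  exact ⟨ge_of_tendsto' h1 fun n => (h2 _).1, le_of_tendsto' h1 fun n => (h2 _).2⟩

theorem convex_unitInterval_Lp : Convex ℝ {f : Lp ℝ 2 μ | ∀ᵐ x ∂μ, 0 ≤ f x ∧ f x ≤ 1} := by
  intro f hf g hg a b ha hb hab
  rw [Set.mem_ofPred_eq] at *
  filter_upwards [hf, hg, Lp.coeFn_add (a • f) (b • g), Lp.coeFn_smul a f, Lp.coeFn_smul b g]
    with x h1 h2 e1 e2 e3
  rw [e1, Pi.add_apply, e2, e3, Pi.smul_apply, Pi.smul_apply, smul_eq_mul, smul_eq_mul]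
  constructor
  · have := mul_nonneg ha h1.1; have := mul_nonneg hb h2.1; linarith
  · have := mul_le_mul_of_nonneg_left h1.2 ha; have := mul_le_mul_of_nonneg_left h2.2 hb; linarith

/-- All resolvents have the same range, since `R_α g = R_1 (g - (α - 1) R_α g)`. -/
theorem StrongResolvent.denseRange {X : Type*} [NormedAddCommGroup X] [NormedSpace ℝ X]
    {R : ℝ → X →L[ℝ] X} (h : StrongResolvent R) : DenseRange (R 1) := by
  intro f
  rw [Metric.mem_closure_iff]
  intro ε hε
  obtain ⟨α, hα, g, hg⟩ := h.exists_range_close f hε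
  refine ⟨R α g, ⟨g - (α - 1) • R α g, ?_⟩, by rwa [dist_eq_norm]⟩
  rw [map_sub, map_smul, ← h.resolvent 1 α one_pos hα g]
  abel

/-- Existence and uniqueness of the semigroup associated with the limiting resolvent. -/
theorem GlobalResolvent.exists_associatedSemigroup
    (h : GlobalResolvent E A B μ (fun n : ℕ => sublevel E ρ (4 * n)) Rn R)
    (S : GlobalSetup E A B μ) (hV : Exhaustion E fun n : ℕ => sublevel E ρ (4 * n))
    (hC : DenseCompactBddDomain E A μ) :
    ∃ T : ℝ≥0 → (Lp ℝ 2 μ →L[ℝ] Lp ℝ 2 μ), IsAssociatedSemigroup E A B μ ρ T ∧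
      (∀ T', IsAssociatedSemigroup E A B μ ρ T' → T' = T) ∧
      ∀ α, 0 < α → ∀ f, IsGenerator T (R α f) (α • R α f - f) := by
  have hR := h.strongResolvent S hV hC
  obtain ⟨T, h0, hadd, h1, hsc, hK, hgen⟩ := hR.exists_semigroup
  have hT : IsSubMarkovSemigroup μ T := by
    refine ⟨h0, hadd, h1, hsc, fun t f hf => ?_⟩
    refine hK _ isClosed_unitInterval_Lp convex_unitInterval_Lp (fun α hα g hg => ?_) t f hf
    rw [Set.mem_ofPred_eq] at *
    filter_upwards [h.smul_mem_Icc S hV hα hg, Lp.coeFn_smul α (R α g)] with x e1 e2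
    rw [e2]; exact e1
  refine ⟨T, ⟨hT, fun α hα => ⟨R α, h.isLimitResolvent S hV hα, hgen α hα⟩⟩, ?_, hgen⟩
  rintro T' ⟨hT', hG'⟩
  -- The single parameter `α = 1` is enough: the limiting resolvent is unique there and has dense
  -- range.
  obtain ⟨G', hG', hgen'⟩ := hG' 1 one_pos
  have e := S.limitResolvent_unique hV one_pos hG' (h.isLimitResolvent S hV one_pos)
  subst e
  exact hT'.contractionSemigroup.eq_of_resolvent hT.contractionSemigroup
    (fun f => by have := hgen' f; rwa [one_smul] at this)
    (fun f => by have := hgen 1 one_pos f; rwa [one_smul] at this) hR.denseRange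

end

/-! ### The pointwise algebra of the weight -/

section

section Algebra

theorem sq_le_mul_of_forall_quadratic_nonneg {X Y A : ℝ}
    (h : ∀ t : ℝ, 0 ≤ X + 2 * t * Y + t ^ 2 * A) : Y ^ 2 ≤ X * A := by
  have := discrim_le_zero (a := A) (b := 2 * Y) (c := X) fun t => by have := h t; linarith
  rw [discrim] at this
  linarith

theorem neg_add_le_mul_of_sq_le {a b c X Y A : ℝ} (ha : 0 ≤ a) (hb : 0 ≤ b) (hX : 0 ≤ X)
    (hA : 0 ≤ A) (hY : Y ^ 2 ≤ X * A) (hc : c ^ 2 ≤ 4 * a * b) : -(a * X + b * A) ≤ c * Y := by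
  have h1 : |c * Y| ≤ a * X + b * A := by
    refine abs_le_of_sq_le_sq ?_ (by positivity)
    have h2 : (c * Y) ^ 2 ≤ (4 * a * b) * (X * A) := by
      rw [mul_pow]; exact mul_le_mul hc hY (sq_nonneg _) (by positivity)
    nlinarith [sq_nonneg (a * X - b * A)]
  linarith [neg_abs_le (c * Y)]

/-- Notation for this group of lemmas: `p`, `p₁`, `p₂` are the values of `p` and its derivatives at
`w`, `e` is the exponential factor, `f` and `f₁` are `Φ(ρ)` and `Φ'(ρ)`, `s = κf`, `g = p/w`, and `m
= p₁ + gs`, so that `∂_w P = 2pme`. The right side is `∂_w² P`. The two sides differ by `2e(p p₂ +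
2p₁gs + g²s(s-1))`, which is nonnegative because `s ≥ 1`. -/
theorem barrier_second_derivative {p p₁ p₂ w e g s m : ℝ} (hp : 0 ≤ p) (hp₁ : 0 ≤ p₁)
    (hp₂ : 0 ≤ p₂) (hw : 0 < w) (he : 0 ≤ e) (hg : 0 ≤ g) (hs : 1 ≤ s) (hgw : p = g * w)
    (hm : m = p₁ + g * s) :
    2 * m ^ 2 * e ≤ 2 * p₁ * m * e + 2 * p * (p₂ + p₁ * s / w - g * s / w) * e +
      2 * p * m * (2 * s * (1 / w) * e) := by
  have e4 : 2 * p₁ * m * e + 2 * p * (p₂ + p₁ * s / w - g * s / w) * e +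
      2 * p * m * (2 * s * (1 / w) * e) - 2 * m ^ 2 * e =
      2 * e * (p * p₂ + 2 * p₁ * (g * s) + g ^ 2 * s * (s - 1)) := by
    rw [hm, hgw]; field_simp; ring
  have e5 : 0 ≤ 2 * e * (p * p₂ + 2 * p₁ * (g * s) + g ^ 2 * s * (s - 1)) := by
    have : 0 ≤ s - 1 := by linarith
    have : 0 ≤ s := by linarith
    positivity
  linarith

/-- The condition `1 ≤ 2lf` gives `0 ≤ gκ ≤ 2lm`. So the two contributions to the mixed derivative,
from the exponent of `w` and from the decay in `ρ`, partly cancel and leave a number between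
`-2lf₁m` and `0`. -/
theorem barrier_mixed_derivative {g κ f f₁ l m : ℝ} (hg : 0 ≤ g) (hκ : 0 ≤ κ) (hf₁ : 0 ≤ f₁)
    (hl : 0 ≤ l) (hlf : 1 ≤ 2 * l * f) (hm0 : 0 ≤ m) (hm : g * (κ * f) ≤ m) :
    (g * (κ * f₁) - 2 * f₁ * l * m) ^ 2 ≤ (2 * l * f₁ * m) ^ 2 := by
  have h1 : g * κ ≤ 2 * l * m :=
    calc g * κ = g * κ * 1 := (mul_one _).symm
      _ ≤ g * κ * (2 * l * f) := mul_le_mul_of_nonneg_left hlf (by positivity)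
      _ = 2 * l * (g * (κ * f)) := by ring
      _ ≤ 2 * l * m := mul_le_mul_of_nonneg_left hm (by positivity)
  have h2 : 0 ≤ f₁ * (g * κ) := by positivity
  have h3 := mul_le_mul_of_nonneg_left h1 hf₁
  have h4 : 0 ≤ f₁ * (2 * l * m) := by positivity
  have e1 : g * (κ * f₁) - 2 * f₁ * l * m = f₁ * (g * κ) - f₁ * (2 * l * m) := by ring
  have e2 : 2 * l * f₁ * m = f₁ * (2 * l * m) := by ring
  rw [e1, e2]
  exact sq_le_sq' (by linarith) (by linarith)

/-- Arithmetic–geometric mean, weighted so as to spend only the fraction `l₂ < 1` of the coercive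
term `2m²X`, and exactly the amount `2lf₁²p²A` that the hypothesis on `ρ` supplies. -/
theorem barrier_mixed_term {p m l l₂ f₁ t X Y A : ℝ} (hl : 0 ≤ l) (hll : l ≤ l₂) (hX : 0 ≤ X)
    (hA : 0 ≤ A) (hY : Y ^ 2 ≤ X * A) (ht : t ^ 2 ≤ (2 * l * f₁ * m) ^ 2) :
    -((2 * l₂ * m ^ 2) * X + (2 * l * f₁ ^ 2 * p ^ 2) * A) ≤ (2 * p * t) * Y := by
  refine neg_add_le_mul_of_sq_le (by have := hl.trans hll; positivity) (by positivity) hX hA hY ?_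
  have h1 := mul_le_mul_of_nonneg_left ht (by positivity : 0 ≤ 4 * p ^ 2)
  have h2 : 0 ≤ 16 * p ^ 2 * f₁ ^ 2 * m ^ 2 * l * (l₂ - l) := by
    have : 0 ≤ l₂ - l := by linarith
    positivity
  linear_combination h1 + h2

/-- The budget. Multiplying the hypothesis on `ρ` by `2lp²e` turns the drift term `-2f₁lp²b` into a
gain `2lf₁²p²A`, which pays for the mixed term, and a loss `2lMfp²`. That loss is paid by the
zero-order term `αw ∂_w P`, which contains `2ακf p²`. The remaining `2(1 - l₂)m²X` and a part of the
zero-order term pay for the two terms with the derivative `c'` of the cut-off, up to the error on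
the left. -/
theorem barrier_collect {p p₁ w e g κ f f₁ l l₂ α M X Y A b c c' m t z : ℝ} (hp : 0 ≤ p)
    (hp₁ : 0 ≤ p₁) (hw : 0 < w) (he : 0 ≤ e) (hα : 0 < α) (hM : 0 ≤ M)
    (hκ : κ * α = 4 * M) (hs : 1 ≤ κ * f) (hl : 0 ≤ l) (hll : l ≤ l₂) (hl₂ : l₂ < 1)
    (hf : 0 < f) (hX : 0 ≤ X) (hA : 0 ≤ A) (hY : Y ^ 2 ≤ X * A)
    (hb : f₁ ^ 2 * A + f₁ * b ≤ M * f) (hgw : p = g * w) (hm : m = p₁ + g * (κ * f))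
    (hz : 2 * m ^ 2 * e ≤ z) (ht : t ^ 2 ≤ (2 * l * f₁ * m) ^ 2) :
    α * (p ^ 2 * e) * c ^ 2 - p ^ 2 * e * c' ^ 2 * (2 / (1 - l₂) * A + 2 / α * b ^ 2) ≤
      α * w * (2 * p * m * e) * c ^ 2 + c ^ 2 * z * X +
      (c ^ 2 * (2 * p * t * e) + 2 * (2 * p * m * e) * c * c') * Y +
      (p ^ 2 * (-(2 * f₁ * l) * e) * c ^ 2 + 2 * (p ^ 2 * e) * c * c') * b := by
  obtain ⟨ε, hε⟩ : ∃ ε, ε = 1 - l₂ := ⟨_, rfl⟩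
  have hl₂ε : l₂ = 1 - ε := by rw [hε]; ring
  have hε0 : 0 < ε := by linarith
  rw [← hε]
  have b1 := barrier_mixed_term (p := p) hl hll hX hA hY ht
  -- The cut-off cross term is charged to the fraction `ε = 1 - l₂` of `2m²X` not used in `b1`.
  have b2 : -((2 * ε * c ^ 2 * m ^ 2) * X + (2 / ε * c' ^ 2 * p ^ 2) * A) ≤
      (4 * p * m * c * c') * Y := by
    refine neg_add_le_mul_of_sq_le (by positivity) (by positivity) hX hA hY (le_of_eq ?_)
    field_simp; ring
  have b3 : 2 * l * (f₁ ^ 2 * A + f₁ * b) ≤ 2 * l * (M * f) :=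
    mul_le_mul_of_nonneg_left hb (by positivity)
  have b4 : -(α / 2 * c ^ 2 + 2 / α * (c' ^ 2 * b ^ 2)) ≤ 2 * c * c' * b := by
    have h1 : α / 2 * c ^ 2 + 2 / α * (c' ^ 2 * b ^ 2) + 2 * c * c' * b =
        (α * c + 2 * (c' * b)) ^ 2 / (2 * α) := by field_simp; ring
    have h2 : 0 ≤ (α * c + 2 * (c' * b)) ^ 2 / (2 * α) := by positivity
    linarith
  have b5 : 2 * α * p ^ 2 * (κ * f) ≤ α * w * (2 * p * m) := by
    have h1 : 0 ≤ 2 * α * p * (w * p₁) := by positivity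
    rw [hm]
    have h2 : α * w * (2 * p * (p₁ + g * (κ * f))) =
        2 * α * p * (g * w) * (κ * f) + 2 * α * p * (w * p₁) := by ring
    rw [h2, ← hgw]
    linarith
  have hα4 : α * (κ * f) = 4 * M * f := by rw [← hκ]; ring
  -- Since `ακf = 4Mf`, half of `ακf` pays for the loss `2lMf`, and the other `3ακf/2 ≥ 3α/2` pay
  -- for Young's inequality in `b4` and for the term kept on the left of the conclusion.
  have b6 : 2 * l * (M * f) + α / 2 + α ≤ 2 * α * (κ * f) := by
    have h1 : 2 * l * (M * f) ≤ 2 * 1 * (M * f) :=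
      mul_le_mul_of_nonneg_right (by linarith) (by positivity)
    have h2 : α * 1 ≤ α * (κ * f) := mul_le_mul_of_nonneg_left hs hα.le
    linarith
  have hc : 0 ≤ c ^ 2 := sq_nonneg c
  have k1 := mul_le_mul_of_nonneg_right (mul_le_mul_of_nonneg_left hz hc) hX
  have k2 := mul_le_mul_of_nonneg_left b1 (mul_nonneg he hc)
  have k3 := mul_le_mul_of_nonneg_left b2 he
  have k4 := mul_le_mul_of_nonneg_left b3 (by positivity : 0 ≤ p ^ 2 * e * c ^ 2)
  have k5 := mul_le_mul_of_nonneg_left b4 (by positivity : 0 ≤ p ^ 2 * e)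
  have k6 := mul_le_mul_of_nonneg_right b5 (mul_nonneg he hc)
  have k7 := mul_le_mul_of_nonneg_left b6 (by positivity : 0 ≤ p ^ 2 * e * c ^ 2)
  rw [hl₂ε] at k2
  generalize κ * f = s at *
  linear_combination k1 + k2 + k3 + k4 + k5 + k6 + k7

/-- The algebraic inequality behind the weighted energy estimate. -/
theorem barrier_inequality {p p₁ p₂ w e κ f f₁ l l₂ α M X Y A b c c' : ℝ} (hp : 0 ≤ p)
    (hp₁ : 0 ≤ p₁) (hp₂ : 0 ≤ p₂) (hw : 0 < w) (he : 0 ≤ e) (hα : 0 < α) (hM : 0 ≤ M)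
    (hκ : κ * α = 4 * M) (hs : 1 ≤ κ * f) (hl : 0 ≤ l) (hll : l ≤ l₂) (hl₂ : l₂ < 1)
    (hlf : 1 ≤ 2 * l * f) (hf : 0 < f) (hf₁ : 0 ≤ f₁) (hκ0 : 0 ≤ κ)
    (hX : 0 ≤ X) (hA : 0 ≤ A) (hY : Y ^ 2 ≤ X * A) (hb : f₁ ^ 2 * A + f₁ * b ≤ M * f) :
    α * (p ^ 2 * e) * c ^ 2 - p ^ 2 * e * c' ^ 2 * (2 / (1 - l₂) * A + 2 / α * b ^ 2) ≤
      α * w * (2 * p * (p₁ + p * (κ * f) * (1 / w)) * e) * c ^ 2 +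
      c ^ 2 * (2 * p₁ * (p₁ + p * (κ * f) * (1 / w)) * e +
        2 * p * (p₂ + p₁ * (κ * f) * (1 / w) + p * (κ * f) * (-(1 / w ^ 2))) * e +
        2 * p * (p₁ + p * (κ * f) * (1 / w)) * (2 * (κ * f) * (1 / w) * e)) * X +
      (c ^ 2 * (2 * p * (p * (κ * f₁) * (1 / w)) * e +
        2 * p * (p₁ + p * (κ * f) * (1 / w)) * (-(2 * f₁ * l) * e)) +
        2 * (2 * p * (p₁ + p * (κ * f) * (1 / w)) * e) * c * c') * Y +
      (p ^ 2 * (-(2 * f₁ * l) * e) * c ^ 2 + 2 * (p ^ 2 * e) * c * c') * b := by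
  obtain ⟨g, hg⟩ : ∃ g, g = p / w := ⟨_, rfl⟩
  obtain ⟨m, hm⟩ : ∃ m, m = p₁ + g * (κ * f) := ⟨_, rfl⟩
  have hg0 : 0 ≤ g := hg ▸ div_nonneg hp hw.le
  have hgw : p = g * w := by rw [hg, div_mul_cancel₀ p hw.ne']
  have hgs : 0 ≤ g * (κ * f) := mul_nonneg hg0 (by linarith)
  have hz := barrier_second_derivative hp hp₁ hp₂ hw he hg0 hs hgw hm
  have ht := barrier_mixed_derivative hg0 hκ0 hf₁ hl hlf (by linarith : 0 ≤ m) (by linarith)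
  have key := barrier_collect (c := c) (c' := c') hp hp₁ hw he hα hM hκ hs hl hll hl₂ hf hX hA hY
    hb hgw hm hz ht
  have e1 : p₁ + p * (κ * f) * (1 / w) = m := by rw [hm, hg]; ring
  have e2 : p₂ + p₁ * (κ * f) * (1 / w) + p * (κ * f) * (-(1 / w ^ 2)) =
      p₂ + p₁ * (κ * f) / w - g * (κ * f) / w := by
    rw [hg]; field_simp; ring
  have e3 : 2 * p * (p * (κ * f₁) * (1 / w)) * e + 2 * p * m * (-(2 * f₁ * l) * e) =
      2 * p * (g * (κ * f₁) - 2 * f₁ * l * m) * e := by rw [hg]; ring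
  rw [e1, e2, e3]
  exact key

end Algebra

/-! ### The cut-off functions p and l entering the weight -/

section Barrier

/-- The ingredients of the weight functions: a convex function `p` vanishing exactly on
`(-∞,γ]`, and a smooth function `l` which is the logarithm on `[γ,∞)`. -/
structure BarrierData (γ : ℝ) (p p₁ p₂ l l₁ l₂ : ℝ → ℝ) : Prop where
  smooth_p : ContDiff ℝ ∞ p
  smooth_p₁ : ContDiff ℝ ∞ p₁
  smooth_l : ContDiff ℝ ∞ l
  smooth_l₁ : ContDiff ℝ ∞ l₁
  deriv_p : ∀ w, HasDerivAt p (p₁ w) w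
  deriv_p₁ : ∀ w, HasDerivAt p₁ (p₂ w) w
  deriv_l : ∀ w, HasDerivAt l (l₁ w) w
  deriv_l₁ : ∀ w, HasDerivAt l₁ (l₂ w) w
  zero : ∀ w ≤ γ, p w = 0 ∧ p₁ w = 0
  pos : ∀ w, γ < w → 0 < p w
  nonneg₁ : ∀ w, 0 ≤ p₁ w
  nonneg₂ : ∀ w, 0 ≤ p₂ w
  le_one : ∀ w ≤ 1, p w ≤ 1
  eq_log : ∀ w, γ < w → l w = Real.log w ∧ l₁ w = 1 / w ∧ l₂ w = -(1 / w ^ 2)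

/-- The function `p` is the antiderivative of a smooth transition shifted to start at `γ`, hence
convex; `l` is the logarithm of a smooth truncation of `w` that stays above `γ/2`. Below `γ` the
function `l` is irrelevant, because `p` vanishes there. -/
theorem exists_barrierData {γ : ℝ} (hγ : 0 < γ) :
    ∃ p p₁ p₂ l l₁ l₂, BarrierData γ p p₁ p₂ l l₁ l₂ := by
  obtain ⟨Ψ, hΨ, hΨ0, hΨd⟩ := exists_smooth_antideriv Real.smoothTransition.contDiff
  obtain ⟨θ, hθ, hθδ, hθ1, -⟩ := exists_smooth_truncation (half_pos hγ)
  have hτ0 : ∀ w, 0 < γ + θ (w - γ) := fun w => by linarith [hθδ (w - γ)]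
  have hτ : ContDiff ℝ ∞ fun w => γ + θ (w - γ) :=
    contDiff_const.add (hθ.comp (contDiff_id.sub contDiff_const))
  set l : ℝ → ℝ := fun w => Real.log (γ + θ (w - γ)) with hl
  have hls : ContDiff ℝ ∞ l := hτ.log fun w => (hτ0 w).ne'
  have hl1s : ContDiff ℝ ∞ (deriv l) := by
    exact (contDiff_infty_iff_deriv.1 hls).2
  have hσ : ContDiff ℝ ∞ Real.smoothTransition := Real.smoothTransition.contDiff
  have hlog : ∀ w, γ < w → l w = Real.log w := fun w hw => by
    simp only [hl, (hθ1 (w - γ) (by linarith)).1]; congr 1; ring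
  have hloge : ∀ w, γ < w → l =ᶠ[𝓝 w] Real.log := fun w hw => by
    filter_upwards [Ioi_mem_nhds hw] with z hz using hlog z hz
  have hl1 : ∀ w, γ < w → deriv l w = 1 / w := fun w hw => by
    rw [(hloge w hw).deriv_eq, Real.deriv_log, one_div]
  have hΨmono : Monotone Ψ := monotone_of_hasDerivAt_nonneg hΨd
    fun s => Real.smoothTransition.nonneg s
  have hΨz : ∀ s ≤ 0, Ψ s = 0 := by
    intro s hs
    have : ∀ x ∈ Set.Icc s 0, Ψ x = Ψ s := by
      refine constant_of_has_deriv_right_zero (hΨ.continuous.continuousOn) fun x hx => ?_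
      have := (hΨd x).hasDerivWithinAt (s := Set.Ici x)
      rwa [Real.smoothTransition.zero_of_nonpos hx.2.le] at this
    rw [← this 0 ⟨hs, le_rfl⟩, hΨ0]
  have hshift : ∀ w, HasDerivAt (fun w => w - γ) 1 w := fun w => (hasDerivAt_id w).sub_const γ
  refine ⟨fun w => Ψ (w - γ), fun w => Real.smoothTransition (w - γ),
    fun w => deriv Real.smoothTransition (w - γ), l, deriv l, deriv (deriv l),
    hΨ.comp (contDiff_id.sub contDiff_const), hσ.comp (contDiff_id.sub contDiff_const), hls, hl1s,
    fun w => ?_, fun w => ?_, fun w => (hls.differentiable (by simp) w).hasDerivAt,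
    fun w => (hl1s.differentiable (by simp) w).hasDerivAt, fun w hw => ⟨hΨz _ (by linarith),
      Real.smoothTransition.zero_of_nonpos (by linarith)⟩, fun w hw => ?_,
    fun w => Real.smoothTransition.nonneg _, fun w => deriv_smoothTransition_nonneg _,
    fun w hw => ?_, fun w hw => ⟨hlog w hw, hl1 w hw, ?_⟩⟩
  · simpa [Function.comp_def] using (hΨd (w - γ)).comp w (hshift w)
  · have := ((hσ.differentiable (by simp) (w - γ)).hasDerivAt).comp w (hshift w)
    simpa [Function.comp_def] using this
  · have h1 : StrictMonoOn Ψ (Set.Ici 0) := by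
      refine strictMonoOn_of_deriv_pos (convex_Ici 0) hΨ.continuous.continuousOn fun s hs => ?_
      rw [interior_Ici] at hs
      rw [(hΨd s).deriv]; exact Real.smoothTransition.pos_of_pos hs
    have := h1 (Set.mem_Ici.2 le_rfl) (Set.mem_Ici.2 (sub_pos.2 hw).le) (sub_pos.2 hw)
    rwa [hΨ0] at this
  · have h1 : Ψ (w - γ) ≤ Ψ 1 := hΨmono (by linarith)
    have h2 := (convex_Icc (0 : ℝ) 1).norm_image_sub_le_of_norm_hasDerivWithin_le (C := 1)
      (fun s _ => (hΨd s).hasDerivWithinAt) (fun s _ => by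
        rw [Real.norm_of_nonneg (Real.smoothTransition.nonneg s)]
        exact Real.smoothTransition.le_one s) (Set.left_mem_Icc.2 zero_le_one)
      (Set.right_mem_Icc.2 zero_le_one)
    rw [hΨ0] at h2
    simp only [sub_zero, Real.norm_eq_abs, abs_one, mul_one] at h2
    exact h1.trans ((le_abs_self _).trans h2)
  · have h1 : deriv l =ᶠ[𝓝 w] fun w => 1 / w := by
      filter_upwards [Ioi_mem_nhds hw] with z hz using hl1 z hz
    rw [h1.deriv_eq]
    simp

end Barrier

end

/-! ### Chain rules for functions of u and ρ, and derivatives of the weight -/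

section

section Chain

variable {d : ℕ} {E V K : Set (Eucl d)} {A : Eucl d → Matrix (Fin d) (Fin d) ℝ}
  {B : Eucl d → Eucl d} {μ : Measure (Eucl d)} {u ρ : Eucl d → ℝ} {G Dρ : Eucl d → Eucl d}

/-- The function `ρ` belongs to the form domain only locally, so `F(u,ρ)` is admissible on `V` only
if it vanishes off a compact subset. A spatial cut-off equal to `1` on that subset does not alter
the function, but moves its approximations into the class of test functions. Boundedness of `u` and
`ρ` permits replacing `F` by a bounded modification. -/
theorem GlobalSetup.hGrad_comp_pair (S : GlobalSetup E A B μ) (hV : IsRelCompactOpen E V)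
    (hK : IsCompact K) (hKV : K ⊆ V) (hu : HGrad (μ.restrict V) {f | IsTest E V f} u G)
    {g : ℕ → Eucl d → ℝ} (hρ : GradApprox (μ.restrict V) g ρ Dρ) {M : ℝ}
    (hM : ∀ᵐ x ∂(μ.restrict V), |u x| ≤ M) (hM' : ∀ᵐ x ∂(μ.restrict V), |ρ x| ≤ M)
    {F : ℝ × ℝ → ℝ} (hF : ContDiff ℝ ∞ F) (h0 : ∀ᵐ x ∂(μ.restrict V), x ∉ K →
      F (u x, ρ x) = 0 ∧ fderiv ℝ F (u x, ρ x) = 0) :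
    HGrad (μ.restrict V) {f | IsTest E V f} (fun x => F (u x, ρ x))
      (fun x => fderiv ℝ F (u x, ρ x) (1, 0) • G x + fderiv ℝ F (u x, ρ x) (0, 1) • Dρ x) := by
  have := S.finite_restrict hV
  obtain ⟨F', hF', -, ⟨C, hC⟩, heq, -⟩ := exists_bounded_modification hF M
  obtain ⟨χ, hχ, hχc, hχ01, hχK, hχt⟩ := hV.exists_cutoff hK hKV
  obtain ⟨C', hC'⟩ := exists_gradient_bound hχ hχc
  obtain ⟨f, hf, hfu⟩ := hu
  have h1 := (hfu.comp_pair hρ hF' hC).smooth_mul hχ (C := max 1 C')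
    (fun x => by rw [abs_of_nonneg (hχ01 x).1]; exact (hχ01 x).2.trans (le_max_left _ _))
    (fun x => (hC' x).trans (le_max_right _ _))
  refine HGrad.congr ⟨_, fun n => hχt _ (hF'.comp ((hfu.smooth n).prodMk (hρ.smooth n))), h1⟩ ?_ ?_
  · filter_upwards [h0, hM, hM'] with x hx hx1 hx2
    have hn : ‖(u x, ρ x)‖ ≤ M := by simp [Prod.norm_def, hx1, hx2]
    rw [(heq _ hn).1]
    by_cases hxK : x ∈ K
    · rw [(hχK x hxK).1, one_mul]
    · rw [(hx hxK).1, mul_zero]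
  · filter_upwards [h0, hM, hM'] with x hx hx1 hx2
    have hn : ‖(u x, ρ x)‖ ≤ M := by simp [Prod.norm_def, hx1, hx2]
    rw [(heq _ hn).1, (heq _ hn).2]
    by_cases hxK : x ∈ K
    · rw [(hχK x hxK).1, (hχK x hxK).2, one_smul, smul_zero, add_zero]
    · rw [(hx hxK).1, (hx hxK).2]; simp

theorem fderiv_apply_fst {F : ℝ × ℝ → ℝ} {s r a : ℝ} (hF : DifferentiableAt ℝ F (s, r))
    (h : HasDerivAt (fun t => F (t, r)) a s) : fderiv ℝ F (s, r) (1, 0) = a := by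
  have h1 : HasDerivAt (fun t : ℝ => (t, r)) ((1 : ℝ), (0 : ℝ)) s :=
    (hasDerivAt_id s).prodMk (hasDerivAt_const s r)
  exact (HasFDerivAt.comp_hasDerivAt s (f := fun t : ℝ => (t, r)) hF.hasFDerivAt h1).unique h

theorem fderiv_apply_snd {F : ℝ × ℝ → ℝ} {s r a : ℝ} (hF : DifferentiableAt ℝ F (s, r))
    (h : HasDerivAt (fun t => F (s, t)) a r) : fderiv ℝ F (s, r) (0, 1) = a := by
  have h1 : HasDerivAt (fun t : ℝ => (s, t)) ((0 : ℝ), (1 : ℝ)) r :=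
    (hasDerivAt_const r s).prodMk (hasDerivAt_id r)
  exact (HasFDerivAt.comp_hasDerivAt r (f := fun t : ℝ => (s, t)) hF.hasFDerivAt h1).unique h

theorem fderiv_eq_zero_of_snd_gt {F : ℝ × ℝ → ℝ} {r₀ : ℝ} (h : ∀ s r, r₀ < r → F (s, r) = 0)
    {s r : ℝ} (hr : r₀ < r) : fderiv ℝ F (s, r) = 0 := by
  have h1 : F =ᶠ[𝓝 (s, r)] fun _ => 0 := by
    filter_upwards [continuous_snd.continuousAt.eventually (lt_mem_nhds hr)] with q hq
    exact h q.1 q.2 hq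
  rw [h1.fderiv_eq]; simp

end Chain

section Weight

variable {γ : ℝ} {p p₁ p₂ l l₁ l₂ Φ Φ₁ χ χ₁ : ℝ → ℝ} {κ a : ℝ}

/-- The exponential factor `e^{-2Φ(r)(a - κ l(w))}`. -/
def barrierExp (l Φ : ℝ → ℝ) (κ a w r : ℝ) : ℝ := Real.exp (-(2 * Φ r * (a - κ * l w)))

/-- The weight `p(w)² e^{-2Φ(r)(a - κ l(w))}`. -/
def barrier (p l Φ : ℝ → ℝ) (κ a w r : ℝ) : ℝ := p w ^ 2 * barrierExp l Φ κ a w r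

/-- The derivative of `barrier` in `w`. -/
def barrierDeriv (p p₁ l l₁ Φ : ℝ → ℝ) (κ a w r : ℝ) : ℝ :=
  2 * p w * (p₁ w + p w * (κ * Φ r) * l₁ w) * barrierExp l Φ κ a w r

theorem hasDerivAt_barrierExp_left (hl : ∀ w, HasDerivAt l (l₁ w) w) (w r : ℝ) :
    HasDerivAt (fun w => barrierExp l Φ κ a w r)
      (2 * (κ * Φ r) * l₁ w * barrierExp l Φ κ a w r) w := by
  have := (((((hl w).const_mul κ).const_sub a).const_mul (2 * Φ r)).fun_neg).exp
  exact this.congr_deriv (by unfold barrierExp; ring)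

theorem hasDerivAt_barrierExp_right (hΦ : ∀ r, HasDerivAt Φ (Φ₁ r) r) (w r : ℝ) :
    HasDerivAt (fun r => barrierExp l Φ κ a w r)
      (-(2 * Φ₁ r * (a - κ * l w)) * barrierExp l Φ κ a w r) r := by
  have := ((((hΦ r).const_mul 2).mul_const (a - κ * l w)).fun_neg).exp
  exact this.congr_deriv (by unfold barrierExp; ring)

theorem hasDerivAt_barrier_left (hp : ∀ w, HasDerivAt p (p₁ w) w)
    (hl : ∀ w, HasDerivAt l (l₁ w) w) (w r : ℝ) :
    HasDerivAt (fun w => barrier p l Φ κ a w r) (barrierDeriv p p₁ l l₁ Φ κ a w r) w := by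
  have := ((hp w).fun_pow 2).fun_mul (hasDerivAt_barrierExp_left (Φ := Φ) (κ := κ) (a := a) hl w r)
  exact this.congr_deriv (by unfold barrierDeriv; push_cast; ring)

theorem hasDerivAt_barrier_right (hΦ : ∀ r, HasDerivAt Φ (Φ₁ r) r) (w r : ℝ) :
    HasDerivAt (fun r => barrier p l Φ κ a w r)
      (p w ^ 2 * (-(2 * Φ₁ r * (a - κ * l w)) * barrierExp l Φ κ a w r)) r :=
  (hasDerivAt_barrierExp_right hΦ w r).const_mul _

theorem hasDerivAt_barrierDeriv_left (hp : ∀ w, HasDerivAt p (p₁ w) w)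
    (hp₁ : ∀ w, HasDerivAt p₁ (p₂ w) w) (hl : ∀ w, HasDerivAt l (l₁ w) w)
    (hl₁ : ∀ w, HasDerivAt l₁ (l₂ w) w) (w r : ℝ) :
    HasDerivAt (fun w => barrierDeriv p p₁ l l₁ Φ κ a w r)
      (2 * p₁ w * (p₁ w + p w * (κ * Φ r) * l₁ w) * barrierExp l Φ κ a w r +
        2 * p w * (p₂ w + p₁ w * (κ * Φ r) * l₁ w + p w * (κ * Φ r) * l₂ w) *
          barrierExp l Φ κ a w r +
        2 * p w * (p₁ w + p w * (κ * Φ r) * l₁ w) *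
          (2 * (κ * Φ r) * l₁ w * barrierExp l Φ κ a w r)) w := by
  have := (((hp w).const_mul 2).fun_mul
    ((hp₁ w).fun_add (((hp w).mul_const (κ * Φ r)).fun_mul (hl₁ w)))).fun_mul
    (hasDerivAt_barrierExp_left (Φ := Φ) (κ := κ) (a := a) hl w r)
  exact this.congr_deriv (by ring)

theorem hasDerivAt_barrierDeriv_right (hΦ : ∀ r, HasDerivAt Φ (Φ₁ r) r) (w r : ℝ) :
    HasDerivAt (fun r => barrierDeriv p p₁ l l₁ Φ κ a w r)
      (2 * p w * (p w * (κ * Φ₁ r) * l₁ w) * barrierExp l Φ κ a w r +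
        2 * p w * (p₁ w + p w * (κ * Φ r) * l₁ w) *
          (-(2 * Φ₁ r * (a - κ * l w)) * barrierExp l Φ κ a w r)) r := by
  have := (((((hΦ r).const_mul κ).const_mul (p w)).mul_const (l₁ w)).const_add
    (p₁ w)).const_mul (2 * p w)
  exact (this.fun_mul (hasDerivAt_barrierExp_right (κ := κ) (a := a) hΦ w r)).congr_deriv (by ring)

theorem contDiff_barrierExp (hl : ContDiff ℝ ∞ l) (hΦ : ContDiff ℝ ∞ Φ) :
    ContDiff ℝ ∞ fun q : ℝ × ℝ => barrierExp l Φ κ a q.1 q.2 :=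
  (((contDiff_const.mul (hΦ.comp contDiff_snd)).mul
    (contDiff_const.sub (contDiff_const.mul (hl.comp contDiff_fst)))).neg).exp

theorem contDiff_barrier (hp : ContDiff ℝ ∞ p) (hl : ContDiff ℝ ∞ l) (hΦ : ContDiff ℝ ∞ Φ) :
    ContDiff ℝ ∞ fun q : ℝ × ℝ => barrier p l Φ κ a q.1 q.2 :=
  ((hp.comp contDiff_fst).pow 2).mul (contDiff_barrierExp hl hΦ)

theorem contDiff_barrierDeriv (hp : ContDiff ℝ ∞ p) (hp₁ : ContDiff ℝ ∞ p₁) (hl : ContDiff ℝ ∞ l)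
    (hl₁ : ContDiff ℝ ∞ l₁) (hΦ : ContDiff ℝ ∞ Φ) :
    ContDiff ℝ ∞ fun q : ℝ × ℝ => barrierDeriv p p₁ l l₁ Φ κ a q.1 q.2 :=
  ((contDiff_const.mul (hp.comp contDiff_fst)).mul ((hp₁.comp contDiff_fst).add
    (((hp.comp contDiff_fst).mul (contDiff_const.mul (hΦ.comp contDiff_snd))).mul
      (hl₁.comp contDiff_fst)))).mul (contDiff_barrierExp hl hΦ)

/-- The chain rule for a cut-off weight evaluated at `(1 - α u, ρ)`. -/
theorem GlobalSetup.hGrad_weight {d : ℕ} {E V K : Set (Eucl d)}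
    {A : Eucl d → Matrix (Fin d) (Fin d) ℝ}
    {B : Eucl d → Eucl d} {μ : Measure (Eucl d)} {u ρ : Eucl d → ℝ} {G Dρ : Eucl d → Eucl d}
    (S : GlobalSetup E A B μ) (hV : IsRelCompactOpen E V)
    (hK : IsCompact K) (hKV : K ⊆ V) (hu : HGrad (μ.restrict V) {f | IsTest E V f} u G)
    {g : ℕ → Eucl d → ℝ} (hρ : GradApprox (μ.restrict V) g ρ Dρ) {M : ℝ}
    (hM : ∀ᵐ x ∂(μ.restrict V), |u x| ≤ M) (hM' : ∀ᵐ x ∂(μ.restrict V), |ρ x| ≤ M)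
    {W Ww Wr : ℝ → ℝ → ℝ} (hW : ContDiff ℝ ∞ fun q : ℝ × ℝ => W q.1 q.2)
    (hWw : ∀ w r, HasDerivAt (fun w => W w r) (Ww w r) w)
    (hWr : ∀ w r, HasDerivAt (fun r => W w r) (Wr w r) r)
    (hχ : ContDiff ℝ ∞ χ) (hχ₁ : ∀ r, HasDerivAt χ (χ₁ r) r) {r₀ : ℝ}
    (hχ0 : ∀ r, r₀ < r → χ r = 0) (hρK : ∀ᵐ x ∂(μ.restrict V), x ∉ K → r₀ < ρ x) (α : ℝ) :
    HGrad (μ.restrict V) {f | IsTest E V f} (fun x => W (1 - α * u x) (ρ x) * χ (ρ x) ^ 2)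
      (fun x => (-(α * (Ww (1 - α * u x) (ρ x) * χ (ρ x) ^ 2))) • G x +
        (Wr (1 - α * u x) (ρ x) * χ (ρ x) ^ 2 +
          2 * W (1 - α * u x) (ρ x) * χ (ρ x) * χ₁ (ρ x)) • Dρ x) := by
  have hF : ContDiff ℝ ∞ fun q : ℝ × ℝ => W (1 - α * q.1) q.2 * χ q.2 ^ 2 :=
    (hW.comp ((contDiff_const.sub (contDiff_const.mul contDiff_fst)).prodMk contDiff_snd)).mul
      ((hχ.comp contDiff_snd).pow 2)
  have h0 : ∀ s r, r₀ < r → (fun q : ℝ × ℝ => W (1 - α * q.1) q.2 * χ q.2 ^ 2) (s, r) = 0 :=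
    fun s r hr => by simp [hχ0 r hr]
  have key := S.hGrad_comp_pair hV hK hKV hu hρ hM hM' hF (by
    filter_upwards [hρK] with x hx hxK
    exact ⟨h0 _ _ (hx hxK), fderiv_eq_zero_of_snd_gt h0 (hx hxK)⟩)
  refine key.congr (ae_of_all _ fun x => rfl) (ae_of_all _ fun x => ?_)
  have hd := hF.differentiable (by simp) (u x, ρ x)
  have h1 : HasDerivAt (fun s => W (1 - α * s) (ρ x)) (Ww (1 - α * u x) (ρ x) * -(α * 1)) (u x) :=
    HasDerivAt.comp (u x) (h := fun s => 1 - α * s) (h₂ := fun w => W w (ρ x))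
      (hWw (1 - α * u x) (ρ x)) (((hasDerivAt_id (u x)).const_mul α).const_sub 1)
  have h2 := fderiv_apply_fst hd (h1.mul_const (χ (ρ x) ^ 2))
  have h3 := fderiv_apply_snd hd ((hWr (1 - α * u x) (ρ x)).fun_mul ((hχ₁ (ρ x)).fun_pow 2))
  simp only [h2, h3]
  congr 2
  · ring
  · push_cast; ring

end Weight

end

/-! ### The pointwise lower bound for the weighted integrand -/

section

section Pointwise

variable {γ : ℝ} {p p₁ p₂ l l₁ l₂ : ℝ → ℝ}

theorem BarrierData.barrier_le (D : BarrierData γ p p₁ p₂ l l₁ l₂) {Φ : ℝ → ℝ} {κ a w r : ℝ}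
    (hw1 : w ≤ 1) (hκ : 0 ≤ κ) (hγ : 0 < γ) (hΦ : 0 ≤ Φ r) :
    0 ≤ barrier p l Φ κ a w r ∧ barrier p l Φ κ a w r ≤ Real.exp (-(2 * Φ r * a)) := by
  refine ⟨mul_nonneg (sq_nonneg _) (Real.exp_nonneg _), ?_⟩
  rcases le_or_gt w γ with hw | hw
  · rw [barrier, (D.zero w hw).1]; simp; positivity
  · have h1 : p w ^ 2 ≤ 1 := pow_le_one₀ (D.pos w hw).le (D.le_one w hw1)
    have h2 : barrierExp l Φ κ a w r ≤ Real.exp (-(2 * Φ r * a)) := by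
      refine Real.exp_le_exp.2 (neg_le_neg (mul_le_mul_of_nonneg_left ?_ (by positivity)))
      have : κ * l w ≤ 0 := by
        rw [(D.eq_log w hw).1]
        exact mul_nonpos_of_nonneg_of_nonpos hκ (Real.log_nonpos (hγ.trans hw).le hw1)
      linarith
    calc barrier p l Φ κ a w r ≤ 1 * Real.exp (-(2 * Φ r * a)) :=
          mul_le_mul h1 h2 (Real.exp_nonneg _) zero_le_one
      _ = _ := one_mul _

/-- The variables stand for `X = ⟨A∇w,∇w⟩`, `Y = ⟨A∇w,∇ρ⟩`, `Aρ = ⟨A∇ρ,∇ρ⟩`, `b = ⟨B,∇ρ⟩`, and `c`,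
`c'` for the cut-off and its derivative. For `w ≤ γ` all terms with the weight vanish. For `γ < w ≤
1` the exponent satisfies `a ≤ a - κ log w ≤ a₂`, which is the range required by
`barrier_inequality`, and `N` bounds the weight times `c'²`. -/
theorem BarrierData.pointwise (D : BarrierData γ p p₁ p₂ l l₁ l₂) {Φ Φ₁ : ℝ → ℝ}
    {κ a a₂ w r α M X Y Aρ b c c' N : ℝ} (hγ : 0 < γ) (hw1 : w ≤ 1) (hα : 0 < α) (hM : 0 ≤ M)
    (hκ : κ * α = 4 * M) (hs : 1 ≤ κ * Φ r) (ha : 0 ≤ a) (haγ : a - κ * Real.log γ ≤ a₂)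
    (ha₂ : a₂ < 1) (haΦ : 1 ≤ 2 * a * Φ r) (hΦ : 0 < Φ r) (hΦ₁ : 0 ≤ Φ₁ r) (hκ0 : 0 ≤ κ)
    (hX : 0 ≤ X) (hA : 0 ≤ Aρ) (hY : Y ^ 2 ≤ X * Aρ)
    (hb : Φ₁ r ^ 2 * Aρ + Φ₁ r * b ≤ M * Φ r) (hN : 0 ≤ N)
    (hcN : c' ^ 2 * Real.exp (-(2 * Φ r * a)) ≤ N) :
    α * (barrier p l Φ κ a w r * c ^ 2) - N * (2 / (1 - a₂) * Aρ + 2 / α * b ^ 2) ≤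
      α * w * (barrierDeriv p p₁ l l₁ Φ κ a w r * c ^ 2) +
      (2 * p₁ w * (p₁ w + p w * (κ * Φ r) * l₁ w) * barrierExp l Φ κ a w r +
        2 * p w * (p₂ w + p₁ w * (κ * Φ r) * l₁ w + p w * (κ * Φ r) * l₂ w) *
          barrierExp l Φ κ a w r +
        2 * p w * (p₁ w + p w * (κ * Φ r) * l₁ w) *
          (2 * (κ * Φ r) * l₁ w * barrierExp l Φ κ a w r)) * c ^ 2 * X +
      ((2 * p w * (p w * (κ * Φ₁ r) * l₁ w) * barrierExp l Φ κ a w r +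
        2 * p w * (p₁ w + p w * (κ * Φ r) * l₁ w) *
          (-(2 * Φ₁ r * (a - κ * l w)) * barrierExp l Φ κ a w r)) * c ^ 2 +
          2 * barrierDeriv p p₁ l l₁ Φ κ a w r * c * c') * Y +
      (p w ^ 2 * (-(2 * Φ₁ r * (a - κ * l w)) * barrierExp l Φ κ a w r) * c ^ 2 +
        2 * barrier p l Φ κ a w r * c * c') * b := by
  have ha₂0 : 0 < 1 - a₂ := by linarith
  have hQ0 : 0 ≤ 2 / (1 - a₂) * Aρ + 2 / α * b ^ 2 := by positivity
  rcases le_or_gt w γ with hw | hw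
  · have h0 := mul_nonneg hN hQ0
    simp only [barrier, barrierDeriv, (D.zero w hw).1, (D.zero w hw).2]
    ring_nf at h0 ⊢
    linarith
  · have hw0 : 0 < w := hγ.trans hw
    have hlog : Real.log w ≤ 0 := Real.log_nonpos hw0.le hw1
    have hlogγ : Real.log γ ≤ Real.log w := Real.log_le_log hγ hw.le
    have h1 : κ * Real.log w ≤ 0 := mul_nonpos_of_nonneg_of_nonpos hκ0 hlog
    have h2 := mul_le_mul_of_nonneg_left hlogγ hκ0
    have hle := (D.barrier_le (Φ := Φ) (κ := κ) (a := a) (r := r) hw1 hκ0 hγ hΦ.le)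
    have hNle : barrier p l Φ κ a w r * c' ^ 2 ≤ N := by
      refine le_trans ?_ hcN
      rw [mul_comm]
      exact mul_le_mul_of_nonneg_left hle.2 (sq_nonneg _)
    have h3 := mul_le_mul_of_nonneg_right hNle hQ0
    have key := barrier_inequality (c := c) (c' := c') (D.pos w hw).le (D.nonneg₁ w)
      (D.nonneg₂ w) hw0
      (Real.exp_nonneg (-(2 * Φ r * (a - κ * Real.log w)))) hα hM hκ hs
      (l := a - κ * Real.log w) (l₂ := a₂) (by linarith) (by linarith)
      ha₂ (by nlinarith) hΦ hΦ₁ hκ0 hX hA hY hb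
    obtain ⟨e1, e2, e3⟩ := D.eq_log w hw
    simp only [barrier, barrierDeriv, barrierExp, e1, e2, e3] at h3 ⊢
    linarith

end Pointwise

/-! ### The integrated weighted estimate -/

section Integral

variable {d : ℕ} {A : Eucl d → Matrix (Fin d) (Fin d) ℝ} {B : Eucl d → Eucl d}
  {ν : Measure (Eucl d)} {𝒯 : Set (Eucl d → ℝ)} {α : ℝ} {u v v' : Eucl d → ℝ}
  {G H H' : Eucl d → Eucl d}

/-- The equation for `w = 1 - αu` tested with `v`, plus the vanishing integral of `⟨B,∇v'⟩`. It is
used with `v = ∂_w P χ²` and `v' = P χ²`, when the terms containing `⟨B,∇u⟩` cancel pointwise. -/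
theorem WeakSol.integral_eq_zero (S : LocalSetup A B ν 𝒯) (h : WeakSol A B ν 𝒯 α (fun _ => 1) u G)
    (hv : HGrad ν 𝒯 v H) (hvM : ∃ M : ℝ, ∀ᵐ x ∂ν, |v x| ≤ M) (hv' : HGrad ν 𝒯 v' H') :
    Integrable (fun x => α * v x - α * (α * (u x * v x) + aForm A x (G x) (H x) -
        inner ℝ (B x) (G x) * v x) + inner ℝ (B x) (H' x)) ν ∧
      ∫ x, (α * v x - α * (α * (u x * v x) + aForm A x (G x) (H x) -
        inner ℝ (B x) (G x) * v x) + inner ℝ (B x) (H' x)) ∂ν = 0 := by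
  have := S.finite
  obtain ⟨M, hM⟩ := hvM
  have i1 : Integrable v ν := hv.memLp.integrable (by norm_num)
  have i2 : Integrable (fun x => u x * v x) ν := integrable_mul_of_memLp h.memLp hv.memLp
  have i3 := LocalSetup.integrable_aForm S h.memLp_grad hv.memLp_grad
  have i4 : Integrable (fun x => inner ℝ (B x) (G x) * v x) ν :=
    integrable_mul_of_bdd (LocalSetup.integrable_inner_B S h.memLp_grad) hv.memLp.1 hM
  have i5 := LocalSetup.integrable_inner_B S hv'.memLp_grad
  have i6 : Integrable (fun x => α * (α * (u x * v x) + aForm A x (G x) (H x) -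
      inner ℝ (B x) (G x) * v x)) ν := (((i2.const_mul α).add i3).sub i4).const_mul α
  refine ⟨((i1.const_mul α).sub i6).add i5, ?_⟩
  have e := h.2.2 v H hv ⟨M, hM⟩
  rw [integral_add (f := fun x => α * v x - α * (α * (u x * v x) + aForm A x (G x) (H x) -
      inner ℝ (B x) (G x) * v x)) ((i1.const_mul α).sub i6) i5, LocalSetup.integral_inner_B S hv',
    integral_sub (i1.const_mul α) i6, integral_const_mul, integral_const_mul,
    integral_sub (f := fun x => α * (u x * v x) + aForm A x (G x) (H x))
      ((i2.const_mul α).add i3) i4, integral_add (i2.const_mul α) i3, integral_const_mul, e]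
  simp

theorem aForm_sq_le {x : Eucl d} (h : (A x).IsSymm) (hpos : ∀ ξ, 0 ≤ aForm A x ξ ξ)
    (ξ η : Eucl d) : aForm A x ξ η ^ 2 ≤ aForm A x ξ ξ * aForm A x η η := by
  refine sq_le_mul_of_forall_quadratic_nonneg fun t => ?_
  have := hpos (ξ + t • η)
  rw [aForm_add_left, aForm_add_right, aForm_add_right, aForm_smul_left, aForm_smul_left,
    aForm_smul_right, aForm_smul_right, aForm_comm h η ξ] at this
  linarith

end Integral

section Estimate

variable {d : ℕ} {E V K R : Set (Eucl d)} {A : Eucl d → Matrix (Fin d) (Fin d) ℝ}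
  {B : Eucl d → Eucl d} {μ : Measure (Eucl d)} {u ρ : Eucl d → ℝ} {G Dρ : Eucl d → Eucl d}
  {γ : ℝ} {p p₁ p₂ l l₁ l₂ Φ Φ₁ χ χ₁ : ℝ → ℝ}

theorem exists_bound_of_continuous {W : ℝ → ℝ → ℝ} (hW : Continuous fun q : ℝ × ℝ => W q.1 q.2)
    (M : ℝ) : ∃ C, ∀ w r, |w| ≤ M → |r| ≤ M → |W w r| ≤ C := by
  obtain ⟨C, hC⟩ := (isCompact_closedBall (0 : ℝ × ℝ) M).exists_bound_of_continuousOn hW.continuousOn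
  refine ⟨C, fun w r hw hr => hC (w, r) ?_⟩
  rw [mem_closedBall_zero_iff]; simp [Prod.norm_def, hw, hr]

/-- Integrate `BarrierData.pointwise` with `w = 1 - αu` and `∇w = -αG`. The full integrand has
integral zero by `WeakSol.integral_eq_zero`, so the weighted mass of `w` is bounded by the error
supported where the cut-off varies. -/
theorem GlobalSetup.barrier_estimate (S : GlobalSetup E A B μ) (hV : IsRelCompactOpen E V)
    (hK : IsCompact K) (hKV : K ⊆ V) {α : ℝ} (hα : 0 < α)
    (h : WeakSol A B (μ.restrict V) {f | IsTest E V f} α (fun _ => 1) u G)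
    {g : ℕ → Eucl d → ℝ} (hρ : GradApprox (μ.restrict V) g ρ Dρ) {M₀ : ℝ}
    (hM₀ : ∀ᵐ x ∂(μ.restrict V), |ρ x| ≤ M₀)
    (D : BarrierData γ p p₁ p₂ l l₁ l₂) (hγ : 0 < γ) (hΦs : ContDiff ℝ ∞ Φ)
    (hΦd : ∀ r, HasDerivAt Φ (Φ₁ r) r) (hχ : ContDiff ℝ ∞ χ) (hχ₁ : ∀ r, HasDerivAt χ (χ₁ r) r)
    {r₀ : ℝ} (hχ0 : ∀ r, r₀ < r → χ r = 0) (hρK : ∀ᵐ x ∂(μ.restrict V), x ∉ K → r₀ < ρ x)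
    {κ a a₂ M k : ℝ} (hM : 0 ≤ M) (hκ : κ * α = 4 * M) (hs : ∀ r, 1 ≤ κ * Φ r) (ha : 0 ≤ a)
    (haγ : a - κ * Real.log γ ≤ a₂) (ha₂ : a₂ < 1) (haΦ : ∀ r, 1 ≤ 2 * a * Φ r)
    (hΦ : ∀ r, 0 < Φ r) (hΦ₁ : ∀ r, 0 ≤ Φ₁ r) (hκ0 : 0 ≤ κ)
    (hb : ∀ᵐ x ∂(μ.restrict V), Φ₁ (ρ x) ^ 2 * aForm A x (Dρ x) (Dρ x) +
      Φ₁ (ρ x) * inner ℝ (B x) (Dρ x) ≤ M * Φ (ρ x))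
    (hR : MeasurableSet R) (hRV : R ⊆ V) (hk : 0 ≤ k)
    (hχR : ∀ᵐ x ∂(μ.restrict V),
      χ₁ (ρ x) ^ 2 * Real.exp (-(2 * Φ (ρ x) * a)) ≤ R.indicator (fun _ => k) x)
    (hBR : MemLp (fun x => inner ℝ (B x) (Dρ x)) 2 (μ.restrict R)) :
    α * ∫ x in V, barrier p l Φ κ a (1 - α * u x) (ρ x) * χ (ρ x) ^ 2 ∂μ ≤
      k * (2 / (1 - a₂) * ∫ x in R, aForm A x (Dρ x) (Dρ x) ∂μ +
        2 / α * ∫ x in R, (inner ℝ (B x) (Dρ x)) ^ 2 ∂μ) := by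
  have S' := S.localSetup hV
  have := S'.finite
  have hu0 := h.nonneg_of_nonneg S' hα (ae_of_all _ fun _ => zero_le_one)
  have hu1 := h.le_of_le S' hα (M := 1) zero_le_one (ae_of_all _ fun _ => le_rfl)
  -- One bound for `|ρ|`, for `u ≤ 1/α` and for `w = 1 - αu`, so that a single compact square
  -- contains all arguments of the weight.
  set M₁ := max (max M₀ α⁻¹) 1 with hM₁
  have hMu : ∀ᵐ x ∂(μ.restrict V), |u x| ≤ M₁ := by
    filter_upwards [hu0, hu1] with x h0 h1
    rw [abs_of_nonneg h0]
    have : u x ≤ α⁻¹ := by rw [← mul_one α⁻¹, le_inv_mul_iff₀ hα]; exact h1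
    exact this.trans ((le_max_right _ _).trans (le_max_left _ _))
  have hMρ : ∀ᵐ x ∂(μ.restrict V), |ρ x| ≤ M₁ := by
    filter_upwards [hM₀] with x hx using hx.trans ((le_max_left _ _).trans (le_max_left _ _))
  have hP := S.hGrad_weight hV hK hKV h.1 hρ hMu hMρ
    (contDiff_barrier (κ := κ) (a := a) D.smooth_p D.smooth_l hΦs)
    (hasDerivAt_barrier_left D.deriv_p D.deriv_l) (hasDerivAt_barrier_right hΦd) hχ hχ₁ hχ0 hρK α
  have hQs := contDiff_barrierDeriv (κ := κ) (a := a) D.smooth_p D.smooth_p₁ D.smooth_l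
    D.smooth_l₁ hΦs
  have hQ := S.hGrad_weight hV hK hKV h.1 hρ hMu hMρ hQs
    (hasDerivAt_barrierDeriv_left D.deriv_p D.deriv_p₁ D.deriv_l D.deriv_l₁)
    (hasDerivAt_barrierDeriv_right hΦd) hχ hχ₁ hχ0 hρK α
  have hQb : ∃ M : ℝ, ∀ᵐ x ∂(μ.restrict V),
      |barrierDeriv p p₁ l l₁ Φ κ a (1 - α * u x) (ρ x) * χ (ρ x) ^ 2| ≤ M := by
    obtain ⟨C, hC⟩ := exists_bound_of_continuous
      (W := fun w r => barrierDeriv p p₁ l l₁ Φ κ a w r * χ r ^ 2)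
      (hQs.continuous.mul ((hχ.continuous.comp continuous_snd).pow 2)) M₁
    refine ⟨C, ?_⟩
    filter_upwards [hu0, hu1, hMρ] with x h0 h1 h2
    refine hC _ _ ?_ h2
    refine le_trans ?_ (le_max_right _ _)
    have := mul_nonneg hα.le h0
    rw [abs_le]; constructor <;> linarith
  obtain ⟨hI, hI0⟩ := h.integral_eq_zero S' hQ hQb hP
  have hPi : Integrable (fun x => barrier p l Φ κ a (1 - α * u x) (ρ x) * χ (ρ x) ^ 2)
    (μ.restrict V) := hP.memLp.integrable (by norm_num)
  have hAi : Integrable (fun x => aForm A x (Dρ x) (Dρ x)) (μ.restrict R) :=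
    (LocalSetup.integrable_aForm S' hρ.memLp_grad hρ.memLp_grad).mono_measure (Measure.restrict_mono_set μ hRV)
  have hBi : Integrable (fun x => (inner ℝ (B x) (Dρ x)) ^ 2) (μ.restrict R) := hBR.integrable_sq
  have hABi := (hAi.const_mul (2 / (1 - a₂))).add (hBi.const_mul (2 / α))
  have hRr : (μ.restrict V).restrict R = μ.restrict R := by
    rw [Measure.restrict_restrict hR, Set.inter_eq_left.2 hRV]
  have hRi : Integrable (R.indicator fun x => k * (2 / (1 - a₂) * aForm A x (Dρ x) (Dρ x) +
      2 / α * (inner ℝ (B x) (Dρ x)) ^ 2)) (μ.restrict V) := by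
    rw [integrable_indicator_iff hR, IntegrableOn, hRr]
    exact hABi.const_mul k
  have hint : ∫ x in V, (R.indicator (fun x => k * (2 / (1 - a₂) * aForm A x (Dρ x) (Dρ x) +
      2 / α * (inner ℝ (B x) (Dρ x)) ^ 2)) x) ∂μ =
      k * (2 / (1 - a₂) * ∫ x in R, aForm A x (Dρ x) (Dρ x) ∂μ +
        2 / α * ∫ x in R, (inner ℝ (B x) (Dρ x)) ^ 2 ∂μ) := by
    rw [integral_indicator hR, hRr, integral_const_mul,
      integral_add (hAi.const_mul _) (hBi.const_mul _), integral_const_mul, integral_const_mul]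
  have hle := integral_mono_ae ((hPi.const_mul α).sub hRi) hI (by
    filter_upwards [hu0, hu1, hb, hχR, LocalSetup.aForm_nonneg S', S'.symm] with x h0 h1 h2 h3 h4 h5
    have h6 := mul_nonneg hα.le h0
    have hY := aForm_sq_le h5 h4 (-α • G x) (Dρ x)
    have key := D.pointwise (c := χ (ρ x)) (c' := χ₁ (ρ x)) hγ (w := 1 - α * u x) (by linarith)
      hα hM hκ (hs (ρ x)) ha haγ ha₂ (haΦ (ρ x)) (hΦ (ρ x)) (hΦ₁ (ρ x)) hκ0 (h4 (-α • G x))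
      (h4 (Dρ x)) hY h2 (Set.indicator_nonneg (fun _ _ => hk) x) h3
    simp only [aForm_add_right, aForm_smul_right, aForm_smul_left, inner_add_right,
      inner_smul_right] at key ⊢
    have e : R.indicator (fun x => k * (2 / (1 - a₂) * aForm A x (Dρ x) (Dρ x) +
      2 / α * (inner ℝ (B x) (Dρ x)) ^ 2)) x = R.indicator (fun _ => k) x *
        (2 / (1 - a₂) * aForm A x (Dρ x) (Dρ x) + 2 / α * (inner ℝ (B x) (Dρ x)) ^ 2) := by
      by_cases hx : x ∈ R <;> simp [hx]
    change α * (barrier p l Φ κ a (1 - α * u x) (ρ x) * χ (ρ x) ^ 2) - R.indicator _ x ≤ _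
    rw [e]
    refine key.trans (le_of_eq ?_)
    ring)
  rw [hI0, integral_sub' (hPi.const_mul α) hRi, integral_const_mul, hint] at hle
  linarith

end Estimate

end

/-! ### Annulus integrals, cut-offs in ρ, and the bound on sublevel sets -/

section

/-- A continuous function on `E`, locally in the domain of the form, whose sublevel sets exhaust
`E` by relatively compact open sets. -/
structure ExhaustionFunction {d : ℕ} (E : Set (Eucl d)) (A : Eucl d → Matrix (Fin d) (Fin d) ℝ)
    (μ : Measure (Eucl d)) (ρ : Eucl d → ℝ) (Dρ : Eucl d → Eucl d) : Prop where
  cont : ContinuousOn ρ E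
  nonneg : ∀ x ∈ E, 0 ≤ ρ x
  grad : HasLocFormGradient E A μ ρ Dρ
  exhaustion : Exhaustion E fun n : ℕ => sublevel E ρ (4 * n)

section Ahat

variable {d : ℕ} {E V : Set (Eucl d)} {A : Eucl d → Matrix (Fin d) (Fin d) ℝ}
  {B : Eucl d → Eucl d} {μ : Measure (Eucl d)} {ρ : Eucl d → ℝ} {Dρ : Eucl d → Eucl d}
  {n : ℕ} {b : ℝ} {ϕ : ℝ → ℝ}

theorem integral_le_sq_of_essSup_le {X : Type*} [MeasurableSpace X] {ν : Measure X} {f : X → ℝ}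
    (hf : 0 ≤ᵐ[ν] f) (hfm : AEStronglyMeasurable f ν) (hb : 0 ≤ b)
    (h : essSup (fun x => ENNReal.ofReal (f x)) ν ^ (1 / 2 : ℝ) * ν Set.univ ^ (1 / 2 : ℝ) ≤
      ENNReal.ofReal b) : ∫ x, f x ∂ν ≤ b ^ 2 := by
  rw [integral_eq_lintegral_of_nonneg_ae hf hfm]
  have h1 : ∫⁻ x, ENNReal.ofReal (f x) ∂ν ≤ ENNReal.ofReal b ^ 2 := by
    calc ∫⁻ x, ENNReal.ofReal (f x) ∂ν
        ≤ ∫⁻ _, essSup (fun x => ENNReal.ofReal (f x)) ν ∂ν := lintegral_mono_ae (ENNReal.ae_le_essSup _)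
      _ = essSup (fun x => ENNReal.ofReal (f x)) ν * ν Set.univ := lintegral_const _
      _ = (essSup (fun x => ENNReal.ofReal (f x)) ν ^ (1 / 2 : ℝ) * ν Set.univ ^ (1 / 2 : ℝ)) ^ 2 := by
          rw [mul_pow, ← ENNReal.rpow_natCast, ← ENNReal.rpow_natCast, ← ENNReal.rpow_mul,
            ← ENNReal.rpow_mul]
          norm_num
      _ ≤ ENNReal.ofReal b ^ 2 := by gcongr
  rw [← ENNReal.ofReal_pow hb] at h1
  exact ENNReal.toReal_le_of_le_ofReal (sq_nonneg b) h1

theorem integral_sq_le_of_eLpNorm_le {X : Type*} [MeasurableSpace X] {ν : Measure X} {f : X → ℝ}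
    (hfm : AEStronglyMeasurable f ν) (hb : 0 ≤ b) (h : eLpNorm f 2 ν ≤ ENNReal.ofReal b) :
    MemLp f 2 ν ∧ ∫ x, f x ^ 2 ∂ν ≤ b ^ 2 := by
  refine ⟨⟨hfm, h.trans_lt ENNReal.ofReal_lt_top⟩, ?_⟩
  rw [integral_eq_lintegral_of_nonneg_ae (ae_of_all _ fun x => sq_nonneg _) (hfm.pow 2)]
  refine ENNReal.toReal_le_of_le_ofReal (sq_nonneg b) ?_
  rw [eLpNorm_eq_lintegral_rpow_enorm_toReal (by norm_num) (by norm_num)] at h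
  have h1 := ENNReal.rpow_le_rpow h (by norm_num : (0 : ℝ) ≤ 2)
  rw [← ENNReal.rpow_mul] at h1
  norm_num at h1
  rw [ENNReal.ofReal_pow hb]
  refine le_trans (le_of_eq (lintegral_congr fun x => ?_)) h1
  rw [← Real.enorm_of_nonneg (sq_nonneg (f x)), enorm_pow]

/-- The energy of `ρ` on the annulus is at most the essential supremum times the measure, whose
square root is one summand of `Ahat`; the drift norm is another. The remaining summand is
nonnegative and may be dropped from an upper bound. -/
theorem GlobalSetup.Ahat_bounds (S : GlobalSetup E A B μ)
    (hV : IsRelCompactOpen E (sublevel E ρ (4 * n))) (hDρ : MemLp Dρ 2 (μ.restrict (sublevel E ρ (4 * n))))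
    (hb : 0 ≤ b) (h : Ahat E A B μ ρ Dρ ϕ n ≤ ENNReal.ofReal b) :
    MemLp (fun x => inner ℝ (B x) (Dρ x)) 2
        (μ.restrict (sublevel E ρ (4 * n) \ sublevel E ρ (2 * n))) ∧
      ∫ x in sublevel E ρ (4 * n) \ sublevel E ρ (2 * n), (inner ℝ (B x) (Dρ x)) ^ 2 ∂μ ≤ b ^ 2 ∧
      ∫ x in sublevel E ρ (4 * n) \ sublevel E ρ (2 * n), aForm A x (Dρ x) (Dρ x) ∂μ ≤ b ^ 2 := by
  have S' := S.localSetup hV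
  have hle : μ.restrict (sublevel E ρ (4 * n) \ sublevel E ρ (2 * n)) ≤
    μ.restrict (sublevel E ρ (4 * n)) := Measure.restrict_mono_set μ Set.sdiff_subset
  have hm1 := (S'.integrable_inner_B hDρ).1.mono_measure hle
  have hm2 := (S'.integrable_aForm hDρ hDρ).1.mono_measure hle
  unfold Ahat at h
  obtain ⟨h1, h2⟩ := integral_sq_le_of_eLpNorm_le hm1 hb (le_add_self.trans h)
  refine ⟨h1, h2, integral_le_sq_of_essSup_le ?_ hm2 hb ?_⟩
  · filter_upwards [(Measure.absolutelyContinuous_of_le hle).ae_le S'.aForm_nonneg] with x hx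
      using hx _
  · rw [Measure.restrict_apply_univ]
    refine le_trans ?_ (le_self_add.trans h)
    gcongr
    exact le_self_add

end Ahat

section Cutoff

/-- The cut-off descends for `ρ` between `5n/2` and `7n/2`, strictly inside the annulus from `2n` to
`4n`: it has support in a compact subset of `V_n`, equals `1` on `E_{2n}`, and its slope is of order
`1/n`. -/
theorem exists_cutoff_transition :
    ∃ C : ℝ, 0 ≤ C ∧ ∀ n : ℕ, 1 ≤ n → ∃ χ χ₁ : ℝ → ℝ, ContDiff ℝ ∞ χ ∧
      (∀ r, HasDerivAt χ (χ₁ r) r) ∧ (∀ r, 7 / 2 * (n : ℝ) < r → χ r = 0) ∧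
      (∀ r, r ≤ 5 / 2 * (n : ℝ) → χ r = 1) ∧ (∀ r, r < 2 * (n : ℝ) → χ₁ r = 0) ∧
      ∀ r, χ₁ r ^ 2 ≤ (C / n) ^ 2 := by
  obtain ⟨C, hC⟩ := exists_deriv_smoothTransition_bound
  have hC0 : 0 ≤ C := (abs_nonneg _).trans (hC 0)
  refine ⟨C, hC0, fun n hn => ?_⟩
  have hn0 : (0 : ℝ) < n := by exact_mod_cast hn
  have hlin : ∀ r, HasDerivAt (fun r : ℝ => (7 / 2 * (n : ℝ) - r) / n) (-1 / n) r := fun r =>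
    ((hasDerivAt_id r).const_sub _).div_const _
  have hσ : ContDiff ℝ ∞ Real.smoothTransition := Real.smoothTransition.contDiff
  refine ⟨fun r => Real.smoothTransition ((7 / 2 * (n : ℝ) - r) / n),
    fun r => deriv Real.smoothTransition ((7 / 2 * (n : ℝ) - r) / n) * (-1 / n),
    hσ.comp ((contDiff_const.sub contDiff_id).div_const _), fun r => ?_, fun r hr => ?_,
    fun r hr => ?_, fun r hr => ?_, fun r => ?_⟩
  · exact HasDerivAt.comp (h₂ := Real.smoothTransition) r
      ((hσ.differentiable (by simp) _).hasDerivAt) (hlin r)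
  · exact Real.smoothTransition.zero_of_nonpos (div_nonpos_of_nonpos_of_nonneg (by linarith) hn0.le)
  · exact Real.smoothTransition.one_of_one_le (by rw [le_div_iff₀ hn0]; linarith)
  · change deriv Real.smoothTransition _ * _ = 0
    rw [deriv_smoothTransition_of_one_lt (by rw [lt_div_iff₀ hn0]; linarith), zero_mul]
  · rw [sq_le_sq, abs_mul, abs_div, abs_div, abs_neg, abs_one, abs_of_pos hn0, abs_of_nonneg hC0,
      div_eq_mul_one_div C]
    exact mul_le_mul_of_nonneg_right (hC _) (by positivity)

end Cutoff

section Local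

variable {d : ℕ} {E : Set (Eucl d)} {A : Eucl d → Matrix (Fin d) (Fin d) ℝ}
  {B : Eucl d → Eucl d} {μ : Measure (Eucl d)} {ρ : Eucl d → ℝ} {Dρ : Eucl d → Eucl d}
  {n : ℕ}

theorem ExhaustionFunction.exists_gradApprox (X : ExhaustionFunction E A μ ρ Dρ)
    (S : GlobalSetup E A B μ) (n : ℕ) :
    ∃ g, GradApprox (μ.restrict (sublevel E ρ (4 * n))) g ρ Dρ := by
  have hV := X.exhaustion.relCompact n
  obtain ⟨v, H, hvH, h1, h2⟩ := X.grad _ hV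
  obtain ⟨g, -, hg⟩ := S.exists_gradApprox hV (GlobalSetup.subset hV) hvH
  exact ⟨g, hg.congr h1.symm h2.symm⟩

theorem ExhaustionFunction.isCompact_le (X : ExhaustionFunction E A μ ρ Dρ) {r : ℝ}
    (hr : r < 4 * n) : IsCompact {x | x ∈ E ∧ ρ x ≤ r} := by
  obtain ⟨-, K, hK, hVK, hKE⟩ := X.exhaustion.relCompact n
  have : {x | x ∈ E ∧ ρ x ≤ r} = K ∩ ρ ⁻¹' Set.Iic r := by
    ext x
    refine ⟨fun hx => ⟨hVK ⟨hx.1, hx.2.trans_lt hr⟩, hx.2⟩, fun hx => ⟨hKE hx.1, hx.2⟩⟩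
  rw [this]
  exact hK.of_isClosed_subset ((X.cont.mono hKE).preimage_isClosed_of_isClosed hK.isClosed
    isClosed_Iic) Set.inter_subset_left

theorem ExhaustionFunction.measurableSet_sublevel (X : ExhaustionFunction E A μ ρ Dρ)
    (S : GlobalSetup E A B μ) (r : ℝ) : MeasurableSet (sublevel E ρ r) := by
  obtain ⟨U, hU, hUE⟩ := (continuousOn_iff'.1 X.cont) (Set.Iio r) isOpen_Iio
  have : sublevel E ρ r = U ∩ E := by rw [← hUE]; ext x; exact and_comm
  rw [this]
  exact hU.measurableSet.inter S.measE

/-- On the annulus monotonicity of `Φ` bounds the weight by `e^{-2aΦ(2n)}`, the cut-off contributes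
`n^{-2}`, and the integrals of `⟨A∇ρ,∇ρ⟩` and `⟨B,∇ρ⟩²` contribute `b²`. The constant `C` does not
depend on `n`, so the bound can be used along the exhaustion. -/
theorem ExhaustionFunction.exists_barrier_bound (X : ExhaustionFunction E A μ ρ Dρ)
    (S : GlobalSetup E A B μ) {γ : ℝ} {p p₁ p₂ l l₁ l₂ Φ Φ₁ ϕ : ℝ → ℝ}
    (D : BarrierData γ p p₁ p₂ l l₁ l₂) (hγ : 0 < γ) (hΦs : ContDiff ℝ ∞ Φ)
    (hΦd : ∀ r, HasDerivAt Φ (Φ₁ r) r) {α κ a a₂ M : ℝ} (hα : 0 < α) (hM : 0 ≤ M)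
    (hκ : κ * α = 4 * M) (hs : ∀ r, 1 ≤ κ * Φ r) (ha : 0 ≤ a)
    (haγ : a - κ * Real.log γ ≤ a₂) (ha₂ : a₂ < 1) (haΦ : ∀ r, 1 ≤ 2 * a * Φ r)
    (hΦ : ∀ r, 0 < Φ r) (hΦ₁ : ∀ r, 0 ≤ Φ₁ r) (hκ0 : 0 ≤ κ)
    (hb : ∀ᵐ x ∂μ, Φ₁ (ρ x) ^ 2 * aForm A x (Dρ x) (Dρ x) +
      Φ₁ (ρ x) * inner ℝ (B x) (Dρ x) ≤ M * Φ (ρ x)) :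
    ∃ C : ℝ, ∀ (n : ℕ) (b : ℝ) (u : Eucl d → ℝ) (G : Eucl d → Eucl d) (s : Set (Eucl d)), 1 ≤ n →
      0 ≤ b → Ahat E A B μ ρ Dρ ϕ n ≤ ENNReal.ofReal b →
      WeakSol A B (μ.restrict (sublevel E ρ (4 * n))) {f | IsTest E (sublevel E ρ (4 * n)) f} α
        (fun _ => 1) u G → MeasurableSet s → s ⊆ sublevel E ρ (2 * n) →
      IntegrableOn (fun x => barrier p l Φ κ a (1 - α * u x) (ρ x)) s μ ∧
      ∫ x in s, barrier p l Φ κ a (1 - α * u x) (ρ x) ∂μ ≤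
        C * (b / n * Real.exp (-(a * Φ (2 * n)))) ^ 2 := by
  obtain ⟨C, hC0, hC⟩ := exists_cutoff_transition
  refine ⟨α⁻¹ * (C ^ 2 * (2 / (1 - a₂) + 2 / α)), fun n b u G s hn hb0 hA h hsm hsn => ?_⟩
  obtain ⟨χ, χ₁, hχ, hχ₁, hχ0, hχ1, hχ2, hχC⟩ := hC n hn
  have hn0 : (0 : ℝ) < n := by exact_mod_cast hn
  have hV := X.exhaustion.relCompact n
  have S' := S.localSetup hV
  have := S'.finite
  have hVm := S.measurableSet hV
  obtain ⟨g, hg⟩ := X.exists_gradApprox S n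
  obtain ⟨hB1, hB2, hA2⟩ := S.Ahat_bounds hV hg.memLp_grad hb0 hA
  have hρb : ∀ᵐ x ∂(μ.restrict (sublevel E ρ (4 * n))), |ρ x| ≤ 4 * n := by
    filter_upwards [ae_restrict_mem hVm] with x hx
    rw [abs_of_nonneg (X.nonneg x hx.1)]; exact hx.2.le
  have hΦm : Monotone Φ := monotone_of_hasDerivAt_nonneg hΦd hΦ₁
  set k := (C / n) ^ 2 * Real.exp (-(2 * Φ (2 * n) * a)) with hk
  have key := S.barrier_estimate hV (X.isCompact_le (n := n) (r := 7 / 2 * n) (by linarith))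
    (fun x hx => ⟨hx.1, hx.2.trans_lt (by linarith)⟩) hα h hg hρb D hγ hΦs hΦd hχ hχ₁ hχ0 (by
      filter_upwards [ae_restrict_mem hVm] with x hx hxK
      by_contra hle
      exact hxK ⟨hx.1, not_lt.1 hle⟩) hM hκ hs ha haγ ha₂ haΦ hΦ hΦ₁ hκ0 (ae_restrict_of_ae hb)
    (R := sublevel E ρ (4 * n) \ sublevel E ρ (2 * n)) (k := k)
    (hVm.diff (X.measurableSet_sublevel S _)) Set.sdiff_subset (by positivity) (by
      filter_upwards [ae_restrict_mem hVm] with x hx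
      by_cases hx2 : ρ x < 2 * n
      · rw [hχ2 _ hx2]
        simp only [ne_eq, OfNat.ofNat_ne_zero, not_false_eq_true, zero_pow, zero_mul]
        exact Set.indicator_nonneg (fun _ _ => by positivity) x
      · rw [Set.indicator_of_mem (show x ∈ sublevel E ρ (4 * n) \ sublevel E ρ (2 * n) from
          ⟨hx, fun h => hx2 h.2⟩)]
        refine mul_le_mul (hχC _) (Real.exp_le_exp.2 (neg_le_neg ?_)) (Real.exp_nonneg _)
          (by positivity)
        have := hΦm (not_lt.1 hx2)
        gcongr) hB1
  have hu0 := h.nonneg_of_nonneg S' hα (ae_of_all _ fun _ => zero_le_one)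
  have hbar : ∀ᵐ x ∂(μ.restrict (sublevel E ρ (4 * n))),
      0 ≤ barrier p l Φ κ a (1 - α * u x) (ρ x) ∧ barrier p l Φ κ a (1 - α * u x) (ρ x) ≤ 1 := by
    filter_upwards [hu0] with x hx
    have h1 := D.barrier_le (Φ := Φ) (κ := κ) (a := a) (r := ρ x) (w := 1 - α * u x)
      (by have := mul_nonneg hα.le hx; linarith) hκ0 hγ (hΦ _).le
    refine ⟨h1.1, h1.2.trans (Real.exp_le_one_iff.2 (neg_nonpos.2 ?_))⟩
    have := haΦ (ρ x)
    linarith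
  have hρm : AEStronglyMeasurable ρ (μ.restrict (sublevel E ρ (4 * n))) := hg.memLp.1
  have hbm : AEStronglyMeasurable (fun x => barrier p l Φ κ a (1 - α * u x) (ρ x))
      (μ.restrict (sublevel E ρ (4 * n))) :=
    (contDiff_barrier D.smooth_p D.smooth_l hΦs).continuous.comp_aestronglyMeasurable
      ((aestronglyMeasurable_const.sub (h.memLp.1.const_mul α)).prodMk hρm)
  have hbi : Integrable (fun x => barrier p l Φ κ a (1 - α * u x) (ρ x))
      (μ.restrict (sublevel E ρ (4 * n))) := by
    refine Integrable.of_bound hbm 1 ?_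
    filter_upwards [hbar] with x hx
    rw [Real.norm_of_nonneg hx.1]; exact hx.2
  have hsV : s ⊆ sublevel E ρ (4 * n) := fun x hx => ⟨(hsn hx).1, (hsn hx).2.trans (by linarith)⟩
  refine ⟨hbi.mono_measure (Measure.restrict_mono_set μ hsV), ?_⟩
  have hbχ : Integrable (fun x => barrier p l Φ κ a (1 - α * u x) (ρ x) * χ (ρ x) ^ 2)
      (μ.restrict (sublevel E ρ (4 * n))) := by
    obtain ⟨C', hC'⟩ := isCompact_Icc.exists_bound_of_continuousOn (s := Set.Icc (-(4 * n : ℝ)) (4 * n))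
      (hχ.continuous.pow 2).continuousOn
    refine hbi.mul_bdd (c := C') ((hχ.continuous.comp_aestronglyMeasurable hρm).pow 2) ?_
    filter_upwards [hρb] with x hx
    exact hC' _ (abs_le.1 hx)
  have h1 : ∫ x in s, barrier p l Φ κ a (1 - α * u x) (ρ x) ∂μ =
      ∫ x in s, barrier p l Φ κ a (1 - α * u x) (ρ x) * χ (ρ x) ^ 2 ∂μ := by
    refine setIntegral_congr_fun hsm fun x hx => ?_
    rw [hχ1 _ ((hsn hx).2.le.trans (by linarith))]; ring
  have h2 : ∫ x in s, barrier p l Φ κ a (1 - α * u x) (ρ x) * χ (ρ x) ^ 2 ∂μ ≤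
      ∫ x in sublevel E ρ (4 * n), barrier p l Φ κ a (1 - α * u x) (ρ x) * χ (ρ x) ^ 2 ∂μ := by
    refine setIntegral_mono_set hbχ ?_ (LE.le.eventuallyLE hsV)
    filter_upwards [hbar] with x hx
    exact mul_nonneg hx.1 (sq_nonneg _)
  have ha₂0 : 0 < 1 - a₂ := by linarith
  have h3 : k * (2 / (1 - a₂) * ∫ x in sublevel E ρ (4 * n) \ sublevel E ρ (2 * n),
      aForm A x (Dρ x) (Dρ x) ∂μ + 2 / α * ∫ x in sublevel E ρ (4 * n) \ sublevel E ρ (2 * n),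
        (inner ℝ (B x) (Dρ x)) ^ 2 ∂μ) ≤ k * (2 / (1 - a₂) * b ^ 2 + 2 / α * b ^ 2) := by
    have : 0 ≤ k := by positivity
    gcongr
  have h4 : k * (2 / (1 - a₂) * b ^ 2 + 2 / α * b ^ 2) = C ^ 2 * (2 / (1 - a₂) + 2 / α) *
      (b / n * Real.exp (-(a * Φ (2 * n)))) ^ 2 := by
    have : Real.exp (-(2 * Φ (2 * n) * a)) = Real.exp (-(a * Φ (2 * n))) ^ 2 := by
      rw [← Real.exp_nat_mul]; congr 1; push_cast; ring
    rw [hk, this]; field_simp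
  rw [mul_assoc, ← h4, h1, le_inv_mul_iff₀ hα]
  exact ((mul_le_mul_of_nonneg_left h2 hα.le).trans key).trans h3

end Local

end

/-! ### The limit along the exhaustion -/

section

/-- Monotonicity in `w` lets the local `1 - αu_n` be replaced by the smaller limit `1 - U` before
the bound tends to zero. -/
theorem BarrierData.barrier_mono {γ : ℝ} {p p₁ p₂ l l₁ l₂ : ℝ → ℝ}
    (D : BarrierData γ p p₁ p₂ l l₁ l₂) {Φ : ℝ → ℝ} {κ a w w' r : ℝ} (hww' : w ≤ w')
    (hκ : 0 ≤ κ) (hγ : 0 < γ) (hΦ : 0 ≤ Φ r) : barrier p l Φ κ a w r ≤ barrier p l Φ κ a w' r := by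
  rcases le_or_gt w γ with hw | hw
  · rw [barrier, (D.zero w hw).1]
    simp only [ne_eq, OfNat.ofNat_ne_zero, not_false_eq_true, zero_pow, zero_mul]
    exact mul_nonneg (sq_nonneg _) (Real.exp_nonneg _)
  · have hp : Monotone p := monotone_of_hasDerivAt_nonneg D.deriv_p D.nonneg₁
    have h1 : p w ^ 2 ≤ p w' ^ 2 := pow_le_pow_left₀ (D.pos w hw).le (hp hww') 2
    refine mul_le_mul h1 (Real.exp_le_exp.2 (neg_le_neg (mul_le_mul_of_nonneg_left ?_
      (by positivity)))) (Real.exp_nonneg _) (sq_nonneg _)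
    rw [(D.eq_log w hw).1, (D.eq_log w' (hw.trans_le hww')).1]
    have := mul_le_mul_of_nonneg_left (Real.log_le_log (hγ.trans hw) hww') hκ
    linarith

variable {d : ℕ} {E : Set (Eucl d)} {A : Eucl d → Matrix (Fin d) (Fin d) ℝ}
  {B : Eucl d → Eucl d} {μ : Measure (Eucl d)} {ρ : Eucl d → ℝ} {Dρ : Eucl d → Eucl d}
  {Rn : ℕ → ℝ → Lp ℝ 2 μ →L[ℝ] Lp ℝ 2 μ} {R : ℝ → Lp ℝ 2 μ →L[ℝ] Lp ℝ 2 μ}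

theorem Exhaustion.ae_exists_mem {V : ℕ → Set (Eucl d)} (hV : Exhaustion E V)
    (S : GlobalSetup E A B μ) : ∀ᵐ x ∂μ, ∃ n, x ∈ V n := by
  filter_upwards [S.ae_mem] with x hx
  obtain ⟨n, hn⟩ := hV.exists_subset {x} isCompact_singleton (Set.singleton_subset_iff.2 hx)
  exact ⟨n, hn rfl⟩

/-- On a fixed `E_{4m}` the integral of the weight at `1 - U` is below the one at `1 - αu_n` for
every `n ≥ 2m`, hence zero in the limit. The weight is positive wherever `1 - U > γ`, so that set is
null. -/
theorem ExhaustionFunction.one_sub_le (X : ExhaustionFunction E A μ ρ Dρ)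
    (S : GlobalSetup E A B μ) {γ : ℝ} {Φ Φ₁ ϕ : ℝ → ℝ} (hγ : 0 < γ) (hΦs : ContDiff ℝ ∞ Φ)
    (hΦd : ∀ r, HasDerivAt Φ (Φ₁ r) r) {α κ a a₂ M : ℝ} (hα : 0 < α) (hM : 0 ≤ M)
    (hκ : κ * α = 4 * M) (hs : ∀ r, 1 ≤ κ * Φ r) (ha : 0 ≤ a)
    (haγ : a - κ * Real.log γ ≤ a₂) (ha₂ : a₂ < 1) (haΦ : ∀ r, 1 ≤ 2 * a * Φ r)
    (hΦ : ∀ r, 0 < Φ r) (hΦ₁ : ∀ r, 0 ≤ Φ₁ r) (hκ0 : 0 ≤ κ)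
    (hb : ∀ᵐ x ∂μ, Φ₁ (ρ x) ^ 2 * aForm A x (Dρ x) (Dρ x) +
      Φ₁ (ρ x) * inner ℝ (B x) (Dρ x) ≤ M * Φ (ρ x)) {b : ℕ → ℝ} (hb0 : ∀ n, 0 ≤ b n)
    (hA : ∀ᶠ n in atTop, Ahat E A B μ ρ Dρ ϕ n ≤ ENNReal.ofReal (b n))
    (hlim : Tendsto (fun n : ℕ => b n / n * Real.exp (-(a * Φ (2 * n)))) atTop (𝓝 0))
    {u : ℕ → Eucl d → ℝ} (hu : ∀ n : ℕ, ∃ G, WeakSol A B (μ.restrict (sublevel E ρ (4 * n)))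
      {f | IsTest E (sublevel E ρ (4 * n)) f} α (fun _ => 1) (u n) G) {U : Eucl d → ℝ}
    (hUm : AEStronglyMeasurable U μ) (hU1 : ∀ᵐ x ∂μ, 0 ≤ U x)
    (hU : ∀ n, ∀ᵐ x ∂μ, α * u n x ≤ U x) : ∀ᵐ x ∂μ, 1 - γ ≤ U x := by
  obtain ⟨p, p₁, p₂, l, l₁, l₂, D⟩ := exists_barrierData hγ
  obtain ⟨C, hC⟩ := X.exists_barrier_bound S (ϕ := ϕ) D hγ hΦs hΦd hα hM hκ hs ha haγ ha₂ haΦ hΦ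
    hΦ₁ hκ0 hb
  choose G hG using hu
  have hlim2 : Tendsto (fun n : ℕ => C * (b n / n * Real.exp (-(a * Φ (2 * n)))) ^ 2) atTop
      (𝓝 0) := by simpa using (hlim.pow 2).const_mul C
  have key : ∀ m : ℕ, ∀ᵐ x ∂μ, x ∈ sublevel E ρ (4 * m) → 1 - γ ≤ U x := fun m => by
    have hV := X.exhaustion.relCompact m
    have hVm := S.measurableSet hV
    have := S.finite_restrict hV
    obtain ⟨g, hg⟩ := X.exists_gradApprox S m
    have hbd : ∀ᵐ x ∂(μ.restrict (sublevel E ρ (4 * m))),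
        0 ≤ barrier p l Φ κ a (1 - U x) (ρ x) ∧ barrier p l Φ κ a (1 - U x) (ρ x) ≤ 1 := by
      filter_upwards [ae_restrict_of_ae hU1] with x hx
      have h1 := D.barrier_le (Φ := Φ) (κ := κ) (a := a) (r := ρ x) (w := 1 - U x)
        (by linarith) hκ0 hγ (hΦ _).le
      refine ⟨h1.1, h1.2.trans (Real.exp_le_one_iff.2 (neg_nonpos.2 ?_))⟩
      have := haΦ (ρ x)
      linarith
    have hi : IntegrableOn (fun x => barrier p l Φ κ a (1 - U x) (ρ x)) (sublevel E ρ (4 * m)) μ := by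
      refine Integrable.of_bound ((contDiff_barrier D.smooth_p D.smooth_l
        hΦs).continuous.comp_aestronglyMeasurable
        ((aestronglyMeasurable_const.sub hUm.restrict).prodMk hg.memLp.1)) 1 ?_
      filter_upwards [hbd] with x hx
      rw [Real.norm_of_nonneg hx.1]; exact hx.2
    have hle : ∫ x in sublevel E ρ (4 * m), barrier p l Φ κ a (1 - U x) (ρ x) ∂μ ≤ 0 := by
      refine ge_of_tendsto hlim2 ?_
      filter_upwards [hA, eventually_ge_atTop (2 * m), eventually_ge_atTop 1] with n hn hnm hn1
      have hsub : sublevel E ρ (4 * m) ⊆ sublevel E ρ (2 * n) := fun x hx => ⟨hx.1, hx.2.trans_le (by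
        have : (2 : ℝ) * m ≤ n := by exact_mod_cast hnm
        linarith)⟩
      obtain ⟨h1, h2⟩ := hC n (b n) (u n) (G n) _ hn1 (hb0 n) hn (hG n) hVm hsub
      refine le_trans (setIntegral_mono_ae_restrict hi h1 ?_) h2
      filter_upwards [ae_restrict_of_ae (hU n)] with x hx
      exact D.barrier_mono (by linarith) hκ0 hγ (hΦ _).le
    have h0 := (setIntegral_eq_zero_iff_of_nonneg_ae (by
      filter_upwards [hbd] with x hx using hx.1) hi).1
      (le_antisymm hle (integral_nonneg_of_ae (by filter_upwards [hbd] with x hx using hx.1)))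
    rw [← ae_restrict_iff' hVm]
    filter_upwards [h0] with x hx
    by_contra hlt
    have h1 : γ < 1 - U x := by linarith [not_le.1 hlt]
    have h2 : 0 < barrier p l Φ κ a (1 - U x) (ρ x) :=
      mul_pos (pow_pos (D.pos _ h1) 2) (Real.exp_pos _)
    exact h2.ne' hx
  filter_upwards [ae_all_iff.2 key, X.exhaustion.ae_exists_mem S] with x hx hx'
  obtain ⟨m, hm⟩ := hx'
  exact hx m hm

/-- Conservativeness from weights adapted to each parameter of the resolvent. -/
theorem GlobalResolvent.isConservative_of_weight
    (h : GlobalResolvent E A B μ (fun n : ℕ => sublevel E ρ (4 * n)) Rn R)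
    (X : ExhaustionFunction E A μ ρ Dρ) (S : GlobalSetup E A B μ)
    {T : ℝ≥0 → (Lp ℝ 2 μ →L[ℝ] Lp ℝ 2 μ)} (hT : IsSubMarkovSemigroup μ T)
    (hG : ∀ α, 0 < α → ∀ f, IsGenerator T (R α f) (α • R α f - f))
    {a M : ℝ} (ha : 0 < a) (ha1 : a < 1) (hM : 0 < M) {ϕ : ℝ → ℝ} {b : ℕ → ℝ}
    (hb0 : ∀ n, 0 ≤ b n)
    (hA : ∀ᶠ n in atTop, Ahat E A B μ ρ Dρ ϕ n ≤ ENNReal.ofReal (b n))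
    (hΦ : ∀ δ > 0, ∃ Φ Φ₁ : ℝ → ℝ, ContDiff ℝ ∞ Φ ∧ (∀ r, HasDerivAt Φ (Φ₁ r) r) ∧
      (∀ r, δ ≤ Φ r) ∧ (∀ r, 0 ≤ Φ₁ r) ∧
      (∀ᵐ x ∂μ, Φ₁ (ρ x) ^ 2 * aForm A x (Dρ x) (Dρ x) +
        Φ₁ (ρ x) * inner ℝ (B x) (Dρ x) ≤ M * Φ (ρ x)) ∧
      Tendsto (fun n : ℕ => b n / n * Real.exp (-(a * Φ (2 * n)))) atTop (𝓝 0)) :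
    IsConservative T := by
  have hV := X.exhaustion
  have hs : ∀ n : ℕ, MeasurableSet (sublevel E ρ (4 * n)) := fun n =>
    S.measurableSet (hV.relCompact n)
  have hμs : ∀ n : ℕ, μ (sublevel E ρ (4 * n)) ≠ ⊤ := fun n => by
    have := S.finite_restrict (hV.relCompact n)
    rw [← Measure.restrict_apply_univ]; exact measure_ne_top _ _
  set F : ℕ → Lp ℝ 2 μ := fun n => indicatorConstLp 2 (hs n) (hμs n) (1 : ℝ) with hF
  have hF1 : ∀ n, ∀ᵐ x ∂μ, F n x = (sublevel E ρ (4 * n)).indicator (fun _ => 1) x := fun n =>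
    ae_indicatorConstLp_one (hs n) (hμs n)
  have hF01 : ∀ n, ∀ᵐ x ∂μ, 0 ≤ F n x ∧ F n x ≤ 1 := fun n => by
    filter_upwards [hF1 n] with x hx
    rw [hx]
    by_cases hxs : x ∈ sublevel E ρ (4 * n) <;> simp [hxs]
  have hGb : ∀ α, 0 < α → ∀ n, ∀ᵐ x ∂μ, 0 ≤ α * R α (F n) x ∧ α * R α (F n) x ≤ 1 :=
    fun α hα n => h.smul_mem_Icc S hV hα (hF01 n)
  have hmono : ∀ α, 0 < α → ∀ᵐ x ∂μ, Monotone fun n => α * R α (F n) x := fun α hα => by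
    have h1 : ∀ n, ∀ᵐ x ∂μ, R α (F n) x ≤ R α (F (n + 1)) x := fun n => by
      have h2 : ∀ᵐ x ∂μ, 0 ≤ (F (n + 1) - F n : Lp ℝ 2 μ) x ∧ (F (n + 1) - F n : Lp ℝ 2 μ) x ≤ 1 := by
        filter_upwards [hF1 n, hF1 (n + 1), Lp.coeFn_sub (F (n + 1)) (F n)] with x hx hx' hx2
        rw [hx2, Pi.sub_apply, hx, hx']
        have hle : x ∈ sublevel E ρ (4 * n) → x ∈ sublevel E ρ (4 * (n + 1 : ℕ)) :=
          fun h => hV.mono n.le_succ h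
        generalize sublevel E ρ (4 * (n + 1 : ℕ)) = s' at hle ⊢
        by_cases hxs : x ∈ sublevel E ρ (4 * n)
        · simp [hxs, hle hxs]
        · by_cases hxs' : x ∈ s' <;> simp [hxs, hxs']
      have h3 := h.smul_mem_Icc S hV hα h2
      rw [map_sub] at h3
      filter_upwards [h3, Lp.coeFn_sub (R α (F (n + 1))) (R α (F n))] with x hx hx'
      rw [hx', Pi.sub_apply] at hx
      have := nonneg_of_mul_nonneg_right hx.1 hα
      linarith
    filter_upwards [ae_all_iff.2 h1] with x hx
    exact monotone_nat_of_le_succ fun n => mul_le_mul_of_nonneg_left (hx n) hα.le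
  set U : ℝ → Eucl d → ℝ := fun α x => ⨆ n, α * R α (F n) x with hU
  have hbdd : ∀ α, 0 < α → ∀ᵐ x ∂μ, BddAbove (Set.range fun n => α * R α (F n) x) := fun α hα => by
    filter_upwards [ae_all_iff.2 (hGb α hα)] with x hx
    exact ⟨1, by rintro _ ⟨n, rfl⟩; exact (hx n).2⟩
  have hGle : ∀ α, 0 < α → ∀ᵐ x ∂μ, Tendsto (fun n => α * R α (F n) x) atTop (𝓝 (U α x)) :=
    fun α hα => by
    filter_upwards [hmono α hα, hbdd α hα] with x hx hx' using tendsto_atTop_ciSup hx hx'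
  -- Any number strictly between `a` and `1` would do.
  set a₂ := (1 + a) / 2 with ha₂
  -- With `κ = 4M/α` and `γ = e^{-cα}` this `c` gives `a - κ log γ = a₂` exactly. It does not depend
  -- on `α`, which is what the resolvent criterion requires.
  refine hT.isConservative hG hs hμs hV.mono (hV.ae_exists_mem S) (c := (a₂ - a) / (4 * M))
    (by apply div_pos <;> linarith) hGle hGb fun α hα => ?_
  set κ := 4 * M / α with hκ
  have hκ0 : 0 < κ := by positivity
  -- The lower bound on `Φ` ensures `κΦ ≥ 1` and `2aΦ ≥ 1`. It depends on `α`, so a separate weight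
  -- is taken for every `α`.
  obtain ⟨Φ, Φ₁, h1, h2, h3, h4, h5, h6⟩ := hΦ (max (1 / κ) (1 / (2 * a))) (by positivity)
  have hΦ1 : ∀ r, 1 / κ ≤ Φ r := fun r => (le_max_left _ _).trans (h3 r)
  have hΦ2 : ∀ r, 1 / (2 * a) ≤ Φ r := fun r => (le_max_right _ _).trans (h3 r)
  refine X.one_sub_le S (u := fun n => Rn n α (F n)) (Real.exp_pos _) h1 h2 hα hM.le
    (by rw [hκ]; field_simp) (fun r => ?_) ha.le (a₂ := a₂) (le_of_eq ?_) (by linarith)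
    (fun r => ?_) (fun r => lt_of_lt_of_le (by positivity) (hΦ1 r)) h4 hκ0.le h5 hb0 hA h6
    (fun n => ?_) ?_ ?_ fun n => ?_
  · have := hΦ1 r
    rw [div_le_iff₀ hκ0] at this; linarith
  · rw [Real.log_exp, hκ]; field_simp; ring
  · have := hΦ2 r
    rw [div_le_iff₀ (by positivity)] at this; linarith
  -- The indicator of `V_n` equals `1` on `V_n`, so this local resolvent solves the equation with
  -- right side `1`.
  · obtain ⟨G, hG'⟩ := (h.isResolvent n α hα (F n)).1
    refine ⟨G, hG'.congr ?_ (ae_eq_refl _)⟩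
    filter_upwards [ae_restrict_of_ae (hF1 n), ae_restrict_mem (hs n)] with x hx hx'
    rw [hx, Set.indicator_of_mem hx']
  · exact aestronglyMeasurable_of_tendsto_ae atTop
      (fun n => (Lp.aestronglyMeasurable (R α (F n))).const_mul α) (hGle α hα)
  · filter_upwards [hGb α hα 0, hbdd α hα] with x hx hx'
    exact hx.1.trans (le_ciSup hx' 0)
  · have hF0 : ∀ᵐ x ∂μ, 0 ≤ F n x := by filter_upwards [hF01 n] with x hx using hx.1
    filter_upwards [h.ae_monotone S hV hα hF0, h.ae_tendsto S hV hα hF0, hbdd α hα] with x hx hx' hx2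
    exact (mul_le_mul_of_nonneg_left (hx.ge_of_tendsto hx' n) hα.le).trans (le_ciSup hx2 n)

end

/-! ### Growth functions and the three criteria -/

section

/-- A smooth primitive of `θ ψ`, where `0 ≤ θ ≤ 1` is a cut-off function vanishing on `(-∞, N]`,
which dominates the primitive `φ` of `ψ` on `[N,∞)`. -/
theorem exists_cutoff_primitive {φ ψ : ℝ → ℝ} {r₁ N δ : ℝ} (hN : 0 < N) (hrN : r₁ < N)
    (hψ : ContDiffOn ℝ ∞ ψ (Set.Ioi r₁)) (hφ : ∀ r, r₁ < r → HasDerivAt φ (ψ r) r)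
    (hψ0 : ∀ r, r₁ < r → 0 ≤ ψ r) :
    ∃ Φ θ : ℝ → ℝ, ContDiff ℝ ∞ Φ ∧ (∀ r, HasDerivAt Φ (θ r * ψ r) r) ∧ (∀ r, δ ≤ Φ r) ∧
      (∀ r, 0 ≤ θ r ∧ θ r ≤ 1) ∧ (∀ r, r ≤ N → θ r = 0) ∧ ∀ r, N ≤ r → φ r ≤ Φ r := by
  set θ : ℝ → ℝ := fun r => Real.smoothTransition ((r - N) / N) with hθ
  have hθs : ContDiff ℝ ∞ θ :=
    Real.smoothTransition.contDiff.comp ((contDiff_id.sub contDiff_const).div_const _)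
  have hθ0 : ∀ r, r ≤ N → θ r = 0 := fun r hr =>
    Real.smoothTransition.zero_of_nonpos (div_nonpos_of_nonpos_of_nonneg (by linarith) hN.le)
  have hθ1 : ∀ r, 2 * N ≤ r → θ r = 1 := fun r hr =>
    Real.smoothTransition.one_of_one_le (by rw [le_div_iff₀ hN]; linarith)
  have hθb : ∀ r, 0 ≤ θ r ∧ θ r ≤ 1 := fun r =>
    ⟨Real.smoothTransition.nonneg _, Real.smoothTransition.le_one _⟩
  have hθψ : ContDiff ℝ ∞ fun r => θ r * ψ r := by
    rw [contDiff_iff_contDiffAt]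
    intro r
    rcases lt_or_ge r₁ r with hr | hr
    · exact hθs.contDiffAt.mul (hψ.contDiffAt (Ioi_mem_nhds hr))
    · refine (contDiffAt_const (c := (0 : ℝ))).congr_of_eventuallyEq ?_
      filter_upwards [Iio_mem_nhds (hr.trans_lt hrN)] with s hs
      rw [hθ0 s (le_of_lt hs), zero_mul]
  have hθψ0 : ∀ r, 0 ≤ θ r * ψ r := fun r => by
    rcases lt_or_ge r₁ r with hr | hr
    · exact mul_nonneg (hθb r).1 (hψ0 r hr)
    · rw [hθ0 r (hr.trans hrN.le), zero_mul]
  obtain ⟨Ψ, hΨ, hΨ0, hΨd⟩ := exists_smooth_antideriv hθψ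
  have hΨm : Monotone Ψ := monotone_of_hasDerivAt_nonneg hΨd hθψ0
  have hΨnn : ∀ r, 0 ≤ Ψ r := by
    intro r
    rcases le_total 0 r with hr | hr
    · exact hΨ0 ▸ hΨm hr
    · have : ∀ x ∈ Set.Icc r 0, Ψ x = Ψ r := by
        refine constant_of_has_deriv_right_zero hΨ.continuous.continuousOn fun x hx => ?_
        have := (hΨd x).hasDerivWithinAt (s := Set.Ici x)
        rwa [hθ0 x (hx.2.le.trans hN.le), zero_mul] at this
      rw [← this 0 ⟨hr, le_rfl⟩, hΨ0]
  -- The added constant puts `Φ` above `φ` at `2N`. The difference `Ψ - φ` decreases on `[N, 2N]`,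
  -- where its slope is `(θ - 1)ψ ≤ 0`, and is constant afterwards, so `2N` is the decisive point.
  refine ⟨fun r => max δ (φ (2 * N)) + Ψ r, θ, contDiff_const.add hΨ,
    fun r => (hΨd r).const_add _, fun r => by have := hΨnn r; have := le_max_left δ (φ (2 * N)); linarith,
    hθb, hθ0, ?_⟩
  have hD : ∀ r, N ≤ r → HasDerivAt (fun r => Ψ r - φ r) (θ r * ψ r - ψ r) r := fun r hr =>
    (hΨd r).sub (hφ r (hrN.trans_le hr))
  have h2N : Ψ (2 * N) - φ (2 * N) ≥ -φ (2 * N) := by linarith [hΨnn (2 * N)]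
  have key : ∀ r, N ≤ r → Ψ (2 * N) - φ (2 * N) ≤ Ψ r - φ r := by
    intro r hr
    rcases le_total r (2 * N) with h | h
    · have : AntitoneOn (fun r => Ψ r - φ r) (Set.Ici N) := by
        refine antitoneOn_of_deriv_nonpos (convex_Ici N)
          (fun x hx => (hD x hx).continuousAt.continuousWithinAt)
          (fun x hx => ?_) fun x hx => ?_
        · rw [interior_Ici] at hx
          exact (hD x (le_of_lt hx)).differentiableAt.differentiableWithinAt
        · rw [interior_Ici] at hx
          rw [(hD x (le_of_lt hx)).deriv]
          have h1 := hψ0 x (hrN.trans hx)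
          have h2 := mul_le_mul_of_nonneg_right (hθb x).2 h1
          linarith
      exact this (Set.mem_Ici.2 hr) (Set.mem_Ici.2 (by linarith)) h
    · have : MonotoneOn (fun r => Ψ r - φ r) (Set.Ici (2 * N)) := by
        refine monotoneOn_of_deriv_nonneg (convex_Ici _)
          (fun x hx => (hD x (by linarith [Set.mem_Ici.1 hx])).continuousAt.continuousWithinAt)
          (fun x hx => ?_) fun x hx => ?_
        · rw [interior_Ici] at hx
          exact (hD x (by linarith [Set.mem_Ioi.1 hx])).differentiableAt.differentiableWithinAt
        · rw [interior_Ici] at hx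
          have := Set.mem_Ioi.1 hx
          rw [(hD x (by linarith)).deriv, hθ1 x this.le]; simp
      exact this (Set.mem_Ici.2 le_rfl) (Set.mem_Ici.2 h) h
  intro r hr
  have := key r hr
  have := le_max_right δ (φ (2 * N))
  linarith

variable {d : ℕ} {E K₀ : Set (Eucl d)} {A : Eucl d → Matrix (Fin d) (Fin d) ℝ}
  {B : Eucl d → Eucl d} {μ : Measure (Eucl d)} {ρ : Eucl d → ℝ} {Dρ : Eucl d → Eucl d}
  {Rn : ℕ → ℝ → Lp ℝ 2 μ →L[ℝ] Lp ℝ 2 μ} {R : ℝ → Lp ℝ 2 μ →L[ℝ] Lp ℝ 2 μ}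
  {T : ℝ≥0 → (Lp ℝ 2 μ →L[ℝ] Lp ℝ 2 μ)}

/-- Conservativeness from a growth function `φ` with derivative `ψ`. -/
theorem GlobalResolvent.isConservative_of_growth
    (h : GlobalResolvent E A B μ (fun n : ℕ => sublevel E ρ (4 * n)) Rn R)
    (X : ExhaustionFunction E A μ ρ Dρ) (S : GlobalSetup E A B μ) (hT : IsSubMarkovSemigroup μ T)
    (hG : ∀ α, 0 < α → ∀ f, IsGenerator T (R α f) (α • R α f - f))
    {φ ψ : ℝ → ℝ} {r₁ : ℝ} (hψ : ContDiffOn ℝ ∞ ψ (Set.Ioi r₁))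
    (hφ : ∀ r, r₁ < r → HasDerivAt φ (ψ r) r) (hψ0 : ∀ r, r₁ < r → 0 ≤ ψ r)
    {K : Set (Eucl d)} (hK : IsCompact K) (hKE : K ⊆ E) {a M : ℝ} (ha : 0 < a) (ha1 : a < 1)
    (hM : 0 < M) (hb : ∀ᵐ x ∂(μ.restrict (E \ K)), r₁ < ρ x →
      ψ (ρ x) ^ 2 * aForm A x (Dρ x) (Dρ x) + ψ (ρ x) * inner ℝ (B x) (Dρ x) ≤ M * φ (ρ x))
    {ϕ : ℝ → ℝ} {b : ℕ → ℝ} (hb0 : ∀ n, 0 ≤ b n)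
    (hA : ∀ᶠ n in atTop, Ahat E A B μ ρ Dρ ϕ n ≤ ENNReal.ofReal (b n))
    (hlim : Tendsto (fun n : ℕ => b n / n * Real.exp (-(a * φ (2 * n)))) atTop (𝓝 0)) :
    IsConservative T := by
  refine h.isConservative_of_weight X S hT hG ha ha1 hM hb0 hA fun δ hδ => ?_
  obtain ⟨m, hm⟩ := X.exhaustion.exists_subset K hK hKE
  -- Beyond `N` the point lies outside `K` and the formulas for `φ` and `ψ` are valid; up to `N` the
  -- cut-off makes the derivative of `Φ` vanish, so no condition is needed there.
  set N : ℝ := max (4 * m) (max (r₁ + 1) 1) with hNdef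
  have hN : 0 < N := zero_lt_one.trans_le ((le_max_right _ _).trans (le_max_right _ _))
  have hrN : r₁ < N := (lt_add_one r₁).trans_le ((le_max_left _ _).trans (le_max_right _ _))
  obtain ⟨Φ, θ, h1, h2, h3, h4, h5, h6⟩ := exists_cutoff_primitive (δ := δ) hN hrN hψ hφ hψ0
  refine ⟨Φ, fun r => θ r * ψ r, h1, h2, h3, fun r => ?_, ?_, ?_⟩
  · change 0 ≤ θ r * ψ r
    rcases lt_or_ge r₁ r with hr | hr
    · exact mul_nonneg (h4 r).1 (hψ0 r hr)
    · rw [h5 r (hr.trans hrN.le), zero_mul]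
  · rw [ae_restrict_iff' (S.measE.diff hK.measurableSet)] at hb
    filter_upwards [hb, S.ae_mem, S.nonneg] with x hx hxE hx0
    have hΦ0 : 0 ≤ M * Φ (ρ x) := mul_nonneg hM.le (hδ.le.trans (h3 _))
    rcases le_or_gt (ρ x) N with hxN | hxN
    · simp only [h5 _ hxN]; simpa using hΦ0
    · have hxK : x ∉ K := fun hxK => by
        have := (hm hxK).2
        have := le_max_left (4 * m : ℝ) (max (r₁ + 1) 1)
        linarith
      have e1 := hx ⟨hxE, hxK⟩ (hrN.trans hxN)
      have e2 := hx0 (Dρ x)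
      have e3 : M * φ (ρ x) ≤ M * Φ (ρ x) := mul_le_mul_of_nonneg_left (h6 _ hxN.le) hM.le
      obtain ⟨t0, t1⟩ := h4 (ρ x)
      have e4 : θ (ρ x) * (ψ (ρ x) ^ 2 * aForm A x (Dρ x) (Dρ x) + ψ (ρ x) * inner ℝ (B x) (Dρ x)) ≤
          M * Φ (ρ x) :=
        (mul_le_mul_of_nonneg_left (e1.trans e3) t0).trans (mul_le_of_le_one_left hΦ0 t1)
      -- The quadratic term carries `θ²` and the drift term only `θ`; as `θ² ≤ θ` and the form is
      -- nonnegative, the inequality multiplied by `θ` is enough.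
      have e5 : 0 ≤ θ (ρ x) * (1 - θ (ρ x)) * (ψ (ρ x) ^ 2 * aForm A x (Dρ x) (Dρ x)) :=
        mul_nonneg (mul_nonneg t0 (by linarith)) (mul_nonneg (sq_nonneg _) e2)
      linarith
  · refine squeeze_zero' (Eventually.of_forall fun n => mul_nonneg
      (div_nonneg (hb0 n) (Nat.cast_nonneg n)) (Real.exp_nonneg _)) ?_ hlim
    filter_upwards [eventually_ge_atTop ⌈N⌉₊] with n hn
    have hn' : N ≤ 2 * n := by
      have h7 : N ≤ n := (Nat.le_ceil N).trans (by exact_mod_cast hn)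
      have : (0 : ℝ) ≤ n := Nat.cast_nonneg n
      linarith
    refine mul_le_mul_of_nonneg_left (Real.exp_le_exp.2 (neg_le_neg
      (mul_le_mul_of_nonneg_left (h6 _ hn') ha.le))) (div_nonneg (hb0 n) (Nat.cast_nonneg n))

theorem tendsto_growth_ratio {b : ℕ → ℝ} {y z : ℕ → ℝ} {c : ℝ} (hc : 0 < c)
    (hb : ∀ᶠ n : ℕ in atTop, b n = n * Real.exp (y n)) (hy : ∀ᶠ n in atTop, y n - z n ≤ -(c * y n))
    (hlim : Tendsto y atTop atTop) :
    Tendsto (fun n : ℕ => b n / n * Real.exp (-z n)) atTop (𝓝 0) := by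
  have h1 : Tendsto (fun n => Real.exp (-(c * y n))) atTop (𝓝 0) :=
    Real.tendsto_exp_neg_atTop_nhds_zero.comp (hlim.const_mul_atTop hc)
  have h2 : ∀ᶠ n : ℕ in atTop, b n / n * Real.exp (-z n) = Real.exp (y n - z n) := by
    filter_upwards [hb, eventually_gt_atTop 0] with n hn hn0
    have : (n : ℝ) ≠ 0 := by exact_mod_cast hn0.ne'
    rw [hn, mul_div_cancel_left₀ _ this, ← Real.exp_add, sub_eq_add_neg]
  refine squeeze_zero' ?_ ?_ h1
  · filter_upwards [h2] with n hn
    rw [hn]; exact Real.exp_nonneg _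
  · filter_upwards [h2, hy] with n hn hn'
    rw [hn]; exact Real.exp_le_exp.2 hn'

theorem tendsto_log_natCast_add_one : Tendsto (fun n : ℕ => Real.log ((n : ℝ) + 1)) atTop atTop :=
  Real.tendsto_log_atTop.comp (tendsto_atTop_add_const_right _ _ tendsto_natCast_atTop_atTop)

/-- The criteria bound `⟨A∇ρ,∇ρ⟩ + ⟨B,∇ρ⟩/ψ` with `ψ = φ'`; multiplying by `ψ²` gives the form used
for the weight. Only the upper bound contained in the absolute value is used. -/
theorem sq_mul_add_le_of_abs_le {ψ A b D Q : ℝ} (h : |A + D| ≤ Q) (hD : ψ ^ 2 * D = ψ * b) :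
    ψ ^ 2 * A + ψ * b ≤ ψ ^ 2 * Q := by
  rw [← hD, ← mul_add]
  exact mul_le_mul_of_nonneg_left ((le_abs_self _).trans h) (sq_nonneg _)

theorem log_add_one_pos {r : ℝ} (hr : 0 < r) : 0 < Real.log (r + 1) := Real.log_pos (by linarith)

theorem contDiffOn_log_add_one : ContDiffOn ℝ ∞ (fun r : ℝ => Real.log (r + 1)) (Set.Ioi 0) :=
  (contDiffOn_id.add contDiffOn_const).log fun r hr => by
    have := Set.mem_Ioi.1 hr
    simp only [id]; linarith

theorem hasDerivAt_log_add_one {r : ℝ} (hr : 0 < r) :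
    HasDerivAt (fun r : ℝ => Real.log (r + 1)) (1 / (r + 1)) r :=
  ((hasDerivAt_id r).add_const 1).log (by simp only [id]; linarith)

/-- Take `φ(r) = C log(r+1)^{2-β}` and `ψ = φ'`. Then `ψ²` times the right side of the hypothesis is
exactly `MC(2-β)²φ`. The exponent `a = (1+α)/2` lies strictly between `α` and `1`, so `e^{-aφ(2n)}`
beats the allowed growth of `Ahat`. -/
theorem CriterionI.isConservative (hc : CriterionI E A B μ ρ Dρ K₀)
    (h : GlobalResolvent E A B μ (fun n : ℕ => sublevel E ρ (4 * n)) Rn R)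
    (X : ExhaustionFunction E A μ ρ Dρ) (S : GlobalSetup E A B μ) (hT : IsSubMarkovSemigroup μ T)
    (hG : ∀ α, 0 < α → ∀ f, IsGenerator T (R α f) (α • R α f - f)) : IsConservative T := by
  obtain ⟨M, C, α, β, hM, hC, hα, hα1, hβ, hβ2, ⟨K, hK, hKE, -, hKb⟩, hA⟩ := hc
  have h2β : 0 < 2 - β := by linarith
  refine h.isConservative_of_growth X S hT hG (φ := fun r => C * Real.log (r + 1) ^ (2 - β))
    (ψ := fun r => C * (2 - β) * Real.log (r + 1) ^ (1 - β) / (r + 1)) (r₁ := 0) ?_ (fun r hr => ?_)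
    (fun r hr => ?_) hK hKE (a := (1 + α) / 2) (M := M * C * (2 - β) ^ 2) (by linarith)
    (by linarith) (by positivity) ?_ (fun n => by positivity) hA ?_
  · refine ContDiffOn.div (contDiffOn_const.mul (contDiffOn_log_add_one.rpow_const_of_ne
      fun r hr => (log_add_one_pos hr).ne')) (contDiffOn_id.add contDiffOn_const) fun r hr => ?_
    have := Set.mem_Ioi.1 hr
    positivity
  · have := ((hasDerivAt_log_add_one hr).rpow_const (p := 2 - β)
      (Or.inl (log_add_one_pos hr).ne')).const_mul C
    refine this.congr_deriv ?_
    rw [show 2 - β - 1 = 1 - β by ring]; ring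
  · have := log_add_one_pos hr
    positivity
  · filter_upwards [hKb] with x hx hρ
    have hl := log_add_one_pos hρ
    have hρ1 : 0 < ρ x + 1 := by linarith
    have hp : 0 < Real.log (ρ x + 1) ^ (1 - β) := Real.rpow_pos_of_pos hl _
    refine (sq_mul_add_le_of_abs_le hx ?_).trans (le_of_eq ?_)
    · field_simp
    · have e : Real.log (ρ x + 1) ^ (2 - β) =
          (Real.log (ρ x + 1) ^ (1 - β)) ^ 2 * Real.log (ρ x + 1) ^ β := by
        rw [← Real.rpow_natCast, ← Real.rpow_mul hl.le, ← Real.rpow_add hl]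
        congr 1; push_cast; ring
      simp only [e]
      field_simp
  · refine tendsto_growth_ratio (c := (1 - α) / 2 / α) (by apply div_pos <;> linarith)
      (y := fun n : ℕ => α * C * Real.log (n + 1) ^ (2 - β)) (Eventually.of_forall fun n => rfl)
      (Eventually.of_forall fun n => ?_) ?_
    · have h0 : (0 : ℝ) ≤ n := Nat.cast_nonneg n
      have h1 : Real.log ((n : ℝ) + 1) ^ (2 - β) ≤ Real.log (2 * n + 1) ^ (2 - β) :=
        Real.rpow_le_rpow (Real.log_nonneg (by linarith))
          (Real.log_le_log (by linarith) (by linarith)) h2β.le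
      have h2 : (1 - α) / 2 / α * (α * C * Real.log ((n : ℝ) + 1) ^ (2 - β)) =
          (1 - α) / 2 * C * Real.log ((n : ℝ) + 1) ^ (2 - β) := by field_simp
      have h3 := mul_le_mul_of_nonneg_left h1 (by positivity : 0 ≤ (1 + α) / 2 * C)
      rw [h2]
      linarith
    · exact ((tendsto_rpow_atTop h2β).comp tendsto_log_natCast_add_one).const_mul_atTop
        (by positivity)

/-- Take `φ(r) = C log log(r+1)`, whose derivative matches the coefficient of the drift in the
hypothesis exactly, unlike that of `C log(log(r+1)+1)`. Now `ψ²` times the right side is the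
constant `C²M`, bounded by `C²Mφ` once `φ ≥ 1`. -/
theorem CriterionII.isConservative (hc : CriterionII E A B μ ρ Dρ K₀)
    (h : GlobalResolvent E A B μ (fun n : ℕ => sublevel E ρ (4 * n)) Rn R)
    (X : ExhaustionFunction E A μ ρ Dρ) (S : GlobalSetup E A B μ) (hT : IsSubMarkovSemigroup μ T)
    (hG : ∀ α, 0 < α → ∀ f, IsGenerator T (R α f) (α • R α f - f)) : IsConservative T := by
  obtain ⟨M, C, α, hM, hC, hα, hα1, ⟨K, hK, hKE, -, hKb⟩, hA⟩ := hc
  -- The double exponential is the threshold beyond which `C log log(r+1) ≥ 1`.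
  have hr₁ : ∀ r, Real.exp (Real.exp (1 / C)) < r →
      0 < r ∧ Real.exp (1 / C) ≤ Real.log (r + 1) := fun r hr => by
    have h1 : Real.exp (Real.exp (1 / C)) < r + 1 := by linarith
    have h2 : 0 < r := (Real.exp_pos _).trans hr
    exact ⟨h2, ((Real.lt_log_iff_exp_lt (by linarith)).2 h1).le⟩
  refine h.isConservative_of_growth X S hT hG (φ := fun r => C * Real.log (Real.log (r + 1)))
    (ψ := fun r => C / ((r + 1) * Real.log (r + 1))) (r₁ := Real.exp (Real.exp (1 / C))) ?_
    (fun r hr => ?_)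
    (fun r hr => ?_) hK hKE (a := (1 + α) / 2) (M := C ^ 2 * M) (by linarith)
    (by linarith) (by positivity) ?_ (fun n => ?_) hA ?_
  · refine ContDiffOn.div contDiffOn_const ((contDiffOn_id.add contDiffOn_const).mul
      (contDiffOn_log_add_one.mono fun r hr => (hr₁ r hr).1)) fun r hr => ?_
    have h1 := log_add_one_pos (hr₁ r hr).1
    have h2 := (hr₁ r hr).1
    positivity
  · have h1 := (hr₁ r hr).1
    have h2 := log_add_one_pos h1
    refine (((hasDerivAt_log_add_one h1).log h2.ne').const_mul C).congr_deriv ?_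
    field_simp
  · have h1 := (hr₁ r hr).1
    have h2 := log_add_one_pos h1
    positivity
  · filter_upwards [hKb] with x hx hρ
    obtain ⟨hρ0, hρ2⟩ := hr₁ _ hρ
    have hl := log_add_one_pos hρ0
    have hρ1 : 0 < ρ x + 1 := by linarith
    refine (sq_mul_add_le_of_abs_le hx ?_).trans ?_
    · field_simp
    · have h1 : 1 ≤ C * Real.log (Real.log (ρ x + 1)) := by
        have := (Real.le_log_iff_exp_le hl).2 hρ2
        rw [div_le_iff₀ hC] at this
        linarith
      have h2 : (C / ((ρ x + 1) * Real.log (ρ x + 1))) ^ 2 *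
          (M * (ρ x + 1) ^ 2 * Real.log (ρ x + 1) ^ 2) = C ^ 2 * M := by field_simp
      rw [h2]
      exact le_mul_of_one_le_right (by positivity) h1
  · have : 0 ≤ Real.log ((n : ℝ) + 1) := Real.log_nonneg (by simp)
    positivity
  · refine tendsto_growth_ratio (c := (1 - α) / 2 / α) (by apply div_pos <;> linarith)
      (y := fun n : ℕ => C * α * Real.log (Real.log (n + 1))) ?_ ?_ ?_
    · filter_upwards [eventually_gt_atTop 0] with n hn
      rw [Real.rpow_def_of_pos (log_add_one_pos (by exact_mod_cast hn)), mul_comm (Real.log _)]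
    · filter_upwards [eventually_gt_atTop 0] with n hn
      have h0 : (0 : ℝ) < n := by exact_mod_cast hn
      have h1 : Real.log (Real.log ((n : ℝ) + 1)) ≤ Real.log (Real.log (2 * n + 1)) :=
        Real.log_le_log (log_add_one_pos h0) (Real.log_le_log (by linarith) (by linarith))
      have h2 : (1 - α) / 2 / α * (C * α * Real.log (Real.log ((n : ℝ) + 1))) =
          (1 - α) / 2 * C * Real.log (Real.log ((n : ℝ) + 1)) := by field_simp
      have h3 := mul_le_mul_of_nonneg_left h1 (by positivity : 0 ≤ (1 + α) / 2 * C)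
      rw [h2]
      linarith
    · exact (Real.tendsto_log_atTop.comp tendsto_log_natCast_add_one).const_mul_atTop
        (by positivity)

/-- Take `φ(r) = Cr²/2`, for which `ψ²M = 2CMφ`. The weight is evaluated at `2n`, where `φ(2n) =
2Cn²`; this gain of a factor is why `α < 2` is allowed: with `a = (1 + α/2)/2 < 1` one has `aφ(2n) =
(1 + α/2)Cn²`, which exceeds `αCn²`. -/
theorem CriterionIII.isConservative (hc : CriterionIII E A B μ ρ Dρ K₀)
    (h : GlobalResolvent E A B μ (fun n : ℕ => sublevel E ρ (4 * n)) Rn R)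
    (X : ExhaustionFunction E A μ ρ Dρ) (S : GlobalSetup E A B μ) (hT : IsSubMarkovSemigroup μ T)
    (hG : ∀ α, 0 < α → ∀ f, IsGenerator T (R α f) (α • R α f - f)) : IsConservative T := by
  obtain ⟨M, C, α, hM, hC, hα, hα2, ⟨K, hK, hKE, -, hKb⟩, hA⟩ := hc
  refine h.isConservative_of_growth X S hT hG (φ := fun r => C * r ^ 2 / 2)
    (ψ := fun r => C * r) (r₁ := 0) (contDiffOn_const.mul contDiffOn_id) (fun r hr => ?_)
    (fun r hr => by positivity) hK hKE (a := (1 + α / 2) / 2) (M := 2 * C * M) (by linarith)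
    (by linarith) (by positivity) ?_ (fun n => by positivity) hA ?_
  · refine ((((hasDerivAt_id r).fun_pow 2).const_mul C).div_const 2).congr_deriv ?_
    simp only [id]; push_cast; ring
  · filter_upwards [hKb] with x hx hρ
    refine (sq_mul_add_le_of_abs_le hx ?_).trans (le_of_eq ?_)
    · field_simp
    · ring
  · refine tendsto_growth_ratio (c := (1 - α / 2) / α) (by apply div_pos <;> linarith)
      (y := fun n : ℕ => α * C * (n : ℝ) ^ 2) (Eventually.of_forall fun n => rfl)
      (Eventually.of_forall fun n => le_of_eq ?_) ?_
    · field_simp; ring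
    · exact ((tendsto_pow_atTop two_ne_zero).comp
        tendsto_natCast_atTop_atTop).const_mul_atTop (by positivity)

end

/-! ### Verification of the standing assumptions -/

section

variable {d : ℕ} {E : Set (Eucl d)} {A : Eucl d → Matrix (Fin d) (Fin d) ℝ}
  {B : Eucl d → Eucl d} {μ : Measure (Eucl d)} {ρ : Eucl d → ℝ}

theorem exhaustion_sublevel (hρcont : ContinuousOn ρ E)
    (hρsub : ∀ n : ℕ, IsRelCompactOpen E (sublevel E ρ n)) :
    Exhaustion E fun n : ℕ => sublevel E ρ (4 * n) where
  relCompact n := by exact_mod_cast hρsub (4 * n)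
  mono := fun m n hmn x hx => ⟨hx.1, hx.2.trans_le (by
    have : (m : ℝ) ≤ n := by exact_mod_cast hmn
    linarith)⟩
  exists_subset K hK hKE := by
    obtain ⟨C, hC⟩ := hK.bddAbove_image (hρcont.mono hKE)
    obtain ⟨n, hn⟩ := exists_nat_gt (C / 4)
    exact ⟨n, fun x hx => ⟨hKE hx, (hC (Set.mem_image_of_mem ρ hx)).trans_lt (by linarith)⟩⟩

/-- Local integrability of the density makes compact subsets of `E` finite. Absolute continuity and
the null boundary put all mass in the interior of `E`. Nonnegativity of the form on all of `E` is
collected from local ellipticity along the exhaustion. -/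
theorem globalSetup_of_wMeasure (hE : IsOpen E ∨ (IsClosed E ∧ volume (frontier E) = 0))
    {φ : Eucl d → ℝ} (hφ : LocallyIntegrableOn φ E volume) (hμ : μ = wMeasure E φ)
    (hAsymm : ∀ᵐ x ∂μ, (A x).IsSymm)
    (hAloc : ∀ i j, LocallyIntegrableOn (fun x => A x i j) E μ)
    (hAell : ∀ V : Set (Eucl d), IsRelCompactOpen E V →
      ∃ ν : ℝ, 0 < ν ∧ ∀ᵐ x ∂(μ.restrict V), ∀ ξ : Eucl d,
        ν⁻¹ * ‖ξ‖ ^ 2 ≤ aForm A x ξ ξ ∧ aForm A x ξ ξ ≤ ν * ‖ξ‖ ^ 2)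
    (hclos : IsClosableEnergy E A μ)
    (hBloc : ∀ K : Set (Eucl d), IsCompact K → K ⊆ E → MemLp B 2 (μ.restrict K))
    (hBdiv : ∀ f : Eucl d → ℝ, IsTest E E f → ∫ x in E, inner ℝ (B x) (gradient f x) ∂μ = 0)
    {V : ℕ → Set (Eucl d)} (hV : Exhaustion E V) : GlobalSetup E A B μ := by
  have hEm : MeasurableSet E := hE.elim IsOpen.measurableSet fun h => h.1.measurableSet
  have hac : μ ≪ volume.restrict E := hμ ▸ withDensity_absolutelyContinuous _ _
  have hmem : ∀ᵐ x ∂μ, x ∈ E := hac.ae_le (ae_restrict_mem hEm)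
  have hres : μ.restrict E = μ := Measure.restrict_eq_self_of_ae_mem hmem
  refine ⟨hEm, ?_, fun K hK hKE => ?_, hAsymm, fun i j => ?_, hAell, ?_, hclos, hBloc, hBdiv⟩
  · rcases hE with hE | ⟨hE, hE0⟩
    · rwa [hE.interior_eq]
    · have h1 : ∀ᵐ x ∂(volume.restrict E), x ∉ frontier E :=
        ae_restrict_of_ae (measure_eq_zero_iff_ae_notMem.1 hE0)
      filter_upwards [hmem, hac.ae_le h1] with x hx hx'
      rw [hE.frontier_eq] at hx'
      by_contra h
      exact hx' ⟨hx, h⟩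
  · rw [hμ, wMeasure, withDensity_apply _ hK.measurableSet,
      Measure.restrict_restrict hK.measurableSet, Set.inter_eq_left.2 hKE]
    exact (hφ.integrableOn_compact_subset hKE hK).lintegral_lt_top
  · have := (hAloc i j).aestronglyMeasurable
    rwa [hres] at this
  · have h1 : ∀ n, ∀ᵐ x ∂μ, x ∈ V n → ∀ ξ, 0 ≤ aForm A x ξ ξ := fun n => by
      obtain ⟨ν, hν, h⟩ := hAell _ (hV.relCompact n)
      obtain ⟨⟨U, hU, hVU⟩, -⟩ := hV.relCompact n
      have hVm : MeasurableSet (V n) := hVU ▸ hEm.inter hU.measurableSet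
      filter_upwards [(ae_restrict_iff' hVm).1 h] with x hx hxV ξ
      exact le_trans (by positivity) (hx hxV ξ).1
    filter_upwards [ae_all_iff.2 h1, hmem] with x hx hxE
    obtain ⟨n, hn⟩ := hV.exists_subset {x} isCompact_singleton (Set.singleton_subset_iff.2 hxE)
    exact hx n (hn rfl)

end

end

end NonSectorial

/-! ### Conclusion -/

theorem mainTheorem4 {d : ℕ} (E : Set (NonSectorial.Eucl d))
    (hE : IsOpen E ∨ (IsClosed E ∧ volume (frontier E) = 0))
    (φ : NonSectorial.Eucl d → ℝ)
    (hφ : LocallyIntegrableOn φ E volume)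
    (hφpos : ∀ᵐ x ∂(volume.restrict E), 0 < φ x)
    (μ : Measure (NonSectorial.Eucl d)) (hμ : μ = NonSectorial.wMeasure E φ)
    (A : NonSectorial.Eucl d → Matrix (Fin d) (Fin d) ℝ)
    (hAsymm : ∀ᵐ x ∂μ, (A x).IsSymm)
    (hAloc : ∀ i j, LocallyIntegrableOn (fun x => A x i j) E μ)
    (hAell : ∀ V : Set (NonSectorial.Eucl d), NonSectorial.IsRelCompactOpen E V →
      ∃ ν : ℝ, 0 < ν ∧ ∀ᵐ x ∂(μ.restrict V), ∀ ξ : NonSectorial.Eucl d,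
        ν⁻¹ * ‖ξ‖ ^ 2 ≤ NonSectorial.aForm A x ξ ξ ∧ NonSectorial.aForm A x ξ ξ ≤ ν * ‖ξ‖ ^ 2)
    (hclos : NonSectorial.IsClosableEnergy E A μ)
    (B : NonSectorial.Eucl d → NonSectorial.Eucl d)
    (hBloc : ∀ K : Set (NonSectorial.Eucl d), IsCompact K → K ⊆ E → MemLp B 2 (μ.restrict K))
    (hBdiv : ∀ f : NonSectorial.Eucl d → ℝ, NonSectorial.IsTest E E f →
      ∫ x in E, inner ℝ (B x) (gradient f x) ∂μ = 0)
    -- assumption (B)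
    (ρ : NonSectorial.Eucl d → ℝ) (Dρ : NonSectorial.Eucl d → NonSectorial.Eucl d)
    (hρcont : ContinuousOn ρ E) (hρnonneg : ∀ x ∈ E, 0 ≤ ρ x)
    (hρgrad : NonSectorial.HasLocFormGradient E A μ ρ Dρ)
    (hρsub : ∀ n : ℕ, NonSectorial.IsRelCompactOpen E (NonSectorial.sublevel E ρ n))
    (K₀ : Set (NonSectorial.Eucl d)) (hK₀ : IsCompact K₀) (hK₀E : K₀ ⊆ E)
    (hBρ : ∀ K : Set (NonSectorial.Eucl d), IsCompact K → K ⊆ E \ K₀ →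
      NonSectorial.EssBddOn μ K (fun x => inner ℝ (B x) (Dρ x)))
    -- assumption (C)
    (hC : NonSectorial.DenseCompactBddDomain E A μ) :
    ∃ T : ℝ≥0 → (Lp ℝ 2 μ →L[ℝ] Lp ℝ 2 μ),
      NonSectorial.IsAssociatedSemigroup E A B μ ρ T ∧
      (∀ T', NonSectorial.IsAssociatedSemigroup E A B μ ρ T' → T' = T) ∧
      (NonSectorial.CriterionI E A B μ ρ Dρ K₀ → NonSectorial.IsConservative T) ∧
      (NonSectorial.CriterionII E A B μ ρ Dρ K₀ → NonSectorial.IsConservative T) ∧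
      (NonSectorial.CriterionIII E A B μ ρ Dρ K₀ → NonSectorial.IsConservative T) := by
  have hV := NonSectorial.exhaustion_sublevel hρcont hρsub
  have S := NonSectorial.globalSetup_of_wMeasure hE hφ hμ hAsymm hAloc hAell hclos hBloc hBdiv hV
  have X : NonSectorial.ExhaustionFunction E A μ ρ Dρ := ⟨hρcont, hρnonneg, hρgrad, hV⟩
  obtain ⟨Rn, R, h⟩ := NonSectorial.exists_globalResolvent S hV
  obtain ⟨T, hT, hTu, hG⟩ := h.exists_associatedSemigroup S hV hC
  exact ⟨T, hT, hTu, fun hc => hc.isConservative h X S hT.1 hG,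
    fun hc => hc.isConservative h X S hT.1 hG, fun hc => hc.isConservative h X S hT.1 hG⟩
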